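/- **Setting.** A *parabolic equation* is an equation $u_t=Lu$ for $u=u(t,x)$, where $t$ lies in a nonempty open interval $T$, $x$ in a connected smooth manifold $X$ with $\dim X\ge 1$, and $u$ in a nonempty open interval $\Omega$. Near each point, in local coordinates, $Lu=\sum b^{ij}u_{ij}+\sum c^{ij}u_iu_j+\sum b^iu_i+q$, with continuous coefficients depending on $(t,x,u)$, $c^{ij}=c^{ji}$, and $b^{ij}=b^{ji}$ positive definite. It is identified with its extended version $E$: put $N=T\times X\times\Omega$; then $E$ is the closure, in the bundle of 2-jets of hypersurfaces of $N$, of the set of 2-jets of graphs of functions satisfying $u_t=Lu$ at the given point. A *PE-morphism* $(N,E)\to(N',E')$ between parabolic equations is a smooth surjective submersion $F:N\to N'$ such that, for every $p\in N$ and every hypersurface $L'\ni F(p)$ of $N'$, the 2-jet of $F^{-1}(L')$ at $p$ lies in $E$ if and only if the 2-jet of $L'$ at $F(p)$ lies in $E'$. A *PE-isomorphism* is a PE-morphism with a two-sided inverse PE-morphism. A *TPE-morphism* is a PE-morphism of the form $(t,x,u)\mapsto(t,y(t,x),v(t,x,u))$. For an open interval $\Omega$ let $\mathcal A^{\rm ext}_{\exp}$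 be the set of functions on $\Omega$ of the form $a(u)=e^{\lambda u}H(u)$, where $H$ is periodic with some period $P>0$ such that two points of $\Omega$ differ by $P$. Let $\mathcal A^{\rm ext}_{\deg}$ be the set of functions on $\Omega$ of the form $a(u)=|u-u_0|^\lambda H(\ln|u-u_0|)$, where $u_0\notin\Omega$ and $H$ is periodic with some period $P>0$ such that the values of $\ln|u-u_0|$ at some two points of $\Omega$ differ by $P$. Here $\lambda,u_0$ are real constants. Let $\mathcal A_{\exp}$ and $\mathcal A_{\deg}$ be the subsets obtained by requiring $H$ to be nonconstant. **Statement.** Let $\mathbf A$ be a reaction-diffusion equation $$u_t=a(u)(\Delta u+\eta\nabla u)+q(x,u),\qquad u\in\Omega,$$ on a connected Riemannian manifold $X$ with smooth vector field $\eta$, where $a:\Omega\to(0,\infty)$ is continuous and not constant and $q$ is continuous. 1. (a) Suppose $a\notin\mathcal A_{\exp}\cup\mathcal A_{\deg}$. Suppose also that $a$ is given on its natural domain: $\Omega=\mathbb R$ if $a(u)=Ce^{\lambda u}$ on $\Omega$, and $\Omega=(u_0,\infty)$ or $(-\infty,u_0)$ if $a(u)=C|u-u_0|^\lambda$ on $\Omega$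 with $u_0\notin\Omega$. Then for every PE-morphism $F:\mathbf A\to\mathbf B$ there are a parabolic equation $\mathbf B'$ and a PE-isomorphism $I:\mathbf B\to\mathbf B'$ of the form $(t,y,v)\mapsto(t'(t),y'(t,y),v'(t,y,v))$ such that $I\circ F$ is a PE-morphism $\mathbf A\to\mathbf B'$ of the form $(t,x,u)\mapsto(t,y(x),\varphi(x)u+\psi(x))$, and $\mathbf B'$ is of the form $$v_t=a(v)(\Delta v+\mathrm H\nabla v)+Q(y,v),\qquad v\in\Omega,\qquad(*)$$ with the same function $a:\Omega\to(0,\infty)$, for some Riemannian metric and smooth vector field $\mathrm H$ on the manifold $Y$ of $\mathbf B$ and some continuous $Q$. (b) If $a\notin\mathcal A^{\rm ext}_{\exp}\cup\mathcal A^{\rm ext}_{\deg}$, then for every PE-morphism $F:\mathbf A\to\mathbf B$ such $\mathbf B'$ and $I$ exist with $I\circ F$ of the form $(t,x,u)\mapsto(t,y(x),u)$. 2. If $F:\mathbf A\to\mathbf B$ is a TPE-morphism and $\mathbf B$ is of the form $(*)$ with the same $a:\Omega\to(0,\infty)$, then $F$ is of the form $(t,x,u)\mapsto(t,y(x),\varphi(x)u+\psi(x))$.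 If moreover $a\notin\mathcal A^{\rm ext}_{\exp}\cup\mathcal A^{\rm ext}_{\deg}$, then $F$ is of the form $(t,x,u)\mapsto(t,y(x),u)$, or else of the form $(t,x,u)\mapsto(t,y(x),2u_0-u)$ with a constant $u_0$ such that the reflection $u\mapsto 2u_0-u$ preserves $\Omega$ and $a$. -/

import Mathlib

open Set Filter Topology Asymptotics
open scoped Manifold ContDiff

noncomputable section

/-! ## 2-jets of hypersurfaces -/

section Jets

variable {V H : Type*} [NormedAddCommGroup V] [NormedSpace ℝ V] [TopologicalSpace H]
  (I : ModelWithCorners ℝ V H) (M : Type*) [TopologicalSpace M] [ChartedSpace H M]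

variable {M} in
/-- `f` is a local equation of `L` at `p`: on a neighbourhood of `p` the function `f` is smooth,
`L` is the zero set of `f`, and moreover `f p = 0` and `df` does not vanish at `p`. -/
def IsLocalEquation (f : M → ℝ) (L : Set M) (p : M) : Prop :=
  f p = 0 ∧ mfderiv I 𝓘(ℝ, ℝ) f p ≠ 0 ∧
    ∃ U : Set M, IsOpen U ∧ p ∈ U ∧ ContMDiffOn I 𝓘(ℝ, ℝ) ∞ f U ∧ ∀ x ∈ U, x ∈ L ↔ f x = 0

/-- A subset of `M` together with a point near which it is a smooth hypersurface
(a submanifold of codimension one) passing through this point. -/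
structure PointedHypersurface where
  pt : M
  carrier : Set M
  exists_equation : ∃ f : M → ℝ, IsLocalEquation I f carrier pt

variable {I M}

/-- The smooth functions whose restriction to the hypersurface vanishes to second order at the
point, i.e. is `o(r ^ 2)`. -/
def PointedHypersurface.contactIdeal (L : PointedHypersurface I M) : Set (M → ℝ) :=
  {f | ContMDiffAt I 𝓘(ℝ, ℝ) ∞ f L.pt ∧
    f =o[𝓝[L.carrier] L.pt] fun q => ‖extChartAt I L.pt q - extChartAt I L.pt L.pt‖ ^ 2}

variable (I M) in
/-- Second order contact: the same point, and the same functions vanish to second order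
along the two hypersurfaces. -/
def contactSetoid : Setoid (PointedHypersurface I M) :=
  Setoid.ker fun L => (L.pt, L.contactIdeal)

variable (I M) in
/-- The bundle of 2-jets of hypersurfaces of `M`. -/
def Jet2 : Type _ := Quotient (contactSetoid I M)

/-- The 2-jet of a hypersurface at a point. -/
def PointedHypersurface.jet (L : PointedHypersurface I M) : Jet2 I M :=
  Quotient.mk (contactSetoid I M) L

/-- In the chart around `c`, the point of `L` has coordinates `z`, and some local equation of `L`
has first and second derivatives `ξ` and `S` there. -/
def PointedHypersurface.HasCoords (L : PointedHypersurface I M) (c : M)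
    (s : V × (V →L[ℝ] ℝ) × (V →L[ℝ] V →L[ℝ] ℝ)) : Prop :=
  L.pt ∈ (extChartAt I c).source ∧ s.1 = extChartAt I c L.pt ∧
    ∃ f : M → ℝ, IsLocalEquation I f L.carrier L.pt ∧
      s.2.1 = fderiv ℝ (f ∘ (extChartAt I c).symm) s.1 ∧
      s.2.2 = fderiv ℝ (fderiv ℝ (f ∘ (extChartAt I c).symm)) s.1

/-- The manifold topology of the jet bundle: the final topology for the maps
`(z, ξ, S) ↦ jet` coming from the charts of `M`. -/
instance : TopologicalSpace (Jet2 I M) :=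
  ⨆ c : M, TopologicalSpace.coinduced
    (fun q : {q : PointedHypersurface I M × (V × (V →L[ℝ] ℝ) × (V →L[ℝ] V →L[ℝ] ℝ)) //
      q.1.HasCoords c q.2} => q.1.1.jet)
    (TopologicalSpace.induced (fun q => q.1.2) inferInstance)

end Jets

/-! ## Parabolic equations on `T × X × Ω` -/

/-- Partial derivative `∂ᵢ w` at `x`, in the chart of `X` around `c`. -/
def pderiv₁ {n : ℕ} {X : Type*} [TopologicalSpace X] [ChartedSpace (EuclideanSpace ℝ (Fin n)) X]
    (c : X) (w : X → ℝ) (x : X) (i : Fin n) : ℝ :=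
  fderiv ℝ (w ∘ (extChartAt (𝓡 n) c).symm) (extChartAt (𝓡 n) c x) (EuclideanSpace.single i 1)

/-- Second partial derivative `∂ᵢ ∂ⱼ w` at `x`, in the chart of `X` around `c`. -/
def pderiv₂ {n : ℕ} {X : Type*} [TopologicalSpace X] [ChartedSpace (EuclideanSpace ℝ (Fin n)) X]
    (c : X) (w : X → ℝ) (x : X) (i j : Fin n) : ℝ :=
  fderiv ℝ (fderiv ℝ (w ∘ (extChartAt (𝓡 n) c).symm)) (extChartAt (𝓡 n) c x)
    (EuclideanSpace.single i 1) (EuclideanSpace.single j 1)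

/-- An equation `u_t = L u` for `u = u(t, x)`, with `t` in an open interval `T`, `x` in the manifold
`X` of positive dimension `n`, and `u` in an open interval `Ω`. Here `op t x w` is the value at `x`
of the operator `L` at time `t` applied to `w`. Near each point, in local coordinates,
`L w = ∑ bⁱʲ wᵢⱼ + ∑ cⁱʲ wᵢ wⱼ + ∑ bⁱ wᵢ + q` with continuous coefficients depending on `(t, x, w)`
and positive definite `bⁱʲ`. -/
structure ParabolicEquation (n : ℕ) (X : Type*) [TopologicalSpace X]
    [ChartedSpace (EuclideanSpace ℝ (Fin n)) X] where
  T : Set ℝ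
  Ω : Set ℝ
  isOpen_T : IsOpen T
  isOpen_Ω : IsOpen Ω
  ordConnected_T : T.OrdConnected
  ordConnected_Ω : Ω.OrdConnected
  nonempty_T : T.Nonempty
  nonempty_Ω : Ω.Nonempty
  dim_pos : 0 < n
  op : ℝ → X → (X → ℝ) → ℝ
  parabolic : ∀ x₀ : X, ∃ W ∈ 𝓝 x₀, W ⊆ (extChartAt (𝓡 n) x₀).source ∧
    ∃ (b c : ℝ × X × ℝ → Matrix (Fin n) (Fin n) ℝ) (b₁ : ℝ × X × ℝ → Fin n → ℝ)
      (q : ℝ × X × ℝ → ℝ),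
      ContinuousOn b (T ×ˢ W ×ˢ Ω) ∧ ContinuousOn c (T ×ˢ W ×ˢ Ω) ∧
      ContinuousOn b₁ (T ×ˢ W ×ˢ Ω) ∧ ContinuousOn q (T ×ˢ W ×ˢ Ω) ∧
      (∀ p ∈ T ×ˢ W ×ˢ Ω, (b p).PosDef ∧ (c p).IsSymm) ∧
      ∀ t ∈ T, ∀ x ∈ W, ∀ w : X → ℝ, ContMDiffAt (𝓡 n) 𝓘(ℝ, ℝ) ∞ w x → w x ∈ Ω →
        op t x w =
          (∑ i, ∑ j, b (t, x, w x) i j * pderiv₂ x₀ w x i j) +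
          (∑ i, ∑ j, c (t, x, w x) i j * pderiv₁ x₀ w x i * pderiv₁ x₀ w x j) +
          (∑ i, b₁ (t, x, w x) i * pderiv₁ x₀ w x i) + q (t, x, w x)

/-- The model of the manifold `ℝ × X × ℝ` of dependent and independent variables `(t, x, u)`. -/
abbrev txuModel (n : ℕ) :
    ModelWithCorners ℝ (ℝ × EuclideanSpace ℝ (Fin n) × ℝ)
      (ModelProd ℝ (ModelProd (EuclideanSpace ℝ (Fin n)) ℝ)) :=
  𝓘(ℝ, ℝ).prod ((𝓡 n).prod 𝓘(ℝ, ℝ))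

namespace ParabolicEquation

variable {n m : ℕ} {X Y : Type*}
  [TopologicalSpace X] [ChartedSpace (EuclideanSpace ℝ (Fin n)) X]
  [TopologicalSpace Y] [ChartedSpace (EuclideanSpace ℝ (Fin m)) Y]

/-- The space `N = T × X × Ω`, an open subset of `ℝ × X × ℝ`. -/
def space (A : ParabolicEquation n X) : Set (ℝ × X × ℝ) := A.T ×ˢ univ ×ˢ A.Ω

/-- The equation in the traditional form: the 2-jets of graphs of smooth functions `u` that satisfy
`u_t = L u` at the point in question. -/
def graphJets (A : ParabolicEquation n X) : Set (Jet2 (txuModel n) (ℝ × X × ℝ)) :=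
  {j | ∃ (L : PointedHypersurface (txuModel n) (ℝ × X × ℝ)) (U : Set (ℝ × X)) (u : ℝ × X → ℝ),
    j = L.jet ∧ L.pt ∈ A.space ∧ IsOpen U ∧ (L.pt.1, L.pt.2.1) ∈ U ∧
    ContMDiffOn (𝓘(ℝ, ℝ).prod (𝓡 n)) 𝓘(ℝ, ℝ) ∞ u U ∧
    (∀ᶠ p in 𝓝 L.pt, p ∈ L.carrier ↔ p.2.2 = u (p.1, p.2.1)) ∧
    deriv (fun t => u (t, L.pt.2.1)) L.pt.1 = A.op L.pt.1 L.pt.2.1 fun x => u (L.pt.1, x)}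

/-- The extended version of the equation: its closure in the bundle of 2-jets of hypersurfaces. -/
def extended (A : ParabolicEquation n X) : Set (Jet2 (txuModel n) (ℝ × X × ℝ)) :=
  closure A.graphJets

end ParabolicEquation

open ParabolicEquation

section Morphisms

variable {n m : ℕ} {X Y : Type*}
  [TopologicalSpace X] [ChartedSpace (EuclideanSpace ℝ (Fin n)) X]
  [TopologicalSpace Y] [ChartedSpace (EuclideanSpace ℝ (Fin m)) Y]

/-- Morphisms of parabolic equations: smooth surjective submersions `F : N → N'` admitted by the
equation `E` of `A` and such that the equation `E'` of `B` is the `F`-projection of `E`. The latter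
means that the 2-jet at `p ∈ N` of the preimage of a hypersurface through `F p` belongs to `E`
exactly when the 2-jet at `F p` of this hypersurface belongs to `E'`. -/
structure IsPEMorphism (A : ParabolicEquation n X) (B : ParabolicEquation m Y)
    (F : ℝ × X × ℝ → ℝ × Y × ℝ) : Prop where
  smooth : ContMDiffOn (txuModel n) (txuModel m) ∞ F A.space
  image_eq : F '' A.space = B.space
  submersion : ∀ p ∈ A.space, Function.Surjective (mfderiv (txuModel n) (txuModel m) F p)
  jets : ∀ (L : PointedHypersurface (txuModel n) (ℝ × X × ℝ))
    (L' : PointedHypersurface (txuModel m) (ℝ × Y × ℝ)),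
    L.pt ∈ A.space → L'.pt = F L.pt → (∀ᶠ p in 𝓝 L.pt, p ∈ L.carrier ↔ F p ∈ L'.carrier) →
      (L.jet ∈ A.extended ↔ L'.jet ∈ B.extended)

/-- Isomorphisms: morphisms with a two-sided inverse morphism. -/
def IsPEIso (A : ParabolicEquation n X) (B : ParabolicEquation m Y)
    (F : ℝ × X × ℝ → ℝ × Y × ℝ) : Prop :=
  IsPEMorphism A B F ∧ ∃ G, IsPEMorphism B A G ∧ InvOn G F A.space B.space

/-- On `N`, the map has the form `(t, x, u) ↦ (t'(t), x'(t, x), u'(t, x, u))`. -/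
def IsTriangular (A : ParabolicEquation n X) (F : ℝ × X × ℝ → ℝ × Y × ℝ) : Prop :=
  ∃ (τ : ℝ → ℝ) (y : ℝ → X → Y) (v : ℝ → X → ℝ → ℝ),
    ∀ t ∈ A.T, ∀ x, ∀ u ∈ A.Ω, F (t, x, u) = (τ t, y t x, v t x u)

/-- Morphisms of the form `(t, x, u) ↦ (t, y(t, x), v(t, x, u))`. -/
def IsTPEMorphism (A : ParabolicEquation n X) (B : ParabolicEquation m Y)
    (F : ℝ × X × ℝ → ℝ × Y × ℝ) : Prop :=
  IsPEMorphism A B F ∧ ∃ (y : ℝ → X → Y) (v : ℝ → X → ℝ → ℝ),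
    ∀ t ∈ A.T, ∀ x, ∀ u ∈ A.Ω, F (t, x, u) = (t, y t x, v t x u)

/-- On `N`, the map has the form `(t, x, u) ↦ (t, y(x), φ(x) u + ψ(x))`. -/
def IsAffineCanonical (A : ParabolicEquation n X) (F : ℝ × X × ℝ → ℝ × Y × ℝ) : Prop :=
  ∃ (y : X → Y) (φ ψ : X → ℝ),
    ∀ t ∈ A.T, ∀ x, ∀ u ∈ A.Ω, F (t, x, u) = (t, y x, φ x * u + ψ x)

/-- On `N`, the map has the form `(t, x, u) ↦ (t, y(x), u)`. -/
def IsCanonical (A : ParabolicEquation n X) (F : ℝ × X × ℝ → ℝ × Y × ℝ) : Prop :=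
  ∃ y : X → Y, ∀ t ∈ A.T, ∀ x, ∀ u ∈ A.Ω, F (t, x, u) = (t, y x, u)

/-- On `N`, the map has the form `(t, x, u) ↦ (t, y(x), 2 u₀ - u)`, where the reflection
`u ↦ 2 u₀ - u` preserves the interval `Ω` and the function `a`. -/
def IsReflectedCanonical (A : ParabolicEquation n X) (a : ℝ → ℝ)
    (F : ℝ × X × ℝ → ℝ × Y × ℝ) : Prop :=
  ∃ (y : X → Y) (u₀ : ℝ), (∀ u ∈ A.Ω, 2 * u₀ - u ∈ A.Ω ∧ a (2 * u₀ - u) = a u) ∧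
    ∀ t ∈ A.T, ∀ x, ∀ u ∈ A.Ω, F (t, x, u) = (t, y x, 2 * u₀ - u)

end Morphisms

/-! ## Reaction-diffusion equations on Riemannian manifolds -/

section ReactionDiffusion

variable {n : ℕ} {X : Type*} [TopologicalSpace X] [ChartedSpace (EuclideanSpace ℝ (Fin n)) X]

/-- The matrix `gᵢⱼ` of a family of bilinear forms on the tangent spaces, in the chart around `c`,
at the point with coordinates `z`. -/
def gramMatrix (g : ∀ x : X, TangentSpace (𝓡 n) x →L[ℝ] TangentSpace (𝓡 n) x →L[ℝ] ℝ) (c : X)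
    (z : EuclideanSpace ℝ (Fin n)) : Matrix (Fin n) (Fin n) ℝ :=
  Matrix.of fun i j =>
    g ((extChartAt (𝓡 n) c).symm z)
      (mfderiv 𝓘(ℝ, EuclideanSpace ℝ (Fin n)) (𝓡 n) (extChartAt (𝓡 n) c).symm z
        (EuclideanSpace.single i (1 : ℝ)))
      (mfderiv 𝓘(ℝ, EuclideanSpace ℝ (Fin n)) (𝓡 n) (extChartAt (𝓡 n) c).symm z
        (EuclideanSpace.single j (1 : ℝ)))

/-- The Laplace–Beltrami operator
`Δ w = (det g)^(-1/2) ∑ᵢⱼ ∂ᵢ ((det g)^(1/2) gⁱʲ ∂ⱼ w)`, computed at `x` in the chart around `x`. -/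
def laplaceBeltrami (g : ∀ x : X, TangentSpace (𝓡 n) x →L[ℝ] TangentSpace (𝓡 n) x →L[ℝ] ℝ)
    (w : X → ℝ) (x : X) : ℝ :=
  (Real.sqrt (gramMatrix g x (extChartAt (𝓡 n) x x)).det)⁻¹ *
    ∑ i, fderiv ℝ
      (fun z => Real.sqrt (gramMatrix g x z).det *
        ∑ j, (gramMatrix g x z)⁻¹ i j *
          fderiv ℝ (w ∘ (extChartAt (𝓡 n) x).symm) z (EuclideanSpace.single j 1))
      (extChartAt (𝓡 n) x x) (EuclideanSpace.single i 1)

/-- The derivative `η ∇ w = dw(η)` of `w` at `x` in the direction of a tangent vector `η`. -/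
def directionalDeriv (w : X → ℝ) (x : X) (η : TangentSpace (𝓡 n) x) : ℝ :=
  mfderiv (𝓡 n) 𝓘(ℝ, ℝ) w x η

/-- `A` is an equation `u_t = a(u) (Δ u + η ∇ u) + q(x, u)` with `u ∈ Ω`, for some smooth Riemannian
metric and smooth vector field `η` on `X` and some continuous `q`, where `a` is a continuous
positive function on the interval `Ω`. -/
def IsReactionDiffusion [IsManifold (𝓡 n) ∞ X] (A : ParabolicEquation n X) (Ω : Set ℝ)
    (a : ℝ → ℝ) : Prop :=
  A.Ω = Ω ∧ ContinuousOn a Ω ∧ (∀ u ∈ Ω, 0 < a u) ∧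
  ∃ (g : Bundle.ContMDiffRiemannianMetric (𝓡 n) ∞ (EuclideanSpace ℝ (Fin n))
      (fun x : X => TangentSpace (𝓡 n) x))
    (η : ∀ x : X, TangentSpace (𝓡 n) x) (q : X → ℝ → ℝ),
    ContMDiff (𝓡 n) (𝓡 n).tangent ∞ (fun x => (⟨x, η x⟩ : TangentBundle (𝓡 n) X)) ∧
    ContinuousOn (fun p : X × ℝ => q p.1 p.2) (univ ×ˢ Ω) ∧
    ∀ t ∈ A.T, ∀ x, ∀ w : X → ℝ, ContMDiffAt (𝓡 n) 𝓘(ℝ, ℝ) ∞ w x → w x ∈ Ω →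
      A.op t x w =
        a (w x) * (laplaceBeltrami g.inner w x + directionalDeriv w x (η x)) + q x (w x)

end ReactionDiffusion

/-! ## The exceptional classes of functions `a` on an interval `Ω` -/

/-- Functions of the form `a(u) = exp(λ u) H(u)` on `Ω`, with `H` periodic. Some two points of `Ω`
have to differ by the period (otherwise every function on a bounded interval is of this form). -/
def AExpExt (Ω : Set ℝ) : Set (ℝ → ℝ) :=
  {a | ∃ (lam P : ℝ) (H : ℝ → ℝ), 0 < P ∧ Function.Periodic H P ∧
    (∃ u ∈ Ω, u + P ∈ Ω) ∧ ∀ u ∈ Ω, a u = Real.exp (lam * u) * H u}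

/-- As `AExpExt`, with nonconstant `H`. -/
def AExp (Ω : Set ℝ) : Set (ℝ → ℝ) :=
  {a | ∃ (lam P : ℝ) (H : ℝ → ℝ), 0 < P ∧ Function.Periodic H P ∧ (∃ s s', H s ≠ H s') ∧
    (∃ u ∈ Ω, u + P ∈ Ω) ∧ ∀ u ∈ Ω, a u = Real.exp (lam * u) * H u}

/-- Functions of the form `a(u) = |u - u₀|^λ H(ln |u - u₀|)` on `Ω`, with `u₀ ∉ Ω` and `H` periodic.
For some two points of `Ω` the values of `ln |u - u₀|` have to differ by the period. -/
def ADegExt (Ω : Set ℝ) : Set (ℝ → ℝ) :=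
  {a | ∃ (lam u₀ P : ℝ) (H : ℝ → ℝ), u₀ ∉ Ω ∧ 0 < P ∧ Function.Periodic H P ∧
    (∃ u ∈ Ω, ∃ u' ∈ Ω, Real.log |u' - u₀| = Real.log |u - u₀| + P) ∧
    ∀ u ∈ Ω, a u = |u - u₀| ^ lam * H (Real.log |u - u₀|)}

/-- As `ADegExt`, with nonconstant `H`. -/
def ADeg (Ω : Set ℝ) : Set (ℝ → ℝ) :=
  {a | ∃ (lam u₀ P : ℝ) (H : ℝ → ℝ), u₀ ∉ Ω ∧ 0 < P ∧ Function.Periodic H P ∧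
    (∃ s s', H s ≠ H s') ∧
    (∃ u ∈ Ω, ∃ u' ∈ Ω, Real.log |u' - u₀| = Real.log |u - u₀| + P) ∧
    ∀ u ∈ Ω, a u = |u - u₀| ^ lam * H (Real.log |u - u₀|)}

/-- An exponential has to be given on the whole line, and a power of `|u - u₀|` on a whole half-line
with end point `u₀`. There is no condition on other functions. -/
def HasNaturalDomain (Ω : Set ℝ) (a : ℝ → ℝ) : Prop :=
  (∀ C lam : ℝ, (∀ u ∈ Ω, a u = C * Real.exp (lam * u)) → Ω = univ) ∧
  (∀ C lam u₀ : ℝ, u₀ ∉ Ω → (∀ u ∈ Ω, a u = C * |u - u₀| ^ lam) → Ω = Ioi u₀ ∨ Ω = Iio u₀)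

end

/-!
A morphism `F : A → B` is compared with the two equations on the level of 2-jets. Away from the jets
tangent to `t = const`, an extended equation is the zero set of a polynomial in the derivatives of a
local equation of the hypersurface (`ParabolicEquation.mem_extended_iff`); its principal part is
positive definite in the directions of `X`. Since `F` carries one zero set to the other, its first
component depends on `t` alone and its second one on `(t, x)` (`IsPEMorphism.fst_eq`,
`IsPEMorphism.snd_fst_eq`): `F = (τ(t), y(t, x), v(t, x, u))`.

The preimage of the graph of a function `w(y)` is the graph of `u(t, x, w(y(t, x)))`, where `u(t, x, ·)`
is the inverse of `v(t, x, ·)`, and both sides of the two equations are polynomials in `s` for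
`w = v + s k` (`op_valInv_comp`, `compare_coeffs`). Comparing the coefficients of `s²` at two points
of a fibre of `y` gives a linear second order equation for the dependent variables, so that they are
related by an affine map, and this map multiplies `a` by a constant (`exists_symmetry_of_overlap`).
In dimension one such an affine symmetry is a translation or a dilation
(`IsAffineSymmetry.eq_id_or`); it exists only if `a` is exceptional, and under the assumptions of
part 1 it preserves the whole interval. Therefore the dependent variables can be normalized by
symmetries in a smooth way (`SymmetryNormalizer`). By the coefficients of `s`, the
velocities of two points of a fibre of `y` differ by `a` times a constant (`exists_velocity_eq`),
hence are equal, as `a` is not constant; by the uniqueness theorem for ordinary differential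
equations the fibres do not depend on time (`spaceMap_eq_of_eq`).

Consequently the normalized map `(t, y(t₀, x), φ(x) u + ψ(x))` has the same fibres as `F`, and the
map between the two targets is an isomorphism (`IsFibreNormalization.exists_isPEIso`). The equation
on the new target is found by descending the linear operator `Δ + η∇`, conjugated with the affine
maps, to `Y` (`DiffusionOp.IsSmooth.exists_pushforward`). A linear operator with smooth coefficients
and positive definite principal part is the Laplacian of the metric inverse to this part plus a
vector field (`isReactionDiffusion_of_hasForm`).

In part 2 the nonlinearity is the same on both sides, so that `v` is affine in `u` and
`y` does not depend on time (`exists_affine_of_hasForm`, `deriv_coordFn_spaceMap_eq_zero`). These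
affine maps scale `a`. If `a` is not exceptional, then the composition of two of them is trivial
whenever its slope is positive, which leaves the identity and one reflection
(`eq_id_or_reflection`).
-/

noncomputable section

set_option linter.unusedSectionVars false

open ParabolicEquation
open ContinuousLinearMap (fst snd compL)
open EuclideanSpace (single proj)
open Finset (sum_congr sum_comm mul_sum sum_mul sum_add_distrib sum_neg_distrib smul_sum)
open Function (Surjective)

/-- The coordinate space `ℝⁿ`. -/
local notation:max "𝔼 " n:max => EuclideanSpace ℝ (Fin n)

/-- The coordinate space of the variables `(t, x, u)`. -/
local notation:max "𝕍 " n:max => (ℝ × EuclideanSpace ℝ (Fin n) × ℝ)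

/-- Bilinear forms. -/
local notation:max "Bil " E:max => (E →L[ℝ] E →L[ℝ] ℝ)

local notation:max "Mat " n:max => Matrix (Fin n) (Fin n) ℝ

/-- The second derivative. -/
local notation:max "D² " f:max => fderiv ℝ (fderiv ℝ f)

/-- The chart around a point of an `n`-dimensional manifold. -/
local notation:max "chart " n:max => extChartAt (𝓡 n)

/-- The chart around a point of a manifold. -/
local notation:max "χ " I:max => extChartAt I

/-- The coordinates of 2-jets of hypersurfaces. -/
local notation:max "𝕁 " E:max => (E × (E →L[ℝ] ℝ) × (E →L[ℝ] E →L[ℝ] ℝ))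

local notation "PHyp" => PointedHypersurface

/-- Near its point, `K` is the preimage of `L` under `J`. -/
local notation:max "Corr " J:max K:max L:max => ∀ᶠ q in 𝓝 (PointedHypersurface.pt K),
  q ∈ PointedHypersurface.carrier K ↔ J q ∈ PointedHypersurface.carrier L

local notation "𝓘₁" => 𝓘(ℝ, ℝ)

/-- The model of the manifold `ℝ × X` of the variables `(t, x)`. -/
local notation:max "txM " n:max => (ModelWithCorners.prod 𝓘(ℝ, ℝ) (𝓡 n))

/-- The trivialization of the tangent bundle around a point. -/
local notation:max "𝕋 " n:max c:max => trivializationAt (EuclideanSpace ℝ (Fin n)) (TangentSpace (𝓡 n)) c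

local notation:max "SmAt " I:max J:max => ContMDiffAt I J ∞

/-- Smoothness of a real function at a point of an `n`-dimensional manifold. -/
local notation:max "SmoothAt " n:max => ContMDiffAt (𝓡 n) 𝓘(ℝ, ℝ) ∞

local notation "PEq" => ParabolicEquation

/-- Hypersurfaces of `ℝ × X × ℝ` with a distinguished point. -/
local notation:max "Hyp " n:max X:max => PointedHypersurface (txuModel n) (ℝ × X × ℝ)

set_option hygiene false in
/-- The components `τ(t)`, `y(t, x)` of a morphism `F : A → B`, and the inverse `u(t, x, v)` of the
component `v(t, x, u)` with respect to `u`. -/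
local notation "τmap" => timeMap A F

set_option hygiene false in
local notation "ymap" => spaceMap A F

set_option hygiene false in
local notation "uinv" => valInv A F

set_option hygiene false in
/-- The component `v(t, x, u)` of a morphism `F`. -/
local notation:max "𝓋 " t:max x:max u:max => (F (t, x, u)).2.2

set_option hygiene false in
/-- The derivative of `u(t, x, v)` with respect to `v`. -/
local notation:max "∂uinv " t:max x:max => deriv fun v => valInv A F (t, x, v)

set_option hygiene false in
/-- The function `k` of `y`, as a function of `x` at the time `t`. -/
local notation:max k:max "⋄" t:max => fun x' => k (spaceMap A F t x')

/-! ### Second-order calculus in normed spaces -/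

section Calculus

variable {E F G : Type*} [NormedAddCommGroup E] [NormedSpace ℝ E] [NormedAddCommGroup F]
  [NormedSpace ℝ F] [NormedAddCommGroup G] [NormedSpace ℝ G]

lemma ContDiffAt.diffAt {f : E → F} {z : E} {k : WithTop ℕ∞} (hf : ContDiffAt ℝ k f z)
    (hk : k ≠ 0 := by simp) : DifferentiableAt ℝ f z :=
  hf.differentiableAt hk

lemma ContDiffAt.diffAt_fderiv {f : E → F} {z : E} (hf : ContDiffAt ℝ 2 f z) :
    DifferentiableAt ℝ (fderiv ℝ f) z :=
  (hf.fderiv_right (m := 1) (by norm_num)).differentiableAt (by simp)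

lemma ContMDiffAt.mdiffAt {H H' M M' : Type*} [TopologicalSpace H] [TopologicalSpace H']
    [TopologicalSpace M] [TopologicalSpace M'] [ChartedSpace H M] [ChartedSpace H' M']
    {I : ModelWithCorners ℝ E H} {J : ModelWithCorners ℝ F H'} {f : M → M'} {x : M}
    (hf : ContMDiffAt I J ∞ f x) : MDifferentiableAt I J f x :=
  hf.mdifferentiableAt (by simp)

lemma fderiv_fderiv_comp {f : F → G} {c : E → F} {z : E} (hf : ContDiffAt ℝ 2 f (c z))
    (hc : ContDiffAt ℝ 2 c z) (a b : E) : D² (f ∘ c) z a b = D² f (c z) (fderiv ℝ c z a)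
    (fderiv ℝ c z b) + fderiv ℝ f (c z) (D² c z a b) := by
  have h1 : fderiv ℝ (f ∘ c) =ᶠ[𝓝 z] fun y => (fderiv ℝ f (c y)).comp (fderiv ℝ c y) := by
    filter_upwards
        [hc.continuousAt.eventually (hf.eventually (by simp)), hc.eventually (by simp)] with y h1 h2
    exact fderiv_comp y h1.diffAt h2.diffAt
  have hf' : DifferentiableAt ℝ (fderiv ℝ f) (c z) := hf.diffAt_fderiv
  have hcd := hc.diffAt
  rw [h1.fderiv_eq,
      fderiv_clm_comp (c := fun y => fderiv ℝ f (c y)) (hf'.comp z hcd) hc.diffAt_fderiv]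
  have : fderiv ℝ (fun y => fderiv ℝ f (c y)) z =
      (D² f (c z)).comp (fderiv ℝ c z) := fderiv_comp z hf' hcd
  simp [this, add_comm]

lemma ContDiffAt.fderiv_fderiv_symm {f : E → G} {z : E} (hf : ContDiffAt ℝ 2 f z) (a b : E) :
    D² f z a b = D² f z b a :=
  hf.isSymmSndFDerivAt (by simp) a b

/-- Second order Taylor expansion at a critical zero. -/
lemma taylor_two_of_fderiv_eq_zero {φ : E → ℝ} {p : E} (hφ : ContDiffAt ℝ 2 φ p) (h0 : φ p = 0)
    (h1 : fderiv ℝ φ p = 0) :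
    (fun z => φ z - (1 / 2) * D² φ p (z - p) (z - p)) =o[𝓝 p] fun z => ‖z - p‖ ^ 2 := by
  set S := D² φ p
  rw [isLittleO_iff]
  intro c hc
  have e1 := (hasFDerivAt_iff_isLittleO.1 hφ.diffAt_fderiv.hasFDerivAt).bound hc
  obtain ⟨r, hr, hball⟩ := Metric.eventually_nhds_iff_ball.1 (e1.and (hφ.eventually (by simp)))
  filter_upwards [Metric.ball_mem_nhds p hr] with z hz
  set R : E → ℝ := fun z => φ z - (1 / 2) * S (z - p) (z - p) with hR
  have hder w (hw : w ∈ Metric.ball p r) : HasFDerivAt R (fderiv ℝ φ w - S (w - p)) w := by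
    have d2 : HasFDerivAt (fun z => S (z - p) (z - p))
        ((S (w - p)).comp (ContinuousLinearMap.id ℝ E) + (S.flip (w - p))) w := by
      have a1 : HasFDerivAt (fun z : E => z - p) (ContinuousLinearMap.id ℝ E) w :=
        (hasFDerivAt_id w).sub_const p
      have a2 : HasFDerivAt (fun z => S (z - p)) S w := by
        simpa [Function.comp_def] using! S.hasFDerivAt.comp w a1
      simpa using a2.clm_apply a1
    have := (((hball w hw).2.diffAt).hasFDerivAt).sub (d2.const_mul (1 / 2))
    refine this.congr_fderiv ?_
    ext v
    have := hφ.fderiv_fderiv_symm v (w - p)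
    simp only [map_sub, _root_.sub_apply] at this
    simp
    linarith
  -- mean value inequality; the derivative of the remainder `R` is `o(‖w - p‖)`
  have hmv : ‖R z - R p‖ ≤ (c * ‖z - p‖) * ‖z - p‖ := by
    refine (convex_closedBall p ‖z - p‖).norm_image_sub_le_of_norm_hasFDerivWithin_le
      (f' := fun w => fderiv ℝ φ w - S (w - p)) (s := Metric.closedBall p ‖z - p‖)
      (fun w hw => (hder w ?_).hasFDerivWithinAt) (fun w hw => ?_) (by simp) (by simp [dist_eq_norm])
    · refine lt_of_le_of_lt (Metric.mem_closedBall.1 hw) ?_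
      rwa [Metric.mem_ball, dist_eq_norm] at hz
    · have hw' : w ∈ Metric.ball p r := by
        refine lt_of_le_of_lt (Metric.mem_closedBall.1 hw) ?_
        rwa [Metric.mem_ball, dist_eq_norm] at hz
      have := (hball w hw').1
      rw [h1, sub_zero] at this
      refine this.trans ?_
      gcongr
      simpa [dist_eq_norm] using hw
  have : R p = 0 := by simp [hR, h0]
  rw [this, sub_zero] at hmv
  calc ‖R z‖ ≤ _ := hmv
    _ = c * ‖‖z - p‖ ^ 2‖ := by rw [norm_pow, norm_norm]; ring

/-- A hypersurface `f = 0` contains a curve with any given tangent velocity. -/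
lemma exists_curve_in_hypersurface [CompleteSpace E] {f : E → ℝ} {p X : E}
    (hf : ContDiffAt ℝ 2 f p) (h0 : f p = 0) (h1 : fderiv ℝ f p ≠ 0) (hX : fderiv ℝ f p X = 0) :
    ∃ γ : ℝ → E, γ 0 = p ∧ HasDerivAt γ X 0 ∧ ∀ᶠ s in 𝓝 0, f (γ s) = 0 := by
  have hs : HasStrictFDerivAt f (fderiv ℝ f p) p := hf.hasStrictFDerivAt (by simp)
  have hr : (fderiv ℝ f p).range = ⊤ := by
    rw [LinearMap.range_eq_top]
    exact LinearMap.surjective (f := (fderiv ℝ f p : E →ₗ[ℝ] ℝ)) (fun h => h1 (by ext x; exact congrArg (fun g => g x) h))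
  set I := hs.implicitFunction f (fderiv ℝ f p) hr
  let x : (fderiv ℝ f p).ker := ⟨X, hX⟩
  refine ⟨fun s => I (f p) (s • x), ?_, ?_, ?_⟩
  · simpa only [zero_smul] using hs.implicitFunction_apply_image hr
  · have h2 : HasDerivAt (fun s : ℝ => s • x) x 0 := by
      simpa using (hasDerivAt_id (0 : ℝ)).smul_const x
    have h3 : HasFDerivAt (I (f p)) (fderiv ℝ f p).ker.subtypeL ((0 : ℝ) • x) := by
      simpa using (hs.to_implicitFunction hr).hasFDerivAt
    exact h3.comp_hasDerivAt (0 : ℝ) h2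
  · have := hs.map_implicitFunction_eq hr
    have ht : Tendsto (fun s : ℝ => ((f p, s • x) : ℝ × (fderiv ℝ f p).ker)) (𝓝 0) (𝓝 (f p, 0)) := by
      have : Continuous (fun s : ℝ => ((f p, s • x) : ℝ × (fderiv ℝ f p).ker)) := by fun_prop
      simpa using this.tendsto 0
    filter_upwards [ht.eventually this] with s hs
    simpa [h0] using hs

/-- If `h` vanishes to second order along the hypersurface `f = 0` at `p`, then the first
derivative of `h` at `p` is proportional to that of `f`, and so is the second derivative on tangent
vectors. -/
lemma exists_fderiv_eq_smul_of_contact [CompleteSpace E] {f h : E → ℝ} {p : E}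
    (hf : ContDiffAt ℝ 2 f p) (hh : ContDiffAt ℝ 2 h p) (h0 : f p = 0) (h1 : fderiv ℝ f p ≠ 0)
    (ho : h =o[𝓝[{z | f z = 0}] p] fun z => ‖z - p‖ ^ 2) : ∃ μ : ℝ, fderiv ℝ h p = μ • fderiv ℝ f p
    ∧ ∀ X Y, fderiv ℝ f p X = 0 → fderiv ℝ f p Y = 0 → D² h p X Y = μ * D² f p X Y := by
  have key : ∀ {φ : E → ℝ} {X : E} {γ : ℝ → E}, φ =o[𝓝[{z | f z = 0}] p] (fun z => ‖z - p‖ ^ 2) →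
      γ 0 = p → HasDerivAt γ X 0 → (∀ᶠ s in 𝓝 0, f (γ s) = 0) →
      (fun s => φ (γ s)) =o[𝓝 0] fun s => s ^ 2 := by
    intro φ X γ hφ h0 hd hz
    have ht : Tendsto γ (𝓝 0) (𝓝[{z | f z = 0}] p) := by
      refine tendsto_nhdsWithin_iff.2 ⟨?_, hz⟩
      simpa [h0] using hd.continuousAt.tendsto
    have hO : (fun s => γ s - p) =O[𝓝 0] fun s => s := by simpa [h0] using hd.isBigO_sub
    exact (hφ.comp_tendsto ht).trans_isBigO ((hO.norm_left).pow 2)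
  have hp : h p = 0 := by
    have := (ho.bound one_pos).self_of_nhdsWithin h0
    simpa using this
  have hker X : fderiv ℝ f p X = 0 → fderiv ℝ h p X = 0 := by
    intro hX
    obtain ⟨γ, g0, gd, gz⟩ := exists_curve_in_hypersurface hf h0 h1 hX
    have e1 : HasDerivAt (fun s => h (γ s)) (fderiv ℝ h p X) 0 := by
      have : HasFDerivAt h (fderiv ℝ h p) (γ 0) := by rw [g0]; exact hh.diffAt.hasFDerivAt
      exact this.comp_hasDerivAt (0 : ℝ) gd
    have e2 : HasDerivAt (fun s => h (γ s)) 0 0 := by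
      rw [hasDerivAt_iff_isLittleO]
      have := key ho g0 gd gz
      simp only [g0, hp, sub_zero, smul_zero]
      exact this.trans_isBigO (by simpa using (isLittleO_pow_id (𝕜 := ℝ) one_lt_two).isBigO)
    exact e1.unique e2
  obtain ⟨e, he⟩ : ∃ e, fderiv ℝ f p e = 1 := by
    obtain ⟨e, he⟩ : ∃ e, fderiv ℝ f p e ≠ 0 := by
      by_contra! hcon
      exact h1 (by ext x; simpa using hcon x)
    exact ⟨(fderiv ℝ f p e)⁻¹ • e, by simp [he]⟩
  set μ := fderiv ℝ h p e with hμ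
  have hfd := hf.differentiableAt (by simp : (2 : WithTop ℕ∞) ≠ 0)
  have hhd := hh.differentiableAt (by simp : (2 : WithTop ℕ∞) ≠ 0)
  have hdh : fderiv ℝ h p = μ • fderiv ℝ f p := by
    ext X
    have := hker (X - fderiv ℝ f p X • e) (by simp [he])
    simp at this
    simp [hμ]; linarith
  -- `φ` vanishes to first order at `p`, so that its second derivative can be read off along curves
  -- in the hypersurface
  set φ : E → ℝ := fun z => h z - μ * f z with hφ
  have hφc : ContDiffAt ℝ 2 φ p := hh.sub (contDiffAt_const.mul hf)
  have hφ1 : fderiv ℝ φ p = 0 := by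
    rw [hφ, fderiv_fun_sub hhd (hfd.const_mul μ), fderiv_const_mul hfd, hdh, sub_self]
  have hφ2 X Y : D² φ p X Y = D² h p X Y - μ * D² f p X Y := by
    have e : fderiv ℝ φ =ᶠ[𝓝 p] fun z => fderiv ℝ h z - μ • fderiv ℝ f z := by
      filter_upwards [hf.eventually (by simp), hh.eventually (by simp)] with z a b
      have a' := a.differentiableAt (by simp : (2 : WithTop ℕ∞) ≠ 0)
      rw [hφ, fderiv_fun_sub b.diffAt (a'.const_mul μ), fderiv_const_mul a']
    have f1 : DifferentiableAt ℝ (fderiv ℝ f) p := hf.diffAt_fderiv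
    rw [e.fderiv_eq, fderiv_fun_sub
        hh.diffAt_fderiv (f1.fun_const_smul μ), fderiv_fun_const_smul f1]
    simp
  have hφo : φ =o[𝓝[{z | f z = 0}] p] fun z => ‖z - p‖ ^ 2 := by
    refine ho.congr' ?_ EventuallyEq.rfl
    filter_upwards [self_mem_nhdsWithin] with z hz
    simp [hφ, show f z = 0 from hz]
  have hdiag X : fderiv ℝ f p X = 0 → D² φ p X X = 0 := by
    intro hX
    obtain ⟨γ, g0, gd, gz⟩ := exists_curve_in_hypersurface hf h0 h1 hX
    have t1 := taylor_two_of_fderiv_eq_zero hφc (by simp [hφ, hp, h0]) hφ1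
    have htg : Tendsto γ (𝓝 0) (𝓝 p) := by simpa [g0] using gd.continuousAt.tendsto
    have hO : (fun s => γ s - p) =O[𝓝 0] fun s => s := by simpa [g0] using gd.isBigO_sub
    have t3 := (key hφo g0 gd gz).sub ((t1.comp_tendsto htg).trans_isBigO ((hO.norm_left).pow 2))
    have t4 : (fun s => (1 / 2) * D² φ p (γ s - p) (γ s - p)) =o[𝓝 0] fun s : ℝ => s ^ 2 := by
      refine t3.congr_left fun s => ?_
      simp
    have t6 : Tendsto (fun s => s⁻¹ • (γ s - p)) (𝓝[≠] 0) (𝓝 X) := by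
      have := hasDerivAt_iff_tendsto_slope_zero.1 gd
      simpa [g0] using this
    have t7 : Tendsto (fun s => (1 / 2) * D² φ p (γ s - p) (γ s - p) / s ^ 2)
        (𝓝[≠] 0) (𝓝 ((1 / 2) * D² φ p X X)) := by
      have c : Continuous fun Z => (1 / 2) * D² φ p Z Z := by fun_prop
      refine ((c.tendsto X).comp t6).congr' ?_
      filter_upwards [self_mem_nhdsWithin] with s hs
      have hs' : s ≠ 0 := hs
      simp only [Function.comp, map_smul, _root_.smul_apply, smul_eq_mul]
      field_simp
    have := tendsto_nhds_unique t7 ((t4.tendsto_div_nhds_zero).mono_left nhdsWithin_le_nhds)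
    linarith
  refine ⟨μ, hdh, fun X Y hX hY => ?_⟩
  -- polarization
  have h3 := hdiag (X + Y) (by simp [hX, hY])
  have h4 := hφc.fderiv_fderiv_symm X Y
  simp only [map_add, _root_.add_apply, hdiag X hX, hdiag Y hY] at h3
  have := hφ2 X Y
  linarith

/-- The inverse function theorem for maps that are smooth near a point. -/
lemma exists_local_inverse [CompleteSpace E] {P : E → F} {z0 : E}
    (hP : ∀ᶠ z in 𝓝 z0, ContDiffAt ℝ ∞ P z) {e : E ≃L[ℝ] F} (he : HasFDerivAt P (e : E →L[ℝ] F) z0)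
    : ∃ L : F → E, L (P z0) = z0 ∧ (∀ᶠ w in 𝓝 (P z0), ContDiffAt ℝ ∞ L w) ∧
    (∀ᶠ w in 𝓝 (P z0), P (L w) = w) ∧ ∀ᶠ z in 𝓝 z0, L (P z) = z := by
  have hn : (∞ : WithTop ℕ∞) ≠ 0 := by simp
  have h0 := hP.self_of_nhds
  set Q := h0.toOpenPartialHomeomorph P he hn
  have hQP : (Q : E → F) = P := h0.toOpenPartialHomeomorph_coe he hn
  have hs : z0 ∈ Q.source := h0.mem_toOpenPartialHomeomorph_source he hn
  have ht : P z0 ∈ Q.target := h0.image_mem_toOpenPartialHomeomorph_target he hn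
  have hz : Q.symm (P z0) = z0 := by rw [← hQP]; exact Q.left_inv hs
  refine ⟨Q.symm, hz, ?_, ?_, ?_⟩
  · have h1 : ∀ᶠ z in 𝓝 z0, ∃ e' : E ≃L[ℝ] F, HasFDerivAt P (e' : E →L[ℝ] F) z := by
      have hnhds : range ((↑) : (E ≃L[ℝ] F) → (E →L[ℝ] F)) ∈ 𝓝 (fderiv ℝ P z0) := by
        rw [he.fderiv]; exact ContinuousLinearEquiv.nhds e
      filter_upwards [((h0.fderiv_right (m := 0) (by simp)).continuousAt) hnhds, hP] with z hz1 hz2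
      obtain ⟨e', he'⟩ := hz1
      exact ⟨e', by rw [he']; exact (hz2.differentiableAt hn).hasFDerivAt⟩
    have hc' := (Q.continuousAt_symm ht).tendsto
    rw [hz] at hc'
    filter_upwards [hc'.eventually h1, hc'.eventually hP, Q.open_target.mem_nhds ht]
      with w hw1 hw2 hw3
    obtain ⟨e', he'⟩ := hw1
    exact Q.contDiffAt_symm hw3 (f₀' := e') (by rwa [hQP]) (by rwa [hQP])
  · filter_upwards [Q.open_target.mem_nhds ht] with w hw
    rw [← hQP]; exact Q.right_inv hw
  · filter_upwards [Q.open_source.mem_nhds hs] with z hz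
    rw [← hQP]; exact Q.left_inv hz

end Calculus

/-! ### Smooth maps in charts, local sections of submersions -/

section Charts

variable {E : Type*} [NormedAddCommGroup E] [NormedSpace ℝ E]
  {H : Type*} [TopologicalSpace H] {I : ModelWithCorners ℝ E H} [I.Boundaryless]
  {M : Type*} [TopologicalSpace M] [ChartedSpace H M] [IsManifold I ∞ M]
  {E' : Type*} [NormedAddCommGroup E'] [NormedSpace ℝ E']
  {H' : Type*} [TopologicalSpace H'] {I' : ModelWithCorners ℝ E' H'} [I'.Boundaryless]
  {M' : Type*} [TopologicalSpace M'] [ChartedSpace H' M'] [IsManifold I' ∞ M']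
  {E'' : Type*} [NormedAddCommGroup E''] [NormedSpace ℝ E'']
  {H'' : Type*} [TopologicalSpace H''] {I'' : ModelWithCorners ℝ E'' H''}
  {M'' : Type*} [TopologicalSpace M''] [ChartedSpace H'' M'']
  {G : Type*} [NormedAddCommGroup G] [NormedSpace ℝ G]

lemma contMDiffAt_extChartAt_symm_apply {c p : M} (hp : p ∈ (χ I c).source) :
    SmAt 𝓘(ℝ, E) I (χ I c).symm (χ I c p) :=
  (contMDiffOn_extChartAt_symm c).contMDiffAt
    ((isOpen_extChartAt_target c).mem_nhds ((χ I c).map_source hp))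

lemma contMDiffAt_extChartAt_of_mem {c p : M} (hp : p ∈ (χ I c).source) :
    SmAt I 𝓘(ℝ, E) (χ I c) p :=
  contMDiffAt_extChartAt' (by simpa using hp)

lemma ContMDiffAt.contDiffAt_comp_extChartAt_symm {f : M → G} {c p : M} (hf : SmAt I 𝓘(ℝ, G) f p)
    (hp : p ∈ (χ I c).source) : ContDiffAt ℝ ∞ (f ∘ (χ I c).symm) (χ I c p) := by
  rw [← contMDiffAt_iff_contDiffAt]
  refine ContMDiffAt.comp _ ?_ (contMDiffAt_extChartAt_symm_apply hp)
  rwa [(χ I c).left_inv hp]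

lemma ContDiffAt.contMDiffAt_comp_extChartAt {g : E → G} {c p : M} (hg : ContDiffAt ℝ ∞ g (χ I c p))
    (hp : p ∈ (χ I c).source) : SmAt I 𝓘(ℝ, G) (g ∘ χ I c) p :=
  hg.contMDiffAt.comp p (contMDiffAt_extChartAt_of_mem hp)

lemma comp_extChartAt_symm_comp_eventuallyEq {α : Type*} (f : M → α) {c p : M}
    (hp : p ∈ (χ I c).source) : (f ∘ (χ I c).symm) ∘ χ I c =ᶠ[𝓝 p] f := by
  filter_upwards [(isOpen_extChartAt_source c).mem_nhds hp] with q hq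
  simp only [Function.comp, (χ I c).left_inv hq]

lemma mfderiv_ne_zero_iff {f : M → G} {c p : M} (hf : SmAt I 𝓘(ℝ, G) f p) (hp : p ∈ (χ I c).source)
    : mfderiv I 𝓘(ℝ, G) f p ≠ 0 ↔ fderiv ℝ (f ∘ (χ I c).symm) (χ I c p) ≠ 0 := by
  have hfd := hf.mdiffAt
  rw [not_iff_not]
  constructor
  · intro h
    rw [← mfderiv_eq_fderiv]
    have hfd' : MDifferentiableAt I 𝓘(ℝ, G) f ((χ I c).symm (χ I c p)) := by
      rwa [(χ I c).left_inv hp]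
    rw [mfderiv_comp _ hfd'
        ((contMDiffAt_extChartAt_symm_apply (I := I) hp).mdiffAt), (χ I c).left_inv hp, h]
    ext; rfl
  · intro h
    rw [← (comp_extChartAt_symm_comp_eventuallyEq (I := I) f hp).mfderiv_eq,
      mfderiv_comp p ((hf.contDiffAt_comp_extChartAt_symm hp).diffAt).mdifferentiableAt
          ((contMDiffAt_extChartAt_of_mem (I := I) hp).mdiffAt), mfderiv_eq_fderiv, h]
    ext; rfl

lemma ContMDiffAt.mfderiv_eq_fderiv_chart {F : M → M'} {p : M} (hF : SmAt I I' F p) :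
    mfderiv I I' F p = fderiv ℝ (χ I' (F p) ∘ F ∘ (χ I p).symm) (χ I p p) := by
  rw [hF.mdiffAt.mfderiv, I.range_eq_univ, fderivWithin_univ]
  rfl

lemma ContMDiffAt.contDiffAt_chart {F : M → M'} {c p : M} {c' : M'} (hF : SmAt I I' F p)
    (hp : p ∈ (χ I c).source) (hp' : F p ∈ (χ I' c').source) :
    ContDiffAt ℝ ∞ (χ I' c' ∘ F ∘ (χ I c).symm) (χ I c p) := by
  rw [← contMDiffAt_iff_contDiffAt]
  have h1 : SmAt I I' F ((χ I c).symm (χ I c p)) := by rwa [(χ I c).left_inv hp]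
  refine ContMDiffAt.comp (I' := I') _ ?_ (h1.comp _
      (contMDiffAt_extChartAt_symm_apply (I := I) hp))
  simp only [Function.comp, (χ I c).left_inv hp]
  exact contMDiffAt_extChartAt_of_mem hp'

variable (I I') in
/-- `F` has a smooth local right inverse at `F p` passing through `p`. -/
def HasLocalSection (F : M → M') (p : M) : Prop :=
  ∃ σ : M' → M, (∀ᶠ q in 𝓝 (F p), SmAt I' I σ q) ∧ σ (F p) = p ∧ ∀ᶠ q in 𝓝 (F p), F (σ q) = q

lemma hasLocalSection_of_surjective_mfderiv [FiniteDimensional ℝ E'] [CompleteSpace E] {F : M → M'}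
    {p : M} (hFe : ∀ᶠ q in 𝓝 p, SmAt I I' F q) (hs : Surjective (mfderiv I I' F p)) :
    HasLocalSection I I' F p := by
  have := FiniteDimensional.complete ℝ E'
  have hF := hFe.self_of_nhds
  set z0 := χ I p p with hz0
  set z1 := χ I' (F p) (F p) with hz₁
  set Fh := χ I' (F p) ∘ F ∘ (χ I p).symm with hFh
  have hFz : Fh z0 = z1 := by simp [hFh, hz0, hz₁]
  set D : E →L[ℝ] E' := fderiv ℝ Fh z0
  have hDs : Surjective D := by
    have := hF.mfderiv_eq_fderiv_chart
    rw [this] at hs; exact hs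
  obtain ⟨R0, hR0⟩ := (D : E →ₗ[ℝ] E').exists_rightInverse_of_surjective
    (LinearMap.range_eq_top.2 hDs)
  let R : E' →L[ℝ] E := LinearMap.toContinuousLinearMap R0
  have hDR w : D (R w) = w := congrArg (fun g => g w) hR0
  -- in charts, invert `F` restricted to the image of a right inverse of its derivative
  set A : E' → E := fun z => z0 + R (z - z1) with hA
  have hA1 : A z1 = z0 := by simp [hA]
  have hAc : ContDiff ℝ ∞ A := by fun_prop
  have hAd : HasFDerivAt A R z1 := by
    have : HasFDerivAt (fun z : E' => z - z1) (ContinuousLinearMap.id ℝ E') z1 :=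
      (hasFDerivAt_id z1).sub_const z1
    exact (R.hasFDerivAt.comp z1 this).const_add z0
  have hts : Tendsto (χ I p).symm (𝓝 z0) (𝓝 p) := by
    have := (continuousAt_extChartAt_symm (I := I) p).tendsto
    rwa [extChartAt_to_inv] at this
  have hFhe : ∀ᶠ z in 𝓝 z0, ContDiffAt ℝ ∞ Fh z := by
    filter_upwards [hts.eventually hFe, extChartAt_target_mem_nhds (I := I) p,
      hts.eventually (hF.continuousAt.eventually (extChartAt_source_mem_nhds (I := I') (F p)))]
      with z h1 h2 h3
    have := h1.contDiffAt_chart ((χ I p).map_target h2) h3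
    rwa [(χ I p).right_inv h2] at this
  have hAt : Tendsto A (𝓝 z1) (𝓝 z0) := by
    have := hAc.continuous.tendsto z1
    rwa [hA1] at this
  have hPe : ∀ᶠ z in 𝓝 z1, ContDiffAt ℝ ∞ (Fh ∘ A) z := by
    filter_upwards [hAt.eventually hFhe] with z hz
    exact hz.comp z hAc.contDiffAt
  have hPd : HasFDerivAt (Fh ∘ A) ((ContinuousLinearEquiv.refl ℝ E' : E' ≃L[ℝ] E') : E' →L[ℝ] E')
      z1 := by
    have h1 : HasFDerivAt Fh D (A z1) := by rw [hA1]; exact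
        (hF.contDiffAt_chart (mem_extChartAt_source p) (mem_extChartAt_source _)).diffAt.hasFDerivAt
    refine (h1.comp z1 hAd).congr_fderiv ?_
    ext w; exact hDR w
  have hPz : (Fh ∘ A) z1 = z1 := by simp [hA1, hFz]
  obtain ⟨L, hLz, hLe, hLr, -⟩ := exists_local_inverse hPe hPd
  rw [hPz] at hLz hLe hLr
  have hLc := hLe.self_of_nhds
  refine ⟨(χ I p).symm ∘ A ∘ L ∘ χ I' (F p), ?_, ?_, ?_⟩
  · have hAL : Tendsto (A ∘ L) (𝓝 z1) (𝓝 z0) := by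
      have := (hAc.contDiffAt.comp z1 hLc).continuousAt.tendsto
      rwa [Function.comp_apply, hLz, hA1] at this
    have hch : Tendsto (χ I' (F p)) (𝓝 (F p)) (𝓝 z1) := continuousAt_extChartAt (F p)
    filter_upwards [hch.eventually hLe, extChartAt_source_mem_nhds (I := I') (F p),
      hch.eventually (hAL.eventually (extChartAt_target_mem_nhds (I := I) p))] with q h1 h2 h3
    refine ContMDiffAt.comp (I' := 𝓘(ℝ, E)) q ?_
        ((hAc.contDiffAt.comp _ h1).contMDiffAt_comp_extChartAt h2)
    have h4 := contMDiffAt_extChartAt_symm_apply ((χ I p).map_target h3)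
    rwa [(χ I p).right_inv h3] at h4
  · simp only [Function.comp, ← hz₁, hLz, hA1, hz0, extChartAt_to_inv]
  · have t1 : ContinuousAt (fun q => (χ I p).symm (A (L (χ I' (F p) q)))) (F p) := by
      have c2 : ContinuousAt (fun q => A (L (χ I' (F p) q))) (F p) :=
        ContinuousAt.comp (g := A ∘ L)
            ((hAc.contDiffAt.comp z1 hLc).continuousAt) (continuousAt_extChartAt (I := I') (F p))
      refine ContinuousAt.comp (g := (χ I p).symm) ?_ c2
      rw [← hz₁, hLz, hA1]
      exact continuousAt_extChartAt_symm p
    have t2 : ContinuousAt (fun q => F ((χ I p).symm (A (L (χ I' (F p) q))))) (F p) := by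
      refine ContinuousAt.comp (g := F) ?_ t1
      rw [← hz₁, hLz, hA1, hz0, extChartAt_to_inv]
      exact hF.continuousAt
    have t3 : F ((χ I p).symm (A (L (χ I' (F p) (F p))))) = F p := by
      rw [← hz₁, hLz, hA1, hz0, extChartAt_to_inv]
    have e1 : ∀ᶠ q in 𝓝 (F p), F ((χ I p).symm (A (L (χ I' (F p) q)))) ∈ (χ I' (F p)).source := by
      have := t2.tendsto
      rw [t3] at this
      exact this.eventually (extChartAt_source_mem_nhds (F p))
    filter_upwards [e1, (continuousAt_extChartAt (I := I') (F p)).eventually hLr,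
      extChartAt_source_mem_nhds (I := I') (F p)] with q h1 h2 h3
    exact (χ I' (F p)).injOn h1 h3 h2

lemma HasLocalSection.contMDiffAt_of_comp {F : M → M'} {p : M} (hs : HasLocalSection I I' F p)
    {h : M' → M''} (hh : SmAt I I'' (h ∘ F) p) : SmAt I' I'' h (F p) := by
  obtain ⟨σ, h1', h2, h3⟩ := hs
  have : SmAt I' I'' ((h ∘ F) ∘ σ) (F p) := by
    refine ContMDiffAt.comp (I' := I) _ ?_ h1'.self_of_nhds
    rwa [h2]
  refine this.congr_of_eventuallyEq ?_
  filter_upwards [h3] with q hq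
  simp [hq]

lemma HasLocalSection.surjective_mfderiv {F : M → M'} {p : M} (hs : HasLocalSection I I' F p)
    (hF : MDifferentiableAt I I' F p) : Surjective (mfderiv I I' F p) := by
  obtain ⟨σ, h1', h2, h3⟩ := hs
  intro w
  have hF' : MDifferentiableAt I I' F (σ (F p)) := by rwa [h2]
  have e : mfderiv I' I' (F ∘ σ) (F p) = mfderiv I' I' (id : M' → M') (F p) :=
    EventuallyEq.mfderiv_eq (h3.mono fun q hq => hq)
  rw [mfderiv_comp _ hF' h1'.self_of_nhds.mdiffAt, mfderiv_id] at e
  have e2 := congrArg (fun g => g w) e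
  rw [h2] at e2
  exact ⟨_, e2⟩

/-- A map with zero derivative on a preconnected open set is constant there. -/
lemma eq_of_mfderiv_eq_zero {F : M → M'} {s : Set M} (hs : IsOpen s) (hc : IsPreconnected s)
    (hF : ∀ x ∈ s, SmAt I I' F x) (h0 : ∀ x ∈ s, mfderiv I I' F x = 0)
    {x y : M} (hx : x ∈ s) (hy : y ∈ s) : F x = F y := by
  have hloc x (hx : x ∈ s) : ∀ᶠ y in 𝓝 x, F y = F x := by
    set Fh := χ I' (F x) ∘ F ∘ (χ I x).symm with hFh
    have hcont : ContinuousAt (F ∘ (χ I x).symm) (χ I x x) := by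
      refine ContinuousAt.comp ?_ (continuousAt_extChartAt_symm x)
      rw [extChartAt_to_inv]; exact (hF x hx).continuousAt
    have e1 : ∀ᶠ z in 𝓝 (χ I x x), (χ I x).symm z ∈ s ∧ F ((χ I x).symm z) ∈ (χ I' (F x)).source ∧
        z ∈ (χ I x).target := by
      refine ((continuousAt_extChartAt_symm x).eventually ?_).and ((hcont.eventually ?_).and
        ((isOpen_extChartAt_target x).mem_nhds (mem_extChartAt_target x)))
      · rw [extChartAt_to_inv]; exact hs.mem_nhds hx
      · simp only [Function.comp, extChartAt_to_inv]
        exact extChartAt_source_mem_nhds (F x)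
    obtain ⟨r, hr, hb⟩ := Metric.eventually_nhds_iff_ball.1 e1
    have hd z (hz : z ∈ Metric.ball (χ I x x) r) : HasFDerivAt Fh (0 : E →L[ℝ] E') z := by
      obtain ⟨h1, h2, h3⟩ := hb z hz
      have d3 := (contMDiffAt_extChartAt_symm_apply (I := I) ((χ I x).map_target h3)).mdiffAt
      rw [(χ I x).right_inv h3] at d3
      have d1 := (contMDiffAt_extChartAt_of_mem (I := I') h2).mdiffAt
      have hh : HasMFDerivAt 𝓘(ℝ, E) 𝓘(ℝ, E') Fh z 0 := by
        have := d1.hasMFDerivAt.comp z (((hF _ h1).mdiffAt).hasMFDerivAt.comp z d3.hasMFDerivAt)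
        convert this using 1
        rw [h0 _ h1]
        ext w
        exact (map_zero (mfderiv I' 𝓘(ℝ, E') (χ I' (F x)) _)).symm
      exact hasMFDerivAt_iff_hasFDerivAt.1 hh
    have hconst z (hz : z ∈ Metric.ball (χ I x x) r) : Fh z = Fh (χ I x x) := by
      refine (convex_ball _ r).is_const_of_fderivWithin_eq_zero (𝕜 := ℝ)
        (fun w hw => (hd w hw).differentiableAt.differentiableWithinAt) (fun w hw => ?_) hz
        (Metric.mem_ball_self hr)
      exact ((hd w hw).hasFDerivWithinAt).fderivWithin (Metric.isOpen_ball.uniqueDiffWithinAt hw)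
    filter_upwards [(continuousAt_extChartAt (I := I) x).eventually (Metric.ball_mem_nhds _ hr),
      extChartAt_source_mem_nhds (I := I) x] with y h1 h2
    have h3 := hconst _ h1
    have h4 := (hb _ h1).2.1
    simp only [hFh, Function.comp, extChartAt_to_inv, (χ I x).left_inv h2] at h3 h4
    exact (χ I' (F x)).injOn h4 (mem_extChartAt_source _) h3
  have : PreconnectedSpace s := Subtype.preconnectedSpace hc
  have hl : IsLocallyConstant (fun z : s => F z) := by
    rw [IsLocallyConstant.iff_eventually_eq]
    intro z
    exact (continuous_subtype_val.tendsto z).eventually (hloc z z.2)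
  exact hl.apply_eq_of_preconnectedSpace ⟨x, hx⟩ ⟨y, hy⟩

end Charts

/-! ### Charts of `ℝ × X × ℝ` and the implicit function theorem -/

section Txu

variable {n : ℕ} {X : Type*} [TopologicalSpace X] [ChartedSpace 𝔼 n X]

lemma extChartAt_txu (c : ℝ × X × ℝ) : χ (txuModel n) c = (PartialEquiv.refl ℝ).prod
    ((chart n c.2.1).prod (PartialEquiv.refl ℝ)) := by
  rw [extChartAt_prod, extChartAt_prod]
  simp only [extChartAt_model_space_eq_id]

lemma extChartAt_txu_apply (c q : ℝ × X × ℝ) :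
    χ (txuModel n) c q = (q.1, chart n c.2.1 q.2.1, q.2.2) := by
  rw [extChartAt_txu]; rfl

lemma extChartAt_txu_symm_apply (c : ℝ × X × ℝ) (z : ℝ × 𝔼 n × ℝ) :
    (χ (txuModel n) c).symm z = (z.1, (chart n c.2.1).symm z.2.1, z.2.2) := by
  rw [extChartAt_txu]; rfl

lemma mem_extChartAt_txu_source {c q : ℝ × X × ℝ} :
    q ∈ (χ (txuModel n) c).source ↔ q.2.1 ∈ (chart n c.2.1).source := by
  rw [extChartAt_txu, PartialEquiv.prod_source, PartialEquiv.prod_source]; simp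

lemma extChartAt_tx (c : ℝ × X) : χ (txM n) c = (PartialEquiv.refl ℝ).prod (chart n c.2) := by
  rw [extChartAt_prod]
  simp only [extChartAt_model_space_eq_id]

variable [IsManifold (𝓡 n) ∞ X]

/-- The equation `f (t, x, u) = v` can be solved smoothly for `u` where `∂f/∂u ≠ 0`. -/
lemma exists_implicit_txu {f : ℝ × X × ℝ → ℝ} {p : ℝ × X × ℝ}
    (hf : ∀ᶠ q in 𝓝 p, SmAt (txuModel n) 𝓘₁ f q)
    (hu : fderiv ℝ (f ∘ (χ (txuModel n) p).symm) (χ (txuModel n) p p) (0, 0, 1) ≠ 0) : ∃ g : ℝ × X ×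
    ℝ → ℝ, (∀ᶠ q in 𝓝 (p.1, p.2.1, f p), SmAt (txuModel n) 𝓘₁ g q) ∧ g (p.1, p.2.1, f p) = p.2.2 ∧
    (∀ᶠ q in 𝓝 (p.1, p.2.1, f p), f (q.1, q.2.1, g q) = q.2.2) ∧ ∀ᶠ q in 𝓝 p, g (q.1, q.2.1, f q) =
    q.2.2 := by
  set z0 := χ (txuModel n) p p with hz0
  set fh := f ∘ (χ (txuModel n) p).symm with hfh
  have hz0' : z0 = (p.1, chart n p.2.1 p.2.1, p.2.2) := extChartAt_txu_apply p p
  have hfc' : ∀ᶠ z in 𝓝 z0, ContDiffAt ℝ ∞ fh z := by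
    have hc : ContinuousAt (χ (txuModel n) p).symm z0 := continuousAt_extChartAt_symm p
    have := hc.tendsto
    rw [hz0, extChartAt_to_inv] at this
    filter_upwards [this.eventually hf, (isOpen_extChartAt_target (I := txuModel n) p).mem_nhds
      (mem_extChartAt_target p)] with z h1 h2
    have := h1.contDiffAt_comp_extChartAt_symm ((χ (txuModel n) p).map_target h2)
    rwa [(χ (txuModel n) p).right_inv h2] at this
  have hfz : fh z0 = f p := by simp only [hfh, Function.comp, hz0, extChartAt_to_inv]
  set D := fderiv ℝ fh z0
  -- `u` is the last component of the inverse of `(t, x, u) ↦ (t, x, f)`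
  set P : ℝ × 𝔼 n × ℝ → ℝ × 𝔼 n × ℝ := fun z => (z.1, z.2.1, fh z) with hP
  have hPc : ∀ᶠ z in 𝓝 z0, ContDiffAt ℝ ∞ P z := by
    filter_upwards [hfc'] with z hz
    exact contDiffAt_fst.prodMk ((contDiffAt_fst.comp _ contDiffAt_snd).prodMk hz)
  let A : 𝕍 n →L[ℝ] 𝕍 n := (fst ℝ _ _).prod (((fst ℝ _ _).comp (snd ℝ _ _)).prod D)
  let B : 𝕍 n →L[ℝ] 𝕍 n := (fst ℝ _ _).prod (((fst ℝ _ _).comp (snd ℝ _ _)).prod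
        ((D (0, 0, 1))⁻¹ • (((snd ℝ _ _).comp (snd ℝ _ _)) - D.comp ((fst ℝ _ _).prod
            (((fst ℝ _ _).comp (snd ℝ _ _)).prod 0)))))
  have hdec (w : ℝ × 𝔼 n × ℝ) : D w = D (w.1, w.2.1, 0) + w.2.2 * D (0, 0, 1) := by
    rw [← smul_eq_mul, ← map_smul, ← map_add]; simp
  let e : 𝕍 n ≃L[ℝ] 𝕍 n := ContinuousLinearEquiv.equivOfInverse A B (by
        intro w
        refine Prod.ext rfl (Prod.ext rfl ?_)
        show (D (0, 0, 1))⁻¹ * (D w - D (w.1, w.2.1, 0)) = w.2.2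
        rw [hdec w]; field_simp; ring)
      (by
        intro w
        refine Prod.ext rfl (Prod.ext rfl ?_)
        show D (w.1, w.2.1, (D (0, 0, 1))⁻¹ * (w.2.2 - D (w.1, w.2.1, 0))) = w.2.2
        rw [hdec]; field_simp; ring)
  have hPd : HasFDerivAt P (e : _ →L[ℝ] _) z0 :=
    hasFDerivAt_fst.prodMk ((hasFDerivAt_fst.comp z0 hasFDerivAt_snd).prodMk
        hfc'.self_of_nhds.diffAt.hasFDerivAt)
  obtain ⟨L, hLz, hLc, hr, hl⟩ := exists_local_inverse hPc hPd
  set p' : ℝ × X × ℝ := (p.1, p.2.1, f p)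
  have hp's : p' ∈ (χ (txuModel n) p).source :=
    mem_extChartAt_txu_source.2 (mem_extChartAt_source p.2.1)
  have hPz : χ (txuModel n) p p' = P z0 := by
    rw [extChartAt_txu_apply, hP]; simp only [hfz]; rw [hz0']
  have hcont' : ContinuousAt (χ (txuModel n) p) p' := continuousAt_extChartAt' hp's
  refine ⟨fun q => (L (χ (txuModel n) p q)).2.2, ?_, ?_, ?_, ?_⟩
  · rw [← hPz] at hLc
    filter_upwards [hcont'.eventually hLc,
      (isOpen_extChartAt_source (I := txuModel n) p).mem_nhds hp's] with q h1 h2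
    have : ContDiffAt ℝ ∞ (fun z => (L z).2.2) (χ (txuModel n) p q) :=
      contDiffAt_snd.comp _ (contDiffAt_snd.comp _ h1)
    exact this.contMDiffAt_comp_extChartAt h2
  · simp only [hPz, hLz]; rw [hz0']
  · rw [← hPz] at hr
    filter_upwards [hcont'.eventually hr,
      (isOpen_extChartAt_source (I := txuModel n) p).mem_nhds hp's] with q h1 h2
    have h3 : (L (χ (txuModel n) p q)).1 = q.1 := by
      have := congrArg (fun z => z.1) h1
      simpa only [hP, extChartAt_txu_apply] using this
    have h4 : (L (χ (txuModel n) p q)).2.1 = chart n p.2.1 q.2.1 := by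
      have := congrArg (fun z => z.2.1) h1
      simpa only [hP, extChartAt_txu_apply] using this
    have h5 : fh (L (χ (txuModel n) p q)) = q.2.2 := by
      have := congrArg (fun z => z.2.2) h1
      simpa only [hP, extChartAt_txu_apply] using this
    rw [← h5, hfh]
    simp only [Function.comp, extChartAt_txu_symm_apply, h3, h4, (chart n p.2.1).left_inv
        (mem_extChartAt_txu_source.1 h2)]
  · filter_upwards [(continuousAt_extChartAt (I := txuModel n) p).eventually hl,
      extChartAt_source_mem_nhds (I := txuModel n) p] with q h1 h2
    have h3 : χ (txuModel n) p (q.1, q.2.1, f q) = P (χ (txuModel n) p q) := by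
      simp only [hP, hfh, Function.comp, (χ (txuModel n) p).left_inv h2]
      simp only [extChartAt_txu_apply]
    rw [h3, h1, extChartAt_txu_apply]

end Txu

/-! ### Transformation of 2-jets of hypersurfaces under diffeomorphisms -/

section JetTransport

variable {E : Type*} [NormedAddCommGroup E] [NormedSpace ℝ E]
  {H : Type*} [TopologicalSpace H] {I : ModelWithCorners ℝ E H} [I.Boundaryless]
  {M : Type*} [TopologicalSpace M] [ChartedSpace H M] [IsManifold I ∞ M]
  {E' : Type*} [NormedAddCommGroup E'] [NormedSpace ℝ E']
  {H' : Type*} [TopologicalSpace H'] {I' : ModelWithCorners ℝ E' H'} [I'.Boundaryless]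
  {M' : Type*} [TopologicalSpace M'] [ChartedSpace H' M'] [IsManifold I' ∞ M']

lemma two_le_infty : (2 : WithTop ℕ∞) ≤ ∞ := ENat.LEInfty.out

lemma PointedHypersurface.jet_eq_iff {K L : PHyp I M} :
    K.jet = L.jet ↔ K.pt = L.pt ∧ K.contactIdeal = L.contactIdeal := by
  refine (Quotient.eq (r := contactSetoid I M)).trans ?_
  exact Setoid.ker_def.trans Prod.ext_iff

lemma PointedHypersurface.jet_eq_of_eventually {K L : PHyp I M} (hp : K.pt = L.pt)
    (hc : ∀ᶠ q in 𝓝 K.pt, q ∈ K.carrier ↔ q ∈ L.carrier) : K.jet = L.jet := by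
  rw [jet_eq_iff]
  refine ⟨hp, ?_⟩
  have : 𝓝[K.carrier] K.pt = 𝓝[L.carrier] L.pt := by
    rw [← hp]
    exact nhdsWithin_eq_iff_eventuallyEq.2 (hc.mono fun q hq => propext hq)
  unfold contactIdeal
  rw [this, hp]

lemma IsLocalEquation.contMDiffAt {f : M → ℝ} {L : Set M} {p : M} (h : IsLocalEquation I f L p) :
    SmAt I 𝓘₁ f p := by
  obtain ⟨-, -, U, hU, hp, hf, -⟩ := h
  exact hf.contMDiffAt (hU.mem_nhds hp)

lemma IsLocalEquation.eventually_contMDiffAt {f : M → ℝ} {L : Set M} {p : M}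
    (h : IsLocalEquation I f L p) : ∀ᶠ q in 𝓝 p, SmAt I 𝓘₁ f q := by
  obtain ⟨-, -, U, hU, hp, hf, -⟩ := h
  filter_upwards [hU.mem_nhds hp] with q hq
  exact hf.contMDiffAt (hU.mem_nhds hq)

lemma IsLocalEquation.eventually_mem_iff {f : M → ℝ} {L : Set M} {p : M}
    (h : IsLocalEquation I f L p) : ∀ᶠ q in 𝓝 p, q ∈ L ↔ f q = 0 := by
  obtain ⟨-, -, U, hU, hp, -, hL⟩ := h
  filter_upwards [hU.mem_nhds hp] with q hq using hL q hq

lemma isLocalEquation_of_eventually {f : M → ℝ} {L : Set M} {p : M} (h0 : f p = 0)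
    (h1 : mfderiv I 𝓘₁ f p ≠ 0) (h2 : ∀ᶠ q in 𝓝 p, SmAt I 𝓘₁ f q)
    (h3 : ∀ᶠ q in 𝓝 p, q ∈ L ↔ f q = 0) : IsLocalEquation I f L p := by
  obtain ⟨U, hU, hUo, hp⟩ := eventually_nhds_iff.1 (h2.and h3)
  exact ⟨h0, h1, U, hUo, hp, fun q hq => (hU q hq).1.contMDiffWithinAt, fun q hq => (hU q hq).2⟩

lemma isBigO_extChartAt {F : M → M'} {c p : M} {c' : M'} (hF : SmAt I I' F p)
    (hp : p ∈ (χ I c).source) (hp' : F p ∈ (χ I' c').source) :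
    (fun q => χ I' c' (F q) - χ I' c' (F p)) =O[𝓝 p] fun q => χ I c q - χ I c p := by
  have h1 := ((hF.contDiffAt_chart hp hp').diffAt).isBigO_sub
  refine (h1.comp_tendsto (continuousAt_extChartAt' hp)).congr' ?_ EventuallyEq.rfl
  filter_upwards [(isOpen_extChartAt_source c).mem_nhds hp] with q hq
  simp only [Function.comp, (χ I c).left_inv hq, (χ I c).left_inv hp]

/-- The equations of two hypersurfaces with the same 2-jet have proportional first derivatives,
and their second derivatives are proportional on the tangent space. -/
lemma exists_smul_of_jet_eq [CompleteSpace E] {K L : PHyp I M} (h : K.jet = L.jet) {f g : M → ℝ}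
    (hf : IsLocalEquation I f K.carrier K.pt) (hg : IsLocalEquation I g L.carrier L.pt) {c : M}
    (hp : K.pt ∈ (χ I c).source) : ∃ μ : ℝ, μ ≠ 0 ∧ fderiv ℝ (g ∘ (χ I c).symm) (χ I c K.pt) = μ •
    fderiv ℝ (f ∘ (χ I c).symm) (χ I c K.pt) ∧ ∀ X Y, fderiv ℝ (f ∘ (χ I c).symm) (χ I c K.pt) X = 0
    → fderiv ℝ (f ∘ (χ I c).symm) (χ I c K.pt) Y = 0 → D² (g ∘ (χ I c).symm) (χ I c K.pt) X Y = μ *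
    D² (f ∘ (χ I c).symm) (χ I c K.pt) X Y := by
  obtain ⟨hpt, hI⟩ := PointedHypersurface.jet_eq_iff.1 h
  rw [← hpt] at hg
  have hgL : g ∈ L.contactIdeal := by
    refine ⟨by rw [← hpt]; exact hg.contMDiffAt, ?_⟩
    have : g =ᶠ[𝓝[L.carrier] L.pt] fun _ => 0 := by
      rw [← hpt]
      filter_upwards [nhdsWithin_le_nhds hg.eventually_mem_iff, self_mem_nhdsWithin] with q h1 h2
      exact h1.1 h2
    exact (isLittleO_zero _ _).congr' this.symm EventuallyEq.rfl
  rw [← hI] at hgL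
  set z0 := χ I c K.pt with hz0
  have hfc : ContDiffAt ℝ 2 (f ∘ (χ I c).symm) z0 :=
    (hf.contMDiffAt.contDiffAt_comp_extChartAt_symm hp).of_le two_le_infty
  have hgc : ContDiffAt ℝ 2 (g ∘ (χ I c).symm) z0 :=
    (hg.contMDiffAt.contDiffAt_comp_extChartAt_symm hp).of_le two_le_infty
  have hz : (χ I c).symm z0 = K.pt := (χ I c).left_inv hp
  have hf1 := (mfderiv_ne_zero_iff hf.contMDiffAt hp).1 hf.2.1
  have ho : (g ∘ (χ I c).symm) =o[𝓝[{z | (f ∘ (χ I c).symm) z = 0}] z0] fun z => ‖z - z0‖ ^ 2 := by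
    have hcs : ContinuousAt (χ I c).symm z0 := continuousAt_extChartAt_symm' hp
    have ht : Tendsto (χ I c).symm (𝓝[{z | (f ∘ (χ I c).symm) z = 0}] z0) (𝓝[K.carrier] K.pt) := by
      refine tendsto_nhdsWithin_iff.2 ⟨?_, ?_⟩
      · simpa only [hz] using hcs.tendsto.mono_left nhdsWithin_le_nhds
      · have h1 := hcs.tendsto
        rw [hz] at h1
        filter_upwards [nhdsWithin_le_nhds (h1.eventually hf.eventually_mem_iff),
          self_mem_nhdsWithin] with z h2 h3
        exact h2.2 h3
    have h1 := hgL.2.comp_tendsto ht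
    refine h1.trans_isBigO ?_
    have h2 := (isBigO_extChartAt (I := I) (I' := I) (F := id) (c := c) (c' := K.pt) (p := K.pt)
      contMDiffAt_id hp (mem_extChartAt_source _))
    refine (((h2.mono nhdsWithin_le_nhds).comp_tendsto ht).norm_norm.pow 2).trans ?_
    refine IsBigO.of_bound' ?_
    filter_upwards [nhdsWithin_le_nhds (extChartAt_target_mem_nhds' (I := I)
      ((χ I c).map_source hp))] with z hz1
    simp only [Function.comp, (χ I c).right_inv hz1, ← hz0]
    exact le_rfl
  obtain ⟨μ, h1, h2⟩ := exists_fderiv_eq_smul_of_contact hfc hgc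
    (by simp only [Function.comp, hz, hf.1]) hf1 ho
  refine ⟨μ, ?_, h1, h2⟩
  rintro rfl
  exact ((mfderiv_ne_zero_iff hg.contMDiffAt hp).1 hg.2.1) (by rw [h1, zero_smul])

/-- The preimage of a hypersurface under a submersion is a hypersurface. -/
lemma IsLocalEquation.comp {F : M → M'} {p : M} (hF : ∀ᶠ q in 𝓝 p, SmAt I I' F q)
    (hs : Surjective (mfderiv I I' F p)) {f : M' → ℝ} {L : Set M} {L' : Set M'}
    (hf : IsLocalEquation I' f L' (F p)) (hL : ∀ᶠ q in 𝓝 p, q ∈ L ↔ F q ∈ L') :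
    IsLocalEquation I (f ∘ F) L p := by
  have hc : Tendsto F (𝓝 p) (𝓝 (F p)) := hF.self_of_nhds.continuousAt
  refine isLocalEquation_of_eventually hf.1 ?_ ?_ ?_
  · rw [mfderiv_comp p hf.contMDiffAt.mdiffAt hF.self_of_nhds.mdiffAt]
    intro h
    apply hf.2.1
    ext w
    obtain ⟨v, rfl⟩ := hs w
    exact congrArg (fun g => g v) h
  · filter_upwards [hF, hc.eventually hf.eventually_contMDiffAt] with q h1 h2
    exact h2.comp q h1
  · filter_upwards [hL, hc.eventually hf.eventually_mem_iff] with q h1 h2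
    rw [h1, h2]; rfl

/-- The image of a hypersurface under a local diffeomorphism with inverse `G`. -/
def PointedHypersurface.map (K : PHyp I M) (J : M → M') (G : M' → M)
    (hG : ∀ᶠ q in 𝓝 (J K.pt), SmAt I' I G q) (hGJ : G (J K.pt) = K.pt)
    (hs : Surjective (mfderiv I' I G (J K.pt))) : PHyp I' M' where
  pt := J K.pt
  carrier := G ⁻¹' K.carrier
  exists_equation := by
    obtain ⟨f, hf⟩ := K.exists_equation
    rw [← hGJ] at hf
    exact ⟨f ∘ G, hf.comp hG hs (.of_forall fun q => Iff.rfl)⟩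

lemma PointedHypersurface.comp_mem_contactIdeal {J : M → M'} {K : PHyp I M} {K' : PHyp I' M'}
    (hpt : K'.pt = J K.pt) (hJ : SmAt I I' J K.pt) (hc : Corr J K K') {h : M' → ℝ}
    (hh : h ∈ K'.contactIdeal) : h ∘ J ∈ K.contactIdeal := by
  obtain ⟨h1, h2⟩ := hh
  rw [hpt] at h1 h2
  refine ⟨h1.comp _ hJ, ?_⟩
  have ht : Tendsto J (𝓝[K.carrier] K.pt) (𝓝[K'.carrier] (J K.pt)) := by
    refine tendsto_nhdsWithin_iff.2 ⟨hJ.continuousAt.tendsto.mono_left nhdsWithin_le_nhds, ?_⟩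
    filter_upwards [nhdsWithin_le_nhds hc, self_mem_nhdsWithin] with q a b using a.1 b
  refine (h2.comp_tendsto ht).trans_isBigO ?_
  have h3 := isBigO_extChartAt (I := I) (I' := I') (F := J) (c := K.pt) (c' := J K.pt) hJ
    (mem_extChartAt_source _) (mem_extChartAt_source _)
  exact (h3.mono nhdsWithin_le_nhds).norm_norm.pow 2

lemma PointedHypersurface.comp_mem_contactIdeal_iff {J : M → M'} {G : M' → M}
    {K : PHyp I M} {K' : PHyp I' M'} (hpt : K'.pt = J K.pt) (hJ : SmAt I I' J K.pt)
    (hG : SmAt I' I G (J K.pt)) (hGJ : G (J K.pt) = K.pt) (hJG : ∀ᶠ q in 𝓝 (J K.pt), J (G q) = q)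
    (hc : Corr J K K') {h : M' → ℝ} : h ∘ J ∈ K.contactIdeal ↔ h ∈ K'.contactIdeal := by
  refine ⟨fun h1 => ?_, comp_mem_contactIdeal hpt hJ hc⟩
  have hGt : Tendsto G (𝓝 (J K.pt)) (𝓝 K.pt) := by
    simpa only [ContinuousAt, hGJ] using hG.continuousAt
  have h2 : (h ∘ J) ∘ G ∈ K'.contactIdeal := by
    refine comp_mem_contactIdeal (by rw [hpt, hGJ]) (by rwa [hpt]) ?_ h1
    rw [hpt]
    filter_upwards [hGt.eventually hc, hJG] with q h3 h4
    rw [h3, h4]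
  have e : (h ∘ J) ∘ G =ᶠ[𝓝 K'.pt] h := by
    rw [hpt]
    filter_upwards [hJG] with q h4
    simp only [Function.comp, h4]
  exact ⟨h2.1.congr_of_eventuallyEq e.symm, h2.2.congr' (e.filter_mono nhdsWithin_le_nhds) .rfl⟩

/-- Diffeomorphisms act on 2-jets of hypersurfaces. -/
lemma PointedHypersurface.jet_eq_of_map {J : M → M'} {G : M' → M} {K L : PHyp I M}
    {K' L' : PHyp I' M'} (h : K.jet = L.jet) (hK : K'.pt = J K.pt) (hL : L'.pt = J L.pt)
    (hJ : SmAt I I' J K.pt) (hG : SmAt I' I G (J K.pt)) (hGJ : G (J K.pt) = K.pt)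
    (hJG : ∀ᶠ q in 𝓝 (J K.pt), J (G q) = q) (hKc : Corr J K K') (hLc : Corr J L L') :
    K'.jet = L'.jet := by
  obtain ⟨hpt, hI⟩ := jet_eq_iff.1 h
  refine jet_eq_iff.2 ⟨by rw [hK, hL, hpt], Set.ext fun φ => ?_⟩
  rw [← comp_mem_contactIdeal_iff hK hJ hG hGJ hJG hKc, hI]
  rw [hpt] at hJ hG hGJ hJG
  exact comp_mem_contactIdeal_iff hL hJ hG hGJ hJG hLc

/-- The action of a coordinate change, with inverse `g`, on the coordinates of 2-jets. -/
def jetCoordChange (j : E → E') (g : E' → E) (s : 𝕁 E) : 𝕁 E' :=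
  (j s.1, s.2.1.comp (fderiv ℝ g (j s.1)), ((compL ℝ E' E ℝ).flip (fderiv ℝ g (j s.1))).comp
      (s.2.2.comp (fderiv ℝ g (j s.1))) +
    (compL ℝ E' E ℝ s.2.1).comp (D² g (j s.1)))

lemma continuousAt_jetCoordChange {j : E → E'} {g : E' → E} {s : 𝕁 E} (hj : ContinuousAt j s.1)
    (hg : ContDiffAt ℝ ∞ g (j s.1)) : ContinuousAt (jetCoordChange j g) s := by
  have h0 : ContinuousAt (fun s : 𝕁 E => j s.1) s := ContinuousAt.comp (g := j) hj continuousAt_fst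
  have hg1 : ContDiffAt ℝ ∞ (fderiv ℝ g) (j s.1) := hg.fderiv_right (by simp)
  have hg2 : ContDiffAt ℝ ∞ D² g (j s.1) := hg1.fderiv_right (by simp)
  have h1 : ContinuousAt (fun s : 𝕁 E =>
      fderiv ℝ g (j s.1)) s := ContinuousAt.comp (g := fderiv ℝ g) hg1.continuousAt h0
  have h2 : ContinuousAt (fun s : 𝕁 E => D² g (j s.1)) s :=
    ContinuousAt.comp (g := D² g) hg2.continuousAt h0
  have h3 : ContinuousAt (fun s : 𝕁 E => s.2.1) s := by fun_prop
  have h4 : ContinuousAt (fun s : 𝕁 E => s.2.2) s := by fun_prop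
  have h5 : ContinuousAt (fun s : 𝕁 E =>
      ((compL ℝ E' E ℝ).flip (fderiv ℝ g (j s.1))).comp
      (s.2.2.comp (fderiv ℝ g (j s.1)))) s :=
    ContinuousAt.clm_comp (((compL ℝ E' E ℝ).flip.continuous.continuousAt).comp h1) (h4.clm_comp h1)
  exact h0.prodMk ((h3.clm_comp h1).prodMk (h5.add
      (ContinuousAt.clm_comp (((compL ℝ E' E ℝ).continuous.continuousAt).comp h3) h2)))

/-- How the coordinates of the jet of a hypersurface change under a diffeomorphism. -/
lemma PointedHypersurface.HasCoords.map {J : M → M'} {G : M' → M} {K : PHyp I M} {K' : PHyp I' M'}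
    (hpt : K'.pt = J K.pt) (hG : ∀ᶠ q in 𝓝 (J K.pt), SmAt I' I G q) (hGJ : G (J K.pt) = K.pt)
    (hs : Surjective (mfderiv I' I G (J K.pt))) (hc : Corr G K' K) {c : M} {c' : M'} {s : 𝕁 E}
    (h : K.HasCoords c s) (hc' : J K.pt ∈ (χ I' c').source) : K'.HasCoords c'
    (jetCoordChange (χ I' c' ∘ J ∘ (χ I c).symm) (χ I c ∘ G ∘ (χ I' c').symm) s) := by
  obtain ⟨hsrc, hs1, f, hf, hs2, hs3⟩ := h
  have hj : (χ I' c' ∘ J ∘ (χ I c).symm) s.1 = χ I' c' (J K.pt) := by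
    simp only [Function.comp, hs1, (χ I c).left_inv hsrc]
  refine ⟨by rwa [hpt], by rw [hpt]; exact hj, f ∘ G, ?_, ?_⟩
  · rw [hpt]
    rw [hpt] at hc
    rw [← hGJ] at hf
    exact hf.comp hG hs hc
  have hsrc' : G (J K.pt) ∈ (χ I c).source := by rwa [hGJ]
  have hgc : ContDiffAt ℝ 2 (χ I c ∘ G ∘ (χ I' c').symm) (χ I' c' (J K.pt)) :=
    (hG.self_of_nhds.contDiffAt_chart hc' hsrc').of_le two_le_infty
  have hgz : (χ I c ∘ G ∘ (χ I' c').symm) (χ I' c' (J K.pt)) = s.1 := by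
    simp only [Function.comp, (χ I' c').left_inv hc', hGJ, hs1]
  have hfc : ContDiffAt ℝ 2 (f ∘ (χ I c).symm)
      ((χ I c ∘ G ∘ (χ I' c').symm) (χ I' c' (J K.pt))) := by
    rw [hgz, hs1]
    exact (hf.contMDiffAt.contDiffAt_comp_extChartAt_symm hsrc).of_le two_le_infty
  have heq : (f ∘ G) ∘ (χ I' c').symm =ᶠ[𝓝 (χ I' c' (J K.pt))]
      (f ∘ (χ I c).symm) ∘ (χ I c ∘ G ∘ (χ I' c').symm) := by
    have h1 : Tendsto (χ I' c').symm (𝓝 (χ I' c' (J K.pt))) (𝓝 (J K.pt)) := by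
      have := (continuousAt_extChartAt_symm' hc').tendsto
      rwa [(χ I' c').left_inv hc'] at this
    have h2 : Tendsto G (𝓝 (J K.pt)) (𝓝 K.pt) := by
      have := hG.self_of_nhds.continuousAt.tendsto
      rwa [hGJ] at this
    filter_upwards [(h2.comp h1).eventually ((isOpen_extChartAt_source c).mem_nhds hsrc)] with z hz
    simp only [Function.comp] at hz
    simp only [Function.comp, (χ I c).left_inv hz]
  constructor
  · simp only [jetCoordChange, hj]
    rw [heq.fderiv_eq, fderiv_comp _ hfc.diffAt hgc.diffAt, hgz, hs2]
  · simp only [jetCoordChange, hj]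
    rw [heq.fderiv.fderiv_eq]
    ext a b
    rw [fderiv_fderiv_comp hfc hgc, hgz, ← hs3, ← hs2]
    simp

lemma isOpen_jet2_iff {O : Set (Jet2 I M)} : IsOpen O ↔ ∀ (c : M) (K : PHyp I M) (s : 𝕁 E),
    K.HasCoords c s → K.jet ∈ O → ∀ᶠ s' in 𝓝 s, ∀ K' : PHyp I M, K'.HasCoords c s' → K'.jet ∈ O := by
  rw [isOpen_iSup_iff]
  refine forall_congr' fun c => ?_
  rw [isOpen_coinduced]
  let T : TopologicalSpace {q : PHyp I M × (𝕁 E) //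
      q.1.HasCoords c q.2} := TopologicalSpace.induced (fun q => q.1.2) inferInstance
  refine (@isOpen_iff_mem_nhds _ T _).trans ?_
  constructor
  · intro h K s hK hKO
    have h1 := h ⟨(K, s), hK⟩ hKO
    rw [nhds_induced, mem_comap] at h1
    obtain ⟨t, ht, hsub⟩ := h1
    filter_upwards [ht] with s' hs' K' hK'
    exact hsub (a := ⟨(K', s'), hK'⟩) hs'
  · rintro h ⟨⟨K, s⟩, hK⟩ hKO
    rw [nhds_induced, mem_comap]
    refine ⟨_, h K s hK hKO, ?_⟩
    rintro ⟨⟨K', s'⟩, hK'⟩ h'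
    exact h' K' hK'

/-- A diffeomorphism `J : O → O'` with inverse `G` that maps a set of jets into another one also
maps the closure into the closure. -/
lemma jet_mem_closure_of_map {J : M → M'} {G : M' → M} {O : Set M} {O' : Set M'}
    (hO : IsOpen O) (hO' : IsOpen O') (hJ : ∀ p ∈ O, SmAt I I' J p)
    (hG : ∀ p ∈ O', SmAt I' I G p) (hJO : ∀ p ∈ O, J p ∈ O')
    (hGJ : ∀ p ∈ O, G (J p) = p) (hJG : ∀ p ∈ O', J (G p) = p)
    {A : Set (Jet2 I M)} {A' : Set (Jet2 I' M')}
    (hA : ∀ (K : PHyp I M) (K' : PHyp I' M'), K.pt ∈ O → K'.pt = J K.pt → Corr G K' K → K.jet ∈ A →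
        K'.jet ∈ A')
    {K : PHyp I M} {K' : PHyp I' M'} (hK : K.pt ∈ O)
    (hpt : K'.pt = J K.pt) (hc : Corr G K' K)
    (hmem : K.jet ∈ closure A) : K'.jet ∈ closure A' := by
  have hsurj p (hp : p ∈ O) : Surjective (mfderiv I' I G (J p)) := by
    refine HasLocalSection.surjective_mfderiv ⟨J, ?_, ?_, ?_⟩ ((hG _ (hJO p hp)).mdiffAt)
    · rw [hGJ p hp]
      filter_upwards [hO.mem_nhds hp] with q hq using hJ q hq
    · rw [hGJ p hp]
    · rw [hGJ p hp]
      filter_upwards [hO.mem_nhds hp] with q hq using hGJ q hq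
  have hGev p (hp : p ∈ O) : ∀ᶠ q in 𝓝 (J p), SmAt I' I G q := by
    filter_upwards [hO'.mem_nhds (hJO p hp)] with q hq using hG q hq
  have hJGev p (hp : p ∈ O) : ∀ᶠ q in 𝓝 (J p), J (G q) = q := by
    filter_upwards [hO'.mem_nhds (hJO p hp)] with q hq using hJG q hq
  let im : ∀ L : PHyp I M, L.pt ∈ O → PHyp I' M' := fun L hL =>
    L.map J G (hGev _ hL) (hGJ _ hL) (hsurj _ hL)
  have him (L : PHyp I M) (hL : L.pt ∈ O) : ∀ᶠ q in 𝓝 L.pt, q ∈ L.carrier ↔ J q ∈ (im L hL).carrier := by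
    filter_upwards [hO.mem_nhds hL] with q hq
    show q ∈ L.carrier ↔ G (J q) ∈ L.carrier
    rw [hGJ q hq]
  rw [mem_closure_iff] at hmem ⊢
  intro o ho hKo
  -- `P` consists of the jets whose image under `J` belongs to `o`
  set P : Set (Jet2 I M) := {j | ∃ (L : PHyp I M) (hL : L.pt ∈ O), L.jet = j ∧ (im L hL).jet ∈ o}
  have hPo : IsOpen P := by
    rw [isOpen_jet2_iff]
    rintro c K1 s hK1 ⟨L, hL, hLj, hLo⟩
    have hK1O : K1.pt ∈ O := by rwa [(PointedHypersurface.jet_eq_iff.1 hLj.symm).1]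
    have h1 : (im K1 hK1O).jet ∈ o := by
      have : (im K1 hK1O).jet = (im L hL).jet :=
        PointedHypersurface.jet_eq_of_map hLj.symm rfl rfl (hJ _ hK1O) (hG _ (hJO _ hK1O))
          (hGJ _ hK1O) (hJGev _ hK1O) (him K1 hK1O) (him L hL)
      rwa [this]
    set c' := J K1.pt
    have h2 : (im K1 hK1O).HasCoords c' _ := PointedHypersurface.HasCoords.map (K' := im K1 hK1O)
      rfl (hGev _ hK1O) (hGJ _ hK1O) (hsurj _ hK1O) (.of_forall fun q => Iff.rfl) hK1
      (mem_extChartAt_source _)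
    have h3 := isOpen_jet2_iff.1 ho c' _ _ h2 h1
    obtain ⟨hsrc, hs1, -⟩ := hK1
    have hsy : (χ I c).symm s.1 = K1.pt := by rw [hs1, (χ I c).left_inv hsrc]
    have hst : s.1 ∈ (χ I c).target := by rw [hs1]; exact (χ I c).map_source hsrc
    have hcs : ContinuousAt (χ I c).symm s.1 := by
      rw [hs1]; exact continuousAt_extChartAt_symm' hsrc
    have hcJ : ContinuousAt J ((χ I c).symm s.1) := by rw [hsy]; exact (hJ _ hK1O).continuousAt
    have hcont := continuousAt_jetCoordChange (s := s) (j := χ I' c' ∘ J ∘ (χ I c).symm)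
      (g := χ I c ∘ G ∘ (χ I' c').symm)
      (by
        refine ContinuousAt.comp ?_ (hcJ.comp hcs)
        simp only [Function.comp, hsy]
        exact continuousAt_extChartAt _)
      (by
        simp only [Function.comp, hsy]
        refine (hG _ (hJO _ hK1O)).contDiffAt_chart (mem_extChartAt_source _) ?_
        rwa [hGJ _ hK1O])
    have hO1 : ∀ᶠ s' : 𝕁 E in 𝓝 s, (χ I c).symm s'.1 ∈ O ∧ J ((χ I c).symm s'.1) ∈
          (χ I' c').source := by
      have hcs' : ContinuousAt (fun s' : 𝕁 E =>
        (χ I c).symm s'.1) s := ContinuousAt.comp hcs continuousAt_fst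
      have hcJ' : ContinuousAt (fun s' : 𝕁 E =>
        J ((χ I c).symm s'.1)) s := ContinuousAt.comp (g := J) hcJ hcs'
      refine (hcs'.eventually ?_).and (hcJ'.eventually ?_)
      · simp only [hsy]; exact hO.mem_nhds hK1O
      · simp only [hsy]; exact extChartAt_source_mem_nhds _
    filter_upwards [hcont.eventually h3, hO1] with s' h4 h5 K2 hK2
    obtain ⟨hsrc2, hs2, -⟩ := id hK2
    rw [hs2, (χ I c).left_inv hsrc2] at h5
    refine ⟨K2, h5.1, rfl, h4 _ ?_⟩
    exact PointedHypersurface.HasCoords.map (K' := im K2 h5.1) rfl (hGev _ h5.1) (hGJ _ h5.1)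
      (hsurj _ h5.1) (.of_forall fun q => Iff.rfl) hK2 h5.2
  have hKP : K.jet ∈ P := by
    refine ⟨K, hK, rfl, ?_⟩
    have : (im K hK).jet = K'.jet := by
      refine PointedHypersurface.jet_eq_of_eventually hpt.symm ?_
      have h1 : (im K hK).pt = K'.pt := hpt.symm
      rw [h1]
      filter_upwards [hc] with q hq
      exact hq.symm
    rwa [this]
  obtain ⟨j, ⟨L, hL, rfl, hLo⟩, hjA⟩ := hmem P hPo hKP
  exact ⟨_, hLo, hA L (im L hL) hL rfl (.of_forall fun q => Iff.rfl) hjA⟩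

end JetTransport

/-! ### The extended equation in coordinates -/

section Symbol

variable {n : ℕ}

/-- The coordinate vector `∂/∂xᵢ` of `ℝ × ℝⁿ × ℝ`. -/
def eX (i : Fin n) : ℝ × 𝔼 n × ℝ := (0, single i 1, 0)

/-- The coordinate vector `∂/∂u` of `ℝ × ℝⁿ × ℝ`. -/
def eU : ℝ × 𝔼 n × ℝ := (0, 0, 1)

/-- The coordinate vector `∂/∂t` of `ℝ × ℝⁿ × ℝ`. -/
def eT : ℝ × 𝔼 n × ℝ := (1, 0, 0)

/-- The vector `ξ_u ∂ᵢ - ξᵢ ∂_u`, which is annihilated by both `ξ` and `dt`. -/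
def tangentVec (ξ : 𝕍 n →L[ℝ] ℝ) (i : Fin n) : ℝ × 𝔼 n × ℝ := ξ eU • eX i - ξ (eX i) • eU

lemma apply_tangentVec (ξ : 𝕍 n →L[ℝ] ℝ) (i : Fin n) : ξ (tangentVec ξ i) = 0 := by
  simp [tangentVec, mul_comm]

/-- The parabolic equation with coefficients `b`, `c`, `b₁`, `q` as a condition on the derivatives
`ξ`, `S` of a local equation `f` of a hypersurface. If the hypersurface is a graph `u = w(t, x)`,
then `f = u - w` yields the expression `w_t - L w`. -/
def jetPoly (b c : Mat n) (b₁ : Fin n → ℝ) (q : ℝ) (ξ : 𝕍 n →L[ℝ] ℝ) (S : Bil (𝕍 n)) : ℝ :=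
  (∑ i, ∑ j, b i j * S (tangentVec ξ i) (tangentVec ξ j)) - ξ eT * ξ eU ^ 2 -
    (∑ i, ∑ j, c i j * ξ (eX i) * ξ (eX j)) * ξ eU + (∑ i, b₁ i * ξ (eX i)) * ξ eU ^ 2 - q * ξ eU ^ 3

lemma jetPoly_smul (b c : Mat n) (b₁ : Fin n → ℝ) (q : ℝ) {ξ ξ' : 𝕍 n →L[ℝ] ℝ} {S S' : Bil (𝕍 n)}
    {μ : ℝ} (hξ : ξ' = μ • ξ) (hS : ∀ X Y, ξ X = 0 → ξ Y = 0 → S' X Y = μ * S X Y) :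
    jetPoly b c b₁ q ξ' S' = μ ^ 3 * jetPoly b c b₁ q ξ S := by
  have ht i : tangentVec ξ' i = μ • tangentVec ξ i := by
    rw [hξ]
    simp only [tangentVec, FunLike.coe_smul, Pi.smul_apply, smul_eq_mul, smul_sub, smul_smul]
  have h1 i j : S' (tangentVec ξ' i) (tangentVec ξ' j) =
      μ ^ 3 * S (tangentVec ξ i) (tangentVec ξ j) := by
    rw [ht, ht, map_smul, map_smul, _root_.smul_apply,
      hS _ _ (apply_tangentVec ξ i) (apply_tangentVec ξ j)]
    simp only [smul_eq_mul]; ring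
  unfold jetPoly
  simp only [h1]
  simp only [hξ, FunLike.coe_smul, Pi.smul_apply, smul_eq_mul, mul_sub, mul_add, mul_sum, sum_mul]
  refine congrArg₂ _ (congrArg₂ _ (congrArg₂ _ (congrArg₂ _ ?_ ?_) ?_) ?_) ?_
  · exact sum_congr rfl fun i _ => sum_congr rfl fun j _ => by ring
  · ring
  · exact sum_congr rfl fun i _ => sum_congr rfl fun j _ => by ring
  · exact sum_congr rfl fun i _ => by ring
  · ring

end Symbol

namespace ParabolicEquation

variable {n : ℕ} {X : Type*} [TopologicalSpace X] [ChartedSpace 𝔼 n X]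

/-- Coefficients of a parabolic equation in the chart around `x0`, near `x0`. -/
structure LocalCoeffs (A : PEq n X) (x0 : X) where
  W : Set X
  isOpen_W : IsOpen W
  mem_W : x0 ∈ W
  W_subset : W ⊆ (chart n x0).source
  b : ℝ × X × ℝ → Mat n
  c : ℝ × X × ℝ → Mat n
  b₁ : ℝ × X × ℝ → Fin n → ℝ
  q : ℝ × X × ℝ → ℝ
  continuousOn_b : ContinuousOn b (A.T ×ˢ W ×ˢ A.Ω)
  continuousOn_c : ContinuousOn c (A.T ×ˢ W ×ˢ A.Ω)
  continuousOn_b₁ : ContinuousOn b₁ (A.T ×ˢ W ×ˢ A.Ω)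
  continuousOn_q : ContinuousOn q (A.T ×ˢ W ×ˢ A.Ω)
  posDef : ∀ p ∈ A.T ×ˢ W ×ˢ A.Ω, (b p).PosDef
  op_eq : ∀ t ∈ A.T, ∀ x ∈ W, ∀ w : X → ℝ, SmoothAt n w x → w x ∈ A.Ω → A.op t x w =
      (∑ i, ∑ j, b (t, x, w x) i j * pderiv₂ x0 w x i j) +
      (∑ i, ∑ j, c (t, x, w x) i j * pderiv₁ x0 w x i * pderiv₁ x0 w x j) +
      (∑ i, b₁ (t, x, w x) i * pderiv₁ x0 w x i) + q (t, x, w x)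

lemma nonempty_localCoeffs (A : PEq n X) (x0 : X) : Nonempty (A.LocalCoeffs x0) := by
  obtain ⟨W, hW, hWs, b, c, b₁, q, h1, h2, h3, h4, h5, h6⟩ := A.parabolic x0
  have hsub : A.T ×ˢ interior W ×ˢ A.Ω ⊆ A.T ×ˢ W ×ˢ A.Ω :=
    prod_mono subset_rfl (prod_mono interior_subset subset_rfl)
  exact ⟨⟨interior W, isOpen_interior, mem_interior_iff_mem_nhds.2 hW, interior_subset.trans hWs,
    b, c, b₁, q, h1.mono hsub, h2.mono hsub, h3.mono hsub, h4.mono hsub,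
    fun p hp => (h5 p (hsub hp)).1, fun t ht x hx w hw hwx => h6 t ht x (interior_subset hx) w hw hwx⟩⟩

/-- A choice of coefficients of the equation near `x0`. -/
def coeffs (A : PEq n X) (x0 : X) : A.LocalCoeffs x0 := Classical.choice (A.nonempty_localCoeffs x0)

/-- The extended equation at `p` as a condition on the derivatives of a local equation of a
hypersurface in the chart of `X` around `x0`. -/
def symbolAt (A : PEq n X) (x0 : X) (p : ℝ × X × ℝ) (ξ : 𝕍 n →L[ℝ] ℝ) (S : Bil (𝕍 n)) : ℝ :=
  jetPoly ((A.coeffs x0).b p) ((A.coeffs x0).c p) ((A.coeffs x0).b₁ p) ((A.coeffs x0).q p) ξ S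

lemma mem_space {A : PEq n X} {p : ℝ × X × ℝ} : p ∈ A.space ↔ p.1 ∈ A.T ∧ p.2.2 ∈ A.Ω := by
  simp [space]

lemma isOpen_space (A : PEq n X) : IsOpen A.space := A.isOpen_T.prod (isOpen_univ.prod A.isOpen_Ω)

end ParabolicEquation

section EqJet

variable {n : ℕ} {X : Type*} [TopologicalSpace X] [ChartedSpace 𝔼 n X]

/-- The chart of `ℝ × X × ℝ` given by the chart of `X` around `x0`. -/
abbrev txuChart (n : ℕ) {X : Type*} [TopologicalSpace X] [ChartedSpace 𝔼 n X]
    (x0 : X) : PartialEquiv (ℝ × X × ℝ) 𝕍 n :=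
  χ (txuModel n) ((0, x0, 0) : ℝ × X × ℝ)

lemma extChartAt_eq_txuChart (c : ℝ × X × ℝ) : χ (txuModel n) c = txuChart n c.2.1 := by
  rw [txuChart, extChartAt_txu, extChartAt_txu]

/-- The derivative of `f` at `p` in the chart given by the chart of `X` around `x0`. -/
def eqJet₁ (n : ℕ) {X : Type*} [TopologicalSpace X]
    [ChartedSpace 𝔼 n X] (x0 : X) (f : ℝ × X × ℝ → ℝ) (p : ℝ × X × ℝ) :
    𝕍 n →L[ℝ] ℝ :=
  fderiv ℝ (f ∘ (txuChart n x0).symm) (txuChart n x0 p)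

/-- The second derivative of `f` at `p` in the chart given by the chart of `X` around `x0`. -/
def eqJet₂ (n : ℕ) {X : Type*} [TopologicalSpace X]
    [ChartedSpace 𝔼 n X] (x0 : X) (f : ℝ × X × ℝ → ℝ) (p : ℝ × X × ℝ) :
    Bil (𝕍 n) :=
  D² (f ∘ (txuChart n x0).symm) (txuChart n x0 p)

variable [IsManifold (𝓡 n) ∞ X]

lemma ContMDiffAt.contDiffAt_tx {u : ℝ × X → ℝ} {t : ℝ} {x0 x : X} (hu : SmAt (txM n) 𝓘₁ u (t, x))
    (hx : x ∈ (chart n x0).source) :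
    ContDiffAt ℝ ∞ (fun z : ℝ × 𝔼 n => u (z.1, (chart n x0).symm z.2)) (t, chart n x0 x) := by
  have h := hu.contDiffAt_comp_extChartAt_symm (c := ((0, x0) : ℝ × X))
    (by rw [extChartAt_tx, PartialEquiv.prod_source]; exact ⟨trivial, hx⟩)
  rwa [extChartAt_tx] at h

lemma ContMDiffAt.slice {u : ℝ × X → ℝ} {t : ℝ} {x : X} (hu : SmAt (txM n) 𝓘₁ u (t, x)) :
    SmoothAt n (fun x => u (t, x)) x :=
  hu.comp x (contMDiffAt_const.prodMk contMDiffAt_id)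

/-- Derivatives of the local equation `v - u(t, x)` of a graph. -/
lemma eqJet_graph {u : ℝ × X → ℝ} {p : ℝ × X × ℝ} {x0 : X} (hu : SmAt (txM n) 𝓘₁ u (p.1, p.2.1))
    (hx : p.2.1 ∈ (chart n x0).source) : let f : ℝ × X × ℝ → ℝ := fun q => q.2.2 - u (q.1, q.2.1)
    eqJet₁ n x0 f p eU = 1 ∧ eqJet₁ n x0 f p eT = - deriv (fun t => u (t, p.2.1)) p.1 ∧
      (∀ i, eqJet₁ n x0 f p (eX i) = - pderiv₁ x0 (fun x => u (p.1, x)) p.2.1 i) ∧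
      ∀ i j, eqJet₂ n x0 f p (tangentVec (eqJet₁ n x0 f p) i) (tangentVec (eqJet₁ n x0 f p) j) =
        - pderiv₂ x0 (fun x => u (p.1, x)) p.2.1 i j := by
  intro f
  set φ := chart n x0
  set uh : ℝ × 𝔼 n → ℝ := fun z => u (z.1, φ.symm z.2) with huh
  have huc : ContDiffAt ℝ ∞ uh (p.1, φ p.2.1) := hu.contDiffAt_tx hx
  have hud : DifferentiableAt ℝ uh (p.1, φ p.2.1) := huc.diffAt
  have hz : txuChart n x0 p = (p.1, φ p.2.1, p.2.2) := extChartAt_txu_apply _ p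
  let π : 𝕍 n →L[ℝ] (ℝ × 𝔼 n) := (fst ℝ _ _).prod ((fst ℝ _ _).comp (snd ℝ _ _))
  let pu : 𝕍 n →L[ℝ] ℝ := (snd ℝ _ _).comp (snd ℝ _ _)
  have hf : f ∘ (txuChart n x0).symm = fun z => pu z - (uh ∘ π) z := by
    funext z
    simp only [Function.comp, extChartAt_txu_symm_apply]
    rfl
  have hd1 (z : ℝ × 𝔼 n × ℝ) : DifferentiableAt ℝ uh (π z) →
      fderiv ℝ (f ∘ (txuChart n x0).symm) z = pu - (fderiv ℝ uh (π z)).comp π := by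
    intro hz
    rw [hf, fderiv_fun_sub pu.differentiableAt (hz.comp z π.differentiableAt), pu.fderiv,
      fderiv_comp z hz π.differentiableAt, π.fderiv]
  have hπ : π (p.1, φ p.2.1, p.2.2) = (p.1, φ p.2.1) := rfl
  have hJ1 : eqJet₁ n x0 f p = pu - (fderiv ℝ uh (p.1, φ p.2.1)).comp π := by
    rw [eqJet₁, hz, hd1 _ (by rwa [hπ]), hπ]
  have hJ2 a b : eqJet₂ n x0 f p a b = - D² uh (p.1, φ p.2.1) (π a) (π b) := by
    have h2 : ContDiffAt ℝ 2 uh (π (p.1, φ p.2.1, p.2.2)) := huc.of_le two_le_infty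
    have h3 : fderiv ℝ (f ∘ (txuChart n x0).symm) =ᶠ[𝓝 (p.1, φ p.2.1, p.2.2)]
        fun z => pu - fderiv ℝ (uh ∘ π) z := by
      have : ∀ᶠ z in 𝓝 (p.1, φ p.2.1, p.2.2), ContDiffAt ℝ 2 uh (π z) :=
        π.continuous.continuousAt.eventually (h2.eventually (by simp))
      filter_upwards [this] with z hz
      have hz' := hz.differentiableAt (by simp : (2 : WithTop ℕ∞) ≠ 0)
      rw [hd1 z hz', fderiv_comp z hz' π.differentiableAt, π.fderiv]
    rw [eqJet₂, hz, h3.fderiv_eq, fderiv_const_sub]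
    have h4 := fderiv_fderiv_comp h2 (π.contDiff.contDiffAt (x := (p.1, φ p.2.1, p.2.2))) a b
    have h5 : fderiv ℝ (π : _ → _) = fun _ => π := by funext z; exact π.fderiv
    rw [h5] at h4
    simp only [fderiv_fun_const, Pi.zero_apply, _root_.zero_apply, map_zero, add_zero] at h4
    rw [_root_.neg_apply, _root_.neg_apply, h4, hπ]
  -- derivatives along the slice `t = const`
  set ι : 𝔼 n → ℝ × 𝔼 n := fun z => (p.1, z) with hι
  have hιd z : HasFDerivAt ι (ContinuousLinearMap.inr ℝ ℝ _) z :=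
    (hasFDerivAt_const p.1 z).prodMk (hasFDerivAt_id z)
  have hιc : ContDiff ℝ ∞ ι := by fun_prop
  have hp1 i : pderiv₁ x0 (fun x => u (p.1, x)) p.2.1 i =
      fderiv ℝ uh (p.1, φ p.2.1) (0, single i 1) := by
    have : (fun x => u (p.1, x)) ∘ φ.symm = uh ∘ ι := rfl
    rw [pderiv₁, this, fderiv_comp _ hud (hιd _).differentiableAt, (hιd _).fderiv]
    simp
  have hp2 i j : pderiv₂ x0 (fun x => u (p.1, x)) p.2.1 i j =
      D² uh (p.1, φ p.2.1) (0, single i 1) (0, single j 1) := by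
    have : (fun x => u (p.1, x)) ∘ φ.symm = uh ∘ ι := rfl
    have h2 : ContDiffAt ℝ 2 uh (ι (φ p.2.1)) := huc.of_le two_le_infty
    rw [pderiv₂, this, fderiv_fderiv_comp h2 (hιc.contDiffAt.of_le two_le_infty), (hιd _).fderiv]
    have h5 : fderiv ℝ ι = fun _ => ContinuousLinearMap.inr ℝ ℝ _ := by
      funext z; exact (hιd z).fderiv
    rw [h5]
    simp [hι]
  have hpt : deriv (fun t => u (t, p.2.1)) p.1 = fderiv ℝ uh (p.1, φ p.2.1) (1, 0) := by
    have h1 : (fun t => u (t, p.2.1)) = uh ∘ fun t => (t, φ p.2.1) := by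
      funext t; simp only [huh, Function.comp, φ.left_inv hx]
    have h2 : HasDerivAt (fun t : ℝ => (t, φ p.2.1)) ((1 : ℝ), (0 : 𝔼 n)) p.1 :=
      (hasDerivAt_id p.1).prodMk (hasDerivAt_const p.1 _)
    rw [h1]
    exact (hud.hasFDerivAt.comp_hasDerivAt p.1 h2).deriv
  have hU : eqJet₁ n x0 f p eU = 1 := by
    rw [hJ1]
    have h1 : pu eU = 1 := rfl
    have h2 : π eU = 0 := rfl
    simp [h1, h2]
  have hX i : eqJet₁ n x0 f p (eX i) = - pderiv₁ x0 (fun x => u (p.1, x)) p.2.1 i := by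
    rw [hp1, hJ1]
    have h1 : pu (eX i) = 0 := rfl
    have h2 : π (eX i) = (0, single i 1) := rfl
    simp [h1, h2]
  refine ⟨hU, ?_, hX, ?_⟩
  · rw [hpt, hJ1]
    have h1 : pu eT = 0 := rfl
    have h2 : π eT = (1, 0) := rfl
    simp [h1, h2]
  · intro i j
    have : ∀ i, π (tangentVec (eqJet₁ n x0 f p) i) = (0, single i 1) := by
      intro i
      have h1 : π eU = 0 := rfl
      have h2 : π (eX i) = (0, single i 1) := rfl
      rw [tangentVec, hU, map_sub, map_smul, map_smul, h1, h2]
      simp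
    rw [hJ2, this, this, hp2]

lemma ParabolicEquation.symbolAt_graph (A : PEq n X) {u : ℝ × X → ℝ} {p : ℝ × X × ℝ} {x0 : X}
    (hp : p ∈ A.space) (hx : p.2.1 ∈ (A.coeffs x0).W) (hu : SmAt (txM n) 𝓘₁ u (p.1, p.2.1))
    (hpu : u (p.1, p.2.1) = p.2.2) : A.symbolAt x0 p
    (eqJet₁ n x0 (fun q => q.2.2 - u (q.1, q.2.1)) p)
    (eqJet₂ n x0 (fun q => q.2.2 - u (q.1, q.2.1)) p) = deriv (fun t => u (t, p.2.1)) p.1 - A.op p.1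
    p.2.1 fun x => u (p.1, x) := by
  obtain ⟨h1, h2, h3, h4⟩ := eqJet_graph hu ((A.coeffs x0).W_subset hx)
  have hp' := mem_space.1 hp
  rw [(A.coeffs x0).op_eq p.1 hp'.1 p.2.1 hx _ hu.slice (by rw [hpu]; exact hp'.2)]
  simp only [hpu, Prod.mk.eta]
  unfold symbolAt jetPoly
  simp only [h1, h2, h3, h4]
  simp only [mul_neg, neg_mul, sum_neg_distrib, neg_neg]
  ring

lemma isLocalEquation_graph {u : ℝ × X → ℝ} {p : ℝ × X × ℝ} {L : Set (ℝ × X × ℝ)}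
    (hu : ∀ᶠ q in 𝓝 (p.1, p.2.1), SmAt (txM n) 𝓘₁ u q) (hpu : u (p.1, p.2.1) = p.2.2)
    (hL : ∀ᶠ q in 𝓝 p, q ∈ L ↔ q.2.2 = u (q.1, q.2.1)) : IsLocalEquation (txuModel n)
    (fun q : ℝ × X × ℝ => q.2.2 - u (q.1, q.2.1)) L p := by
  have hc : Tendsto (fun q : ℝ × X × ℝ => (q.1, q.2.1)) (𝓝 p) (𝓝 (p.1, p.2.1)) := by
    have : Continuous (fun q : ℝ × X × ℝ => (q.1, q.2.1)) := by fun_prop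
    exact this.tendsto p
  have hsm : ∀ᶠ q in 𝓝 p, SmAt (txuModel n) 𝓘₁ (fun q : ℝ × X × ℝ => q.2.2 - u (q.1, q.2.1)) q := by
    filter_upwards [hc.eventually hu] with q hq
    have e2 : SmAt (txuModel n) 𝓘₁ (fun q : ℝ × X × ℝ => q.2.2) q :=
      contMDiffAt_snd.comp q contMDiffAt_snd
    exact e2.sub (hq.comp q (contMDiffAt_fst.prodMk (contMDiffAt_fst.comp q contMDiffAt_snd)))
  refine isLocalEquation_of_eventually (by simp [hpu]) ?_ hsm ?_
  · rw [mfderiv_ne_zero_iff hsm.self_of_nhds (c := ((0, p.2.1, 0) : ℝ × X × ℝ))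
      (mem_extChartAt_txu_source.2 (mem_extChartAt_source _))]
    intro h
    have h1 := (eqJet_graph hu.self_of_nhds (mem_extChartAt_source (I := 𝓡 n) p.2.1)).1
    rw [eqJet₁, h] at h1
    simp at h1
  · filter_upwards [hL] with q hq
    rw [hq, sub_eq_zero]

/-- The hypersurface `L` is, near its point, the graph of the smooth function `u(t, x)`. -/
def PointedHypersurface.IsGraph (L : Hyp n X) (u : ℝ × X → ℝ) : Prop :=
  (∀ᶠ q in 𝓝 (L.pt.1, L.pt.2.1), SmAt (txM n) 𝓘₁ u q) ∧
    ∀ᶠ q in 𝓝 L.pt, q ∈ L.carrier ↔ q.2.2 = u (q.1, q.2.1)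

lemma PointedHypersurface.IsGraph.apply {L : Hyp n X} {u : ℝ × X → ℝ} (h : L.IsGraph u) :
    u (L.pt.1, L.pt.2.1) = L.pt.2.2 := by
  obtain ⟨f, hf⟩ := L.exists_equation
  exact (h.2.self_of_nhds.1 (hf.eventually_mem_iff.self_of_nhds.2 hf.1)).symm

lemma PointedHypersurface.IsGraph.isLocalEquation {L : Hyp n X} {u : ℝ × X → ℝ} (h : L.IsGraph u) :
    IsLocalEquation (txuModel n) (fun q => q.2.2 - u (q.1, q.2.1)) L.carrier L.pt :=
  isLocalEquation_graph h.1 h.apply h.2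

lemma PointedHypersurface.exists_isGraph {u : ℝ × X → ℝ} {p : ℝ × X × ℝ}
    (hu : ∀ᶠ q in 𝓝 (p.1, p.2.1), SmAt (txM n) 𝓘₁ u q) (hp : u (p.1, p.2.1) = p.2.2) :
    ∃ L : Hyp n X, L.pt = p ∧ L.IsGraph u :=
  ⟨⟨p, {q | q.2.2 = u (q.1, q.2.1)}, _, isLocalEquation_graph hu hp (.of_forall fun q => Iff.rfl)⟩,
    rfl, hu, .of_forall fun q => Iff.rfl⟩

/-- A hypersurface that is transversal to the `u`-axis is locally a graph. -/
lemma IsLocalEquation.exists_graph {f : ℝ × X × ℝ → ℝ} {L : Hyp n X}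
    (hf : IsLocalEquation (txuModel n) f L.carrier L.pt) (hu : eqJet₁ n L.pt.2.1 f L.pt eU ≠ 0) :
    ∃ u : ℝ × X → ℝ, L.IsGraph u := by
  set p := L.pt
  rw [eqJet₁, ← extChartAt_eq_txuChart] at hu
  obtain ⟨g, g1, g2, g3, g4⟩ := exists_implicit_txu hf.eventually_contMDiffAt hu
  rw [hf.1] at g1 g2 g3
  have hc : Continuous (fun q : ℝ × X => ((q.1, q.2, 0) : ℝ × X × ℝ)) := by fun_prop
  refine ⟨fun q => g (q.1, q.2, 0), ?_, ?_⟩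
  · have h1 : Tendsto (fun q : ℝ × X => ((q.1, q.2, 0) : ℝ × X × ℝ)) (𝓝 (p.1, p.2.1))
      (𝓝 (p.1, p.2.1, 0)) := hc.tendsto _
    filter_upwards [h1.eventually g1] with q hq
    exact hq.comp q (contMDiffAt_fst.prodMk (contMDiffAt_snd.prodMk contMDiffAt_const))
  · have h2 : Tendsto (fun q : ℝ × X × ℝ => ((q.1, q.2.1, 0) : ℝ × X × ℝ)) (𝓝 p)
        (𝓝 (p.1, p.2.1, 0)) := by
      have : Continuous (fun q : ℝ × X × ℝ => ((q.1, q.2.1, 0) : ℝ × X × ℝ)) := by fun_prop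
      exact this.tendsto p
    filter_upwards [hf.eventually_mem_iff, g4, h2.eventually g3] with q h3 h4 h5
    rw [h3]
    constructor
    · intro h; rw [h] at h4; exact h4.symm
    · intro h
      have h6 : f (q.1, q.2.1, g (q.1, q.2.1, 0)) = 0 := h5
      rwa [← h] at h6

end EqJet

section Extended

variable {n : ℕ} {X : Type*} [TopologicalSpace X] [ChartedSpace 𝔼 n X] [IsManifold (𝓡 n) ∞ X]

lemma mem_txuChart_source {x0 : X} {q : ℝ × X × ℝ} :
    q ∈ (txuChart n x0).source ↔ q.2.1 ∈ (chart n x0).source :=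
  mem_extChartAt_txu_source

lemma ParabolicEquation.symbolAt_eq_zero_iff_of_jet_eq (A : PEq n X) {x0 : X} {K L : Hyp n X}
    (h : K.jet = L.jet) {f g : ℝ × X × ℝ → ℝ} (hf : IsLocalEquation (txuModel n) f K.carrier K.pt)
    (hg : IsLocalEquation (txuModel n) g L.carrier L.pt) (hx : K.pt.2.1 ∈ (chart n x0).source) :
    A.symbolAt x0 L.pt (eqJet₁ n x0 g L.pt) (eqJet₂ n x0 g L.pt) = 0 ↔ A.symbolAt x0 K.pt
    (eqJet₁ n x0 f K.pt) (eqJet₂ n x0 f K.pt) = 0 := by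
  obtain ⟨μ, h0, h1, h2⟩ := exists_smul_of_jet_eq h hf hg (mem_txuChart_source.2 hx)
  rw [← (PointedHypersurface.jet_eq_iff.1 h).1]
  unfold symbolAt
  have h3 := jetPoly_smul ((A.coeffs x0).b K.pt) ((A.coeffs x0).c K.pt) ((A.coeffs x0).b₁ K.pt)
    ((A.coeffs x0).q K.pt) (ξ := eqJet₁ n x0 f K.pt) (ξ' := eqJet₁ n x0 g K.pt)
    (S := eqJet₂ n x0 f K.pt) (S' := eqJet₂ n x0 g K.pt) (μ := μ) h1 h2
  rw [h3]
  simp [h0]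

lemma ContinuousAt.jetPoly {α : Type*} [TopologicalSpace α] {a : α} {b c : α → Mat n}
    {b₁ : α → Fin n → ℝ} {q : α → ℝ} {ξ : α → 𝕍 n →L[ℝ] ℝ} {S : α → Bil (𝕍 n)}
    (hb : ContinuousAt b a) (hc : ContinuousAt c a) (hb1 : ContinuousAt b₁ a)
    (hq : ContinuousAt q a) (hξ : ContinuousAt ξ a) (hS : ContinuousAt S a) : ContinuousAt
    (fun z => jetPoly (b z) (c z) (b₁ z) (q z) (ξ z) (S z)) a := by
  have hξv v : ContinuousAt (fun z => ξ z v) a := hξ.clm_apply continuousAt_const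
  have ht i : ContinuousAt (fun z => tangentVec (ξ z) i) a :=
    ((hξv eU).smul continuousAt_const).sub ((hξv (eX i)).smul continuousAt_const)
  have hbe i j : ContinuousAt (fun z => b z i j) a := (continuousAt_pi.1 (continuousAt_pi.1 hb i) j)
  have hce i j : ContinuousAt (fun z => c z i j) a := (continuousAt_pi.1 (continuousAt_pi.1 hc i) j)
  have h1e i : ContinuousAt (fun z => b₁ z i) a := continuousAt_pi.1 hb1 i
  have s1 : ContinuousAt (fun z => ∑ i, ∑ j, b z i j *
      S z (tangentVec (ξ z) i) (tangentVec (ξ z) j)) a :=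
    tendsto_finsetSum _ fun i _ => tendsto_finsetSum _ fun j _ =>
      (hbe i j).mul ((hS.clm_apply (ht i)).clm_apply (ht j))
  have s2 : ContinuousAt (fun z => ∑ i, ∑ j, c z i j * ξ z (eX i) * ξ z (eX j)) a :=
    tendsto_finsetSum _ fun i _ => tendsto_finsetSum _ fun j _ =>
      ((hce i j).mul (hξv _)).mul (hξv _)
  have s3 : ContinuousAt (fun z => ∑ i, b₁ z i * ξ z (eX i)) a :=
    tendsto_finsetSum _ fun i _ => (h1e i).mul (hξv _)
  exact (((s1.sub ((hξv eT).mul ((hξv eU).pow 2))).sub (s2.mul (hξv eU))).add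
    (s3.mul ((hξv eU).pow 2))).sub (hq.mul ((hξv eU).pow 3))

lemma ParabolicEquation.continuousAt_symbolAt (A : PEq n X) {x0 : X} {s : 𝕁 (𝕍 n)}
    {p : ℝ × X × ℝ} (hs : s.1 = txuChart n x0 p) (hp : p ∈ A.T ×ˢ (A.coeffs x0).W ×ˢ A.Ω) :
    ContinuousAt (fun s : 𝕁 (𝕍 n) => A.symbolAt x0 ((txuChart n x0).symm s.1) s.2.1 s.2.2) s := by
  have hsrc : p ∈ (txuChart n x0).source := mem_txuChart_source.2 ((A.coeffs x0).W_subset hp.2.1)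
  have hsy : (txuChart n x0).symm s.1 = p := by rw [hs, (txuChart n x0).left_inv hsrc]
  have hc : ContinuousAt (fun s : 𝕁 (𝕍 n) => (txuChart n x0).symm s.1) s := by
    refine ContinuousAt.comp (g := (txuChart n x0).symm) ?_ continuousAt_fst
    rw [hs]; exact continuousAt_extChartAt_symm' hsrc
  have aux : ∀ {α : Type} [TopologicalSpace α] (b : ℝ × X × ℝ → α),
      ContinuousOn b (A.T ×ˢ (A.coeffs x0).W ×ˢ A.Ω) →
      ContinuousAt (fun s : 𝕁 (𝕍 n) =>
      b ((txuChart n x0).symm s.1)) s := by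
    intro α _ b hb
    refine ContinuousAt.comp (g := b) ?_ hc
    rw [hsy]; exact hb.continuousAt
        ((A.isOpen_T.prod ((A.coeffs x0).isOpen_W.prod A.isOpen_Ω)).mem_nhds hp)
  exact ContinuousAt.jetPoly (aux _ (A.coeffs x0).continuousOn_b)
    (aux _ (A.coeffs x0).continuousOn_c) (aux _ (A.coeffs x0).continuousOn_b₁)
    (aux _ (A.coeffs x0).continuousOn_q) (continuousAt_fst.comp continuousAt_snd)
    (continuousAt_snd.comp continuousAt_snd)

/-- The condition on a 2-jet to belong to an equation is closed, so that it holds on the extended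
equation. -/
lemma ParabolicEquation.symbolAt_eq_zero_of_mem_extended (A : PEq n X)
    {L : Hyp n X} (hp : L.pt ∈ A.space) {f : ℝ × X × ℝ → ℝ}
    (hf : IsLocalEquation (txuModel n) f L.carrier L.pt) (h : L.jet ∈ A.extended) :
    A.symbolAt L.pt.2.1 L.pt (eqJet₁ n L.pt.2.1 f L.pt) (eqJet₂ n L.pt.2.1 f L.pt) = 0 := by
  by_contra hne
  set x0 := L.pt.2.1
  set N : Set (ℝ × X × ℝ) := A.T ×ˢ (A.coeffs x0).W ×ˢ A.Ω
  have hNs q (hq : q ∈ N) : q ∈ (txuChart n x0).source :=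
    mem_txuChart_source.2 ((A.coeffs x0).W_subset hq.2.1)
  -- the jets at which the symbol does not vanish; they form an open set without solution graphs
  set O : Set (Jet2 (txuModel n) (ℝ × X × ℝ)) := {j | ∃ (K : PHyp (txuModel n)
    (ℝ × X × ℝ)) (g : ℝ × X × ℝ → ℝ), K.jet = j ∧ K.pt ∈ N ∧
    IsLocalEquation (txuModel n) g K.carrier K.pt ∧
    A.symbolAt x0 K.pt (eqJet₁ n x0 g K.pt) (eqJet₂ n x0 g K.pt) ≠ 0}
  have hOo : IsOpen O := by
    rw [isOpen_jet2_iff]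
    rintro c K s hK ⟨K', g, hKj, hK'N, hg, hne'⟩
    have hpt : K'.pt = K.pt := (PointedHypersurface.jet_eq_iff.1 hKj).1
    have hKN : K.pt ∈ N := hpt ▸ hK'N
    have hmap : ∀ {K : Hyp n X} {s}, K.HasCoords c s →
        K.pt ∈ N → K.HasCoords ((0, x0, 0) : ℝ × X × ℝ)
        (jetCoordChange (txuChart n x0 ∘ id ∘ (χ (txuModel n) c).symm)
          (χ (txuModel n) c ∘ id ∘ (txuChart n x0).symm) s) := by
      intro K s hK hKN
      refine PointedHypersurface.HasCoords.map (J := id) (G := id) (K' := K) rfl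
        (.of_forall fun q => contMDiffAt_id) rfl ?_
        (.of_forall fun q => Iff.rfl) hK (hNs _ hKN)
      rw [mfderiv_id]; exact fun w => ⟨w, rfl⟩
    have hcoord : ∀ {K : Hyp n X} {s},
        K.HasCoords ((0, x0, 0) : ℝ × X × ℝ) s → ∃ g, IsLocalEquation (txuModel n) g K.carrier K.pt ∧
        A.symbolAt x0 K.pt (eqJet₁ n x0 g K.pt) (eqJet₂ n x0 g K.pt) =
          A.symbolAt x0 ((txuChart n x0).symm s.1) s.2.1 s.2.2 := by
      rintro K s ⟨h1, h2, g, h3, h4, h5⟩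
      refine ⟨g, h3, ?_⟩
      rw [eqJet₁, eqJet₂, h4, h5, h2, (txuChart n x0).left_inv h1]
    have h1 := hmap hK hKN
    obtain ⟨hsrc, hs1, -⟩ := hK
    have hsy : (χ (txuModel n) c).symm s.1 = K.pt := by rw [hs1, (χ (txuModel n) c).left_inv hsrc]
    obtain ⟨g₁, hg₁, heq1⟩ := hcoord h1
    have hne1 : A.symbolAt x0 K.pt (eqJet₁ n x0 g₁ K.pt) (eqJet₂ n x0 g₁ K.pt) ≠ 0 := fun h0 =>
      hne' ((A.symbolAt_eq_zero_iff_of_jet_eq hKj.symm hg₁ hg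
        ((A.coeffs x0).W_subset hKN.2.1)).2 h0)
    rw [heq1] at hne1
    have hcs : ContinuousAt (χ (txuModel n) c).symm s.1 := by
      rw [hs1]; exact continuousAt_extChartAt_symm' hsrc
    have hcont := continuousAt_jetCoordChange (s := s)
      (j := txuChart n x0 ∘ id ∘ (χ (txuModel n) c).symm)
      (g := χ (txuModel n) c ∘ id ∘ (txuChart n x0).symm)
      (by
        refine ContinuousAt.comp ?_ hcs
        simp only [Function.comp, hsy, id]
        exact continuousAt_extChartAt' (hNs _ hKN))
      (by
        simp only [Function.comp, hsy]
        exact contMDiffAt_id.contDiffAt_chart (hNs _ hKN) hsrc)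
    have hcont2 := A.continuousAt_symbolAt (x0 := x0) (p := K.pt)
      (s := jetCoordChange (txuChart n x0 ∘ id ∘ (χ (txuModel n) c).symm)
          (χ (txuModel n) c ∘ id ∘ (txuChart n x0).symm) s)
      (by simp only [jetCoordChange, Function.comp, hsy, id]) hKN
    have e2 : ∀ᶠ s' : 𝕁 (𝕍 n) in 𝓝 s, (χ (txuModel n) c).symm s'.1 ∈ N := by
      have := ContinuousAt.comp (x := s) hcs continuousAt_fst
      refine this.eventually ?_
      simp only [Function.comp, hsy]
      exact (A.isOpen_T.prod ((A.coeffs x0).isOpen_W.prod A.isOpen_Ω)).mem_nhds hKN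
    filter_upwards [hcont.eventually (hcont2.eventually_ne hne1), e2] with s' h3 h4 K2 hK2
    have hK2N : K2.pt ∈ N := by rwa [hK2.2.1, (χ (txuModel n) c).left_inv hK2.1] at h4
    obtain ⟨g₂, hg₂, heq2⟩ := hcoord (hmap hK2 hK2N)
    exact ⟨K2, g₂, rfl, hK2N, hg₂, by rw [heq2]; exact h3⟩
  have hp' := mem_space.1 hp
  have hLO : L.jet ∈ O := ⟨L, f, rfl, ⟨hp'.1, (A.coeffs x0).mem_W, hp'.2⟩, hf, hne⟩
  obtain ⟨j, ⟨K, g, hKj, hKN, hg, hgne⟩, K', U, u, hK'j, hK's, hU, hUp, huU, hcar, heq⟩ :=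
    mem_closure_iff.1 h O hOo hLO
  have hjj : K.jet = K'.jet := hKj.trans hK'j
  have hpt : K.pt = K'.pt := (PointedHypersurface.jet_eq_iff.1 hjj).1
  have hG : K'.IsGraph u :=
    ⟨by filter_upwards [hU.mem_nhds hUp] with q hq using huU.contMDiffAt (hU.mem_nhds hq), hcar⟩
  have h0 := A.symbolAt_graph hK's (x0 := x0) (by rw [← hpt]; exact hKN.2.1) hG.1.self_of_nhds
    hG.apply
  rw [heq, sub_self] at h0
  exact hgne ((A.symbolAt_eq_zero_iff_of_jet_eq hjj hg hG.isLocalEquation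
    ((A.coeffs x0).W_subset hKN.2.1)).1 h0)

lemma ParabolicEquation.graphJets_subset_extended (A : PEq n X) : A.graphJets ⊆ A.extended := subset_closure

lemma ParabolicEquation.mem_graphJets (A : PEq n X) {L : Hyp n X} (hp : L.pt ∈ A.space)
    {u : ℝ × X → ℝ} (hg : L.IsGraph u)
    (h : deriv (fun t => u (t, L.pt.2.1)) L.pt.1 = A.op L.pt.1 L.pt.2.1 fun x => u (L.pt.1, x)) :
    L.jet ∈ A.graphJets := by
  obtain ⟨U, hU, hUo, hUp⟩ := eventually_nhds_iff.1 hg.1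
  exact ⟨L, U, u, rfl, hp, hUo, hUp, fun q hq => (hU q hq).contMDiffWithinAt, hg.2, h⟩

/-- A graph belongs to the extended equation if and only if it satisfies the equation in the
traditional sense. -/
lemma ParabolicEquation.graph_mem_extended_iff (A : PEq n X) {L : Hyp n X} (hp : L.pt ∈ A.space)
    {u : ℝ × X → ℝ} (hg : L.IsGraph u) : L.jet ∈ A.extended ↔
      deriv (fun t => u (t, L.pt.2.1)) L.pt.1 = A.op L.pt.1 L.pt.2.1 fun x => u (L.pt.1, x) := by
  refine ⟨fun h => ?_, fun h => A.graphJets_subset_extended (A.mem_graphJets hp hg h)⟩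
  have h0 := A.symbolAt_eq_zero_of_mem_extended hp hg.isLocalEquation h
  rwa [A.symbolAt_graph hp (A.coeffs _).mem_W hg.1.self_of_nhds hg.apply, sub_eq_zero] at h0

lemma ParabolicEquation.mem_graphJets_of_symbolAt_eq_zero (A : PEq n X) {L : Hyp n X}
    (hp : L.pt ∈ A.space) {f : ℝ × X × ℝ → ℝ} (hf : IsLocalEquation (txuModel n) f L.carrier L.pt)
    (hu : eqJet₁ n L.pt.2.1 f L.pt eU ≠ 0)
    (h : A.symbolAt L.pt.2.1 L.pt (eqJet₁ n L.pt.2.1 f L.pt) (eqJet₂ n L.pt.2.1 f L.pt) = 0) :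
    L.jet ∈ A.graphJets := by
  obtain ⟨u, hg⟩ := hf.exists_graph hu
  have h0 := (A.symbolAt_eq_zero_iff_of_jet_eq (x0 := L.pt.2.1) rfl hf hg.isLocalEquation
    (mem_extChartAt_source _)).2 h
  rw [A.symbolAt_graph hp (A.coeffs _).mem_W hg.1.self_of_nhds hg.apply, sub_eq_zero] at h0
  exact A.mem_graphJets hp hg h0

/-- The `u`-coordinate on `ℝ × ℝⁿ × ℝ`. -/
def coordU (n : ℕ) : 𝕍 n →L[ℝ] ℝ := (snd ℝ _ _).comp (snd ℝ _ _)

/-- The quadratic form `(du)²`. -/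
def coordU₂ (n : ℕ) : Bil (𝕍 n) := (coordU n).smulRight (coordU n)

lemma eqJet_add_quadratic {f : ℝ × X × ℝ → ℝ} {p : ℝ × X × ℝ} {x0 : X}
    (hf : SmAt (txuModel n) 𝓘₁ f p) (hx : p.2.1 ∈ (chart n x0).source) (ε δ : ℝ) :
    let g : ℝ × X × ℝ → ℝ := fun q => f q + (ε * (q.2.2 - p.2.2) + δ / 2 * (q.2.2 - p.2.2) ^ 2)
    eqJet₁ n x0 g p = eqJet₁ n x0 f p + ε • coordU n ∧
      eqJet₂ n x0 g p = eqJet₂ n x0 f p + δ • coordU₂ n := by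
  intro g
  set z0 := txuChart n x0 p with hz0
  have hz : z0 = (p.1, chart n x0 p.2.1, p.2.2) := extChartAt_txu_apply _ p
  have hcz : coordU n z0 = p.2.2 := by rw [hz]; rfl
  set fh := f ∘ (txuChart n x0).symm with hfh
  have hfc : ContDiffAt ℝ 2 fh z0 :=
    (hf.contDiffAt_comp_extChartAt_symm (mem_txuChart_source.2 hx)).of_le two_le_infty
  have hg : g ∘ (txuChart n x0).symm = fun z => fh z +
      (ε * (coordU n z - p.2.2) + δ / 2 * (coordU n z - p.2.2) ^ 2) := by
    funext z
    simp only [Function.comp, g, hfh, extChartAt_txu_symm_apply]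
    rfl
  have hq z : HasFDerivAt (fun z => ε * (coordU n z - p.2.2) + δ / 2 * (coordU n z - p.2.2) ^ 2)
      (ε • coordU n + (δ * (coordU n z - p.2.2)) • coordU n) z := by
    have h1 : HasFDerivAt (fun z => coordU n z - p.2.2) (coordU n) z :=
      (coordU n).hasFDerivAt.sub_const _
    refine ((h1.const_mul ε).add ((h1.pow 2).const_mul (δ / 2))).congr_fderiv ?_
    ext <;> simp <;> ring
  have hd : fderiv ℝ (g ∘ (txuChart n x0).symm) =ᶠ[𝓝 z0]
      fun z => fderiv ℝ fh z + (ε • coordU n + (δ * (coordU n z - p.2.2)) • coordU n) := by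
    filter_upwards [hfc.eventually (by simp)] with z hz
    rw [hg]
    exact (hz.diffAt.hasFDerivAt.add (hq z)).fderiv
  have hJ1 : eqJet₁ n x0 g p = eqJet₁ n x0 f p + ε • coordU n := by
    rw [eqJet₁, ← hz0, hd.self_of_nhds]
    beta_reduce
    rw [hcz, sub_self, mul_zero, zero_smul, add_zero]
    rfl
  refine ⟨hJ1, ?_⟩
  rw [eqJet₂, ← hz0, hd.fderiv_eq]
  have h2 : HasFDerivAt (fun z => ε • coordU n + (δ * (coordU n z - p.2.2)) • coordU n)
      (δ • coordU₂ n) z0 := by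
    have h3 : HasFDerivAt (fun z => coordU n z - p.2.2) (coordU n) z0 :=
      (coordU n).hasFDerivAt.sub_const _
    refine (((h3.const_mul δ).smul_const (coordU n)).const_add _).congr_fderiv ?_
    refine ContinuousLinearMap.ext fun x => ContinuousLinearMap.ext fun y => ?_
    simp [coordU₂, mul_assoc]
  exact (hfc.diffAt_fderiv.hasFDerivAt.add h2).fderiv

lemma Matrix.PosDef.sum_pos {n : ℕ} {b : Mat n} (hb : b.PosDef) {v : Fin n → ℝ}
    (hv : v ≠ 0) : 0 < ∑ i, ∑ j, b i j * v i * v j := by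
  have := hb.dotProduct_mulVec_pos hv
  simp only [dotProduct, Matrix.mulVec, mul_sum, star_trivial] at this
  refine this.trans_eq (sum_congr rfl fun i _ => sum_congr rfl fun j _ => by ring)

lemma tendsto_add_smul_of_tendsto_zero {W : Type*} [NormedAddCommGroup W] [NormedSpace ℝ W]
    (v w : W) {l : Filter ℝ} {δ : ℝ → ℝ} (hδ : Tendsto δ l (𝓝 0)) :
    Tendsto (fun ε => v + δ ε • w) l (𝓝 v) := by
  simpa using (tendsto_const_nhds (x := v)).add (hδ.smul (tendsto_const_nhds (x := w)))

set_option synthInstance.maxHeartbeats 100000 in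
/-- Away from the jets tangent to `t = const`, the extended equation is the zero set of its symbol.
A jet with `f_u = 0` and `f_x ≠ 0` on this zero set is a limit of jets of graphs that satisfy the
equation: perturb `f` by `ε (u - u0) + δ(ε) (u - u0)² / 2`. -/
lemma ParabolicEquation.mem_extended_iff (A : PEq n X) {L : Hyp n X} (hp : L.pt ∈ A.space)
    {f : ℝ × X × ℝ → ℝ} (hf : IsLocalEquation (txuModel n) f L.carrier L.pt)
    (hξ : eqJet₁ n L.pt.2.1 f L.pt eU ≠ 0 ∨ ∃ i, eqJet₁ n L.pt.2.1 f L.pt (eX i) ≠ 0) : L.jet ∈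
    A.extended ↔ A.symbolAt L.pt.2.1 L.pt (eqJet₁ n L.pt.2.1 f L.pt) (eqJet₂ n L.pt.2.1 f L.pt) = 0
    := by
  refine ⟨A.symbolAt_eq_zero_of_mem_extended hp hf, fun h => ?_⟩
  by_cases hu : eqJet₁ n L.pt.2.1 f L.pt eU = 0
  swap
  · exact A.graphJets_subset_extended (A.mem_graphJets_of_symbolAt_eq_zero hp hf hu h)
  obtain ⟨i0, hi0⟩ := hξ.resolve_left (not_not.2 hu)
  set p := L.pt
  set x0 := p.2.1
  set ξ := eqJet₁ n x0 f p with hξdef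
  set S := eqJet₂ n x0 f p
  have hp' := mem_space.1 hp
  set C := A.coeffs x0 with hC
  have hb : (C.b p).PosDef := C.posDef p ⟨hp'.1, C.mem_W, hp'.2⟩
  set β : ℝ := ∑ i, ∑ j, C.b p i j * ξ (eX i) * ξ (eX j) with hβ
  have hβ0 : 0 < β := hb.sum_pos (v := fun i => ξ (eX i)) (fun h0 => hi0 (congrFun h0 i0))
  -- the symbol is affine in `δ` with slope `β > 0`; `δ(ε)` is its zero
  set δ : ℝ → ℝ := fun ε => - A.symbolAt x0 p (ξ + ε • coordU n) S / β with hδ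
  have hcU : coordU n eU = 1 := rfl
  have hcX i : coordU n (eX i) = 0 := rfl
  have hpert ε : A.symbolAt x0 p (ξ + ε • coordU n) (S + δ ε • coordU₂ n) = 0 := by
    have ht : ∀ i, coordU n (tangentVec (ξ + ε • coordU n) i) = - ξ (eX i) := by
      intro i; simp [tangentVec, hcU, hcX]
    have : A.symbolAt x0 p (ξ + ε • coordU n) (S + δ ε • coordU₂ n) =
        A.symbolAt x0 p (ξ + ε • coordU n) S + δ ε * β := by
      unfold symbolAt jetPoly
      have h1 i j : (S + δ ε • coordU₂ n) (tangentVec (ξ + ε • coordU n) i)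
          (tangentVec (ξ + ε • coordU n) j) = S (tangentVec (ξ + ε • coordU n) i)
          (tangentVec (ξ + ε • coordU n) j) + δ ε * (ξ (eX i) * ξ (eX j)) := by
        simp [coordU₂, ht]
      simp only [h1, mul_add, sum_add_distrib, hβ, mul_sum]
      have h2 i j : C.b p i j * (δ ε * (ξ (eX i) * ξ (eX j))) =
        δ ε * (C.b p i j * ξ (eX i) * ξ (eX j)) := by ring
      simp only [← hC, h2]
      ring
    rw [this, hδ]
    field_simp
    ring
  have hcont : Continuous δ := by
    have h1 : Continuous fun ε : ℝ => A.symbolAt x0 p (ξ + ε • coordU n) S := by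
      refine continuous_iff_continuousAt.2 fun ε => ContinuousAt.jetPoly continuousAt_const
        continuousAt_const continuousAt_const continuousAt_const ?_ continuousAt_const
      exact continuousAt_const.add (continuousAt_id.smul continuousAt_const)
    exact h1.neg.div_const β
  have hδ0 : δ 0 = 0 := by simp [hδ, h]
  have hsrc : p ∈ (txuChart n x0).source := mem_txuChart_source.2 (mem_extChartAt_source _)
  rw [ParabolicEquation.extended, mem_closure_iff]
  intro O hO hLO
  have hLc : L.HasCoords ((0, x0, 0) : ℝ × X × ℝ) (txuChart n x0 p, ξ, S) :=
    ⟨hsrc, rfl, f, hf, rfl, rfl⟩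
  have htend : Tendsto (fun ε : ℝ => (txuChart n x0 p, ξ + ε • coordU n, S + δ ε • coordU₂ n))
      (𝓝[≠] 0) (𝓝 (txuChart n x0 p, ξ, S)) := by
    have h1 := tendsto_add_smul_of_tendsto_zero ξ (coordU n) (tendsto_id (α := ℝ) (x := 𝓝 0))
    have h2 := tendsto_add_smul_of_tendsto_zero S (coordU₂ n) (hδ0 ▸ hcont.tendsto 0)
    exact (tendsto_const_nhds.prodMk_nhds (h1.prodMk_nhds h2)).mono_left nhdsWithin_le_nhds
  obtain ⟨ε, hε, hεne⟩ := ((htend.eventually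
      (isOpen_jet2_iff.1 hO _ _ _ hLc hLO)).and self_mem_nhdsWithin).exists
  have hεne' : ε ≠ 0 := hεne
  obtain ⟨hg1, hg2⟩ := eqJet_add_quadratic hf.contMDiffAt (mem_extChartAt_source (I := 𝓡 n) x0) ε
    (δ ε)
  set g : ℝ × X × ℝ → ℝ := fun q => f q + (ε * (q.2.2 - p.2.2) + δ ε / 2 * (q.2.2 - p.2.2) ^ 2)
    with hg
  have hgsm : ∀ᶠ q in 𝓝 p, SmAt (txuModel n) 𝓘₁ g q := by
    filter_upwards [hf.eventually_contMDiffAt] with q hq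
    have e3 : ContMDiff 𝓘₁ 𝓘₁ ∞ (fun v : ℝ => ε * (v - p.2.2) + δ ε / 2 * (v - p.2.2) ^ 2) := by
      have : ContDiff ℝ ∞ (fun v : ℝ => ε * (v - p.2.2) + δ ε / 2 * (v - p.2.2) ^ 2) := by fun_prop
      exact this.contMDiff
    exact hq.add (e3.contMDiffAt.comp q (contMDiffAt_snd.comp q contMDiffAt_snd))
  have hgeq : IsLocalEquation (txuModel n) g {q | g q = 0} p := by
    refine isLocalEquation_of_eventually (by simp [hg, hf.1]) ?_ hgsm (.of_forall fun q => Iff.rfl)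
    rw [mfderiv_ne_zero_iff hgsm.self_of_nhds hsrc]
    intro h0
    have h1 : eqJet₁ n x0 g p (eX i0) = 0 := by rw [eqJet₁, h0]; rfl
    rw [hg1] at h1
    apply hi0
    simpa [hcX] using h1
  let K : Hyp n X := ⟨p, {q | g q = 0}, ⟨g, hgeq⟩⟩
  have hK : K.HasCoords ((0, x0, 0) : ℝ × X × ℝ)
      (txuChart n x0 p, ξ + ε • coordU n, S + δ ε • coordU₂ n) :=
    ⟨hsrc, rfl, g, hgeq, hg1.symm, hg2.symm⟩
  refine ⟨K.jet, hε K hK, A.mem_graphJets_of_symbolAt_eq_zero (L := K) hp hgeq ?_ ?_⟩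
  · show eqJet₁ n x0 g p eU ≠ 0
    rwa [hg1, _root_.add_apply, _root_.smul_apply, hcU, ← hξdef, hu, zero_add, smul_eq_mul, mul_one]
  · show A.symbolAt x0 p (eqJet₁ n x0 g p) (eqJet₂ n x0 g p) = 0
    rw [hg1, hg2]; exact hpert ε

end Extended

/-! ### Morphisms preserve time and are fibred over the space variables -/

section Triangular

variable {n m : ℕ}

lemma eq_sum_eX (w : 𝕍 n) : w = w.1 • eT + ((∑ i, w.2.1 i • eX i) + w.2.2 • eU) := by
  have h : ∑ i, w.2.1 i • (single i (1 : ℝ) : 𝔼 n) = w.2.1 := by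
    ext j; simp [Finset.sum_apply, Pi.single_apply]
  obtain ⟨t, x, u⟩ := w
  refine Prod.ext ?_ (Prod.ext ?_ ?_)
  · simp [eT, eX, eU, Prod.fst_sum]
  · simp only [eT, eX, eU, Prod.fst_add, Prod.snd_add, Prod.smul_fst, Prod.smul_snd, Prod.snd_sum,
      Prod.fst_sum, smul_zero, zero_add, add_zero]
    exact h.symm
  · simp [eT, eX, eU, Prod.snd_sum]

lemma exists_apply_ne_zero_iff (ξ : 𝕍 n →L[ℝ] ℝ) :
    (∃ w : 𝕍 n, w.1 = 0 ∧ ξ w ≠ 0) ↔ ξ eU ≠ 0 ∨ ∃ i, ξ (eX i) ≠ 0 := by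
  constructor
  · rintro ⟨w, h1, h2⟩
    by_contra! h
    apply h2
    rw [eq_sum_eX w, h1]
    simp [h.1, h.2]
  · rintro (h | ⟨i, h⟩)
    · exact ⟨eU, rfl, h⟩
    · exact ⟨eX i, rfl, h⟩

lemma tangentVec_fst (ξ : 𝕍 n →L[ℝ] ℝ) (i : Fin n) : (tangentVec ξ i).1 = 0 := by
  simp [tangentVec, eX, eU]

/-- The principal part of `jetPoly`. -/
def jetForm (b : Mat n) (ξ : 𝕍 n →L[ℝ] ℝ) (S : 𝕍 n → 𝕍 n → ℝ) : ℝ :=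
  ∑ i, ∑ j, b i j * S (tangentVec ξ i) (tangentVec ξ j)

lemma jetPoly_eq_add (b c : Mat n) (b₁ : Fin n → ℝ) (q : ℝ) (ξ : 𝕍 n →L[ℝ] ℝ) (S S' : Bil (𝕍 n))
    (Q : 𝕍 n → 𝕍 n → ℝ) (h : ∀ a b, S' a b = S a b + Q a b) : jetPoly b c b₁ q ξ S' = jetPoly b c b₁
    q ξ S + jetForm b ξ Q := by
  unfold jetPoly jetForm
  simp only [h, mul_add, sum_add_distrib]
  ring

/-- The form `ν ⊗ ν`. -/
def sqForm (ν : 𝕍 n →L[ℝ] ℝ) : Bil (𝕍 n) := ν.smulRight ν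

lemma sqForm_apply (ν : 𝕍 n →L[ℝ] ℝ) (a b : 𝕍 n) : sqForm ν a b = ν a * ν b := by simp [sqForm]

lemma jetForm_sq_eq_zero {b : Mat n} (hb : b.PosDef) {ξ : 𝕍 n →L[ℝ] ℝ} {θ : 𝕍 n → ℝ}
    (h : jetForm b ξ (fun v w => θ v * θ w) = 0) (i : Fin n) : θ (tangentVec ξ i) = 0 := by
  by_contra hne
  have := hb.sum_pos (v := fun i => θ (tangentVec ξ i)) (fun h0 => hne (congrFun h0 i))
  rw [jetForm] at h
  simp only [← mul_assoc] at h
  exact this.ne' h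

/-- The principal part of the symbol is positive on the square of a suitable covector. -/
lemma exists_jetForm_pos {b : Mat n} (hn : 0 < n) (hb : b.PosDef)
    {ξ : 𝕍 n →L[ℝ] ℝ} (hξ : ∃ w : 𝕍 n, w.1 = 0 ∧ ξ w ≠ 0) :
    ∃ ν : 𝕍 n →L[ℝ] ℝ, 0 < jetForm b ξ (fun v w => ν v * ν w) := by
  have key (ν : 𝕍 n →L[ℝ] ℝ) i : ν (tangentVec ξ i) ≠ 0 →
      0 < jetForm b ξ (fun v w => ν v * ν w) := by
    intro hi
    have := hb.sum_pos (v := fun i => ν (tangentVec ξ i)) (fun h0 => hi (congrFun h0 i))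
    rw [jetForm]
    simpa only [← mul_assoc] using this
  rw [exists_apply_ne_zero_iff] at hξ
  by_cases h : ξ eU = 0
  · obtain ⟨i, hi⟩ := hξ.resolve_left (not_not.2 h)
    refine ⟨coordU n, key _ i ?_⟩
    have h1 : coordU n eU = 1 := rfl
    have h2 : coordU n (eX i) = 0 := rfl
    simp [tangentVec, h1, h2, hi]
  · let i : Fin n := ⟨0, hn⟩
    refine ⟨(proj i).comp ((fst ℝ _ _).comp (snd ℝ _ _)), key _ i ?_⟩
    simpa [tangentVec, eX, eU] using h

/-- Pointwise consequences of the fact that `F` carries one extended equation to the other, where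
`D` and `D₂` are the first and second derivatives of `F`: if `ξ'` is not proportional to `dt'`, then
the principal part of the first equation vanishes whenever that of the second one does. -/
lemma jetForm_eq_zero_of_jetForm_eq_zero {b c : Mat n} {b₁ : Fin n → ℝ} {q : ℝ}
    {b' c' : Matrix (Fin m) (Fin m) ℝ} {b₁' : Fin m → ℝ} {q' : ℝ} (hm : 0 < m) (hb' : b'.PosDef)
    {ξ : 𝕍 n →L[ℝ] ℝ} {ξ' : 𝕍 m →L[ℝ] ℝ} (hξ' : ∃ w : 𝕍 m, w.1 = 0 ∧ ξ' w ≠ 0)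
    {D : 𝕍 n →L[ℝ] 𝕍 m} {S₀ : Bil (𝕍 n)}
    (h : ∀ (S' : Bil (𝕍 m)) (S : Bil (𝕍 n)),
      (∀ v w, S' v w = S' w v) → (∀ v w, S v w = S₀ v w + S' (D v) (D w)) →
      (jetPoly b c b₁ q ξ S = 0 ↔ jetPoly b' c' b₁' q' ξ' S' = 0)) :
    (∀ ν : 𝕍 m →L[ℝ] ℝ, jetForm b' ξ' (fun v w => ν v * ν w) = 0 →
      jetForm b ξ (fun v w => ν (D v) * ν (D w)) = 0) ∧
    (∃ S' : Bil (𝕍 m), (∀ v w, S' v w = S' w v) ∧ jetPoly b' c' b₁' q' ξ' S' = 0) ∧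
    ∃ ν : 𝕍 m →L[ℝ] ℝ, jetForm b ξ (fun v w => ν (D v) * ν (D w)) ≠ 0 := by
  obtain ⟨ν0, hν0⟩ := exists_jetForm_pos hm hb' hξ'
  set κ := jetForm b' ξ' (fun v w => ν0 v * ν0 w) with hκ
  have lin' (s : ℝ) (ν : 𝕍 m →L[ℝ] ℝ) : jetPoly b' c' b₁' q' ξ' (s • sqForm ν0 + sqForm ν) =
      jetPoly b' c' b₁' q' ξ' 0 + s * κ + jetForm b' ξ' (fun v w => ν v * ν w) := by
    rw [jetPoly_eq_add b' c' b₁' q' ξ' (s • sqForm ν0) _ (fun v w => ν v * ν w)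
      (fun v w => by simp [sqForm_apply]),
      jetPoly_eq_add b' c' b₁' q' ξ' 0 (s • sqForm ν0) (fun v w => s * (ν0 v * ν0 w))
      (fun v w => by simp [sqForm_apply])]
    congr 2
    rw [hκ, jetForm, jetForm, mul_sum]
    refine sum_congr rfl fun i _ => ?_
    rw [mul_sum]
    exact sum_congr rfl fun j _ => by ring
  set κ2 := jetForm b ξ (fun v w => ν0 (D v) * ν0 (D w)) with hκ2
  let pull : (𝕍 m →L[ℝ] ℝ) → Bil (𝕍 n) := fun ν => sqForm (ν.comp D)
  have lin (s : ℝ) (ν : 𝕍 m →L[ℝ] ℝ) : jetPoly b c b₁ q ξ (S₀ + (s • pull ν0 + pull ν)) =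
      jetPoly b c b₁ q ξ S₀ + s * κ2 + jetForm b ξ (fun v w => ν (D v) * ν (D w)) := by
    rw [jetPoly_eq_add b c b₁ q ξ (S₀ + s • pull ν0) _ (fun v w => ν (D v) * ν (D w))
      (fun v w => by simp [pull, sqForm_apply]; ring),
      jetPoly_eq_add b c b₁ q ξ S₀ (S₀ + s • pull ν0) (fun v w => s * (ν0 (D v) * ν0 (D w)))
      (fun v w => by simp [pull, sqForm_apply])]
    congr 2
    rw [hκ2, jetForm, jetForm, mul_sum]
    refine sum_congr rfl fun i _ => ?_
    rw [mul_sum]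
    exact sum_congr rfl fun j _ => by ring
  have key (s : ℝ) (ν : 𝕍 m →L[ℝ] ℝ) : (jetPoly b c b₁ q ξ S₀ + s * κ2 + jetForm b ξ (fun v w => ν (D v) * ν (D w)) = 0 ↔
      jetPoly b' c' b₁' q' ξ' 0 + s * κ + jetForm b' ξ' (fun v w => ν v * ν w) = 0) := by
    rw [← lin, ← lin']
    refine h _ _ (fun v w => by simp [sqForm_apply, mul_comm]) (fun v w => ?_)
    simp [pull, sqForm_apply]
  have z' : jetForm b' ξ' (fun v w => (0 : 𝕍 m →L[ℝ] ℝ) v * (0 : 𝕍 m →L[ℝ] ℝ) w) = 0 := by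
    simp [jetForm]
  have z : jetForm b ξ (fun v w => (0 : 𝕍 m →L[ℝ] ℝ) (D v) * (0 : 𝕍 m →L[ℝ] ℝ) (D w)) = 0 := by
    simp [jetForm]
  -- for this `s0` the form `s0 ν0²` solves the second equation, hence its pullback the first one;
  -- adding `ν²` then compares the principal parts
  set s0 := - jetPoly b' c' b₁' q' ξ' 0 / κ with hs0
  have e0 : jetPoly b' c' b₁' q' ξ' 0 + s0 * κ = 0 := by rw [hs0]; field_simp; ring
  have e1 := (key s0 0).2 (by rw [z', e0, add_zero])
  rw [z, add_zero] at e1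
  refine ⟨fun ν hν => ?_, ⟨s0 • sqForm ν0 + sqForm 0, ?_, ?_⟩, ν0, fun h0 => ?_⟩
  · have e2 := (key s0 ν).2 (by rw [hν, e0, add_zero])
    rwa [e1, zero_add] at e2
  · intro v w; simp [sqForm_apply, mul_comm]
  · rw [lin', z', e0, add_zero]
  · have e3 := (key s0 ν0).1 (by rw [e1, zero_add]; exact h0)
    rw [e0, zero_add] at e3
    exact hν0.ne' e3

variable {X Y : Type*} [TopologicalSpace X] [ChartedSpace 𝔼 n X] [IsManifold (𝓡 n) ∞ X]
  [TopologicalSpace Y] [ChartedSpace 𝔼 m Y] [IsManifold (𝓡 m) ∞ Y]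

lemma ParabolicEquation.mem_extended_iff_of_hasCoords (A : PEq n X) {L : Hyp n X}
    (hp : L.pt ∈ A.space) {s : 𝕁 (𝕍 n)} (hL : L.HasCoords (0, L.pt.2.1, 0) s)
    (hs : ∃ w : 𝕍 n, w.1 = 0 ∧ s.2.1 w ≠ 0) : L.jet ∈ A.extended ↔ A.symbolAt L.pt.2.1 L.pt s.2.1
    s.2.2 = 0 := by
  obtain ⟨-, h1, f, hf, h2, h3⟩ := hL
  have e1 : s.2.1 = eqJet₁ n L.pt.2.1 f L.pt := by rw [h2, h1]; rfl
  have e2 : s.2.2 = eqJet₂ n L.pt.2.1 f L.pt := by rw [h3, h1]; rfl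
  rw [e1] at hs
  rw [e1, e2]
  exact A.mem_extended_iff hp hf ((exists_apply_ne_zero_iff _).1 hs)

/-- Every pair of a nonzero covector and a symmetric form is a 2-jet of a hypersurface. -/
lemma exists_hasCoords (p : ℝ × X × ℝ) {ξ : 𝕍 n →L[ℝ] ℝ} (hξ : ξ ≠ 0)
    {S : Bil (𝕍 n)} (hS : ∀ v w, S v w = S w v) :
    ∃ L : Hyp n X, L.pt = p ∧ L.HasCoords (0, p.2.1, 0) (txuChart n p.2.1 p, ξ, S) := by
  set ch := txuChart n p.2.1
  set z0 := ch p with hz0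
  have hsrc : p ∈ ch.source := mem_txuChart_source.2 (mem_extChartAt_source _)
  let h : 𝕍 n → ℝ := fun z => ξ (z - z0) + (1 / 2) * S (z - z0) (z - z0)
  have hd z : HasFDerivAt h (ξ + S (z - z0)) z := by
    have e0 : HasFDerivAt (fun z : 𝕍 n => z - z0) (ContinuousLinearMap.id ℝ _) z :=
      (hasFDerivAt_id z).sub_const z0
    refine ((ξ.hasFDerivAt.comp z e0).add
        (((S.hasFDerivAt.comp z e0).clm_apply e0).const_mul (1 / 2))).congr_fderiv ?_
    refine ContinuousLinearMap.ext fun v => ?_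
    simp only [Function.comp, _root_.add_apply, _root_.smul_apply, ContinuousLinearMap.comp_apply,
      ContinuousLinearMap.id_apply, ContinuousLinearMap.flip_apply, smul_eq_mul, hS v (z - z0)]
    ring
  have hd1 : fderiv ℝ h = fun z => ξ + S (z - z0) := funext fun z => (hd z).fderiv
  have hd2 : D² h z0 = S := by
    rw [hd1]
    have e0 : HasFDerivAt (fun z : 𝕍 n => z - z0) (ContinuousLinearMap.id ℝ _) z0 :=
      (hasFDerivAt_id z0).sub_const z0
    exact ((S.hasFDerivAt.comp z0 e0).const_add ξ).fderiv
  have hsm : ContDiff ℝ ∞ h := by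
    have e0 : ContDiff ℝ ∞ (fun z : 𝕍 n => z - z0) := contDiff_id.sub contDiff_const
    exact (ξ.contDiff.comp e0).add (contDiff_const.mul ((S.contDiff.comp e0).clm_apply e0))
  have heq : (h ∘ ch) ∘ ch.symm =ᶠ[𝓝 z0] h := by
    have : ch.target ∈ 𝓝 z0 := extChartAt_target_mem_nhds' (ch.map_source hsrc)
    filter_upwards [this] with z hz
    simp only [Function.comp, ch.right_inv hz]
  have hfsm : ∀ᶠ q in 𝓝 p, SmAt (txuModel n) 𝓘₁ (h ∘ ch) q := by
    filter_upwards [(isOpen_extChartAt_source _).mem_nhds hsrc] with q hq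
    exact hsm.contDiffAt.contMDiffAt_comp_extChartAt hq
  have hloc : IsLocalEquation (txuModel n) (h ∘ ch) {q | (h ∘ ch) q = 0} p := by
    refine isLocalEquation_of_eventually (by simp [h, hz0]) ?_ hfsm (.of_forall fun q => Iff.rfl)
    rw [mfderiv_ne_zero_iff hfsm.self_of_nhds hsrc, heq.fderiv_eq, hd1]
    simpa using hξ
  refine ⟨⟨p, {q | (h ∘ ch) q = 0}, ⟨h ∘ ch, hloc⟩⟩, rfl, hsrc, rfl, h ∘ ch, hloc, ?_, ?_⟩
  · show ξ = fderiv ℝ ((h ∘ ch) ∘ ch.symm) z0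
    rw [heq.fderiv_eq, hd1]; simp
  · show S = D² ((h ∘ ch) ∘ ch.symm) z0
    rw [heq.fderiv.fderiv_eq, hd2]

/-- The map `F` in the charts around `x0` and `y0`. -/
def txuRep (n : ℕ) {X : Type*} [TopologicalSpace X] [ChartedSpace 𝔼 n X]
    (m : ℕ) {Y : Type*} [TopologicalSpace Y] [ChartedSpace 𝔼 m Y]
    (x0 : X) (y0 : Y) (F : ℝ × X × ℝ → ℝ × Y × ℝ) : 𝕍 n → 𝕍 m :=
  txuChart m y0 ∘ F ∘ (txuChart n x0).symm

lemma IsPEMorphism.contMDiffAt {A : PEq n X} {B : PEq m Y}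
    {F : ℝ × X × ℝ → ℝ × Y × ℝ} (hF : IsPEMorphism A B F) {p : ℝ × X × ℝ} (hp : p ∈ A.space) :
    SmAt (txuModel n) (txuModel m) F p :=
  hF.smooth.contMDiffAt (A.isOpen_space.mem_nhds hp)

lemma IsPEMorphism.eventually_contMDiffAt {A : PEq n X} {B : PEq m Y}
    {F : ℝ × X × ℝ → ℝ × Y × ℝ} (hF : IsPEMorphism A B F) {p : ℝ × X × ℝ} (hp : p ∈ A.space) :
    ∀ᶠ q in 𝓝 p, SmAt (txuModel n) (txuModel m) F q := by
  filter_upwards [A.isOpen_space.mem_nhds hp] with q hq using hF.contMDiffAt hq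

lemma IsPEMorphism.map_mem {A : PEq n X} {B : PEq m Y} {F : ℝ × X × ℝ → ℝ × Y × ℝ}
    (hF : IsPEMorphism A B F) {p : ℝ × X × ℝ} (hp : p ∈ A.space) : F p ∈ B.space := hF.image_eq ▸ mem_image_of_mem F hp

lemma IsPEMorphism.symbolAt_iff {A : PEq n X} {B : PEq m Y} {F : ℝ × X × ℝ → ℝ × Y × ℝ}
    (hF : IsPEMorphism A B F) {p : ℝ × X × ℝ} (hp : p ∈ A.space) {D : 𝕍 n →L[ℝ] 𝕍 m}
    {D₂ : 𝕍 n →L[ℝ] 𝕍 n →L[ℝ] 𝕍 m}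
    (hD : D = fderiv ℝ (txuRep n m p.2.1 (F p).2.1 F) (txuChart n p.2.1 p))
    (hD2 : D₂ = D² (txuRep n m p.2.1 (F p).2.1 F) (txuChart n p.2.1 p)) {ξ' : 𝕍 m →L[ℝ] ℝ}
    (hξ' : ∃ w : 𝕍 m, w.1 = 0 ∧ ξ' w ≠ 0) (hξ : ∃ w : 𝕍 n, w.1 = 0 ∧ ξ' (D w) ≠ 0) {S' : Bil (𝕍 m)}
    (hS' : ∀ v w, S' v w = S' w v) {S : Bil (𝕍 n)}
    (hS : ∀ v w, S v w = ξ' (D₂ v w) + S' (D v) (D w)) : A.symbolAt p.2.1 p (ξ'.comp D) S = 0 ↔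
    B.symbolAt (F p).2.1 (F p) ξ' S' = 0 := by
  have hξ0 : ξ' ≠ 0 := by
    rintro rfl
    obtain ⟨w, -, h⟩ := hξ'
    exact h rfl
  obtain ⟨L', hpt, hc'⟩ := exists_hasCoords (F p) hξ0 hS'
  let L : Hyp n X := ⟨p, F ⁻¹' L'.carrier, by
    obtain ⟨f, hf⟩ := L'.exists_equation
    rw [hpt] at hf
    exact ⟨f ∘ F, hf.comp (hF.eventually_contMDiffAt hp) (hF.submersion p hp)
      (.of_forall fun q => Iff.rfl)⟩⟩
  have hc := PointedHypersurface.HasCoords.map (J := fun _ => p) (G := F) (K := L') (K' := L)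
    (c' := ((0, p.2.1, 0) : ℝ × X × ℝ)) rfl (hF.eventually_contMDiffAt hp) hpt.symm (hF.submersion p hp)
    (.of_forall fun q => Iff.rfl) hc' (mem_txuChart_source.2 (mem_extChartAt_source _))
  set s := jetCoordChange (χ (txuModel n) ((0, p.2.1, 0) : ℝ × X × ℝ) ∘ (fun _ => p) ∘
      (χ (txuModel m) ((0, (F p).2.1, 0) : ℝ × Y × ℝ)).symm)
      (χ (txuModel m) ((0, (F p).2.1, 0) : ℝ × Y × ℝ) ∘ F ∘
        (χ (txuModel n) ((0, p.2.1, 0) : ℝ × X × ℝ)).symm)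
      (txuChart m (F p).2.1 (F p), ξ', S')
  have hs1 : s.2.1 = ξ'.comp D := by rw [hD]; rfl
  have hs2 : s.2.2 = S := by
    refine ContinuousLinearMap.ext fun v => ContinuousLinearMap.ext fun w => ?_
    rw [hS, hD, hD2, add_comm]; rfl
  have h1 := A.mem_extended_iff_of_hasCoords (L := L) hp hc (by
    obtain ⟨w, hw1, hw2⟩ := hξ
    exact ⟨w, hw1, by rw [hs1]; exact hw2⟩)
  rw [← hpt] at hc'
  have h2 := B.mem_extended_iff_of_hasCoords (L := L') (by rw [hpt]; exact hF.map_mem hp) hc' hξ'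
  rw [hs1, hs2] at h1
  rw [hpt] at h2
  rw [← h1, ← h2, hF.jets L L' hp hpt (.of_forall fun q => Iff.rfl)]

end Triangular

section TriangularForm

variable {n m : ℕ}

lemma exists_covector_of_ne_zero {w : 𝕍 m} (hw : w ≠ 0) :
    ∃ ξ : 𝕍 m →L[ℝ] ℝ, ξ w ≠ 0 ∧ ∃ w' : 𝕍 m, w'.1 = 0 ∧ ξ w' ≠ 0 := by
  obtain ⟨ξ, hξ⟩ := SeparatingDual.exists_ne_zero (R := ℝ) hw
  by_cases h : ξ eU = 0
  swap
  · exact ⟨ξ, hξ, eU, rfl, h⟩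
  have h1 : coordU m eU = 1 := rfl
  by_cases h2 : ξ w + coordU m w = 0
  · refine ⟨ξ - coordU m, fun h3 => hξ ?_, eU, rfl, by simp [h, h1]⟩
    rw [_root_.sub_apply] at h3
    linarith
  · exact ⟨ξ + coordU m, by simpa using h2, eU, rfl, by simp [h, h1]⟩

lemma finrank_txu : Module.finrank ℝ 𝕍 m = m + 2 := by simp; omega

lemma exists_ne_zero_of_surjective (hm : 0 < m) {D : 𝕍 n →L[ℝ] 𝕍 m}
    (hD : Surjective D) {c : Fin n → ℝ} : ∃ i, D (eX i) ≠ c i • D eU := by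
  by_contra! h
  have h1 : (⊤ : Submodule ℝ 𝕍 m) ≤ Submodule.span ℝ (({D eT, D eU} : Finset 𝕍 m) : Set 𝕍 m) := by
    rintro v -
    obtain ⟨w, rfl⟩ := hD v
    have hU : D eU ∈ Submodule.span ℝ (({D eT, D eU} : Finset 𝕍 m) : Set 𝕍 m) :=
      Submodule.subset_span (by simp)
    rw [eq_sum_eX w, map_add, map_add, map_smul, map_smul, map_sum]
    refine Submodule.add_mem _ (Submodule.smul_mem _ _
        (Submodule.subset_span (by simp))) (Submodule.add_mem _
      (Submodule.sum_mem _ fun i _ => ?_) (Submodule.smul_mem _ _ hU))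
    rw [map_smul, h]
    exact Submodule.smul_mem _ _ (Submodule.smul_mem _ _ hU)
  have h2 := Submodule.finrank_mono h1
  rw [finrank_top, finrank_txu] at h2
  have : Module.finrank ℝ (Submodule.span ℝ (({D eT, D eU} : Finset 𝕍 m) : Set 𝕍 m)) ≤ 2 :=
    (finrank_span_finset_le_card (R := ℝ) ({D eT, D eU} : Finset 𝕍 m)).trans Finset.card_le_two
  omega

variable {X Y : Type*} [TopologicalSpace X] [ChartedSpace 𝔼 n X] [IsManifold (𝓡 n) ∞ X]
  [TopologicalSpace Y] [ChartedSpace 𝔼 m Y] [IsManifold (𝓡 m) ∞ Y]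

lemma mfderiv_eq_fderiv_txuRep {F : ℝ × X × ℝ → ℝ × Y × ℝ} {p : ℝ × X × ℝ}
    (hF : SmAt (txuModel n) (txuModel m) F p) :
    (mfderiv (txuModel n) (txuModel m) F p : 𝕍 n →L[ℝ] 𝕍 m) = fderiv ℝ
    (txuRep n m p.2.1 (F p).2.1 F) (txuChart n p.2.1 p) := by
  rw [hF.mfderiv_eq_fderiv_chart, extChartAt_eq_txuChart, extChartAt_eq_txuChart]
  rfl

variable {A : PEq n X} {B : PEq m Y} {F : ℝ × X × ℝ → ℝ × Y × ℝ}

/-- The symbol computation at a point: `dF` maps `{dt = 0}` into `{dt' = 0}` and does not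
annihilate `∂_u`. -/
lemma IsPEMorphism.fst_mfderiv_eq_zero (hF : IsPEMorphism A B F) {p : ℝ × X × ℝ} (hp : p ∈ A.space)
    {D : 𝕍 n →L[ℝ] 𝕍 m} (hD : D = fderiv ℝ (txuRep n m p.2.1 (F p).2.1 F) (txuChart n p.2.1 p)) :
    Surjective D ∧ D eU ≠ 0 ∧ ∀ w : 𝕍 n, w.1 = 0 → (D w).1 = 0 := by
  have hm := B.dim_pos
  have hDs : Surjective D := by
    have := hF.submersion p hp
    rwa [hD, ← mfderiv_eq_fderiv_txuRep (hF.contMDiffAt hp)]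
  have hpA := mem_space.1 hp
  have hpB := mem_space.1 (hF.map_mem hp)
  set D₂ := D² (txuRep n m p.2.1 (F p).2.1 F) (txuChart n p.2.1 p) with hD2
  have key (ξ' : 𝕍 m →L[ℝ] ℝ) : (∃ w : 𝕍 m, w.1 = 0 ∧ ξ' w ≠ 0) →
      (∃ w : 𝕍 n, w.1 = 0 ∧ ξ' (D w) ≠ 0) → _ := fun h1 h2 =>
    jetForm_eq_zero_of_jetForm_eq_zero hm
      ((B.coeffs _).posDef (F p) ⟨hpB.1, (B.coeffs _).mem_W, hpB.2⟩) h1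
      (ξ := ξ'.comp D) (D := D) (S₀ := (compL ℝ 𝕍 n 𝕍 m ℝ ξ').comp D₂)
      (fun S' S hS' hS => hF.symbolAt_iff hp hD hD2 h1 h2 hS' hS)
  have hU : D eU ≠ 0 := by
    intro h0
    obtain ⟨i, hi⟩ := exists_ne_zero_of_surjective hm hDs (c := 0)
    rw [Pi.zero_apply, zero_smul] at hi
    obtain ⟨ξ', h1, h2⟩ := exists_covector_of_ne_zero hi
    obtain ⟨-, -, ν, hν⟩ := key ξ' h2 ⟨eX i, rfl, h1⟩
    apply hν
    have : ∀ j, D (tangentVec (ξ'.comp D) j) = 0 := by intro j; simp [tangentVec, h0]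
    simp [jetForm, this]
  refine ⟨hDs, hU, ?_⟩
  -- the square of `dt'` is annihilated by the principal part of the second equation
  have hθ (ξ' : 𝕍 m →L[ℝ] ℝ) : (∃ w : 𝕍 m, w.1 = 0 ∧ ξ' w ≠ 0) →
      (∃ w : 𝕍 n, w.1 = 0 ∧ ξ' (D w) ≠ 0) → ∀ i,
      ξ' (D eU) * (D (eX i)).1 = ξ' (D (eX i)) * (D eU).1 := by
    intro h1 h2 i
    obtain ⟨h3, -⟩ := key ξ' h1 h2
    have h5 := jetForm_sq_eq_zero
        ((A.coeffs _).posDef p ⟨hpA.1, (A.coeffs _).mem_W, hpA.2⟩) (θ := fun v => (D v).1)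
            (h3 (fst ℝ _ _) (by simp [jetForm, tangentVec_fst])) i
    simp only [tangentVec, map_sub, map_smul, ContinuousLinearMap.comp_apply, Prod.fst_sub,
      Prod.smul_fst, smul_eq_mul] at h5
    linarith
  have hθu : (D eU).1 = 0 := by
    by_contra hne
    obtain ⟨i, hi⟩ := exists_ne_zero_of_surjective hm hDs (c := fun i => (D (eX i)).1 / (D eU).1)
    have hi' : D ((D eU).1 • eX i - (D (eX i)).1 • eU) ≠ 0 := by
      intro h0
      apply hi
      rw [map_sub, map_smul, map_smul, sub_eq_zero] at h0
      have : D (eX i) = (D eU).1⁻¹ • ((D (eX i)).1 • D eU) := by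
        rw [← h0, smul_smul, inv_mul_cancel₀ hne, one_smul]
      rwa [smul_smul, inv_mul_eq_div] at this
    obtain ⟨ξ', hξ'⟩ := SeparatingDual.exists_ne_zero (R := ℝ) hi'
    apply hξ'
    have := hθ ξ' ⟨_, by simp [mul_comm], hξ'⟩ ⟨_, by simp [eX, eU], hξ'⟩ i
    simp only [map_sub, map_smul, smul_eq_mul]
    linarith
  have hθx i : (D (eX i)).1 = 0 := by
    obtain ⟨ξ', hξ'⟩ := SeparatingDual.exists_ne_zero (R := ℝ) hU
    have := hθ ξ' ⟨_, hθu, hξ'⟩ ⟨eU, rfl, hξ'⟩ i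
    rw [hθu, mul_zero] at this
    exact (mul_eq_zero.1 this).resolve_left hξ'
  intro w hw
  rw [eq_sum_eX w, hw, zero_smul, zero_add, map_add, map_sum, Prod.fst_add, Prod.fst_sum, map_smul,
    Prod.smul_fst, hθu]
  simp [hθx]

/-- Time is preserved. -/
lemma IsPEMorphism.fst_eq [ConnectedSpace X] (hF : IsPEMorphism A B F) {t : ℝ} (ht : t ∈ A.T)
    {x x' : X} {u u' : ℝ} (hu : u ∈ A.Ω) (hu' : u' ∈ A.Ω) : (F (t, x, u)).1 = (F (t, x', u')).1 := by
  have hc : IsPreconnected ((univ : Set X) ×ˢ A.Ω) :=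
    isPreconnected_univ.prod A.ordConnected_Ω.isPreconnected
  have hd q (hq : q ∈ (univ : Set X) ×ˢ A.Ω) : HasMFDerivAt ((𝓡 n).prod 𝓘₁) 𝓘₁
      (fun q : X × ℝ => (F (t, q)).1) q 0 := by
    have hp : (t, q) ∈ A.space := mem_space.2 ⟨ht, hq.2⟩
    have h1 := (hasMFDerivAt_const (I := (𝓡 n).prod 𝓘₁) (I' := 𝓘₁) t q).prodMk
      (hasMFDerivAt_id (I := (𝓡 n).prod 𝓘₁) q)
    have h3 := (hasMFDerivAt_fst (I := 𝓘₁) (I' := (𝓡 m).prod 𝓘₁) (F (t, q))).comp q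
        ((((hF.contMDiffAt hp).mdiffAt).hasMFDerivAt).comp q h1)
    refine h3.congr_mfderiv ?_
    apply ContinuousLinearMap.ext
    intro v
    have h4 := (hF.fst_mfderiv_eq_zero hp rfl).2.2 (0, v) rfl
    rwa [← mfderiv_eq_fderiv_txuRep (hF.contMDiffAt hp)] at h4
  exact eq_of_mfderiv_eq_zero (isOpen_univ.prod A.isOpen_Ω) hc (F := fun q : X × ℝ => (F (t, q)).1)
    (fun q hq => contMDiffAt_fst.comp q ((hF.contMDiffAt (mem_space.2 ⟨ht, hq.2⟩)).comp q
      (contMDiffAt_const.prodMk contMDiffAt_id))) (fun q hq => (hd q hq).mfderiv)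
    (x := (x, u)) (y := (x', u')) ⟨trivial, hu⟩ ⟨trivial, hu'⟩

/-- `dF` maps `∂_u` to a nonzero multiple of `∂_v`. -/
lemma IsPEMorphism.mfderiv_eU [ConnectedSpace X] (hF : IsPEMorphism A B F) {p : ℝ × X × ℝ}
    (hp : p ∈ A.space) {D : 𝕍 n →L[ℝ] 𝕍 m}
    (hD : D = fderiv ℝ (txuRep n m p.2.1 (F p).2.1 F) (txuChart n p.2.1 p)) :
    (D eU).2.1 = 0 ∧ (D eU).2.2 ≠ 0 ∧ (D eT).1 ≠ 0 := by
  obtain ⟨hDs, hU, hθ⟩ := hF.fst_mfderiv_eq_zero hp hD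
  have hpA := mem_space.1 hp
  have hpB := mem_space.1 (hF.map_mem hp)
  set z := txuChart n p.2.1 p
  have hz' : z = (p.1, chart n p.2.1 p.2.1, p.2.2) := extChartAt_txu_apply _ p
  set rep := txuRep n m p.2.1 (F p).2.1 F with hrep
  set D₂ := D² rep z with hD2
  have hrepc : ContDiffAt ℝ 2 rep z := ((hF.contMDiffAt hp).contDiffAt_chart
      (mem_txuChart_source.2 (mem_extChartAt_source _))
      (mem_txuChart_source.2 (mem_extChartAt_source _))).of_le two_le_infty
  have hT : (D eT).1 ≠ 0 := by
    intro h0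
    obtain ⟨w, hw⟩ := hDs eT
    have h1 : (D w).1 = 0 := by
      rw [eq_sum_eX w, map_add, Prod.fst_add, map_smul, Prod.smul_fst, h0, smul_zero, zero_add]
      exact hθ _ (by simp [eX, eU, Prod.fst_sum])
    rw [hw] at h1
    exact one_ne_zero h1
  -- the first component of `F` depends on time alone
  have h2nd (v w : 𝕍 n) : v.1 = 0 → w.1 = 0 → (D₂ v w).1 = 0 := by
    intro hv hw
    have e1 := fderiv_fderiv_comp (f := Prod.fst) (c := rep) (z := z)
      (contDiff_fst.contDiffAt) hrepc v w
    have e2 : fderiv ℝ (Prod.fst : 𝕍 m → ℝ) = fun _ => fst ℝ _ _ := by funext z; exact fderiv_fst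
    rw [e2] at e1
    simp only [fderiv_fun_const, Pi.zero_apply, _root_.zero_apply, zero_add,
      ContinuousLinearMap.coe_fst'] at e1
    rw [← e1]
    set τ : ℝ → ℝ := fun s => (F (s, p.2.1, p.2.2)).1
    have h3 : (Prod.fst ∘ rep) =ᶠ[𝓝 z] τ ∘ Prod.fst := by
      have hopen : IsOpen (A.T ×ˢ (univ : Set 𝔼 n) ×ˢ A.Ω) :=
        A.isOpen_T.prod (isOpen_univ.prod A.isOpen_Ω)
      filter_upwards [hopen.mem_nhds (show z ∈ _ by rw [hz']; exact ⟨hpA.1, trivial, hpA.2⟩)]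
        with s hs
      simp only [hrep, txuRep, Function.comp, extChartAt_txu_apply, extChartAt_txu_symm_apply]
      exact hF.fst_eq hs.1 hs.2.2 hpA.2
    have hτc : ContDiffAt ℝ 2 τ (Prod.fst z) := by
      have e3 : SmAt 𝓘₁ 𝓘₁ τ p.1 := contMDiffAt_fst.comp p.1 ((hF.contMDiffAt hp).comp p.1
          (contMDiffAt_id.prodMk contMDiffAt_const))
      rw [hz']
      exact e3.contDiffAt.of_le two_le_infty
    rw [h3.fderiv.fderiv_eq, fderiv_fderiv_comp hτc contDiff_fst.contDiffAt]
    have e4 : fderiv ℝ (Prod.fst : 𝕍 n → ℝ) = fun _ => fst ℝ _ _ := by funext z; exact fderiv_fst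
    rw [e4]
    simp [hv]
  have hker (ξ' : 𝕍 m →L[ℝ] ℝ) : ξ' eU = 0 → ξ' (D eU) = 0 := by
    intro h0
    by_contra hne
    have adm' : ∃ w : 𝕍 m, w.1 = 0 ∧ ξ' w ≠ 0 := ⟨D eU, hθ eU rfl, hne⟩
    have adm : ∃ w : 𝕍 n, w.1 = 0 ∧ ξ' (D w) ≠ 0 := ⟨eU, rfl, hne⟩
    set S₀ : (𝕍 m →L[ℝ] ℝ) → Bil (𝕍 n) := fun η => (compL ℝ 𝕍 n 𝕍 m ℝ η).comp D₂ with hS₀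
    obtain ⟨-, ⟨S', hS', hz'⟩, -⟩ :=
      jetForm_eq_zero_of_jetForm_eq_zero B.dim_pos
      ((B.coeffs _).posDef (F p) ⟨hpB.1, (B.coeffs _).mem_W, hpB.2⟩) adm'
      (ξ := ξ'.comp D) (D := D) (S₀ := S₀ ξ')
      (fun S' S hS' hS => hF.symbolAt_iff hp hD hD2 adm' adm hS' hS)
    let pull : Bil (𝕍 n) := ((compL ℝ 𝕍 n 𝕍 m ℝ).flip D).comp (S'.comp D)
    -- adding `dt'` to `ξ'` does not affect the second equation, since `ξ' eU = 0`, but it changes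
    -- the term with `f_t` of the first one unless `ξ' (D eU) = 0`
    let ft : 𝕍 m →L[ℝ] ℝ := fst ℝ _ _
    have hft w : ft w = w.1 := rfl
    have a1 := (hF.symbolAt_iff hp hD hD2 adm' adm hS' (S := S₀ ξ' + pull) (fun v w => rfl)).2 hz'
    have a2 := (hF.symbolAt_iff hp hD hD2 (ξ' := ξ' + ft)
      ⟨D eU, hθ eU rfl, by simpa [hft, hθ eU rfl] using hne⟩
      ⟨eU, rfl, by simpa [hft, hθ eU rfl] using hne⟩ hS' (S := S₀ (ξ' + ft) + pull)
      (fun v w => rfl)).2 (by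
        have t1 i : tangentVec (ξ' + ft) i = tangentVec ξ' i := by simp [tangentVec, hft, eX, eU]
        have e1 : (ξ' + ft) eU = 0 := by
          rw [_root_.add_apply, h0, hft]
          simp [eU]
        rw [← hz']
        unfold symbolAt jetPoly
        simp only [t1, e1, h0]
        ring)
    have f1 i : ((ξ' + ft).comp D) (eX i) = (ξ'.comp D) (eX i) := by simp [hft, hθ (eX i) rfl]
    have f2 : ((ξ' + ft).comp D) eU = (ξ'.comp D) eU := by simp [hft, hθ eU rfl]
    have f3 : ((ξ' + ft).comp D) eT = (ξ'.comp D) eT + (D eT).1 := by simp [hft]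
    have f4 i : tangentVec ((ξ' + ft).comp D) i = tangentVec (ξ'.comp D) i := by
      rw [tangentVec, tangentVec, f1, f2]
    have f5 i j : (S₀ (ξ' + ft) + pull) (tangentVec (ξ'.comp D) i) (tangentVec (ξ'.comp D) j) =
        (S₀ ξ' + pull) (tangentVec (ξ'.comp D) i) (tangentVec (ξ'.comp D) j) := by
      have := h2nd _ _ (tangentVec_fst (ξ'.comp D) i) (tangentVec_fst (ξ'.comp D) j)
      simp [hS₀, hft, this]
    unfold symbolAt jetPoly at a1 a2
    simp only [f1, f2, f3, f4, f5] at a2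
    have a3 : (D eT).1 * (ξ'.comp D) eU ^ 2 = 0 := by linarith
    rcases mul_eq_zero.1 a3 with h | h
    · exact hT h
    · exact hne (pow_eq_zero_iff (by norm_num) |>.1 h)
  have h1 : (D eU).2.1 = 0 := by
    ext j
    exact hker ((proj j).comp ((fst ℝ _ _).comp (snd ℝ _ _))) (by simp [eU])
  refine ⟨h1, fun h2 => hU ?_, hT⟩
  exact Prod.ext (hθ eU rfl) (Prod.ext h1 h2)

/-- The space variables of the second equation are functions of those of the first one. -/
lemma IsPEMorphism.snd_fst_eq [ConnectedSpace X] [T2Space Y] (hF : IsPEMorphism A B F) {t : ℝ}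
    (ht : t ∈ A.T) (x : X) {u u' : ℝ} (hu : u ∈ A.Ω) (hu' : u' ∈ A.Ω) :
    (F (t, x, u)).2.1 = (F (t, x, u')).2.1 := by
  have hd u (hu : u ∈ A.Ω) : HasMFDerivAt 𝓘₁ (𝓡 m) (fun u : ℝ => (F (t, x, u)).2.1) u 0 := by
    have hp : (t, x, u) ∈ A.space := mem_space.2 ⟨ht, hu⟩
    have h1 := (hasMFDerivAt_const (I := 𝓘₁) (I' := 𝓘₁) t u).prodMk
      ((hasMFDerivAt_const (I := 𝓘₁) (I' := 𝓡 n) x u).prodMk (hasMFDerivAt_id (I := 𝓘₁) u))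
    have h3 := (hasMFDerivAt_fst (I := 𝓡 m) (I' := 𝓘₁) (F (t, x, u)).2).comp u
      ((hasMFDerivAt_snd (I := 𝓘₁) (I' := (𝓡 m).prod 𝓘₁) (F (t, x, u))).comp u
      ((((hF.contMDiffAt hp).mdiffAt).hasMFDerivAt).comp u h1))
    refine h3.congr_mfderiv ?_
    apply ContinuousLinearMap.ext
    intro v
    have h4 := (hF.mfderiv_eU hp rfl).1
    rw [← mfderiv_eq_fderiv_txuRep (hF.contMDiffAt hp)] at h4
    have h5 (L : 𝕍 n →L[ℝ] 𝕍 m) (r : ℝ) : (L eU).2.1 = 0 → (L (0, 0, r)).2.1 = 0 := by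
      intro hL
      have : ((0, 0, r) : 𝕍 n) = r • (eU : 𝕍 n) := by simp [eU]
      rw [this, map_smul, Prod.smul_snd, Prod.smul_fst, hL, smul_zero]
    exact h5 _ v h4
  exact eq_of_mfderiv_eq_zero A.isOpen_Ω A.ordConnected_Ω.isPreconnected
    (F := fun u : ℝ => (F (t, x, u)).2.1)
    (fun u hu => contMDiffAt_fst.comp u (contMDiffAt_snd.comp u
      ((hF.contMDiffAt (mem_space.2 ⟨ht, hu⟩)).comp u
      (contMDiffAt_const.prodMk (contMDiffAt_const.prodMk contMDiffAt_id)))))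
    (fun q hq => (hd q hq).mfderiv) hu hu'

end TriangularForm

/-! ### Diffusion operators -/

section Diffusion

/-- A second order elliptic operator without zeroth order term on the manifold `X`: the matrix
`mat x` and the vector `drift x` are its coefficients at `x` in the chart around `x`. -/
structure DiffusionOp (n : ℕ) (X : Type*) where
  mat : X → Mat n
  drift : X → Fin n → ℝ
  posDef : ∀ x, (mat x).PosDef

variable {n : ℕ} {X : Type*} [TopologicalSpace X] [ChartedSpace 𝔼 n X]
  {H : Type*} [NormedAddCommGroup H] [NormedSpace ℝ H]

/-- First partial derivatives at `x` in the chart around `x`, for vector-valued functions. -/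
def pd₁ (w : X → H) (x : X) (i : Fin n) : H :=
  fderiv ℝ (w ∘ (chart n x).symm) (chart n x x) (single i 1)

/-- Second partial derivatives at `x` in the chart around `x`, for vector-valued functions. -/
def pd₂ (w : X → H) (x : X) (i j : Fin n) : H :=
  D² (w ∘ (chart n x).symm) (chart n x x) (single i 1) (single j 1)

namespace DiffusionOp

/-- The operator applied to a (vector-valued) function. -/
def op (𝒟 : DiffusionOp n X) (w : X → H) (x : X) : H :=
  (∑ i, ∑ j, 𝒟.mat x i j • pd₂ w x i j) + ∑ i, 𝒟.drift x i • pd₁ w x i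

/-- The principal symbol of the operator, as a form on differentials of functions
(the carré du champ). -/
def gamma (𝒟 : DiffusionOp n X) (f h : X → ℝ) (x : X) : ℝ :=
  ∑ i, ∑ j, 𝒟.mat x i j * pd₁ f x i * pd₁ h x j

lemma mat_symm (𝒟 : DiffusionOp n X) (x : X) (i j : Fin n) : 𝒟.mat x i j = 𝒟.mat x j i := by
  have := congrFun (congrFun (𝒟.posDef x).1 j) i
  simpa using this

lemma gamma_comm (𝒟 : DiffusionOp n X) (f h : X → ℝ) (x : X) : 𝒟.gamma f h x = 𝒟.gamma h f x := by
  rw [gamma, gamma, sum_comm]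
  refine sum_congr rfl fun i _ => sum_congr rfl fun j _ => ?_
  rw [𝒟.mat_symm]; ring

end DiffusionOp

variable [IsManifold (𝓡 n) ∞ X]

lemma ContMDiffAt.contDiffAt_two {w : X → H} {x : X} (hw : SmAt (𝓡 n) 𝓘(ℝ, H) w x) :
    ContDiffAt ℝ 2 (w ∘ (chart n x).symm) (chart n x x) :=
  (hw.contDiffAt_comp_extChartAt_symm (mem_extChartAt_source x)).of_le two_le_infty

lemma comp_symm_apply_self (w : X → H) (x : X) : (w ∘ (chart n x).symm) (chart n x x) = w x := by
  simp only [Function.comp, extChartAt_to_inv]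

lemma pd₁_comp {K : Type*} [NormedAddCommGroup K] [NormedSpace ℝ K] {Z : X → H} {x : X}
    (hZ : SmAt (𝓡 n) 𝓘(ℝ, H) Z x) {h : H → K} (hh : ContDiffAt ℝ 2 h (Z x)) (i : Fin n) :
    pd₁ (h ∘ Z) x i = fderiv ℝ h (Z x) (pd₁ Z x i) := by
  have e := comp_symm_apply_self (n := n) Z x
  have hh' : ContDiffAt ℝ 2 h ((Z ∘ (chart n x).symm) (chart n x x)) := by rwa [e]
  rw [pd₁, Function.comp_assoc, fderiv_comp _ hh'.diffAt hZ.contDiffAt_two.diffAt, e]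
  rfl

lemma pd₂_comp {K : Type*} [NormedAddCommGroup K] [NormedSpace ℝ K] {Z : X → H} {x : X}
    (hZ : SmAt (𝓡 n) 𝓘(ℝ, H) Z x) {h : H → K} (hh : ContDiffAt ℝ 2 h (Z x)) (i j : Fin n) :
    pd₂ (h ∘ Z) x i j = D² h (Z x) (pd₁ Z x i) (pd₁ Z x j) + fderiv ℝ h (Z x) (pd₂ Z x i j) := by
  have e := comp_symm_apply_self (n := n) Z x
  have hh' : ContDiffAt ℝ 2 h ((Z ∘ (chart n x).symm) (chart n x x)) := by rwa [e]
  rw [pd₂, Function.comp_assoc, fderiv_fderiv_comp hh' hZ.contDiffAt_two, e]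
  rfl

lemma pd₁_congr {w w' : X → H} {x : X} (h : w =ᶠ[𝓝 x] w') : pd₁ (n := n) w x = pd₁ w' x := by
  have ht : Tendsto (chart n x).symm (𝓝 (chart n x x)) (𝓝 x) := by
    have := (continuousAt_extChartAt_symm (I := 𝓡 n) x).tendsto
    rwa [extChartAt_to_inv] at this
  have : w ∘ (chart n x).symm =ᶠ[𝓝 (chart n x x)] w' ∘ (chart n x).symm := ht.eventually h
  funext i
  rw [pd₁, pd₁, this.fderiv_eq]

lemma pd₂_congr {w w' : X → H} {x : X} (h : w =ᶠ[𝓝 x] w') : pd₂ (n := n) w x = pd₂ w' x := by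
  have ht : Tendsto (chart n x).symm (𝓝 (chart n x x)) (𝓝 x) := by
    have := (continuousAt_extChartAt_symm (I := 𝓡 n) x).tendsto
    rwa [extChartAt_to_inv] at this
  have : w ∘ (chart n x).symm =ᶠ[𝓝 (chart n x x)] w' ∘ (chart n x).symm := ht.eventually h
  funext i j
  rw [pd₂, pd₂, this.fderiv.fderiv_eq]

lemma pd₁_prodMk {K : Type*} [NormedAddCommGroup K] [NormedSpace ℝ K] {f : X → H} {h : X → K}
    {x : X} (hf : SmAt (𝓡 n) 𝓘(ℝ, H) f x) (hh : SmAt (𝓡 n) 𝓘(ℝ, K) h x)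
    (i : Fin n) : pd₁ (fun x => (f x, h x)) x i = (pd₁ f x i, pd₁ h x i) := by
  have e : (fun x => (f x, h x)) ∘ (chart n x).symm = fun z =>
    ((f ∘ (chart n x).symm) z, (h ∘ (chart n x).symm) z) := rfl
  rw [pd₁, e, ((hf.contDiffAt_two.diffAt.hasFDerivAt).prodMk
    hh.contDiffAt_two.diffAt.hasFDerivAt).fderiv]
  rfl

lemma pd₂_prodMk {K : Type*} [NormedAddCommGroup K] [NormedSpace ℝ K] {f : X → H} {h : X → K}
    {x : X} (hf : SmAt (𝓡 n) 𝓘(ℝ, H) f x) (hh : SmAt (𝓡 n) 𝓘(ℝ, K) h x)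
    (i j : Fin n) : pd₂ (fun x => (f x, h x)) x i j = (pd₂ f x i j, pd₂ h x i j) := by
  have hs : ContMDiffAt (𝓡 n) 𝓘(ℝ, H × K) ∞ (fun x => (f x, h x)) x := hf.prodMk_space hh
  have e1 := pd₂_comp hs (h := (Prod.fst : H × K → H)) contDiff_fst.contDiffAt i j
  have e2 := pd₂_comp hs (h := (Prod.snd : H × K → K)) contDiff_snd.contDiffAt i j
  have f1 : fderiv ℝ (Prod.fst : H × K → H) = fun _ => fst ℝ _ _ := by funext z; exact fderiv_fst
  have f2 : fderiv ℝ (Prod.snd : H × K → K) = fun _ => snd ℝ _ _ := by funext z; exact fderiv_snd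
  rw [f1] at e1
  rw [f2] at e2
  simp only [fderiv_fun_const, Pi.zero_apply, _root_.zero_apply, zero_add,
    ContinuousLinearMap.coe_fst', ContinuousLinearMap.coe_snd'] at e1 e2
  exact Prod.ext e1.symm e2.symm

lemma pd₁_mul {f h : X → ℝ} {x : X} (hf : SmoothAt n f x) (hh : SmoothAt n h x) (i : Fin n) :
    pd₁ (fun x => f x * h x) x i = f x * pd₁ h x i + h x * pd₁ f x i := by
  have e : (fun x => f x * h x) ∘ (chart n x).symm = fun z =>
    (f ∘ (chart n x).symm) z * (h ∘ (chart n x).symm) z := rfl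
  rw [pd₁, e, ((hf.contDiffAt_two.diffAt.hasFDerivAt).fun_mul
    hh.contDiffAt_two.diffAt.hasFDerivAt).fderiv, comp_symm_apply_self,
    comp_symm_apply_self]
  rfl

lemma pd₂_mul {f h : X → ℝ} {x : X} (hf : SmoothAt n f x) (hh : SmoothAt n h x) (i j : Fin n) : pd₂
    (fun x => f x * h x) x i j = f x * pd₂ h x i j + h x * pd₂ f x i j + pd₁ f x i * pd₁ h x j + pd₁
    f x j * pd₁ h x i := by
  have hf2 := hf.contDiffAt_two
  have hh2 := hh.contDiffAt_two
  have e : fderiv ℝ ((fun x => f x * h x) ∘ (chart n x).symm) =ᶠ[𝓝 (chart n x x)] fun z =>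
      (f ∘ (chart n x).symm) z • fderiv ℝ (h ∘ (chart n x).symm) z + (h ∘ (chart n x).symm) z • fderiv ℝ (f ∘ (chart n x).symm) z := by
    filter_upwards [hf2.eventually (by simp), hh2.eventually (by simp)] with z hz hz'
    exact (hz.diffAt.hasFDerivAt.mul hz'.diffAt.hasFDerivAt).fderiv
  have d3 := hf2.diffAt_fderiv.hasFDerivAt
  have d4 := hh2.diffAt_fderiv.hasFDerivAt
  rw [pd₂, e.fderiv_eq,
      ((hf2.diffAt.hasFDerivAt.fun_smul d4).fun_add
          (hh2.diffAt.hasFDerivAt.fun_smul d3)).fderiv, comp_symm_apply_self,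
    comp_symm_apply_self]
  simp only [_root_.add_apply, _root_.smul_apply, ContinuousLinearMap.smulRight_apply, smul_eq_mul]
  simp only [pd₁, pd₂]
  ring

lemma pd₁_const (c : H) (x : X) (i : Fin n) : pd₁ (fun _ : X => c) x i = 0 := by
  have : (fun _ : X => c) ∘ (chart n x).symm = fun _ => c := rfl
  rw [pd₁, this]; simp

lemma pd₂_const (c : H) (x : X) (i j : Fin n) : pd₂ (fun _ : X => c) x i j = 0 := by
  have : (fun _ : X => c) ∘ (chart n x).symm = fun _ => c := rfl
  rw [pd₂, this]; simp

lemma pd₁_add {f h : X → H} {x : X} (hf : SmAt (𝓡 n) 𝓘(ℝ, H) f x) (hh : SmAt (𝓡 n) 𝓘(ℝ, H) h x)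
    (i : Fin n) : pd₁ (fun x => f x + h x) x i = pd₁ f x i + pd₁ h x i := by
  have e : (fun x => f x + h x) ∘ (chart n x).symm = fun z =>
    (f ∘ (chart n x).symm) z + (h ∘ (chart n x).symm) z := rfl
  rw [pd₁, e, ((hf.contDiffAt_two.diffAt.hasFDerivAt).fun_add
    hh.contDiffAt_two.diffAt.hasFDerivAt).fderiv]
  rfl

lemma pd₂_add {f h : X → H} {x : X} (hf : SmAt (𝓡 n) 𝓘(ℝ, H) f x) (hh : SmAt (𝓡 n) 𝓘(ℝ, H) h x)
    (i j : Fin n) : pd₂ (fun x => f x + h x) x i j = pd₂ f x i j + pd₂ h x i j := by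
  have hf2 := hf.contDiffAt_two
  have hh2 := hh.contDiffAt_two
  have e : fderiv ℝ ((fun x => f x + h x) ∘ (chart n x).symm) =ᶠ[𝓝 (chart n x x)] fun z =>
      fderiv ℝ (f ∘ (chart n x).symm) z + fderiv ℝ (h ∘ (chart n x).symm) z := by
    filter_upwards [hf2.eventually (by simp), hh2.eventually (by simp)] with z hz hz'
    exact (hz.diffAt.hasFDerivAt.add hz'.diffAt.hasFDerivAt).fderiv
  rw [pd₂, e.fderiv_eq, (hf2.diffAt_fderiv.hasFDerivAt.fun_add
      hh2.diffAt_fderiv.hasFDerivAt).fderiv]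
  rfl

lemma pd₁_const_mul (s : ℝ) {f : X → ℝ} {x : X} (hf : SmoothAt n f x)
    (i : Fin n) : pd₁ (fun x => s * f x) x i = s * pd₁ f x i := by
  rw [pd₁_mul contMDiffAt_const hf, pd₁_const]; simp

lemma pd₂_const_mul (s : ℝ) {f : X → ℝ} {x : X} (hf : SmoothAt n f x)
    (i j : Fin n) : pd₂ (fun x => s * f x) x i j = s * pd₂ f x i j := by
  rw [pd₂_mul contMDiffAt_const hf, pd₂_const, pd₁_const, pd₁_const]; simp

namespace DiffusionOp

variable (𝒟 : DiffusionOp n X)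

/-- Chain rule of the second order. -/
lemma op_comp {Z : X → H} {x : X} (hZ : SmAt (𝓡 n) 𝓘(ℝ, H) Z x) {h : H → ℝ}
    (hh : ContDiffAt ℝ 2 h (Z x)) : 𝒟.op (h ∘ Z) x =
    (∑ i, ∑ j, 𝒟.mat x i j * D² h (Z x) (pd₁ Z x i) (pd₁ Z x j)) + fderiv ℝ h (Z x) (𝒟.op Z x) := by
  simp only [op, pd₁_comp hZ hh, pd₂_comp hZ hh, map_add, map_sum, map_smul, smul_eq_mul, mul_add,
    sum_add_distrib]
  ring

lemma op_congr {w w' : X → H} {x : X} (h : w =ᶠ[𝓝 x] w') : 𝒟.op w x = 𝒟.op w' x := by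
  rw [op, op, pd₁_congr h, pd₂_congr h]

lemma gamma_congr {f f' h h' : X → ℝ} {x : X} (hf : f =ᶠ[𝓝 x] f') (hh : h =ᶠ[𝓝 x] h') :
    𝒟.gamma f h x = 𝒟.gamma f' h' x := by
  rw [gamma, gamma, pd₁_congr hf, pd₁_congr hh]

lemma op_mul {f h : X → ℝ} {x : X} (hf : SmoothAt n f x) (hh : SmoothAt n h x) :
    𝒟.op (fun x => f x * h x) x = f x * 𝒟.op h x + h x * 𝒟.op f x + 2 * 𝒟.gamma f h x := by
  have e1 : 2 * 𝒟.gamma f h x = ∑ i, ∑ j, 𝒟.mat x i j *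
      (pd₁ f x i * pd₁ h x j + pd₁ f x j * pd₁ h x i) := by
    have : 𝒟.gamma f h x = ∑ i, ∑ j, 𝒟.mat x i j * (pd₁ f x j * pd₁ h x i) := by
      rw [gamma_comm, gamma]
      refine sum_congr rfl fun i _ => sum_congr rfl fun j _ => by ring
    rw [two_mul]
    nth_rewrite 2 [this]
    rw [gamma, ← sum_add_distrib]
    refine sum_congr rfl fun i _ => ?_
    rw [← sum_add_distrib]
    exact sum_congr rfl fun j _ => by ring
  rw [e1]
  simp only [op, pd₂_mul hf hh, pd₁_mul hf hh, smul_eq_mul, mul_add, sum_add_distrib, mul_sum]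
  have e2 i j : 𝒟.mat x i j * (f x * pd₂ h x i j) = f x * (𝒟.mat x i j * pd₂ h x i j) := by ring
  have e3 i j : 𝒟.mat x i j * (h x * pd₂ f x i j) = h x * (𝒟.mat x i j * pd₂ f x i j) := by ring
  have e4 i : 𝒟.drift x i * (f x * pd₁ h x i) = f x * (𝒟.drift x i * pd₁ h x i) := by ring
  have e5 i : 𝒟.drift x i * (h x * pd₁ f x i) = h x * (𝒟.drift x i * pd₁ f x i) := by ring
  simp only [e2, e3, e4, e5]
  ring

lemma gamma_mul_left {f h k : X → ℝ} {x : X} (hf : SmoothAt n f x) (hh : SmoothAt n h x) :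
    𝒟.gamma (fun x => f x * h x) k x = f x * 𝒟.gamma h k x + h x * 𝒟.gamma f k x := by
  simp only [gamma, pd₁_mul hf hh, mul_add, add_mul, sum_add_distrib, mul_sum]
  congr 1 <;> exact sum_congr rfl fun i _ => sum_congr rfl fun j _ => by ring

lemma gamma_const_left (c : ℝ) (h : X → ℝ) (x : X) : 𝒟.gamma (fun _ => c) h x = 0 := by
  simp [gamma, pd₁_const]

lemma op_const (c : ℝ) (x : X) : 𝒟.op (fun _ => c) x = 0 := by simp [op, pd₁_const, pd₂_const]

lemma op_add {f h : X → ℝ} {x : X} (hf : SmoothAt n f x) (hh : SmoothAt n h x) :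
    𝒟.op (fun x => f x + h x) x = 𝒟.op f x + 𝒟.op h x := by
  simp only [op, pd₁_add hf hh, pd₂_add hf hh, smul_add, sum_add_distrib]
  ring

lemma op_const_mul (c : ℝ) {f : X → ℝ} {x : X} (hf : SmoothAt n f x) :
    𝒟.op (fun x => c * f x) x = c * 𝒟.op f x := by
  rw [𝒟.op_mul contMDiffAt_const hf, 𝒟.op_const, 𝒟.gamma_const_left]; ring

lemma gamma_add_left {f h k : X → ℝ} {x : X} (hf : SmoothAt n f x) (hh : SmoothAt n h x) :
    𝒟.gamma (fun x => f x + h x) k x = 𝒟.gamma f k x + 𝒟.gamma h k x := by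
  simp only [gamma, pd₁_add hf hh, mul_add, add_mul, sum_add_distrib]

lemma gamma_self_pos {f : X → ℝ} {x : X} (hf : pd₁ (n := n) f x ≠ 0) : 0 < 𝒟.gamma f f x :=
  (𝒟.posDef x).sum_pos hf

lemma gamma_self_nonneg (f : X → ℝ) (x : X) : 0 ≤ 𝒟.gamma f f x := by
  by_cases h : pd₁ (n := n) f x = 0
  · simp [gamma, h]
  · exact (𝒟.gamma_self_pos h).le

/-- Expansion of the operator on `x ↦ U (x, v0 + s κ x)` in powers of `s`, where `κ` vanishes
at the point. Here `U` is given in the chart around `x`. -/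
lemma op_comp_add_smul {U : X → ℝ → ℝ} {κ : X → ℝ} {x : X} {v0 : ℝ}
    (hU : SmAt ((𝓡 n).prod 𝓘₁) 𝓘₁ (fun q : X × ℝ => U q.1 q.2) (x, v0)) (hκ : SmoothAt n κ x)
    (h0 : κ x = 0) (s : ℝ) : 𝒟.op (fun x' => U x' (v0 + s * κ x')) x = 𝒟.op (fun x' => U x' v0) x +
    s * (2 * 𝒟.gamma (fun x' => deriv (U x') v0) κ x + deriv (U x) v0 * 𝒟.op κ x) + s ^ 2 *
    (deriv (deriv (U x)) v0 * 𝒟.gamma κ κ x) := by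
  set φ := chart n x with hφ
  set Uh : 𝔼 n × ℝ → ℝ := fun z => U (φ.symm z.1) z.2 with hUh
  have hUc : ContDiffAt ℝ ∞ Uh (φ x, v0) := by
    have h := hU.contDiffAt_comp_extChartAt_symm (c := ((x, v0) : X × ℝ)) (mem_extChartAt_source _)
    rwa [extChartAt_prod] at h
  have hU2 : ContDiffAt ℝ 2 Uh (φ x, v0) := hUc.of_le two_le_infty
  have hφs : SmAt (𝓡 n) 𝓘(ℝ, 𝔼 n) φ x := contMDiffAt_extChartAt_of_mem (mem_extChartAt_source x)
  have pφ : φ ∘ φ.symm =ᶠ[𝓝 (φ x)] id := by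
    filter_upwards [extChartAt_target_mem_nhds (I := 𝓡 n) x] with z hz
    exact φ.right_inv hz
  have pφ1 (i : Fin n) : pd₁ φ x i = single i 1 := by rw [pd₁, pφ.fderiv_eq, fderiv_id]; rfl
  have pφ2 (i j : Fin n) : pd₂ φ x i j = 0 := by
    rw [pd₂, pφ.fderiv.fderiv_eq]
    have : fderiv ℝ (id : 𝔼 n → _) =
      fun _ => ContinuousLinearMap.id ℝ 𝔼 n := by funext z; exact fderiv_id
    rw [this]; simp
  set e : Fin n → 𝔼 n × ℝ := fun i => (single i 1, 0) with he
  set ev : 𝔼 n × ℝ := (0, 1) with hev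
  have hsrc : φ.source ∈ 𝓝 x := extChartAt_source_mem_nhds x
  -- derivatives of `x ↦ U (x, v0 + s κ x)`
  have hW (s : ℝ) : (fun x' => U x' (v0 + s * κ x')) =ᶠ[𝓝 x]
      Uh ∘ fun x' => (φ x', v0 + s * κ x') := by
    filter_upwards [hsrc] with x' hx'
    simp only [hUh, Function.comp, φ.left_inv hx']
  have hsκ (s : ℝ) : SmoothAt n (fun x => s * κ x) x := contMDiffAt_const.mul hκ
  have hlin (s : ℝ) : SmoothAt n (fun x => v0 + s * κ x) x := contMDiffAt_const.add (hsκ s)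
  have q1 (s : ℝ) (i : Fin n) : pd₁ (fun x' => (φ x', v0 + s * κ x')) x i = e i + (s * pd₁ κ x i) • ev := by
    rw [pd₁_prodMk hφs (hlin s), pφ1, pd₁_add contMDiffAt_const (hsκ s), pd₁_const,
      pd₁_const_mul s hκ]
    simp [he, hev]
  have q2 (s : ℝ) (i j : Fin n) : pd₂ (fun x' => (φ x', v0 + s * κ x')) x i j = (s * pd₂ κ x i j) • ev := by
    rw [pd₂_prodMk hφs (hlin s), pφ2, pd₂_add contMDiffAt_const (hsκ s), pd₂_const,
      pd₂_const_mul s hκ]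
    simp [hev]
  have hbase : ∀ s : ℝ, (φ x, v0 + s * κ x) = (φ x, v0) := by simp [h0]
  have r1 (s : ℝ) (i : Fin n) : pd₁ (fun x' => U x' (v0 + s * κ x')) x i =
      fderiv ℝ Uh (φ x, v0) (e i) + s * pd₁ κ x i * fderiv ℝ Uh (φ x, v0) ev := by
    rw [pd₁_congr (hW s), pd₁_comp (Z := fun x' => (φ x', v0 + s * κ x'))
      (hφs.prodMk_space (hlin s)) (by rw [hbase]; exact hU2), q1, hbase, map_add, map_smul]
    rfl
  have r2 (s : ℝ) (i j : Fin n) : pd₂ (fun x' => U x' (v0 + s * κ x')) x i j =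
      D² Uh (φ x, v0) (e i + (s * pd₁ κ x i) • ev) (e j + (s * pd₁ κ x j) • ev) +
        s * pd₂ κ x i j * fderiv ℝ Uh (φ x, v0) ev := by
    rw [pd₂_congr (hW s), pd₂_comp (Z := fun x' => (φ x', v0 + s * κ x'))
      (hφs.prodMk_space (hlin s)) (by rw [hbase]; exact hU2), q1, q1, q2, hbase, map_smul]
    rfl
  have hzero : (fun x' => U x' v0) = fun x' => U x' (v0 + 0 * κ x') := by simp
  -- the derivative `U_v`
  have hcurve (z : 𝔼 n) (v : ℝ) : HasDerivAt (fun v : ℝ => (z, v)) ev v :=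
    (hasDerivAt_const v z).prodMk (hasDerivAt_id v)
  have hev1 : ∀ᶠ z in 𝓝 (φ x, v0), HasDerivAt (fun v => Uh (z.1, v)) (fderiv ℝ Uh z ev) z.2 := by
    filter_upwards [hU2.eventually (by simp)] with z hz
    exact hz.diffAt.hasFDerivAt.comp_hasDerivAt z.2 (hcurve z.1 z.2)
  have hdU : DifferentiableAt ℝ (fderiv ℝ Uh) (φ x, v0) := hU2.diffAt_fderiv
  have hUx v : U x v = Uh (φ x, v) := by simp only [hUh, hφ, extChartAt_to_inv]
  have hUv : deriv (U x) v0 = fderiv ℝ Uh (φ x, v0) ev := by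
    have : U x = fun v => Uh (φ x, v) := funext hUx
    rw [this]; exact hev1.self_of_nhds.deriv
  have hUvv : deriv (deriv (U x)) v0 = D² Uh (φ x, v0) ev ev := by
    have h1 : deriv (U x) =ᶠ[𝓝 v0] fun v => fderiv ℝ Uh (φ x, v) ev := by
      have ht : Tendsto (fun v : ℝ => (φ x, v)) (𝓝 v0) (𝓝 (φ x, v0)) :=
        (hcurve (φ x) v0).continuousAt.tendsto
      filter_upwards [ht.eventually hev1] with v hv
      have : U x = fun v => Uh (φ x, v) := funext hUx
      rw [this]; exact hv.deriv
    rw [h1.deriv_eq]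
    have h2 := hdU.hasFDerivAt.comp_hasDerivAt v0 (hcurve (φ x) v0)
    have h3 := h2.clm_apply (hasDerivAt_const v0 ev)
    rw [map_zero, add_zero] at h3
    exact h3.deriv
  have hUvi (i : Fin n) : pd₁ (fun x' => deriv (U x') v0) x i = D² Uh (φ x, v0) (e i) ev := by
    have h1 : (fun x' => deriv (U x') v0) =ᶠ[𝓝 x] (fun z => fderiv ℝ Uh (z, v0) ev) ∘ φ := by
      have ht : Tendsto (fun x' : X => (φ x', v0)) (𝓝 x) (𝓝 (φ x, v0)) :=
        (hφs.continuousAt).tendsto.prodMk_nhds tendsto_const_nhds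
      filter_upwards [hsrc, ht.eventually hev1] with x' hx' hv
      have : U x' = fun v => Uh (φ x', v) := by funext v; simp only [hUh, φ.left_inv hx']
      simp only [Function.comp, this]; exact hv.deriv
    have hc : HasFDerivAt (fun z : 𝔼 n => (z, v0))
        (ContinuousLinearMap.inl ℝ _ _) (φ x) := (hasFDerivAt_id _).prodMk (hasFDerivAt_const _ _)
    have h2 := (hdU.hasFDerivAt.comp (φ x) hc).clm_apply (hasFDerivAt_const ev (φ x))
    have h3 : ContDiffAt ℝ 2 (fun z => fderiv ℝ Uh (z, v0) ev) (φ x) := by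
      have e1 : ContDiffAt ℝ 2 (fderiv ℝ Uh) (φ x, v0) :=
        (hUc.of_le (m := 3) ENat.LEInfty.out).fderiv_right (by norm_num)
      have e2 : ContDiffAt ℝ 2 (fun z : 𝔼 n => (z, v0)) (φ x) :=
        contDiffAt_id.prodMk contDiffAt_const
      exact (e1.comp (φ x) e2).clm_apply contDiffAt_const
    have h4 : fderiv ℝ (fun z => fderiv ℝ Uh (z, v0) ev) (φ x) = _ := h2.fderiv
    rw [pd₁_congr h1, pd₁_comp hφs h3, pφ1, h4]
    simp [he]
  have hsymm := hU2.fderiv_fderiv_symm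
  have t1 : ∀ i : Fin n, pd₁ (fun x' => U x' v0) x i = fderiv ℝ Uh (φ x, v0) (e i) := by
    intro i; rw [hzero, r1]; simp
  have t2 : ∀ i j : Fin n, pd₂ (fun x' => U x' v0) x i j = D² Uh (φ x, v0) (e i) (e j) := by
    intro i j; rw [hzero, r2]; simp
  simp only [op, gamma, r1, r2, t1, t2, hUv, hUvv, hUvi, smul_eq_mul]
  set D1 := fderiv ℝ Uh (φ x, v0)
  set D2 := D² Uh (φ x, v0)
  have hexp i j : 𝒟.mat x i j * (D2 (e i + (s * pd₁ κ x i) • ev) (e j + (s * pd₁ κ x j) • ev) +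
      s * pd₂ κ x i j * D1 ev) = 𝒟.mat x i j * D2 (e i) (e j) +
      s * (𝒟.mat x i j * D2 (e i) ev * pd₁ κ x j) + s * (𝒟.mat x i j * D2 (e j) ev * pd₁ κ x i) +
      s ^ 2 * D2 ev ev * (𝒟.mat x i j * pd₁ κ x i * pd₁ κ x j) +
      s * D1 ev * (𝒟.mat x i j * pd₂ κ x i j) := by
    simp only [map_add, map_smul, _root_.add_apply, _root_.smul_apply, smul_eq_mul, hsymm ev (e j)]
    ring
  have hswap : ∑ i, ∑ j, 𝒟.mat x i j * D2 (e j) ev * pd₁ κ x i =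
      ∑ i, ∑ j, 𝒟.mat x i j * D2 (e i) ev * pd₁ κ x j := by
    rw [sum_comm]
    exact sum_congr rfl fun i _ => sum_congr rfl fun j _ => by rw [𝒟.mat_symm]
  have hdr i : 𝒟.drift x i * (D1 (e i) + s * pd₁ κ x i * D1 ev) =
      𝒟.drift x i * D1 (e i) + s * D1 ev * (𝒟.drift x i * pd₁ κ x i) := by ring
  simp only [hexp, hdr, sum_add_distrib, ← mul_sum, hswap]
  ring

end DiffusionOp

/-- The equation has the form `u_t = a(u) 𝒟 u + q(x, u)` for a linear differential operator `𝒟`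
of the second order. -/
def ParabolicEquation.HasForm (A : PEq n X) (a : ℝ → ℝ) (𝒟 : DiffusionOp n X)
    (q : X → ℝ → ℝ) : Prop :=
  ∀ t ∈ A.T, ∀ x, ∀ w : X → ℝ, SmoothAt n w x → w x ∈ A.Ω →
    A.op t x w = a (w x) * 𝒟.op w x + q x (w x)

end Diffusion

/-! ### The Laplace operator of a metric on a vector space -/

section MatrixCalculus

variable {n : ℕ} {E : Type*} [NormedAddCommGroup E] [NormedSpace ℝ E]

lemma ContDiffAt.matrix_det {k : ℕ∞} {G : E → Mat n} {z : E}
    (hG : ∀ i j, ContDiffAt ℝ k (fun z => G z i j) z) : ContDiffAt ℝ k (fun z => (G z).det) z := by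
  simp only [Matrix.det_apply]
  refine ContDiffAt.sum fun σ _ => ContDiffAt.const_smul _ ?_
  exact contDiffAt_prod fun i _ => hG _ _

lemma ContDiffAt.matrix_inv {k : ℕ∞} {G : E → Mat n} {z : E}
    (hG : ∀ i j, ContDiffAt ℝ k (fun z => G z i j) z) (h0 : (G z).det ≠ 0) (i j : Fin n) :
    ContDiffAt ℝ k (fun z => (G z)⁻¹ i j) z := by
  simp only [Matrix.inv_def, Ring.inverse_eq_inv', Matrix.smul_apply, smul_eq_mul,
    Matrix.adjugate_apply]
  refine ((ContDiffAt.matrix_det hG).inv h0).mul (ContDiffAt.matrix_det fun a b => ?_)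
  by_cases h : a = j
  · subst h; simp only [Matrix.updateRow_self]; exact contDiffAt_const
  · simp only [Matrix.updateRow_ne h]; exact hG a b

lemma fderiv_det_one (M : Fin n → Fin n → ℝ) : fderiv ℝ
    (fun N : Fin n → Fin n → ℝ => (Matrix.of N).det) (fun i j => (1 : Matrix _ _ ℝ) i j) M = ∑ i, M
    i i := by
  set f : (Fin n → Fin n → ℝ) → ℝ := fun N => (Matrix.of N).det
  have hd : DifferentiableAt ℝ f (fun i j => (1 : Matrix _ _ ℝ) i j) := by
    refine (ContDiffAt.matrix_det (k := 1) fun i j => ?_).diffAt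
    exact contDiffAt_pi.1 (contDiffAt_pi.1 contDiffAt_id i) j
  have hc : HasDerivAt (fun s : ℝ => (fun i j => (1 : Matrix _ _ ℝ) i j) + s • M) M 0 := by
    simpa using ((hasDerivAt_id (0 : ℝ)).smul_const M).const_add (fun i j => (1 : Mat n) i j)
  have hd' : HasFDerivAt f (fderiv ℝ f (fun i j => (1 : Matrix _ _ ℝ) i j))
      ((fun i j => (1 : Matrix _ _ ℝ) i j) + (0 : ℝ) • M) := by
    rw [zero_smul, add_zero]; exact hd.hasFDerivAt
  have h2 : HasDerivAt (f ∘ fun s : ℝ => (fun i j => (1 : Matrix _ _ ℝ) i j) + s • M)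
      (Matrix.of M).trace 0 := by
    have e : (f ∘ fun s : ℝ => (fun i j => (1 : Matrix _ _ ℝ) i j) + s • M) = fun s : ℝ =>
        1 + (Matrix.of M).trace * s + (((1 + (Polynomial.X : Polynomial ℝ) •
          (Matrix.of M).map Polynomial.C).det).divX.divX.eval s) * s ^ 2 := by
      funext s
      rw [← Matrix.det_one_add_smul]
      rfl
    rw [e]
    set p := (((1 + (Polynomial.X : Polynomial ℝ) • (Matrix.of M).map Polynomial.C).det).divX.divX)
    have h3 := (((hasDerivAt_id (0 : ℝ)).const_mul (Matrix.of M).trace).const_add 1).add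
      ((p.hasDerivAt 0).mul (hasDerivAt_pow 2 (0 : ℝ)))
    exact h3.congr_deriv (by simp)
  exact (hd'.comp_hasDerivAt (0 : ℝ) hc).unique h2

/-- Jacobi's formula. -/
lemma fderiv_det {G : E → Mat n} {z : E} (hG : ∀ i j, DifferentiableAt ℝ (fun z => G z i j) z)
    (h0 : (G z).det ≠ 0) (v : E) : fderiv ℝ (fun z => (G z).det) z v = (G z).det * ∑ i, ∑ j, (G z)⁻¹
    i j * fderiv ℝ (fun z => G z j i) z v := by
  have hu : IsUnit (G z).det := isUnit_iff_ne_zero.2 h0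
  set N : E → Fin n → Fin n → ℝ := fun z' i j => ∑ k, (G z)⁻¹ i k * G z' k j
  have hNz : N z = fun i j => (1 : Matrix _ _ ℝ) i j := by
    funext i j
    rw [← Matrix.nonsing_inv_mul _ hu, Matrix.mul_apply]
  have hd : HasFDerivAt N (ContinuousLinearMap.pi fun i => ContinuousLinearMap.pi fun j =>
      ∑ k, (G z)⁻¹ i k • fderiv ℝ (fun z => G z k j) z) z := by
    refine hasFDerivAt_pi.2 fun i => hasFDerivAt_pi.2 fun j => ?_
    exact HasFDerivAt.fun_sum fun k _ => (hG k j).hasFDerivAt.const_mul _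
  have hf : DifferentiableAt ℝ (fun N : Fin n → Fin n → ℝ => (Matrix.of N).det) (N z) := by
    refine (ContDiffAt.matrix_det (k := 1) fun i j => ?_).diffAt
    exact contDiffAt_pi.1 (contDiffAt_pi.1 contDiffAt_id i) j
  have e : (fun z' => (G z').det) = fun z' => (G z).det *
      ((fun N : Fin n → Fin n → ℝ => (Matrix.of N).det) ∘ N) z' := by
    funext z'
    have : Matrix.of (N z') = (G z)⁻¹ * G z' := by ext i j; rw [Matrix.mul_apply]; rfl
    simp only [Function.comp, this, Matrix.det_mul]
    rw [← mul_assoc, ← Matrix.det_mul, Matrix.mul_nonsing_inv _ hu, Matrix.det_one, one_mul]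
  rw [e, ((hf.hasFDerivAt.comp z hd).const_mul _).fderiv, hNz]
  simp only [_root_.smul_apply, smul_eq_mul, ContinuousLinearMap.comp_apply]
  rw [fderiv_det_one]
  simp [_root_.sum_apply]

lemma fderiv_matrix_inv {G : E → Mat n} {z : E} (hG : ∀ i j, ContDiffAt ℝ 1 (fun z => G z i j) z)
    (h0 : (G z).det ≠ 0) (v : E) (i j : Fin n) : fderiv ℝ (fun z => (G z)⁻¹ i j) z v = -∑ a, ∑ b,
    (G z)⁻¹ i a * fderiv ℝ (fun z => G z a b) z v * (G z)⁻¹ b j := by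
  have hGd i j : DifferentiableAt ℝ (fun z => G z i j) z := (hG i j).diffAt
  have hPd i j : DifferentiableAt ℝ (fun z => (G z)⁻¹ i j) z :=
    (ContDiffAt.matrix_inv (k := 1) (fun i j => hG i j) h0 i j).diffAt
  -- differentiate `G⁻¹ G = 1`
  have key i b : (∑ a, ((G z)⁻¹ i a * fderiv ℝ (fun z => G z a b) z v +
      fderiv ℝ (fun z => (G z)⁻¹ i a) z v * G z a b)) = 0 := by
    have e : (fun z' => ∑ a, (G z')⁻¹ i a * G z' a b) =ᶠ[𝓝 z] fun _ => (1 : Matrix _ _ ℝ) i b := by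
      filter_upwards [(ContDiffAt.matrix_det (k := 1) hG).continuousAt.eventually_ne h0] with z' hz'
      rw [← Matrix.nonsing_inv_mul _ (isUnit_iff_ne_zero.2 hz'), Matrix.mul_apply]
    have h1 := (HasFDerivAt.fun_sum (u := Finset.univ)
      fun a _ => ((hPd i a).hasFDerivAt.fun_mul (hGd a b).hasFDerivAt)).fderiv
    rw [e.fderiv_eq] at h1
    have h2 := congrArg (fun L : E →L[ℝ] ℝ => L v) h1
    simp only [fderiv_fun_const, Pi.zero_apply, _root_.zero_apply, _root_.sum_apply,
      _root_.add_apply, _root_.smul_apply, smul_eq_mul] at h2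
    rw [h2]
    exact sum_congr rfl fun a _ => by ring
  have h3 b : (∑ a, fderiv ℝ (fun z => (G z)⁻¹ i a) z v * G z a b) =
      -∑ a, (G z)⁻¹ i a * fderiv ℝ (fun z => G z a b) z v := by
    have := key i b
    rw [sum_add_distrib] at this
    linarith
  have h4 : fderiv ℝ (fun z => (G z)⁻¹ i j) z v =
      ∑ b, (∑ a, fderiv ℝ (fun z => (G z)⁻¹ i a) z v * G z a b) * (G z)⁻¹ b j := by
    simp only [sum_mul, mul_assoc]
    rw [sum_comm]
    simp only [← mul_sum]
    have : ∀ a, (∑ b, G z a b * (G z)⁻¹ b j) = (1 : Matrix _ _ ℝ) a j := by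
      intro a; rw [← Matrix.mul_nonsing_inv _ (isUnit_iff_ne_zero.2 h0), Matrix.mul_apply]
    simp only [this, Matrix.one_apply]
    simp
  rw [h4]
  simp only [h3, neg_mul, sum_neg_distrib, sum_mul]
  rw [sum_comm]

end MatrixCalculus

section Forms

variable {n : ℕ}

/-- The Gram matrix of a bilinear form in the standard basis. -/
def gramOf (β : Bil (𝔼 n)) : Mat n := Matrix.of fun i j => β (single i 1) (single j 1)

/-- The trace of a bilinear map with respect to a metric. -/
def metricTrace {W : Type*} [NormedAddCommGroup W] [NormedSpace ℝ W]
    (β : Bil (𝔼 n)) (T : 𝔼 n → 𝔼 n → W) : W :=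
  ∑ i, ∑ j, (gramOf β)⁻¹ i j • T (single i 1) (single j 1)

/-- The contracted Christoffel symbols of the first kind of a metric `β` with derivative `D`. -/
def christoffel (β : Bil (𝔼 n)) (D : 𝔼 n →L[ℝ] Bil (𝔼 n)) (v : 𝔼 n) : ℝ :=
  metricTrace β fun a b => D a b v - (1 / 2) * D v a b

/-- The coefficients of the first derivatives in the Laplace operator of a metric `β` with
derivative `D`, namely `-gⁱʲ Γᵏᵢⱼ`. -/
def laplaceDrift (β : Bil (𝔼 n)) (D : 𝔼 n →L[ℝ] Bil (𝔼 n)) : 𝔼 n :=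
  -metricTrace β fun a b => christoffel β D b • a

lemma sum_smul_single (v : 𝔼 n) : v = ∑ i, v i • (single i (1 : ℝ) : 𝔼 n) := by
  ext j
  simp [Finset.sum_apply, Pi.single_apply]

lemma metricTrace_smul_right {β : Bil (𝔼 n)} (h0 : (gramOf β).det ≠ 0) (w : 𝔼 n) :
    metricTrace β (fun a b => β b w • a) = w := by
  have e j : β (single j 1) w = ∑ k, gramOf β j k * w k := by
    conv_lhs => rw [sum_smul_single w]
    simp only [map_sum, map_smul, smul_eq_mul, gramOf, Matrix.of_apply]
    exact sum_congr rfl fun k _ => mul_comm _ _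
  have h1 i : (∑ j, (gramOf β)⁻¹ i j * ∑ k, gramOf β j k * w k) = w i := by
    simp only [mul_sum, ← mul_assoc]
    rw [sum_comm]
    simp only [← sum_mul]
    have : ∀ k, (∑ j, (gramOf β)⁻¹ i j * gramOf β j k) = (1 : Matrix _ _ ℝ) i k := by
      intro k; rw [← Matrix.nonsing_inv_mul _ (isUnit_iff_ne_zero.2 h0), Matrix.mul_apply]
    simp only [this, Matrix.one_apply]
    simp
  conv_rhs => rw [sum_smul_single w]
  unfold metricTrace
  refine sum_congr rfl fun i _ => ?_
  simp only [e, smul_smul, ← Finset.sum_smul, h1]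

lemma metricTrace_comp {W : Type*} [NormedAddCommGroup W] [NormedSpace ℝ W] {β β' : Bil (𝔼 n)}
    {J : 𝔼 n →L[ℝ] 𝔼 n} (hβ : ∀ v w, β v w = β' (J v) (J w)) (h0 : (gramOf β).det ≠ 0)
    (T : 𝔼 n →ₗ[ℝ] 𝔼 n →ₗ[ℝ] W) : metricTrace β (fun a b => T (J a) (J b)) = metricTrace β'
    (fun a b => T a b) := by
  -- `M` is the matrix of `J`, and the Gram matrices are related by `G = Mᵀ G' M`
  set M : Mat n := Matrix.of fun k i => J (single i 1) k
  have hJ i : J (single i 1) = ∑ k, M k i • (single k (1 : ℝ) : 𝔼 n) := sum_smul_single _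
  have hG : gramOf β = M.transpose * gramOf β' * M := by
    ext i j
    simp only [gramOf, Matrix.of_apply, hβ, hJ, map_sum, map_smul, Matrix.mul_apply,
      Matrix.transpose_apply, _root_.sum_apply, _root_.smul_apply, smul_eq_mul, sum_mul,
      mul_sum]
    refine sum_congr rfl fun k _ => sum_congr rfl fun l _ => by ring
  have hdet : M.det * (gramOf β').det * M.det ≠ 0 := by
    rwa [hG, Matrix.det_mul, Matrix.det_mul, Matrix.det_transpose] at h0
  have hMu : IsUnit M.det := isUnit_iff_ne_zero.2 (right_ne_zero_of_mul hdet)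
  have hP : M * (gramOf β)⁻¹ * M.transpose = (gramOf β')⁻¹ := by
    rw [hG, Matrix.mul_inv_rev, Matrix.mul_inv_rev, ← mul_assoc, ← mul_assoc,
      Matrix.mul_nonsing_inv _ hMu, one_mul, mul_assoc,
      Matrix.nonsing_inv_mul _ (by rwa [Matrix.det_transpose]), mul_one]
  unfold metricTrace
  set S : Fin n → Fin n → W := fun k l => T (single k 1) (single l 1) with hS
  have hL i j : T (J (single i 1)) (J (single j 1)) = ∑ k, ∑ l, (M k i * M l j) • S k l := by
    rw [hJ, hJ]
    simp only [map_sum, map_smul, LinearMap.sum_apply, LinearMap.smul_apply, smul_sum,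
      smul_smul, hS]
    rw [sum_comm]
    exact sum_congr rfl fun k _ => sum_congr rfl fun l _ => by rw [mul_comm]
  have hR k l : (gramOf β')⁻¹ k l = ∑ i, ∑ j, (gramOf β)⁻¹ i j * (M k i * M l j) := by
    rw [← hP]
    simp only [Matrix.mul_apply, Matrix.transpose_apply, sum_mul]
    rw [sum_comm]
    exact sum_congr rfl fun i _ => sum_congr rfl fun j _ => by ring
  calc _ = ∑ p : Fin n × Fin n, ∑ r : Fin n × Fin n,
        ((gramOf β)⁻¹ p.1 p.2 * (M r.1 p.1 * M r.2 p.2)) • S r.1 r.2 := by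
        simp only [hL, smul_sum, smul_smul, Fintype.sum_prod_type]
    _ = ∑ r : Fin n × Fin n, ∑ p : Fin n × Fin n,
        ((gramOf β)⁻¹ p.1 p.2 * (M r.1 p.1 * M r.2 p.2)) • S r.1 r.2 := sum_comm
    _ = _ := by
        simp only [hR, Finset.sum_smul, Fintype.sum_prod_type]
        rfl

lemma gramOf_inv_symm {β : Bil (𝔼 n)} (hs : ∀ v w, β v w = β w v) (i j : Fin n) :
    (gramOf β)⁻¹ i j = (gramOf β)⁻¹ j i := by
  have : (gramOf β).transpose = gramOf β := by ext i j; exact hs _ _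
  conv_lhs => rw [← this, ← Matrix.transpose_nonsing_inv]
  rfl

lemma metricTrace_swap {W : Type*} [NormedAddCommGroup W] [NormedSpace ℝ W]
    {β : Bil (𝔼 n)} (hs : ∀ v w, β v w = β w v) (T : 𝔼 n → 𝔼 n → W) :
    metricTrace β (fun a b => T b a) = metricTrace β T := by
  unfold metricTrace
  rw [sum_comm]
  exact sum_congr rfl fun i _ => sum_congr rfl fun j _ => by rw [gramOf_inv_symm hs]

lemma metricTrace_add {W : Type*} [NormedAddCommGroup W] [NormedSpace ℝ W]
    (β : Bil (𝔼 n)) (S T : 𝔼 n → 𝔼 n → W) :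
    metricTrace β (fun a b => S a b + T a b) = metricTrace β S + metricTrace β T := by
  simp only [metricTrace, smul_add, sum_add_distrib]

lemma metricTrace_smul {W : Type*} [NormedAddCommGroup W] [NormedSpace ℝ W] (β : Bil (𝔼 n)) (c : ℝ)
    (T : 𝔼 n → 𝔼 n → W) : metricTrace β (fun a b => c • T a b) = c • metricTrace β T := by
  simp only [metricTrace, smul_sum, smul_comm c]

lemma map_metricTrace {W W' : Type*} [NormedAddCommGroup W] [NormedSpace ℝ W]
    [NormedAddCommGroup W'] [NormedSpace ℝ W'] (L : W →L[ℝ] W') (β : Bil (𝔼 n)) (T : 𝔼 n → 𝔼 n → W)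
    : L (metricTrace β T) = metricTrace β fun a b => L (T a b) := by
  simp only [metricTrace, map_sum, map_smul]

variable (β : Bil (𝔼 n)) (D : 𝔼 n →L[ℝ] Bil (𝔼 n))

lemma christoffel_add (v w : 𝔼 n) :
    christoffel β D (v + w) = christoffel β D v + christoffel β D w := by
  rw [christoffel, christoffel, christoffel, ← metricTrace_add]
  congr 1
  funext a b
  simp only [map_add, _root_.add_apply]
  ring

lemma christoffel_smul (c : ℝ) (v : 𝔼 n) : christoffel β D (c • v) = c * christoffel β D v := by
  rw [christoffel, christoffel, ← smul_eq_mul, ← metricTrace_smul]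
  congr 1
  funext a b
  simp only [map_smul, _root_.smul_apply, smul_eq_mul]
  ring

variable {β D}

/-- How the contracted Christoffel symbols change with the coordinates; `K` stands for the second
derivative of the change of coordinates and `J` for the first. -/
lemma christoffel_comp {β' : Bil (𝔼 n)} {D' : 𝔼 n →L[ℝ] Bil (𝔼 n)} {J : 𝔼 n →L[ℝ] 𝔼 n}
    {K : 𝔼 n →L[ℝ] 𝔼 n →L[ℝ] 𝔼 n} (hβ : ∀ v w, β v w = β' (J v) (J w))
    (h0 : (gramOf β).det ≠ 0) (hs : ∀ v w, β' v w = β' w v) (hK : ∀ v w, K v w = K w v)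
    (hD : ∀ a v w, D a v w = D' (J a) (J v) (J w) + β' (K a v) (J w) + β' (J v) (K a w)) (v : 𝔼 n) :
    christoffel β D v = christoffel β' D' (J v) + β' (metricTrace β fun a b => K a b) (J v) := by
  have hsβ v w : β v w = β w v := by rw [hβ, hβ, hs]
  have e1 : christoffel β' D' (J v) =
      metricTrace β fun a b => D' (J a) (J b) (J v) - (1 / 2) * D' (J v) (J a) (J b) := by
    rw [christoffel]
    exact (metricTrace_comp hβ h0 (LinearMap.mk₂ ℝ
      (fun a b => D' a b (J v) - (1 / 2) * D' (J v) a b)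
      (fun a a' b => by simp only [map_add, _root_.add_apply]; ring)
      (fun c a b => by simp only [map_smul, _root_.smul_apply, smul_eq_mul]; ring)
      (fun a b b' => by simp only [map_add, _root_.add_apply]; ring)
      (fun c a b => by simp only [map_smul, _root_.smul_apply, smul_eq_mul]; ring))).symm
  have e2 : β' (metricTrace β fun a b => K a b) (J v) = metricTrace β fun a b => β' (K a b) (J v) :=
    map_metricTrace (β'.flip (J v)) β fun a b => K a b
  -- the terms with `K a v` cancel
  have e3 : (metricTrace β fun a b => (1 / 2 : ℝ) • β' (K v a) (J b)) =
      metricTrace β fun a b => (1 / 2 : ℝ) • β' (K v b) (J a) :=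
    (metricTrace_swap hsβ fun a b => (1 / 2 : ℝ) • β' (K v a) (J b)).symm
  have e4 : christoffel β D v = (metricTrace β fun a b =>
      (D' (J a) (J b) (J v) - (1 / 2) * D' (J v) (J a) (J b)) + β' (K a b) (J v)) +
      ((metricTrace β fun a b => (1 / 2 : ℝ) • β' (K v a) (J b)) +
        (-1 : ℝ) • metricTrace β fun a b => (1 / 2 : ℝ) • β' (K v b) (J a)) := by
    rw [christoffel, ← metricTrace_smul, ← metricTrace_add, ← metricTrace_add]
    congr 1
    funext a b
    rw [hD, hD, hs (J b) (K a v), hK a v, hs (J a) (K v b)]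
    simp only [smul_eq_mul]
    ring
  rw [e4, e3, metricTrace_add, e1, e2]
  simp

/-- The Laplace operator of the coordinate functions does not depend on the coordinates in which
it is computed. -/
lemma laplaceDrift_comp {β' : Bil (𝔼 n)} {D' : 𝔼 n →L[ℝ] Bil (𝔼 n)} {J : 𝔼 n →L[ℝ] 𝔼 n}
    {K : 𝔼 n →L[ℝ] 𝔼 n →L[ℝ] 𝔼 n} (hβ : ∀ v w, β v w = β' (J v) (J w)) (h0 : (gramOf β).det ≠ 0)
    (h0' : (gramOf β').det ≠ 0) (hs : ∀ v w, β' v w = β' w v) (hK : ∀ v w, K v w = K w v)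
    (hD : ∀ a v w, D a v w = D' (J a) (J v) (J w) + β' (K a v) (J w) + β' (J v) (K a w)) :
    metricTrace β (fun a b => K a b) + J (laplaceDrift β D) = laplaceDrift β' D' := by
  set h := metricTrace β (fun a b => K a b)
  have e1 : J (laplaceDrift β D) =
      -metricTrace β fun a b => (christoffel β' D' (J b) + β' (J b) h) • J a := by
    rw [laplaceDrift, map_neg, map_metricTrace]
    congr 2
    funext a b
    rw [map_smul, christoffel_comp hβ h0 hs hK hD, hs _ (J b)]
  have e2 := metricTrace_comp hβ h0 (LinearMap.mk₂ ℝ (fun a b => (christoffel β' D' b + β' b h) • a)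
      (fun a a' b => by simp only [smul_add])
      (fun c a b => by rw [smul_comm])
      (fun a b b' => by rw [christoffel_add, map_add, _root_.add_apply, ← add_smul]; ring_nf)
      (fun c a b => by
        rw [christoffel_smul, map_smul, _root_.smul_apply, smul_eq_mul, ← mul_add, mul_smul]))
  simp only [LinearMap.mk₂_apply] at e2
  rw [e1, e2]
  simp only [add_smul]
  rw [metricTrace_add, metricTrace_smul_right h0', laplaceDrift]
  abel

lemma fderiv_form_apply {β : 𝔼 n → Bil (𝔼 n)} {z : 𝔼 n} (hβ : DifferentiableAt ℝ β z) (v a b : 𝔼 n)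
    : fderiv ℝ (fun z => β z a b) z v = fderiv ℝ β z v a b := by
  rw [((hβ.hasFDerivAt.clm_apply (hasFDerivAt_const a z)).clm_apply (hasFDerivAt_const b z)).fderiv]
  simp

lemma sum_mul_sum_mul (P : Mat n) (d : Fin n → Fin n → Fin n → ℝ) (w : Fin n → ℝ) :
    (∑ i, ∑ j, (∑ a, ∑ b, P i a * d i a b * P b j) * w j) = ∑ b, ∑ j, P b j *
    ((∑ i, ∑ a, P i a * d i a b) * w j) := by
  simp only [sum_mul, mul_sum]
  calc _ = ∑ q : (Fin n × Fin n) × (Fin n × Fin n), P q.1.1 q.2.1 *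
        d q.1.1 q.2.1 q.2.2 * P q.2.2 q.1.2 * w q.1.2 := by
        simp only [Fintype.sum_prod_type]
    _ = ∑ q : (Fin n × Fin n) × (Fin n × Fin n), P q.2.1 q.2.2 *
        d q.2.1 q.2.2 q.1.1 * P q.1.1 q.1.2 * w q.1.2 :=
        Fintype.sum_equiv ⟨fun q => ((q.2.2, q.1.2), (q.1.1, q.2.1)),
          fun q => ((q.2.1, q.1.2), (q.2.2, q.1.1)), fun q => rfl, fun q => rfl⟩ _ _ fun q => rfl
    _ = _ := by
        simp only [Fintype.sum_prod_type]
        exact sum_congr rfl fun b _ => sum_congr rfl fun j _ =>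
          sum_congr rfl fun i _ => sum_congr rfl fun a _ => by ring

/-- The Laplace–Beltrami expression in terms of Christoffel symbols. -/
lemma laplace_expand {β : 𝔼 n → Bil (𝔼 n)} {z : 𝔼 n}
    (hβ : ContDiffAt ℝ 1 β z) (hs : ∀ᶠ z' in 𝓝 z, ∀ v w, β z' v w = β z' w v)
    (hdet : 0 < (gramOf (β z)).det) {w : 𝔼 n → ℝ} (hw : ContDiffAt ℝ 2 w z) :
    (Real.sqrt (gramOf (β z)).det)⁻¹ * ∑ i, fderiv ℝ (fun z' => Real.sqrt (gramOf (β z')).det *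
        ∑ j, (gramOf (β z'))⁻¹ i j * fderiv ℝ w z' (single j 1)) z (single i 1) =
      metricTrace (β z) (fun a b => D² w z a b) +
        fderiv ℝ w z (laplaceDrift (β z) (fderiv ℝ β z)) := by
  have hβd := hβ.diffAt
  set D := fderiv ℝ β z with hD
  set P := (gramOf (β z))⁻¹ with hP
  have hDs v a b : D v a b = D v b a := by
    rw [hD, ← fderiv_form_apply hβd, ← fderiv_form_apply hβd]
    exact congrArg (fun L : 𝔼 n →L[ℝ] ℝ => L v) (Filter.EventuallyEq.fderiv_eq (hs.mono fun z' h => h a b))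
  have hG i j : ContDiffAt ℝ 1 (fun z => gramOf (β z) i j) z :=
    (hβ.clm_apply contDiffAt_const).clm_apply contDiffAt_const
  have hGd i j : DifferentiableAt ℝ (fun z => gramOf (β z) i j) z := (hG i j).diffAt
  have hGf i j v : fderiv ℝ (fun z => gramOf (β z) i j) z v = D v (single i 1) (single j 1) := fderiv_form_apply hβd v _ _
  have hPd i j : DifferentiableAt ℝ (fun z => (gramOf (β z))⁻¹ i j) z :=
    (ContDiffAt.matrix_inv (k := 1) (fun i j => hG i j) hdet.ne' i j).diffAt
  -- `σ` is the density of the volume; its derivative is given by Jacobi's formula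
  set σ := Real.sqrt (gramOf (β z)).det with hσ
  have hσ0 : σ ≠ 0 := (Real.sqrt_pos.2 hdet).ne'
  have hσσ : σ * σ = (gramOf (β z)).det := Real.mul_self_sqrt hdet.le
  have hsq := ((ContDiffAt.matrix_det (k := 1) hG).diffAt).hasFDerivAt.sqrt hdet.ne'
  rw [← hσ] at hsq
  have hJac := fderiv_det hGd hdet.ne'
  rw [← hσσ] at hJac
  have hwd (j : Fin n) : HasFDerivAt (fun z' => fderiv ℝ w z' (single j 1))
      ((D² w z).flip (single j 1)) z := by
    have := hw.diffAt_fderiv.hasFDerivAt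
    refine (this.clm_apply (hasFDerivAt_const (single j (1 : ℝ)) z)).congr_fderiv ?_
    ext v
    simp
  have hder (i : Fin n) : fderiv ℝ (fun z' => Real.sqrt (gramOf (β z')).det *
        ∑ j, (gramOf (β z'))⁻¹ i j * fderiv ℝ w z' (single j 1)) z (single i 1) =
      σ * ((∑ j, (P i j * D² w z (single i 1)
          (single j 1) + fderiv ℝ (fun z => (gramOf (β z))⁻¹ i j) z
          (single i 1) * fderiv ℝ w z (single j 1))) +
        (1 / 2) * (∑ a, ∑ b, P a b * D (single i 1) (single b 1) (single a 1)) *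
          ∑ j, P i j * fderiv ℝ w z (single j 1)) := by
    have h := hsq.fun_mul (HasFDerivAt.fun_sum (u := Finset.univ)
      fun j _ => (hPd i j).hasFDerivAt.fun_mul (hwd j))
    rw [h.fderiv]
    simp only [_root_.add_apply, _root_.smul_apply, _root_.sum_apply, smul_eq_mul,
      ContinuousLinearMap.flip_apply, hJac, hGf, ← hP]
    rw [mul_add]
    congr 1
    · congr 1
      exact sum_congr rfl fun j _ => by ring
    · field_simp
  rw [sum_congr rfl fun i _ => hder i, ← mul_sum, ← mul_assoc, inv_mul_cancel₀ hσ0, one_mul]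
  simp only [sum_add_distrib, add_assoc]
  congr 1
  -- the terms with first derivatives
  have hchr (b : Fin n) : christoffel (β z) D (single b 1) =
      (∑ i, ∑ a, P i a * D (single i 1) (single a 1) (single b 1)) - (1 / 2) * ∑ a, ∑ c, P a c *
        D (single b 1) (single c 1) (single a 1) := by
    simp only [christoffel, metricTrace, ← hP, smul_eq_mul, mul_sum, ← Finset.sum_sub_distrib]
    refine sum_congr rfl fun i _ => sum_congr rfl fun a _ => ?_
    rw [hDs (single b 1) (single a 1)]
    ring
  have hPs : ∀ i j, P i j = P j i := gramOf_inv_symm hs.self_of_nhds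
  have hlhs : fderiv ℝ w z (laplaceDrift (β z) D) = -∑ i, ∑ j,
      P i j * (christoffel (β z) D (single i 1) * fderiv ℝ w z (single j 1)) := by
    rw [laplaceDrift, map_neg, map_metricTrace, metricTrace, sum_comm]
    congr 1
    refine sum_congr rfl fun i _ => sum_congr rfl fun j _ => ?_
    rw [map_smul, smul_eq_mul, smul_eq_mul, ← hP, hPs]
  have hinv (i j : Fin n) : fderiv ℝ (fun z => (gramOf (β z))⁻¹ i j) z (single i 1) =
      -∑ a, ∑ b, P i a * D (single i 1) (single a 1) (single b 1) * P b j := by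
    rw [fderiv_matrix_inv hG hdet.ne']
    simp only [hGf, ← hP]
  have h1 : (∑ i : Fin n, ∑ j : Fin n, fderiv ℝ (fun z => (gramOf (β z))⁻¹ i j) z
      (single i 1) * fderiv ℝ w z (single j 1)) =
      -∑ b : Fin n, ∑ j : Fin n, P b j * ((∑ i, ∑ a, P i a * D (single i 1)
        (single a 1) (single b 1)) *
        fderiv ℝ w z (single j 1)) := by
    simp only [hinv, neg_mul, sum_neg_distrib]
    congr 1
    exact sum_mul_sum_mul P (fun i a b => D (single i 1) (single a 1)
      (single b 1)) fun j => fderiv ℝ w z (single j 1)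
  have h2 : (∑ i : Fin n, (1 / 2) * (∑ a, ∑ b, P a b * D (single i 1) (single b 1) (single a 1)) *
          ∑ j, P i j * fderiv ℝ w z (single j 1)) =
      ∑ i : Fin n, ∑ j : Fin n, P i j * ((1 / 2) * (∑ a, ∑ b, P a b * D (single i 1)
      (single b 1) (single a 1)) * fderiv ℝ w z (single j 1)) := by
    refine sum_congr rfl fun i _ => ?_
    rw [mul_sum]
    exact sum_congr rfl fun j _ => by ring
  rw [h1, h2, hlhs, ← sum_neg_distrib, ← sum_neg_distrib, ← sum_add_distrib]
  refine sum_congr rfl fun i _ => ?_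
  rw [← sum_neg_distrib, ← sum_neg_distrib, ← sum_add_distrib]
  refine sum_congr rfl fun j _ => ?_
  rw [hchr]
  ring

end Forms

/-! ### The Laplace–Beltrami operator -/

section Laplace

variable {n : ℕ} {X : Type*} [TopologicalSpace X] [ChartedSpace 𝔼 n X]

/-- The derivative of the inverse of the chart around `c`, read in the coordinates that identify each
tangent space of `X` with the model space. -/
def chartFrame (c : X) (z : 𝔼 n) : 𝔼 n →L[ℝ] 𝔼 n := mfderiv 𝓘(ℝ, 𝔼 n) (𝓡 n) (chart n c).symm z

/-- A field of bilinear forms on the tangent spaces of `X`, in the chart around `c`. -/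
def chartForm (g : ∀ x : X, TangentSpace (𝓡 n) x →L[ℝ] TangentSpace (𝓡 n) x →L[ℝ] ℝ) (c : X)
    (z : 𝔼 n) : Bil (𝔼 n) :=
  let β : Bil (𝔼 n) := g ((chart n c).symm z)
  β.bilinearComp (chartFrame c z) (chartFrame c z)

lemma form_eq_sum (β : Bil (𝔼 n)) : β = ∑ i, ∑ j, β (single i 1) (single j 1) •
    (proj i : 𝔼 n →L[ℝ] ℝ).smulRight (proj j : 𝔼 n →L[ℝ] ℝ) := by
  apply ContinuousLinearMap.ext; intro v
  apply ContinuousLinearMap.ext; intro w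
  conv_lhs => rw [sum_smul_single v, sum_smul_single w]
  simp only [map_sum, map_smul, _root_.sum_apply, _root_.smul_apply, smul_eq_mul,
    ContinuousLinearMap.smulRight_apply, mul_sum]
  rw [sum_comm]
  refine sum_congr rfl fun i _ => sum_congr rfl fun j _ => ?_
  have e : ∀ (k : Fin n) (u : 𝔼 n), (proj k : 𝔼 n →L[ℝ] ℝ) u = u k := fun _ _ => rfl
  rw [e, e]
  ring

lemma ContDiffAt.smul_const_fun {E G : Type*} [NormedAddCommGroup E] [NormedSpace ℝ E]
    [NormedAddCommGroup G] [NormedSpace ℝ G] {f : E → ℝ} {z : E} (hf : ContDiffAt ℝ ∞ f z) (c : G) :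
    ContDiffAt ℝ ∞ (fun z => f z • c) z :=
  hf.smul contDiffAt_const

lemma ContDiffAt.fderiv_form_apply {E : Type*} [NormedAddCommGroup E] [NormedSpace ℝ E]
    {β : E → E →L[ℝ] E →L[ℝ] ℝ} {z : E} (hβ : ContDiffAt ℝ ∞ β z) (a b c : E) :
    ContDiffAt ℝ ∞ (fun z => fderiv ℝ β z a b c) z :=
  (((hβ.fderiv_right (m := ∞) (by simp)).clm_apply contDiffAt_const).clm_apply
    contDiffAt_const).clm_apply contDiffAt_const

lemma ContMDiffAt.smul_const_fun {G : Type*} [NormedAddCommGroup G] [NormedSpace ℝ G] {f : X → ℝ}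
    {x : X} (hf : SmoothAt n f x) (c : G) : SmAt (𝓡 n) 𝓘(ℝ, G) (fun x => f x • c) x :=
  hf.smul contMDiffAt_const

variable [IsManifold (𝓡 n) ∞ X]

/-- An operator with smooth coefficients. -/
def DiffusionOp.IsSmooth (𝒟 : DiffusionOp n X) : Prop :=
  ∀ (x : X) (w : X → ℝ), (∀ᶠ x' in 𝓝 x, SmoothAt n w x') → SmoothAt n (𝒟.op w) x

lemma chartFrame_eq {c x : X} (hx : x ∈ (chart n c).source) : chartFrame c (chart n c x) =
    (𝕋 n c).symmL ℝ x := by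
  rw [TangentBundle.symmL_trivializationAt (by simpa using hx), ModelWithCorners.range_eq_univ,
    mfderivWithin_univ]
  rfl

variable (g : Bundle.ContMDiffRiemannianMetric (𝓡 n) ∞ 𝔼 n (fun x : X => TangentSpace (𝓡 n) x))

/-- The metric at a point as a bilinear form on the model space. -/
def metricAt (x : X) : Bil (𝔼 n) := g.inner x

lemma chartForm_apply (c : X) (z v w : 𝔼 n) : chartForm g.inner c z v w =
    metricAt g ((chart n c).symm z) (chartFrame c z v) (chartFrame c z w) := rfl

lemma contMDiffAt_metricAt_chartFrame {c x : X} (hx : x ∈ (chart n c).source) (v w : 𝔼 n) : SmoothAt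
    n (fun x' => metricAt g x' (chartFrame c (chart n c x') v) (chartFrame c (chart n c x') w)) x := by
  have : IsManifold (𝓡 n) (∞ + 1) X := by simpa using ‹IsManifold (𝓡 n) ∞ X›
  have hxb : x ∈ (𝕋 n c).baseSet := by simpa using hx
  have hs (v : 𝔼 n) : SmAt (𝓡 n) ((𝓡 n).prod 𝓘(ℝ, 𝔼 n)) (fun x' =>
      Bundle.TotalSpace.mk' 𝔼 n (E := fun x : X => TangentSpace (𝓡 n) x) x'
        ((𝕋 n c).symmL ℝ x' v)) x := by
    rw [Bundle.Trivialization.contMDiffAt_section_iff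
      (𝕋 n c) hxb]
    refine (contMDiffAt_const (c := v)).congr_of_eventuallyEq ?_
    filter_upwards [(𝕋 n c).open_baseSet.mem_nhds hxb]
      with x' hx'
    rw [Bundle.Trivialization.symmL_apply _ hx']
    exact congrArg Prod.snd (Bundle.Trivialization.apply_mk_symm _ hx' v)
  have := ContMDiffAt.clm_bundle_apply₂ (F₁ := 𝔼 n) (F₂ := 𝔼 n) (F₃ := ℝ)
    (E₃ := Bundle.Trivial X ℝ) (g.contMDiff x) (hs v) (hs w)
  simp only [Bundle.contMDiffAt_totalSpace] at this
  refine this.2.congr_of_eventuallyEq ?_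
  filter_upwards [(isOpen_extChartAt_source c).mem_nhds hx] with x' hx'
  rw [chartFrame_eq hx']
  rfl

lemma contDiffAt_chartForm {c x : X} (hx : x ∈ (chart n c).source) :
    ContDiffAt ℝ ∞ (chartForm g.inner c) (chart n c x) := by
  have h1 (v w : 𝔼 n) : ContDiffAt ℝ ∞ (fun z => chartForm g.inner c z v w) (chart n c x) := by
    refine ((contMDiffAt_metricAt_chartFrame g hx v w).contDiffAt_comp_extChartAt_symm
      hx).congr_of_eventuallyEq ?_
    filter_upwards [(isOpen_extChartAt_target c).mem_nhds ((chart n c).map_source hx)] with z hz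
    simp only [Function.comp, (chart n c).right_inv hz]
    rfl
  have h2 : chartForm g.inner c = fun z => ∑ i, ∑ j, chartForm g.inner c z
      (single i 1) (single j 1) •
      (proj i : 𝔼 n →L[ℝ] ℝ).smulRight (proj j : 𝔼 n →L[ℝ] ℝ) :=
    funext fun z => form_eq_sum _
  rw [h2]
  exact ContDiffAt.sum fun i _ => ContDiffAt.sum fun j _ => (h1 _ _).smul_const_fun _

lemma chartForm_symm (c : X) (z v w : 𝔼 n) :
    chartForm g.inner c z v w = chartForm g.inner c z w v := by
  have h (p : X) (u u' : 𝔼 n) : metricAt g p u u' = metricAt g p u' u := g.symm p u u'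
  rw [chartForm_apply, chartForm_apply, h]

lemma posDef_gramOf_chartForm {c x : X} (hx : x ∈ (chart n c).source) :
    (gramOf (chartForm g.inner c (chart n c x))).PosDef := by
  have hxb : x ∈ (𝕋 n c).baseSet := by simpa using hx
  refine Matrix.PosDef.of_dotProduct_mulVec_pos ?_ ?_
  · ext i j
    exact chartForm_symm g _ _ _ _
  · intro v hv
    set V : 𝔼 n := WithLp.toLp 2 v with hV
    have h1 : star v ⬝ᵥ (gramOf (chartForm g.inner c (chart n c x))).mulVec v =
        chartForm g.inner c (chart n c x) V V := by
      conv_rhs => rw [sum_smul_single V]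
      simp only [map_sum, map_smul, _root_.sum_apply, _root_.smul_apply, smul_eq_mul,
        dotProduct, Matrix.mulVec, gramOf, Matrix.of_apply, star_trivial, mul_sum]
      rw [sum_comm]
      exact sum_congr rfl fun i _ => sum_congr rfl fun j _ => by simp only [hV]; ring
    rw [h1, chartForm_apply]
    have hpos (p : X) (u : 𝔼 n) : u ≠ 0 → 0 < metricAt g p u u := fun hu => g.pos p u hu
    refine hpos _ _ fun h0 => hv ?_
    rw [chartFrame_eq hx] at h0
    have h3 : V = 0 := ((𝕋 n c).continuousLinearMapAt_symmL
      (R := ℝ) hxb V).symm.trans ((congrArg ((𝕋 n c).continuousLinearMapAt ℝ x) h0).trans (map_zero _))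
    ext i
    exact congrArg (fun u : 𝔼 n => u i) h3

/-- The change of the metric under a change of charts. -/
lemma chartForm_comp {c c' z : _} (hz : z ∈ (chart n (c : X)).target)
    (hz' : (chart n c).symm z ∈ (chart n c').source) (v w : 𝔼 n) : chartForm g.inner c z v w =
    chartForm g.inner c' (chart n c' ((chart n c).symm z))
    (fderiv ℝ (chart n c' ∘ (chart n c).symm) z v) (fderiv ℝ (chart n c' ∘ (chart n c).symm) z w) := by
  set x := (chart n c).symm z
  have e : (chart n c).symm =ᶠ[𝓝 z] (chart n c').symm ∘ (chart n c' ∘ (chart n c).symm) := by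
    have hc : ContinuousAt (chart n c).symm z := (continuousAt_extChartAt_symm'' (I := 𝓡 n) hz)
    filter_upwards [hc.eventually ((isOpen_extChartAt_source c').mem_nhds hz')] with z' h
    simp only [Function.comp, (chart n c').left_inv h]
  have d1 : MDifferentiableAt 𝓘(ℝ, 𝔼 n) 𝓘(ℝ, 𝔼 n) (chart n c' ∘ (chart n c).symm) z := by
    have := (contMDiffAt_extChartAt_of_mem (I := 𝓡 n) hz').contDiffAt_comp_extChartAt_symm
        ((chart n c).map_target hz)
    rw [(chart n c).right_inv hz] at this
    exact this.diffAt.mdifferentiableAt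
  have h1 : chartFrame c z = (chartFrame c' (chart n c' x)).comp
      (fderiv ℝ (chart n c' ∘ (chart n c).symm) z) := by
    rw [chartFrame, e.mfderiv_eq, mfderiv_comp z
        ((contMDiffAt_extChartAt_symm_apply (I := 𝓡 n) hz').mdiffAt) d1, mfderiv_eq_fderiv]
    rfl
  rw [chartForm_apply, chartForm_apply, h1, (chart n c').left_inv hz']
  rfl

/-- The Laplace–Beltrami operator. -/
def laplaceOp : DiffusionOp n X where
  mat x := (gramOf (chartForm g.inner x (chart n x x)))⁻¹
  drift x := laplaceDrift (chartForm g.inner x (chart n x x))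
    (fderiv ℝ (chartForm g.inner x) (chart n x x))
  posDef x := (posDef_gramOf_chartForm g (mem_extChartAt_source x)).inv

lemma DiffusionOp.sum_drift {H : Type*} [NormedAddCommGroup H] [NormedSpace ℝ H] (d : 𝔼 n)
    (w : X → H) (x : X) : ∑ i, d i • pd₁ w x i = fderiv ℝ (w ∘ (chart n x).symm) (chart n x x) d := by
  conv_rhs => rw [sum_smul_single d]
  simp only [map_sum, map_smul, pd₁]

lemma laplaceOp_op {H : Type*} [NormedAddCommGroup H] [NormedSpace ℝ H] (w : X → H) (x : X) :
    (laplaceOp g).op w x = metricTrace (chartForm g.inner x (chart n x x))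
      (fun a b => D² (w ∘ (chart n x).symm) (chart n x x) a b) +
      fderiv ℝ (w ∘ (chart n x).symm) (chart n x x)
        (laplaceDrift (chartForm g.inner x (chart n x x))
          (fderiv ℝ (chartForm g.inner x) (chart n x x))) := by
  rw [← DiffusionOp.sum_drift]
  rfl

lemma laplaceBeltrami_eq {w : X → ℝ} {x : X} (hw : SmoothAt n w x) :
    laplaceBeltrami g.inner w x = (laplaceOp g).op w x := by
  rw [laplaceOp_op, ← laplace_expand ((contDiffAt_chartForm g (mem_extChartAt_source x)).of_le
    (m := 1) (by simp)) (.of_forall fun z => chartForm_symm g x z)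
    (posDef_gramOf_chartForm g (mem_extChartAt_source x)).det_pos hw.contDiffAt_two]
  rfl

/-- The Laplace–Beltrami operator in an arbitrary chart. -/
lemma laplaceOp_op_chart {c x : X} (hx : x ∈ (chart n c).source) {w : X → ℝ} (hw : SmoothAt n w x) :
    (laplaceOp g).op w x = metricTrace (chartForm g.inner c (chart n c x))
      (fun a b => D² (w ∘ (chart n c).symm) (chart n c x) a b) +
      fderiv ℝ (w ∘ (chart n c).symm) (chart n c x)
        (laplaceDrift (chartForm g.inner c (chart n c x))
          (fderiv ℝ (chartForm g.inner c) (chart n c x))) := by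
  set ψ := chart n c ∘ (chart n x).symm
  set z := chart n x x with hz
  have hφ := contMDiffAt_extChartAt_of_mem (I := 𝓡 n) hx
  have hψ2 : ContDiffAt ℝ 2 ψ z := hφ.contDiffAt_two
  have hψz : ψ z = chart n c x := comp_symm_apply_self _ _
  have hzt : z ∈ (chart n x).target := mem_extChartAt_target x
  have hβ v w : chartForm g.inner x z v w =
      chartForm g.inner c (chart n c x) (fderiv ℝ ψ z v) (fderiv ℝ ψ z w) := by
    rw [chartForm_comp g hzt (by rwa [hz, extChartAt_to_inv]) v w, hz, extChartAt_to_inv]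
  have hβev : ∀ᶠ z' in 𝓝 z, ∀ v w, chartForm g.inner x z' v w =
      chartForm g.inner c (ψ z') (fderiv ℝ ψ z' v) (fderiv ℝ ψ z' w) := by
    have hc : ContinuousAt (chart n x).symm z := continuousAt_extChartAt_symm x
    filter_upwards [(isOpen_extChartAt_target x).mem_nhds hzt, hc.eventually
      ((isOpen_extChartAt_source c).mem_nhds (by rwa [hz, extChartAt_to_inv]))] with z' h1 h2 v w
    exact chartForm_comp g h1 h2 v w
  have hβd := (contDiffAt_chartForm g (mem_extChartAt_source x)).diffAt
  have hβd' := (contDiffAt_chartForm g hx).diffAt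
  have hψd := hψ2.diffAt
  have hψd' := hψ2.diffAt_fderiv
  -- differentiate the transformation law of the metric
  have hD a v w : fderiv ℝ (chartForm g.inner x) z a v w =
      fderiv ℝ (chartForm g.inner c) (chart n c x) (fderiv ℝ ψ z a) (fderiv ℝ ψ z v)
        (fderiv ℝ ψ z w) +
      chartForm g.inner c (chart n c x) (D² ψ z a v) (fderiv ℝ ψ z w) +
      chartForm g.inner c (chart n c x) (fderiv ℝ ψ z v) (D² ψ z a w) := by
    have h0 : (fun z' => chartForm g.inner x z' v w)
      =ᶠ[𝓝 z] fun z' => chartForm g.inner c (ψ z') (fderiv ℝ ψ z' v) (fderiv ℝ ψ z' w) :=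
      hβev.mono fun z' h => h v w
    rw [← fderiv_form_apply hβd, h0.fderiv_eq]
    rw [← hψz] at hβd' ⊢
    have h1 := hβd'.hasFDerivAt.comp z hψd.hasFDerivAt
    have h2 := (h1.clm_apply (hψd'.hasFDerivAt.clm_apply (hasFDerivAt_const v z))).clm_apply
      (hψd'.hasFDerivAt.clm_apply (hasFDerivAt_const w z))
    refine Eq.trans (congrArg (fun L : 𝔼 n →L[ℝ] ℝ => L a) h2.fderiv) ?_
    simp
    ring
  have h0 := (posDef_gramOf_chartForm g (mem_extChartAt_source x)).det_pos.ne'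
  have hdrift := laplaceDrift_comp hβ h0
      ((posDef_gramOf_chartForm g hx).det_pos.ne') (chartForm_symm g c _)
    (fun v w => hψ2.fderiv_fderiv_symm v w) hD
  have hop : (laplaceOp g).op (chart n c) x = laplaceDrift (chartForm g.inner c (chart n c x))
          (fderiv ℝ (chartForm g.inner c) (chart n c x)) := by
    rw [laplaceOp_op, ← hdrift]
  have htr := metricTrace_comp hβ h0 (LinearMap.mk₂ ℝ
    (fun a b => D² (w ∘ (chart n c).symm) (chart n c x) a b)
    (fun a a' b => by simp) (fun c a b => by simp) (fun a b b' => by simp) (fun c a b => by simp))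
  simp only [LinearMap.mk₂_apply] at htr
  rw [← (laplaceOp g).op_congr (comp_extChartAt_symm_comp_eventuallyEq (I := 𝓡 n) w hx),
    (laplaceOp g).op_comp hφ
        ((hw.contDiffAt_comp_extChartAt_symm hx).of_le two_le_infty), hop, ← htr]
  rfl

lemma isSmooth_laplaceOp : (laplaceOp g).IsSmooth := by
  intro x w hw
  set G : 𝔼 n → ℝ := fun z => metricTrace (chartForm g.inner x z)
      (fun a b => D² (w ∘ (chart n x).symm) z a b) +
      fderiv ℝ (w ∘ (chart n x).symm) z
        (laplaceDrift (chartForm g.inner x z) (fderiv ℝ (chartForm g.inner x) z))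
  have hx := mem_extChartAt_source (I := 𝓡 n) x
  have hβ := contDiffAt_chartForm g hx
  have hβ' := fun a b c => hβ.fderiv_form_apply a b c
  have hh' : ContDiffAt ℝ ∞ (fderiv ℝ (w ∘ (chart n x).symm)) (chart n x x) :=
    (hw.self_of_nhds.contDiffAt_comp_extChartAt_symm hx).fderiv_right (by simp)
  have hP : ∀ i j, ContDiffAt ℝ ∞ (fun z => (gramOf (chartForm g.inner x z))⁻¹ i j)
      (chart n x x) := ContDiffAt.matrix_inv (k := ⊤)
    (fun i j => (hβ.clm_apply contDiffAt_const).clm_apply contDiffAt_const)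
    (posDef_gramOf_chartForm g hx).det_pos.ne'
  have htr : ∀ {T : 𝔼 n → 𝔼 n → 𝔼 n → ℝ}, (∀ a b, ContDiffAt ℝ ∞ (fun z => T z a b)
      (chart n x x)) → ContDiffAt ℝ ∞ (fun z => metricTrace (chartForm g.inner x z) (T z))
      (chart n x x) := fun hT =>
    ContDiffAt.sum fun i _ => ContDiffAt.sum fun j _ => (hP i j).smul (hT _ _)
  have hchr v : ContDiffAt ℝ ∞ (fun z => christoffel (chartForm g.inner x z)
      (fderiv ℝ (chartForm g.inner x) z) v) (chart n x x) :=
    htr fun a b => ContDiffAt.sub (hβ' _ _ _) (contDiffAt_const.mul (hβ' _ _ _))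
  have hdr : ContDiffAt ℝ ∞ (fun z => laplaceDrift (chartForm g.inner x z)
      (fderiv ℝ (chartForm g.inner x) z)) (chart n x x) :=
    ContDiffAt.neg (ContDiffAt.sum fun i _ => ContDiffAt.sum fun j _ =>
      (hP i j).smul ((hchr _).smul contDiffAt_const))
  have hGs : ContDiffAt ℝ ∞ G (chart n x x) :=
    (htr fun a b =>
        ((hh'.fderiv_right (by simp)).clm_apply contDiffAt_const).clm_apply contDiffAt_const).add
      (hh'.clm_apply hdr)
  refine (hGs.contMDiffAt_comp_extChartAt hx).congr_of_eventuallyEq ?_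
  filter_upwards [(isOpen_extChartAt_source x).mem_nhds hx, hw] with x' h1 h2
  exact laplaceOp_op_chart g h1 h2

end Laplace

/-! ### Reaction-diffusion equations and operators with smooth coefficients -/

section ReactionDiffusionForm

variable {n : ℕ} {X : Type*} [TopologicalSpace X] [ChartedSpace 𝔼 n X] [IsManifold (𝓡 n) ∞ X]

lemma trivializationAt_snd {c x : X} (v : 𝔼 n) :
    (𝕋 n c ⟨x, v⟩).2 = fderiv ℝ (chart n c ∘ (chart n x).symm)
    (chart n x x) v := by
  rw [TangentBundle.trivializationAt_apply, ModelWithCorners.range_eq_univ, fderivWithin_univ]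
  rfl

lemma fderiv_chartFrame {c x : X} (hx : x ∈ (chart n c).source) (v : 𝔼 n) :
    fderiv ℝ (chart n c ∘ (chart n x).symm) (chart n x x) (chartFrame c (chart n c x) v) = v := by
  have hxb : x ∈ (𝕋 n c).baseSet := by simpa using hx
  rw [← trivializationAt_snd, chartFrame_eq hx]
  have h := (𝕋 n c).continuousLinearMapAt_symmL (R := ℝ) hxb v
  rwa [Bundle.Trivialization.continuousLinearMapAt_apply_of_mem _ _ hxb] at h

/-- The derivative along a smooth vector field is smooth. -/
lemma contMDiffAt_fderiv_section {η : ∀ x : X, TangentSpace (𝓡 n) x}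
    (hη : ContMDiff (𝓡 n) (𝓡 n).tangent ∞ (fun x => (⟨x, η x⟩ : TangentBundle (𝓡 n) X))) {x : X}
    {w : X → ℝ} (hw : ∀ᶠ x' in 𝓝 x, SmoothAt n w x') :
    SmoothAt n (fun x' => fderiv ℝ (w ∘ (chart n x').symm) (chart n x' x') (η x' : 𝔼 n)) x := by
  have h1 := (Bundle.contMDiffAt_section (IB := 𝓡 n) (n := ∞) (F := 𝔼 n)
    (E := fun x : X => TangentSpace (𝓡 n) x) (s := η) x).1 (hη x)
  have hx := mem_extChartAt_source (I := 𝓡 n) x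
  have h2 : ContDiffAt ℝ ∞ (fderiv ℝ (w ∘ (chart n x).symm)) (chart n x x) :=
    (hw.self_of_nhds.contDiffAt_comp_extChartAt_symm hx).fderiv_right (by simp)
  refine ((h2.contMDiffAt_comp_extChartAt hx).clm_apply h1).congr_of_eventuallyEq ?_
  filter_upwards [(isOpen_extChartAt_source x).mem_nhds hx, hw] with x' hx' hw'
  rw [trivializationAt_snd (c := x) (η x')]
  have hd := (hw'.contDiffAt_comp_extChartAt_symm hx').diffAt
  have hz : (chart n x ∘ (chart n x').symm) (chart n x' x') =
    chart n x x' := comp_symm_apply_self _ _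
  rw [← hz] at hd
  have h6 : (w ∘ (chart n x).symm) ∘ (chart n x ∘ (chart n x').symm)
      =ᶠ[𝓝 (chart n x' x')] w ∘ (chart n x').symm := by
    filter_upwards
        [(continuousAt_extChartAt_symm x').eventually ((isOpen_extChartAt_source x).mem_nhds
      (by rwa [extChartAt_to_inv]))] with z' h
    simp only [Function.comp, (chart n x).left_inv h]
  rw [← h6.fderiv_eq,
      fderiv_comp _ hd ((contMDiffAt_extChartAt_of_mem (I := 𝓡 n) hx').contDiffAt_two.diffAt), hz]
  rfl

lemma directionalDeriv_eq {w : X → ℝ} {x : X} (hw : SmoothAt n w x) (η : TangentSpace (𝓡 n) x) :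
    directionalDeriv w x η = fderiv ℝ (w ∘ (chart n x).symm) (chart n x x) (η : 𝔼 n) := by
  rw [directionalDeriv, hw.mfderiv_eq_fderiv_chart]
  rfl

/-- The operator `Δ + η ∇`. -/
def laplaceAddField (g : Bundle.ContMDiffRiemannianMetric (𝓡 n) ∞ 𝔼 n
    (fun x : X => TangentSpace (𝓡 n) x)) (η : ∀ x : X, TangentSpace (𝓡 n) x) : DiffusionOp n X where
  mat := (laplaceOp g).mat
  drift x i := (laplaceOp g).drift x i + (show 𝔼 n from η x) i
  posDef := (laplaceOp g).posDef

lemma laplaceAddField_op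
    (g : Bundle.ContMDiffRiemannianMetric (𝓡 n) ∞ 𝔼 n (fun x : X => TangentSpace (𝓡 n) x))
    (η : ∀ x : X, TangentSpace (𝓡 n) x) (w : X → ℝ) (x : X) : (laplaceAddField g η).op w x =
    (laplaceOp g).op w x + fderiv ℝ (w ∘ (chart n x).symm) (chart n x x) (η x : 𝔼 n) := by
  rw [← DiffusionOp.sum_drift (η x : 𝔼 n) w x]
  simp only [DiffusionOp.op, laplaceAddField, add_smul, sum_add_distrib, add_assoc]

lemma IsReactionDiffusion.exists_form {A : PEq n X} {Ω : Set ℝ} {a : ℝ → ℝ}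
    (hA : IsReactionDiffusion A Ω a) : ∃ (𝒟 : DiffusionOp n X) (q : X → ℝ → ℝ), 𝒟.IsSmooth ∧
    A.HasForm a 𝒟 q ∧ ContinuousOn (fun p : X × ℝ => q p.1 p.2) (univ ×ˢ A.Ω) := by
  obtain ⟨rfl, -, -, g, η, q, hη, hq, hop⟩ := hA
  refine ⟨laplaceAddField g η, q, ?_, ?_, hq⟩
  · intro x w hw
    refine ((isSmooth_laplaceOp g x w hw).add (contMDiffAt_fderiv_section hη hw)).congr_of_eventuallyEq
      (.of_forall fun x' => ?_)
    exact laplaceAddField_op g η w x'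
  · intro t ht x w hw hwx
    rw [hop t ht x w hw hwx, laplaceBeltrami_eq g hw, laplaceAddField_op, directionalDeriv_eq hw]

variable (𝒟 : DiffusionOp n X)

namespace DiffusionOp

variable {𝒟} in
lemma IsSmooth.contMDiffAt_gamma (h𝒟 : 𝒟.IsSmooth) {f h : X → ℝ} {x : X}
    (hf : ∀ᶠ x' in 𝓝 x, SmoothAt n f x') (hh : ∀ᶠ x' in 𝓝 x, SmoothAt n h x') : SmoothAt n
    (𝒟.gamma f h) x := by
  have h1 := h𝒟 x (fun x => f x * h x) (by filter_upwards [hf, hh] with y e1 e2 using e1.mul e2)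
  have h2 : SmoothAt n (fun x => (1 / 2) * (𝒟.op (fun x => f x * h x) x -
      (f x * 𝒟.op h x + h x * 𝒟.op f x))) x :=
    contMDiffAt_const.mul (h1.sub ((hf.self_of_nhds.mul (h𝒟 x h hh)).add
      (hh.self_of_nhds.mul (h𝒟 x f hf))))
  refine h2.congr_of_eventuallyEq ?_
  filter_upwards [hf, hh] with y e1 e2
  rw [𝒟.op_mul e1 e2]
  ring

/-- The principal symbol of the operator in the chart around `c`. -/
def chartMat (c x : X) : Mat n :=
  Matrix.of fun k l => 𝒟.gamma (fun x => chart n c x k) (fun x => chart n c x l) x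

lemma contMDiffAt_extChartAt_coord {c x : X} (hx : x ∈ (chart n c).source) (k : Fin n) :
    SmoothAt n (fun x => chart n c x k) x :=
  ((proj k : 𝔼 n →L[ℝ] ℝ).contDiff.contMDiff.contMDiffAt).comp x (contMDiffAt_extChartAt_of_mem hx)

lemma eventually_contMDiffAt_extChartAt_coord {c x : X} (hx : x ∈ (chart n c).source) (k : Fin n) :
    ∀ᶠ x' in 𝓝 x, SmoothAt n (fun x => chart n c x k) x' := by
  filter_upwards [(isOpen_extChartAt_source c).mem_nhds hx] with x' hx'
  exact contMDiffAt_extChartAt_coord hx' k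

lemma pd₁_extChartAt_coord {c x : X} (hx : x ∈ (chart n c).source) (k i : Fin n) : pd₁
    (fun x => chart n c x k) x i = fderiv ℝ (chart n c ∘ (chart n x).symm) (chart n x x)
    (single i 1) k := by
  have h := pd₁_comp (contMDiffAt_extChartAt_of_mem (I := 𝓡 n) hx) (h := (proj k : 𝔼 n →L[ℝ] ℝ))
    (proj k : 𝔼 n →L[ℝ] ℝ).contDiff.contDiffAt i
  rwa [ContinuousLinearMap.fderiv] at h

lemma chartMat_self (x : X) : 𝒟.chartMat x x = 𝒟.mat x := by
  have h (k i : Fin n) : pd₁ (fun x' => chart n x x' k) x i = if k = i then 1 else 0 := by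
    rw [pd₁_extChartAt_coord (mem_extChartAt_source x)]
    have e : chart n x ∘ (chart n x).symm =ᶠ[𝓝 (chart n x x)] id := by
      filter_upwards [(isOpen_extChartAt_target x).mem_nhds (mem_extChartAt_target x)] with z hz
      exact (chart n x).right_inv hz
    rw [e.fderiv_eq, fderiv_id]
    simp
  ext k l
  simp only [chartMat, gamma, Matrix.of_apply, h]
  simp

/-- The metric whose inverse is the principal symbol of the operator. -/
def metricForm (x : X) : Bil (𝔼 n) := ∑ i, ∑ j, (𝒟.mat x)⁻¹ i j •
      (proj i : 𝔼 n →L[ℝ] ℝ).smulRight (proj j : 𝔼 n →L[ℝ] ℝ)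

lemma metricForm_apply (x : X) (v w : 𝔼 n) :
    𝒟.metricForm x v w = ∑ i, ∑ j, (𝒟.mat x)⁻¹ i j * v i * w j := by
  simp only [metricForm, _root_.sum_apply, _root_.smul_apply, smul_eq_mul,
    ContinuousLinearMap.smulRight_apply]
  refine sum_congr rfl fun i _ => sum_congr rfl fun j _ => ?_
  have e : ∀ (k : Fin n) (u : 𝔼 n), (proj k : 𝔼 n →L[ℝ] ℝ) u = u k := fun _ _ => rfl
  rw [e, e]
  ring

lemma metricForm_symm (x : X) (v w : 𝔼 n) : 𝒟.metricForm x v w = 𝒟.metricForm x w v := by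
  rw [metricForm_apply, metricForm_apply, sum_comm]
  refine sum_congr rfl fun i _ => sum_congr rfl fun j _ => ?_
  have : (𝒟.mat x)⁻¹ j i = (𝒟.mat x)⁻¹ i j := by
    have := congrFun (congrFun (𝒟.posDef x).inv.1 i) j
    simpa using this
  rw [this]; ring

lemma metricForm_pos (x : X) {v : 𝔼 n} (hv : v ≠ 0) : 0 < 𝒟.metricForm x v v := by
  rw [metricForm_apply]
  exact (𝒟.posDef x).inv.sum_pos (v := fun i => v i) fun h => hv (by ext i; exact congrFun h i)

lemma isVonNBounded_metricForm (x : X) :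
    Bornology.IsVonNBounded ℝ {v : 𝔼 n | 𝒟.metricForm x v v < 1} := by
  rw [NormedSpace.isVonNBounded_iff']
  rcases (Metric.sphere (0 : 𝔼 n) 1).eq_empty_or_nonempty with he | hne
  · refine ⟨0, fun v _ => ?_⟩
    by_contra! h
    have : ‖v‖⁻¹ • v ∈ Metric.sphere (0 : 𝔼 n) 1 := by
      rw [mem_sphere_zero_iff_norm, norm_smul, norm_inv, norm_norm, inv_mul_cancel₀ h.ne']
    rwa [he] at this
  · have hc : Continuous fun v : 𝔼 n => 𝒟.metricForm x v v :=
      (𝒟.metricForm x).continuous.clm_apply continuous_id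
    obtain ⟨v0, hv₀, hmin⟩ := (isCompact_sphere (0 : 𝔼 n) 1).exists_isMinOn hne hc.continuousOn
    have hpos : 0 < 𝒟.metricForm x v0 v0 := 𝒟.metricForm_pos x fun h => by
      rw [mem_sphere_zero_iff_norm, h, norm_zero] at hv₀
      exact zero_ne_one hv₀
    refine ⟨(𝒟.metricForm x v0 v0)⁻¹ + 1, fun v hv => ?_⟩
    rcases eq_or_ne v 0 with rfl | hv0
    · rw [norm_zero]; positivity
    have h1 : ‖v‖⁻¹ • v ∈ Metric.sphere (0 : 𝔼 n) 1 := by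
      rw [mem_sphere_zero_iff_norm, norm_smul, norm_inv, norm_norm, inv_mul_cancel₀
          (norm_pos_iff.2 hv0).ne']
    have h2 : 𝒟.metricForm x v0 v0 ≤ 𝒟.metricForm x (‖v‖⁻¹ • v) (‖v‖⁻¹ • v) := hmin h1
    simp only [map_smul, _root_.smul_apply, smul_eq_mul] at h2
    have h3 : 𝒟.metricForm x v0 v0 * ‖v‖ ^ 2 < 1 := by
      have h4 : 𝒟.metricForm x v0 v0 * ‖v‖ ^ 2 ≤ 𝒟.metricForm x v v := by
        calc _ ≤ ‖v‖⁻¹ * (‖v‖⁻¹ * 𝒟.metricForm x v v) * ‖v‖ ^ 2 := by gcongr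
          _ = _ := by field_simp
      exact h4.trans_lt hv
    have h5 : ‖v‖ ^ 2 < (𝒟.metricForm x v0 v0)⁻¹ := by rw [← one_div, lt_div_iff₀ hpos]; linarith
    nlinarith [sq_nonneg (‖v‖ - 1)]

/-- The Gram matrix of the metric in the chart around `c`. -/
lemma metricForm_chartFrame {c x : X} (hx : x ∈ (chart n c).source) (i j : Fin n) : 𝒟.metricForm x
    (chartFrame c (chart n c x) (single i 1)) (chartFrame c (chart n c x) (single j 1)) =
    (𝒟.chartMat c x)⁻¹ i j := by
  set M := 𝒟.mat x with hM
  set L := fderiv ℝ (chart n c ∘ (chart n x).symm) (chart n x x) with hL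
  set R : 𝔼 n →L[ℝ] 𝔼 n := chartFrame c (chart n c x)
  -- `P` and `J` are the Jacobi matrices of the change of charts and of its inverse
  set P : Mat n := Matrix.of fun k i => L (single i 1) k with hP
  set J : Mat n := Matrix.of fun k i => R (single i 1) k with hJ
  have hPJ : P * J = 1 := by
    ext k i
    have h1 : L (R (single i 1)) = single i 1 := fderiv_chartFrame hx _
    rw [sum_smul_single (R _)] at h1
    have h2 := congrArg (fun u : 𝔼 n => u k) h1
    simp only [map_sum, map_smul, WithLp.ofLp_sum, Finset.sum_apply, PiLp.smul_apply,
      smul_eq_mul] at h2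
    rw [Matrix.mul_apply, Matrix.one_apply]
    simp only [hP, hJ, Matrix.of_apply]
    rw [show (if k = i then (1 : ℝ) else 0) = (single i (1 : ℝ) : 𝔼 n) k by simp, ← h2]
    exact sum_congr rfl fun l _ => mul_comm _ _
  have hJP : J * P = 1 := mul_eq_one_comm.1 hPJ
  have hMu : IsUnit M.det := isUnit_iff_ne_zero.2 (𝒟.posDef x).det_pos.ne'
  have hC : 𝒟.chartMat c x = P * M * P.transpose := by
    ext k l
    simp only [chartMat, Matrix.of_apply, gamma, pd₁_extChartAt_coord hx, Matrix.mul_apply,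
      Matrix.transpose_apply, sum_mul]
    rw [sum_comm]
    refine sum_congr rfl fun i _ => sum_congr rfl fun j _ => ?_
    simp only [hP, hL, hM, Matrix.of_apply]
    ring
  have hG : 𝒟.metricForm x (R (single i 1)) (R (single j 1)) = (J.transpose * M⁻¹ * J) i j := by
    rw [metricForm_apply]
    simp only [Matrix.mul_apply, Matrix.transpose_apply, sum_mul]
    rw [sum_comm]
    refine sum_congr rfl fun k _ => sum_congr rfl fun l _ => ?_
    simp only [hJ, hM, Matrix.of_apply]
    ring
  rw [hG, Matrix.inv_eq_left_inv (A := 𝒟.chartMat c x) (B := J.transpose * M⁻¹ * J)]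
  rw [hC]
  calc J.transpose * M⁻¹ * J * (P * M * P.transpose)
      = J.transpose * M⁻¹ * (J * P) * M * P.transpose := by simp only [mul_assoc]
    _ = J.transpose * (M⁻¹ * M) * P.transpose := by rw [hJP, mul_one]; simp only [mul_assoc]
    _ = (P * J).transpose := by rw [Matrix.nonsing_inv_mul _ hMu, mul_one, Matrix.transpose_mul]
    _ = 1 := by rw [hPJ, Matrix.transpose_one]

end DiffusionOp

lemma ContMDiffAt.matrix_inv {G : X → Mat n} {x : X} (hG : ∀ i j, SmoothAt n (fun x => G x i j) x)
    (h0 : (G x).det ≠ 0) (i j : Fin n) : SmoothAt n (fun x => (G x)⁻¹ i j) x := by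
  have hx := mem_extChartAt_source (I := 𝓡 n) x
  have h := ContDiffAt.matrix_inv (k := ⊤) (G := G ∘ (chart n x).symm)
    (fun i j => (hG i j).contDiffAt_comp_extChartAt_symm hx)
    (by rwa [Function.comp, extChartAt_to_inv]) i j
  exact (h.contMDiffAt_comp_extChartAt hx).congr_of_eventuallyEq
    (comp_extChartAt_symm_comp_eventuallyEq (I := 𝓡 n) (fun x => (G x)⁻¹ i j) hx).symm

lemma DiffusionOp.contMDiffAt_metricForm (h𝒟 : 𝒟.IsSmooth) (c : X) :
    ContMDiffAt (𝓡 n) 𝓘(ℝ, Bil (𝔼 n)) ∞ (fun x => ∑ i, ∑ j,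
      (𝒟.chartMat c x)⁻¹ i j • (proj i : 𝔼 n →L[ℝ] ℝ).smulRight (proj j : 𝔼 n →L[ℝ] ℝ)) c := by
  have h1 : ∀ i j, SmoothAt n (fun x => (𝒟.chartMat c x)⁻¹ i j) c :=
    ContMDiffAt.matrix_inv (fun i j => by
      have hc := mem_extChartAt_source (I := 𝓡 n) c
      have := h𝒟.contMDiffAt_gamma (eventually_contMDiffAt_extChartAt_coord hc i)
        (eventually_contMDiffAt_extChartAt_coord hc j)
      exact this) (by
      rw [𝒟.chartMat_self]
      exact (𝒟.posDef c).det_pos.ne')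
  exact contMDiffAt_finsetSum fun i _ => contMDiffAt_finsetSum fun j _ => (h1 i j).smul_const_fun _

/-- The metric whose inverse is the principal symbol of an operator with smooth coefficients. -/
def DiffusionOp.metric (h𝒟 : 𝒟.IsSmooth) : Bundle.ContMDiffRiemannianMetric (𝓡 n) ∞ 𝔼 n
      (fun x : X => TangentSpace (𝓡 n) x) where
  inner x := 𝒟.metricForm x
  symm x := 𝒟.metricForm_symm x
  pos x _ hv := 𝒟.metricForm_pos x hv
  isVonNBounded x := 𝒟.isVonNBounded_metricForm x
  contMDiff := by
    intro c
    rw [Bundle.contMDiffAt_totalSpace]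
    refine ⟨contMDiffAt_id, ?_⟩
    refine (𝒟.contMDiffAt_metricForm h𝒟 c).congr_of_eventuallyEq ?_
    filter_upwards [(isOpen_extChartAt_source c).mem_nhds
        (mem_extChartAt_source (I := 𝓡 n) c)] with x hx
    have hxb : x ∈ (𝕋 n c).baseSet := by simpa using hx
    rw [form_eq_sum (Prod.snd _)]
    refine sum_congr rfl fun i _ => sum_congr rfl fun j _ => ?_
    congr 1
    rw [← 𝒟.metricForm_chartFrame hx, chartFrame_eq hx]
    exact (inCoordinates_apply_eq₂ hxb hxb (mem_univ _)).trans (by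
      simp only [Bundle.Trivial.fiberBundle_trivializationAt',
        Bundle.Trivial.linearMapAt_trivialization, LinearMap.id_coe, id_eq]
      have hs (v : 𝔼 n) : (𝕋 n c).symmL ℝ x v =
        (𝕋 n c).symm x v := Bundle.Trivialization.symmL_apply _ hxb v
      exact congrArg₂ (fun v w : 𝔼 n => 𝒟.metricForm x v w) (hs _).symm (hs _).symm)

lemma DiffusionOp.laplaceOp_metric_mat (h𝒟 : 𝒟.IsSmooth) (x : X) :
    (laplaceOp (𝒟.metric h𝒟)).mat x = 𝒟.mat x := by
  have h : gramOf (chartForm (𝒟.metric h𝒟).inner x (chart n x x)) = (𝒟.mat x)⁻¹ := by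
    rw [← 𝒟.chartMat_self x]
    ext i j
    rw [← 𝒟.metricForm_chartFrame (mem_extChartAt_source (I := 𝓡 n) x) i j]
    have e := chartForm_apply (𝒟.metric h𝒟) x (chart n x x) (single i 1) (single j 1)
    rwa [extChartAt_to_inv] at e
  change (gramOf (chartForm (𝒟.metric h𝒟).inner x (chart n x x)))⁻¹ = 𝒟.mat x
  rw [h, Matrix.nonsing_inv_nonsing_inv _ (isUnit_iff_ne_zero.2 (𝒟.posDef x).det_pos.ne')]

/-- The difference of the first-order coefficients of an operator and of the Laplace operator of
its metric. -/
def DiffusionOp.field (h𝒟 : 𝒟.IsSmooth) (x : X) : 𝔼 n :=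
  WithLp.toLp 2 fun i => 𝒟.drift x i - (laplaceOp (𝒟.metric h𝒟)).drift x i

lemma DiffusionOp.fderiv_field (h𝒟 : 𝒟.IsSmooth) (w : X → ℝ) (x : X) : fderiv ℝ
    (w ∘ (chart n x).symm) (chart n x x) (𝒟.field h𝒟 x) = 𝒟.op w x - (laplaceOp (𝒟.metric h𝒟)).op w
    x := by
  rw [← DiffusionOp.sum_drift]
  simp only [DiffusionOp.op, 𝒟.laplaceOp_metric_mat h𝒟, DiffusionOp.field, sub_smul,
    Finset.sum_sub_distrib]
  ring

lemma DiffusionOp.contMDiff_field (h𝒟 : 𝒟.IsSmooth) : ContMDiff (𝓡 n) (𝓡 n).tangent ∞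
    (fun x => (⟨x, 𝒟.field h𝒟 x⟩ : TangentBundle (𝓡 n) X)) := by
  intro c
  refine (Bundle.contMDiffAt_section (IB := 𝓡 n) (n := ∞) (F := 𝔼 n)
    (E := fun x : X => TangentSpace (𝓡 n) x) (s := fun x => 𝒟.field h𝒟 x) c).2 ?_
  have hc := mem_extChartAt_source (I := 𝓡 n) c
  have h1 (k : Fin n) : SmoothAt n (fun x =>
      𝒟.op (fun x => chart n c x k) x -
        (laplaceOp (𝒟.metric h𝒟)).op (fun x => chart n c x k) x) c :=
    have hk := eventually_contMDiffAt_extChartAt_coord hc k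
    (h𝒟 c _ hk).sub (isSmooth_laplaceOp _ c _ hk)
  have h2 : SmAt (𝓡 n) 𝓘(ℝ, 𝔼 n) (fun x => ∑ k : Fin n, (𝒟.op (fun x => chart n c x k) x -
        (laplaceOp (𝒟.metric h𝒟)).op (fun x => chart n c x k) x) •
        (single k 1 : 𝔼 n)) c :=
    contMDiffAt_finsetSum fun k _ => (h1 k).smul_const_fun _
  refine h2.congr_of_eventuallyEq ?_
  filter_upwards [(isOpen_extChartAt_source c).mem_nhds hc] with x hx
  rw [trivializationAt_snd (c := c) (𝒟.field h𝒟 x), sum_smul_single (fderiv ℝ _ _ _)]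
  refine sum_congr rfl fun k _ => ?_
  congr 1
  rw [← 𝒟.fderiv_field h𝒟]
  have := ((proj k : 𝔼 n →L[ℝ] ℝ).hasFDerivAt.comp _
      ((contMDiffAt_extChartAt_of_mem (I := 𝓡 n) hx).contDiffAt_two.diffAt).hasFDerivAt).fderiv
  exact (congrArg (fun L : 𝔼 n →L[ℝ] ℝ => L (𝒟.field h𝒟 x)) this).symm

/-- An equation whose operator has the form `a(w) 𝒟 w + Q(x, w)`, where the coefficients of `𝒟` are
smooth, is a reaction-diffusion equation: the metric is the inverse of the principal symbol
of `𝒟`. -/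
lemma isReactionDiffusion_of_hasForm {B : PEq n X} {a : ℝ → ℝ} {Q : X → ℝ → ℝ}
    (ha : ContinuousOn a B.Ω) (ha0 : ∀ u ∈ B.Ω, 0 < a u) (h𝒟 : 𝒟.IsSmooth) (hB : B.HasForm a 𝒟 Q)
    (hQ : ContinuousOn (fun p : X × ℝ => Q p.1 p.2) (univ ×ˢ B.Ω)) : IsReactionDiffusion B B.Ω a := by
  refine ⟨rfl, ha, ha0, 𝒟.metric h𝒟, 𝒟.field h𝒟, Q, 𝒟.contMDiff_field h𝒟, hQ, ?_⟩
  intro t ht x w hw hwx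
  rw [hB t ht x w hw hwx, laplaceBeltrami_eq _ hw]
  refine Eq.trans ?_ (congrArg (fun d => a (w x) * ((laplaceOp (𝒟.metric h𝒟)).op w x + d) +
    Q x (w x)) ((directionalDeriv_eq hw (𝒟.field h𝒟 x)).trans (𝒟.fderiv_field h𝒟 w x)).symm)
  ring

end ReactionDiffusionForm

/-! ### Affine symmetries of a function on an interval -/

section Symmetries

variable {Ω : Set ℝ} {a : ℝ → ℝ}

lemma exists_periodic_extension (hΩ : Ω.OrdConnected) {P : ℝ} (hP : 0 < P) {h : ℝ → ℝ} {u0 : ℝ}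
    (hu₀ : u0 ∈ Ω) (hu0P : u0 + P ∈ Ω) (hh : ∀ u ∈ Ω, u + P ∈ Ω → h (u + P) = h u) :
    ∃ H : ℝ → ℝ, Function.Periodic H P ∧ ∀ u ∈ Ω, h u = H u := by
  have key : ∀ (k : ℕ) (u : ℝ), u ∈ Ω → u + k * P ∈ Ω → h (u + k * P) = h u := by
    intro k
    induction k with
    | zero => intro u _ _; simp
    | succ k ih =>
      intro u hu hu'
      have h1 : u + k * P ∈ Ω := hΩ.out hu hu' ⟨by
        have : (0 : ℝ) ≤ k * P := by positivity
        linarith, by push_cast; linarith⟩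
      have e : u + (k + 1 : ℕ) * P = u + k * P + P := by push_cast; ring
      rw [e] at hu' ⊢
      rw [hh _ h1 hu', ih u hu h1]
  refine ⟨fun u => h (toIcoMod hP u0 u), fun u => by simp, fun u hu => ?_⟩
  have hm := toIcoMod_mem_Ico hP u0 u
  have hmΩ : toIcoMod hP u0 u ∈ Ω := hΩ.out hu₀ hu0P ⟨hm.1, hm.2.le⟩
  have e : toIcoMod hP u0 u + toIcoDiv hP u0 u * P = u := by
    simpa using toIcoMod_add_toIcoDiv_zsmul hP u0 u
  change h u = h (toIcoMod hP u0 u)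
  obtain ⟨k, hk | hk⟩ := (toIcoDiv hP u0 u).eq_nat_or_neg
  · rw [hk, Int.cast_natCast] at e
    have := key k _ hmΩ (by rwa [e])
    rwa [e] at this
  · rw [hk] at e
    push_cast at e
    have e' : toIcoMod hP u0 u = u + k * P := by linarith
    rw [e'] at hmΩ ⊢
    exact (key k _ hu hmΩ).symm

/-- The map `u ↦ k u + b` multiplies `a` by the constant `C` wherever this makes sense. -/
structure IsAffineSymmetry (Ω : Set ℝ) (a : ℝ → ℝ) (k b C : ℝ) : Prop where
  pos : 0 < k
  exists_mem : ∃ u ∈ Ω, k * u + b ∈ Ω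
  map_eq : ∀ u ∈ Ω, k * u + b ∈ Ω → a (k * u + b) = C * a u

lemma IsAffineSymmetry.factor_pos (ha : ∀ u ∈ Ω, 0 < a u) {k b C : ℝ}
    (h : IsAffineSymmetry Ω a k b C) : 0 < C := by
  obtain ⟨u, hu, hu'⟩ := h.exists_mem
  exact pos_of_mul_pos_left ((h.map_eq u hu hu') ▸ ha _ hu') (ha u hu).le

lemma IsAffineSymmetry.mem_aExpExt (hΩ : Ω.OrdConnected) (ha : ∀ u ∈ Ω, 0 < a u) {b C : ℝ}
    (h : IsAffineSymmetry Ω a 1 b C) (hb : b ≠ 0) : a ∈ AExpExt Ω := by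
  have hC := h.factor_pos ha
  obtain ⟨u, hu, hu'⟩ := h.exists_mem
  rw [one_mul] at hu'
  have h1 : ∀ u ∈ Ω, u + b ∈ Ω → a (u + b) = C * a u := by simpa using h.map_eq
  have hlam : Real.exp (Real.log C / b * b) = C := by rw [div_mul_cancel₀ _ hb, Real.exp_log hC]
  have hex : ∃ u ∈ Ω, u + |b| ∈ Ω := by
    rcases abs_cases b with ⟨e, _⟩ | ⟨e, _⟩ <;> rw [e]
    · exact ⟨u, hu, hu'⟩
    · exact ⟨u + b, hu', by simpa using hu⟩
  obtain ⟨u0, hu₀, hu0'⟩ := hex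
  obtain ⟨H, hH, hH'⟩ := exists_periodic_extension (h := fun u => a u * Real.exp (-(Real.log C / b * u)))
    hΩ (abs_pos.2 hb) hu₀ hu0' (by
      intro u hu hu'
      rcases abs_cases b with ⟨e, _⟩ | ⟨e, _⟩ <;> rw [e] at hu' ⊢
      · rw [h1 u hu hu', mul_add, neg_add, Real.exp_add, Real.exp_neg (_ * b), hlam]
        field_simp
      · have h2 := h1 (u + -b) hu' (by simpa using hu)
        rw [neg_add_cancel_right] at h2
        rw [h2, mul_add, mul_neg, neg_add, neg_neg, Real.exp_add, hlam]
        ring)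
  refine ⟨Real.log C / b, |b|, H, abs_pos.2 hb, hH, ⟨u0, hu₀, hu0'⟩, fun u hu => ?_⟩
  rw [← hH' u hu, mul_comm, mul_assoc, ← Real.exp_add, neg_add_cancel, Real.exp_zero, mul_one]

lemma exists_sign_of_notMem (hΩ : Ω.OrdConnected) {u0 : ℝ} (hu₀ : u0 ∉ Ω) :
    ∃ ε : ℝ, (ε = 1 ∨ ε = -1) ∧ ∀ u ∈ Ω, 0 < ε * (u - u0) := by
  by_cases h : ∃ u ∈ Ω, u0 < u
  · obtain ⟨u, hu, hlt⟩ := h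
    refine ⟨1, Or.inl rfl, fun v hv => ?_⟩
    by_contra! hle
    exact hu₀ (hΩ.out hv hu ⟨by linarith, hlt.le⟩)
  · push Not at h
    refine ⟨-1, Or.inr rfl, fun v hv => ?_⟩
    have : v ≠ u0 := fun e => hu₀ (e ▸ hv)
    have := lt_of_le_of_ne (h v hv) this
    linarith

lemma abs_sub_eq_of_sign {ε u u0 : ℝ} (hε : ε = 1 ∨ ε = -1) (h : 0 < ε * (u - u0)) :
    |u - u0| = ε * (u - u0) := by
  rcases hε with rfl | rfl
  · rw [one_mul] at h ⊢; exact abs_of_pos h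
  · rw [neg_one_mul] at h ⊢; exact abs_of_neg (by linarith)

lemma mul_self_of_sign {ε : ℝ} (hε : ε = 1 ∨ ε = -1) : ε * ε = 1 := by
  rcases hε with rfl | rfl <;> norm_num

/-- A dilation becomes a translation in the variable `ln |u - u0|`. -/
lemma IsAffineSymmetry.mem_aDegExt (hΩ : Ω.OrdConnected) (ha : ∀ u ∈ Ω, 0 < a u) {k u0 C : ℝ}
    (h : IsAffineSymmetry Ω a k ((1 - k) * u0) C) (hk : k ≠ 1) (hu₀ : u0 ∉ Ω) : a ∈ ADegExt Ω := by
  obtain ⟨ε, hε, hεΩ⟩ := exists_sign_of_notMem hΩ hu₀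
  have hk0 := h.pos
  -- `r` is inverse to `u ↦ ln |u - u0|`
  set r : ℝ → ℝ := fun s => u0 + ε * Real.exp s with hr
  have hrlog u (hu : u ∈ Ω) : r (Real.log |u - u0|) = u := by
    have h1 := hεΩ u hu
    rw [hr, abs_sub_eq_of_sign hε h1]
    simp only
    rw [Real.exp_log h1, ← mul_assoc, mul_self_of_sign hε]
    ring
  have hrk s : r (1 * s + Real.log k) = k * r s + (1 - k) * u0 := by
    simp only [hr]
    rw [one_mul, Real.exp_add, Real.exp_log hk0]
    ring
  have hord : (r ⁻¹' Ω).OrdConnected := by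
    rcases hε with rfl | rfl
    · exact hΩ.preimage_mono fun s s' hs => by simp only [hr]; gcongr
    · exact hΩ.preimage_anti fun s s' hs => by
        simp only [hr, neg_one_mul]
        gcongr
  have hsym : IsAffineSymmetry (r ⁻¹' Ω) (a ∘ r) 1 (Real.log k) C := by
    obtain ⟨u, hu, hu'⟩ := h.exists_mem
    refine ⟨one_pos, ⟨Real.log |u - u0|, ?_, ?_⟩, fun s hs hs' => ?_⟩
    · rwa [mem_preimage, hrlog u hu]
    · rwa [mem_preimage, hrk, hrlog u hu]
    · rw [mem_preimage, hrk] at hs'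
      simp only [Function.comp, hrk]
      exact h.map_eq _ hs hs'
  obtain ⟨lam, P, H, hP, hH, ⟨s, hs, hs'⟩, hform⟩ := hsym.mem_aExpExt hord (fun s hs => ha _ hs)
    (Real.log_ne_zero_of_pos_of_ne_one hk0 hk)
  have hlogr s : Real.log |r s - u0| = s := by
    have : |r s - u0| = Real.exp s := by
      simp only [hr, add_sub_cancel_left, abs_mul, Real.abs_exp]
      rcases hε with rfl | rfl <;> simp
    rw [this, Real.log_exp]
  refine ⟨lam, u0, P, H, hu₀, hP, hH, ⟨r s, hs, r (s + P), hs', by rw [hlogr, hlogr]⟩,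
    fun u hu => ?_⟩
  have h1 := hform (Real.log |u - u0|) (by rwa [mem_preimage, hrlog u hu])
  simp only [hrlog u hu] at h1
  rw [h1, Real.rpow_def_of_pos (by
    rw [abs_sub_eq_of_sign hε (hεΩ u hu)]; exact hεΩ u hu), mul_comm lam]

lemma add_mul_sub_mem (hΩ : Ω.OrdConnected) {u0 u l : ℝ} (hu₀ : u0 ∈ Ω) (hu : u ∈ Ω) (h0 : 0 ≤ l)
    (h1 : l ≤ 1) : u0 + l * (u - u0) ∈ Ω := by
  simpa [AffineMap.lineMap_apply, add_comm] using hΩ.convex.lineMap_mem hu₀ hu ⟨h0, h1⟩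

/-- A function that is scaled by a contraction whose fixed point lies in the interval is constant:
iterate the contraction. -/
lemma eq_of_contraction (hΩ : Ω.OrdConnected) (hc : ContinuousOn a Ω) {k u0 : ℝ} (hk : 0 < k)
    (hk1 : k < 1) (hu₀ : u0 ∈ Ω) (h : ∀ u ∈ Ω, a (u0 + k * (u - u0)) = a u) {u : ℝ} (hu : u ∈ Ω) :
    a u = a u0 := by
  have hmem (j : ℕ) : u0 + k ^ j * (u - u0) ∈ Ω :=
    add_mul_sub_mem hΩ hu₀ hu (by positivity) (pow_le_one₀ hk.le hk1.le)
  have hval (j : ℕ) : a (u0 + k ^ j * (u - u0)) = a u := by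
    induction j with
    | zero => simp
    | succ j ih => rw [← ih, ← h _ (hmem j)]; congr 1; ring
  have hlim : Tendsto (fun j : ℕ => u0 + k ^ j * (u - u0)) atTop (𝓝 u0) := by
    simpa using ((tendsto_pow_atTop_nhds_zero_of_lt_one hk.le hk1).mul_const (u - u0)).const_add u0
  exact tendsto_nhds_unique (tendsto_const_nhds.congr fun j => (hval j).symm)
      ((hc u0 hu₀).tendsto.comp (tendsto_nhdsWithin_iff.2 ⟨hlim, Eventually.of_forall hmem⟩))

/-- A nonconstant function that has a nontrivial affine symmetry is exceptional. -/
lemma IsAffineSymmetry.eq_id_or (hΩ : Ω.OrdConnected) (hc : ContinuousOn a Ω)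
    (ha : ∀ u ∈ Ω, 0 < a u) (hne : ∃ u1 ∈ Ω, ∃ u2 ∈ Ω, a u1 ≠ a u2) {k b C : ℝ}
    (h : IsAffineSymmetry Ω a k b C) : (k = 1 ∧ b = 0) ∨ a ∈ AExpExt Ω ∨ a ∈ ADegExt Ω := by
  rcases eq_or_ne k 1 with rfl | hk
  · rcases eq_or_ne b 0 with rfl | hb
    · exact Or.inl ⟨rfl, rfl⟩
    · exact Or.inr (Or.inl (h.mem_aExpExt hΩ ha hb))
  have hk' : 1 - k ≠ 0 := sub_ne_zero.2 hk.symm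
  obtain ⟨u0, rfl⟩ : ∃ u0, b = (1 - k) * u0 := ⟨b / (1 - k), by field_simp⟩
  by_cases hu₀ : u0 ∈ Ω
  · exfalso
    have e u : k * u + (1 - k) * u0 = u0 + k * (u - u0) := by ring
    have hC : C = 1 := by
      have h1 := h.map_eq u0 hu₀ (by rwa [e, sub_self, mul_zero, add_zero])
      rw [e, sub_self, mul_zero, add_zero] at h1
      exact (mul_right_cancel₀ (ha u0 hu₀).ne' ((one_mul _).trans h1)).symm
    have hconst : ∀ u ∈ Ω, a u = a u0 := by
      rcases lt_or_gt_of_ne hk with hlt | hgt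
      · refine fun u hu => eq_of_contraction hΩ hc h.pos hlt hu₀ (fun u hu => ?_) hu
        have := h.map_eq u hu (by rw [e]; exact add_mul_sub_mem hΩ hu₀ hu h.pos.le hlt.le)
        rw [← e, this, hC, one_mul]
      · have hk0 := h.pos
        have hlt := inv_lt_one_of_one_lt₀ hgt
        refine fun u hu => eq_of_contraction hΩ hc (inv_pos.2 h.pos) hlt hu₀ (fun u hu => ?_) hu
        have e2 : k * (u0 + k⁻¹ * (u - u0)) + (1 - k) * u0 = u := by field_simp; ring
        have := h.map_eq _ (add_mul_sub_mem hΩ hu₀ hu (inv_pos.2 h.pos).le hlt.le) (by rwa [e2])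
        rw [e2, hC, one_mul] at this
        exact this.symm
    obtain ⟨u1, h₁, u2, h₂, hn⟩ := hne
    exact hn ((hconst u1 h₁).trans (hconst u2 h₂).symm)
  · exact Or.inr (Or.inr (h.mem_aDegExt hΩ ha hk hu₀))

/-- A smooth family of affine bijections of the interval that scale the function, parametrized by
the points of the interval and equivariant under all affine symmetries. It allows to normalize
functions that are defined up to such symmetries. -/
structure SymmetryNormalizer (Ω : Set ℝ) (a : ℝ → ℝ) where
  slope : ℝ → ℝ
  shift : ℝ → ℝ
  factor : ℝ → ℝ
  slope_pos : ∀ p ∈ Ω, 0 < slope p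
  factor_pos : ∀ p ∈ Ω, 0 < factor p
  contDiffAt_slope : ∀ p ∈ Ω, ContDiffAt ℝ ∞ slope p
  contDiffAt_shift : ∀ p ∈ Ω, ContDiffAt ℝ ∞ shift p
  contDiffAt_factor : ∀ p ∈ Ω, ContDiffAt ℝ ∞ factor p
  mem_iff : ∀ p ∈ Ω, ∀ u, slope p * u + shift p ∈ Ω ↔ u ∈ Ω
  map_eq : ∀ p ∈ Ω, ∀ u ∈ Ω, a (slope p * u + shift p) = factor p * a u
  symm_mem_iff : ∀ {k b C : ℝ}, IsAffineSymmetry Ω a k b C → ∀ u, k * u + b ∈ Ω ↔ u ∈ Ω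
  slope_symm : ∀ {k b C : ℝ}, IsAffineSymmetry Ω a k b C → ∀ p ∈ Ω, slope (k * p + b) * k = slope p
  shift_symm : ∀ {k b C : ℝ}, IsAffineSymmetry Ω a k b C → ∀ p ∈ Ω,
    slope (k * p + b) * b + shift (k * p + b) = shift p
  symm_unique : ∀ {k b k' b' C : ℝ}, IsAffineSymmetry Ω a k b C → IsAffineSymmetry Ω a k' b' C →
    k = k' ∧ b = b'

/-- The trivial normalizer of a function without symmetries. -/
def SymmetryNormalizer.id (h : ∀ {k b C : ℝ}, IsAffineSymmetry Ω a k b C → k = 1 ∧ b = 0) :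
    SymmetryNormalizer Ω a where
  slope _ := 1
  shift _ := 0
  factor _ := 1
  slope_pos _ _ := one_pos
  factor_pos _ _ := one_pos
  contDiffAt_slope _ _ := contDiffAt_const
  contDiffAt_shift _ _ := contDiffAt_const
  contDiffAt_factor _ _ := contDiffAt_const
  mem_iff _ _ u := by simp
  map_eq _ _ u _ := by simp
  symm_mem_iff hs u := by obtain ⟨rfl, rfl⟩ := h hs; simp
  slope_symm hs p _ := by obtain ⟨rfl, rfl⟩ := h hs; simp
  shift_symm hs p _ := by obtain ⟨rfl, rfl⟩ := h hs; simp
  symm_unique hs hs' := by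
    obtain ⟨rfl, rfl⟩ := h hs
    obtain ⟨rfl, rfl⟩ := h hs'
    exact ⟨rfl, rfl⟩

lemma symmetry_exp {K lam : ℝ} (hK : K ≠ 0) (hlam : lam ≠ 0)
    (ha : ∀ u, a u = K * Real.exp (lam * u)) {k b C : ℝ} (h : IsAffineSymmetry univ a k b C) :
    k = 1 ∧ C = Real.exp (lam * b) := by
  have h0 := h.map_eq 0 (mem_univ _) (mem_univ _)
  have h1 := h.map_eq 1 (mem_univ _) (mem_univ _)
  rw [ha, ha] at h0 h1
  have hC : C = Real.exp (lam * b) := by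
    have : K * Real.exp (lam * b) = K * C := by simpa [mul_comm] using h0
    exact (mul_left_cancel₀ hK this).symm
  refine ⟨?_, hC⟩
  have h2 : K * Real.exp (lam * (k + b)) = K * Real.exp (lam * b + lam) := by
    rw [Real.exp_add, ← hC]
    simpa [mul_comm, mul_assoc, mul_left_comm] using h1
  have h3 := Real.exp_injective (mul_left_cancel₀ hK h2)
  have h4 : lam * k = lam * 1 := by linarith
  exact mul_left_cancel₀ hlam h4

/-- The normalizer of an exponential consists of translations. -/
def SymmetryNormalizer.exp {K lam : ℝ} (hK : K ≠ 0) (hlam : lam ≠ 0)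
    (ha : ∀ u, a u = K * Real.exp (lam * u)) : SymmetryNormalizer univ a where
  slope _ := 1
  shift p := -p
  factor p := Real.exp (-(lam * p))
  slope_pos _ _ := one_pos
  factor_pos _ _ := Real.exp_pos _
  contDiffAt_slope _ _ := contDiffAt_const
  contDiffAt_shift _ _ := contDiffAt_id.neg
  contDiffAt_factor _ _ := (contDiffAt_const.mul contDiffAt_id).neg.exp
  mem_iff _ _ u := by simp
  map_eq p _ u _ := by
    rw [ha, ha, mul_left_comm, ← Real.exp_add]
    congr 2
    ring
  symm_mem_iff hs u := by simp
  slope_symm hs p _ := by rw [(symmetry_exp hK hlam ha hs).1, one_mul]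
  shift_symm hs p _ := by rw [(symmetry_exp hK hlam ha hs).1]; ring
  symm_unique hs hs' := by
    obtain ⟨rfl, h1⟩ := symmetry_exp hK hlam ha hs
    obtain ⟨rfl, h2⟩ := symmetry_exp hK hlam ha hs'
    refine ⟨rfl, mul_left_cancel₀ hlam (Real.exp_injective (h1.symm.trans h2))⟩

lemma symmetry_rpow {K lam u0 ε : ℝ} (hK : K ≠ 0) (hlam : lam ≠ 0) (hε : ε = 1 ∨ ε = -1)
    (ha : ∀ u, 0 < ε * (u - u0) → a u = K * (ε * (u - u0)) ^ lam) {k b C : ℝ}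
    (h : IsAffineSymmetry {u | 0 < ε * (u - u0)} a k b C) : b = (1 - k) * u0 ∧ C = k ^ lam := by
  have hεε := mul_self_of_sign hε
  have hk := h.pos
  -- `d` measures how far the fixed point is from `u0`; `(k + d / s) ^ lam` cannot depend on `s`
  -- unless `d = 0`
  set d := ε * (b + k * u0 - u0) with hd
  have key s : 0 < s → 0 < k * s + d → (k + d / s) ^ lam = C := by
    intro hs hs'
    have e1 : ε * (u0 + ε * s - u0) = s := by rw [add_sub_cancel_left, ← mul_assoc, hεε, one_mul]
    have e2 : ε * (k * (u0 + ε * s) + b - u0) = k * s + d := by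
      rw [hd]; linear_combination k * s * hεε
    have h1 := h.map_eq (u0 + ε * s) (by rwa [mem_ofPred_eq, e1]) (by rwa [mem_ofPred_eq, e2])
    rw [ha _ (by rwa [e2]), ha _ (by rwa [e1]), e1, e2, mul_left_comm] at h1
    have h2 := mul_left_cancel₀ hK h1
    have h3 : k + d / s = (k * s + d) / s := by field_simp
    rw [h3, Real.div_rpow hs'.le hs.le, h2, mul_div_assoc, div_self (Real.rpow_pos_of_pos hs _).ne',
      mul_one]
  have hd0 : d = 0 := by
    have hs : 0 < (|d| + 1) / k := by positivity
    have e : k * ((|d| + 1) / k) = |d| + 1 := by field_simp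
    have hd' := neg_abs_le d
    have h2 := key (2 * ((|d| + 1) / k)) (by positivity) (by
      rw [mul_left_comm, e]; linarith [abs_nonneg d])
    have p1 : 0 ≤ k + d / ((|d| + 1) / k) := by
      have : k + d / ((|d| + 1) / k) = k * ((|d| + d + 1) / (|d| + 1)) := by
        field_simp
        ring
      rw [this]
      exact mul_nonneg hk.le (div_nonneg (by linarith) (by positivity))
    have p2 : 0 ≤ k + d / (2 * ((|d| + 1) / k)) := by
      have : k + d / (2 * ((|d| + 1) / k)) = k * ((2 * |d| + d + 2) / (2 * (|d| + 1))) := by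
        field_simp
        ring
      rw [this]
      exact mul_nonneg hk.le (div_nonneg (by linarith [abs_nonneg d]) (by positivity))
    have h3 := Real.rpow_left_injOn hlam p1 p2 ((key _ hs (by rw [e]; linarith)).trans h2.symm)
    have h4 : d / ((|d| + 1) / k) = d / ((|d| + 1) / k) / 2 := by
      rw [div_div, mul_comm _ (2 : ℝ)]; linarith
    have h5 : d / ((|d| + 1) / k) = 0 := by linarith
    exact (div_eq_zero_iff.1 h5).resolve_right hs.ne'
  constructor
  · linear_combination ε * hd0 - (b + k * u0 - u0) * hεε
  · have := key 1 one_pos (by rw [hd0]; linarith)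
    rw [hd0, zero_div, add_zero] at this
    exact this.symm

/-- The normalizer of a power consists of dilations. -/
def SymmetryNormalizer.rpow {K lam u0 ε : ℝ} (hK : K ≠ 0) (hlam : lam ≠ 0) (hε : ε = 1 ∨ ε = -1)
    (ha : ∀ u, 0 < ε * (u - u0) → a u = K * (ε * (u - u0)) ^ lam) :
    SymmetryNormalizer {u | 0 < ε * (u - u0)} a where
  slope p := (ε * (p - u0))⁻¹
  shift p := u0 - (ε * (p - u0))⁻¹ * u0
  factor p := (ε * (p - u0)) ^ (-lam)
  slope_pos _ hp := inv_pos.2 hp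
  factor_pos _ hp := Real.rpow_pos_of_pos hp _
  contDiffAt_slope p hp :=
    (contDiffAt_const.mul (contDiffAt_id.sub contDiffAt_const)).inv (ne_of_gt hp)
  contDiffAt_shift p hp := contDiffAt_const.sub
    (((contDiffAt_const.mul (contDiffAt_id.sub contDiffAt_const)).inv (ne_of_gt hp)).mul
      contDiffAt_const)
  contDiffAt_factor p hp :=
    (contDiffAt_const.mul (contDiffAt_id.sub contDiffAt_const)).rpow_const_of_ne (ne_of_gt hp)
  mem_iff p hp u := by
    have e : ε * ((ε * (p - u0))⁻¹ * u + (u0 - (ε * (p - u0))⁻¹ * u0) - u0) =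
      (ε * (p - u0))⁻¹ * (ε * (u - u0)) := by ring
    rw [mem_ofPred_eq, mem_ofPred_eq, e]
    exact mul_pos_iff_of_pos_left (inv_pos.2 hp)
  map_eq p hp u hu := by
    have e : ε * ((ε * (p - u0))⁻¹ * u + (u0 - (ε * (p - u0))⁻¹ * u0) - u0) =
      (ε * (p - u0))⁻¹ * (ε * (u - u0)) := by ring
    have hp' : 0 < ε * (p - u0) := hp
    have hu' : 0 < ε * (u - u0) := hu
    rw [ha u hu, ha _ (by rw [e]; positivity), e, Real.mul_rpow (by positivity) hu'.le,
      Real.rpow_neg hp'.le, Real.inv_rpow hp'.le]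
    ring
  symm_mem_iff {k b C} hs u := by
    have hk := hs.pos
    obtain ⟨rfl, -⟩ := symmetry_rpow hK hlam hε ha hs
    have e : ε * (k * u + (1 - k) * u0 - u0) = k * (ε * (u - u0)) := by ring
    rw [mem_ofPred_eq, mem_ofPred_eq, e]
    exact mul_pos_iff_of_pos_left hk
  slope_symm {k b C} hs p hp := by
    obtain ⟨rfl, -⟩ := symmetry_rpow hK hlam hε ha hs
    have e : ε * (k * p + (1 - k) * u0 - u0) = k * (ε * (p - u0)) := by ring
    rw [e, mul_inv, mul_right_comm, inv_mul_cancel₀ hs.pos.ne', one_mul]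
  shift_symm {k b C} hs p hp := by
    obtain ⟨rfl, -⟩ := symmetry_rpow hK hlam hε ha hs
    have e : ε * (k * p + (1 - k) * u0 - u0) = k * (ε * (p - u0)) := by ring
    have h1 : (k * (ε * (p - u0)))⁻¹ * k = (ε * (p - u0))⁻¹ := by
      rw [mul_inv, mul_right_comm, inv_mul_cancel₀ hs.pos.ne', one_mul]
    rw [e]
    linear_combination -u0 * h1
  symm_unique {k b k' b' C} hs hs' := by
    obtain ⟨rfl, h1⟩ := symmetry_rpow hK hlam hε ha hs
    obtain ⟨rfl, h2⟩ := symmetry_rpow hK hlam hε ha hs'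
    have := Real.rpow_left_injOn hlam hs.pos.le hs'.pos.le (h1.symm.trans h2)
    exact ⟨this, by rw [this]⟩

lemma nonempty_symmetryNormalizer_of_notMem_ext (hΩ : Ω.OrdConnected) (hc : ContinuousOn a Ω)
    (ha : ∀ u ∈ Ω, 0 < a u) (hne : ∃ u1 ∈ Ω, ∃ u2 ∈ Ω, a u1 ≠ a u2)
    (hext : a ∉ AExpExt Ω ∪ ADegExt Ω) :
    ∃ N : SymmetryNormalizer Ω a, ∀ p, N.slope p = 1 ∧ N.shift p = 0 :=
  ⟨.id fun h => (h.eq_id_or hΩ hc ha hne).resolve_right fun h => hext (h.elim Or.inl Or.inr),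
    fun _ => ⟨rfl, rfl⟩⟩

lemma nonempty_symmetryNormalizer (hΩ : Ω.OrdConnected) (hc : ContinuousOn a Ω)
    (ha : ∀ u ∈ Ω, 0 < a u) (hne : ∃ u1 ∈ Ω, ∃ u2 ∈ Ω, a u1 ≠ a u2) (hexc : a ∉ AExp Ω ∪ ADeg Ω)
    (hnat : HasNaturalDomain Ω a) : Nonempty (SymmetryNormalizer Ω a) := by
  by_cases hext : a ∈ AExpExt Ω ∪ ADegExt Ω
  swap
  · exact ⟨(nonempty_symmetryNormalizer_of_notMem_ext hΩ hc ha hne hext).choose⟩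
  obtain ⟨u1, h₁, u2, h₂, hn⟩ := hne
  rcases hext with ⟨lam, P, H, hP, hH, hex, hform⟩ | ⟨lam, u0, P, H, hu₀, hP, hH, hex, hform⟩
  · have hconst : ∀ s, H s = H 0 := by
      by_contra! h
      obtain ⟨s, hs⟩ := h
      exact hexc (Or.inl ⟨lam, P, H, hP, hH, ⟨s, 0, hs⟩, hex, hform⟩)
    have hform' u (hu : u ∈ Ω) : a u = H 0 * Real.exp (lam * u) := by
      rw [hform u hu, hconst, mul_comm]
    obtain rfl := hnat.1 _ _ hform'
    refine ⟨.exp (K := H 0) (lam := lam) ?_ ?_ fun u => hform' u (mem_univ u)⟩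
    · exact left_ne_zero_of_mul ((hform' u1 h₁) ▸ (ha u1 h₁).ne')
    · rintro rfl
      exact hn (by rw [hform' u1 h₁, hform' u2 h₂, zero_mul, zero_mul])
  · have hconst : ∀ s, H s = H 0 := by
      by_contra! h
      obtain ⟨s, hs⟩ := h
      exact hexc (Or.inr ⟨lam, u0, P, H, hu₀, hP, hH, ⟨s, 0, hs⟩, hex, hform⟩)
    have hform' u (hu : u ∈ Ω) : a u = H 0 * |u - u0| ^ lam := by rw [hform u hu, hconst, mul_comm]
    obtain ⟨ε, hε, rfl⟩ : ∃ ε : ℝ, (ε = 1 ∨ ε = -1) ∧ Ω = {u | 0 < ε * (u - u0)} := by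
      rcases hnat.2 _ _ _ hu₀ hform' with rfl | rfl
      · exact ⟨1, Or.inl rfl, by ext u; simp⟩
      · exact ⟨-1, Or.inr rfl, by ext u; simp⟩
    refine ⟨.rpow (K := H 0) (lam := lam) ?_ ?_ hε fun u hu => ?_⟩
    · exact left_ne_zero_of_mul ((hform' u1 h₁) ▸ (ha u1 h₁).ne')
    · rintro rfl
      exact hn (by rw [hform' u1 h₁, hform' u2 h₂, Real.rpow_zero, Real.rpow_zero])
    · rw [hform' u hu, abs_sub_eq_of_sign hε hu]

/-- A continuous function on an interval that is locally constant off one point is constant. -/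
lemma eq_of_locally_constant_off_point (hΩ : Ω.OrdConnected)
    (hc : ContinuousOn a Ω) (p : ℝ) (h : ∀ u ∈ Ω, u ≠ p → ∀ᶠ u' in 𝓝 u, a u' = a u) {u1 u2 : ℝ}
    (h₁ : u1 ∈ Ω) (h₂ : u2 ∈ Ω) : a u1 = a u2 := by
  wlog hle : u1 ≤ u2 generalizing u1 u2
  · exact (this h₂ h₁ (le_of_not_ge hle)).symm
  have hsub := hΩ.out h₁ h₂
  have := MeasureTheory.integral_eq_of_hasDerivAt_off_countable_of_le a (fun _ => (0 : ℝ)) hle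
    (countable_singleton p) (hc.mono hsub) (fun u hu =>
      (hasDerivAt_const u (a u)).congr_of_eventuallyEq
        (h u (hsub (Ioo_subset_Icc_self hu.1)) hu.2)) (by simp)
  simp at this
  linarith

end Symmetries

/-! ### Functions of one variable and coordinate functions -/

section Affine

lemma ContDiffAt.deriv_infty {f : ℝ → ℝ} {x : ℝ} (hf : ContDiffAt ℝ ∞ f x) :
    ContDiffAt ℝ ∞ (deriv f) x := by
  have h : ContDiffAt ℝ ∞ (fun z => fderiv ℝ f z 1) x :=
    (hf.fderiv_right (m := ∞) (by simp)).clm_apply contDiffAt_const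
  exact h.congr_of_eventuallyEq (.of_forall fun z => (fderiv_apply_one_eq_deriv).symm)

lemma exists_affine_of_deriv_deriv {I : Set ℝ} (hI : IsOpen I) (hc : IsPreconnected I)
    {f g : ℝ → ℝ} (hf : ∀ v ∈ I, ContDiffAt ℝ ∞ f v) (hg : ∀ v ∈ I, ContDiffAt ℝ ∞ g v)
    (hg0 : ∀ v ∈ I, deriv g v ≠ 0)
    (h : ∀ v ∈ I, deriv (deriv f) v * deriv g v = deriv f v * deriv (deriv g) v) :
    ∃ k b : ℝ, ∀ v ∈ I, f v = k * g v + b := by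
  have d1 : ∀ {f : ℝ → ℝ} {v : ℝ}, ContDiffAt ℝ ∞ f v → HasDerivAt f (deriv f v) v :=
    fun h => h.diffAt.hasDerivAt
  have e1 v (hv : v ∈ I) : HasDerivAt (fun v => deriv f v / deriv g v) 0 v := by
    have := (d1 (hf v hv).deriv_infty).fun_div (d1 (hg v hv).deriv_infty) (hg0 v hv)
    rwa [h v hv, sub_self, zero_div] at this
  obtain ⟨k, hk⟩ := hI.exists_is_const_of_deriv_eq_zero hc
    (fun v hv => (e1 v hv).differentiableAt.differentiableWithinAt) fun v hv => (e1 v hv).deriv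
  have e2 v (hv : v ∈ I) : HasDerivAt (fun v => f v - k * g v) 0 v := by
    have := (d1 (hf v hv)).fun_sub ((d1 (hg v hv)).const_mul k)
    rwa [← hk v hv, div_mul_cancel₀ _ (hg0 v hv), sub_self, hk v hv] at this
  obtain ⟨b, hb⟩ := hI.exists_is_const_of_deriv_eq_zero hc
    (fun v hv => (e2 v hv).differentiableAt.differentiableWithinAt) fun v hv => (e2 v hv).deriv
  exact ⟨k, b, fun v hv => by linarith [hb v hv]⟩

/-- If a nonconstant function times a constant is constant, this constant vanishes. -/
lemma eq_zero_of_mul_eq {Ω : Set ℝ} {a : ℝ → ℝ} (hne : ∃ u1 ∈ Ω, ∃ u2 ∈ Ω, a u1 ≠ a u2) {K D : ℝ}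
    (h : ∀ u ∈ Ω, a u * K = D) : D = 0 := by
  obtain ⟨u1, h₁, u2, h₂, hn⟩ := hne
  have : (a u1 - a u2) * K = 0 := by rw [sub_mul, h u1 h₁, h u2 h₂, sub_self]
  rw [← h u1 h₁, (mul_eq_zero.1 this).resolve_left (sub_ne_zero.2 hn), mul_zero]

/-- A smooth one-parameter family of affine maps that scale a nonconstant function by a constant
factor does not depend on the parameter: where it moves, the function is locally constant. -/
lemma deriv_eq_zero_of_scaling {Ω : Set ℝ} (hΩ : Ω.OrdConnected) (hΩo : IsOpen Ω) {a : ℝ → ℝ}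
    (hc : ContinuousOn a Ω) (hne : ∃ u1 ∈ Ω, ∃ u2 ∈ Ω, a u1 ≠ a u2) {S : ℝ → ℝ → ℝ} {t C : ℝ}
    (hC : C ≠ 0) {k b : ℝ → ℝ} (hS : ∀ᶠ s in 𝓝 t, ∀ u ∈ Ω, S s u = k s * u + b s)
    (hd : ∀ u ∈ Ω, ContDiffAt ℝ ∞ (fun s => S s u) t)
    (ha : ∀ᶠ s in 𝓝 t, ∀ u ∈ Ω, a (S s u) = C * a u) {u0 : ℝ} (hu₀ : u0 ∈ Ω) :
    deriv (fun s => S s u0) t = 0 := by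
  have hda u (hu : u ∈ Ω) : HasDerivAt (fun s => S s u) (deriv (fun s => S s u) t) t :=
    ((hd u hu).diffAt).hasDerivAt
  -- off its zeros the derivative forces `a` to be locally constant
  have hloc u (hu : u ∈ Ω) : deriv (fun s => S s u) t ≠ 0 → ∀ᶠ u' in 𝓝 u, a u' = a u := by
    intro h0
    have h1 : HasStrictDerivAt (fun s => S s u) (deriv (fun s => S s u) t) t :=
      (hd u hu).hasStrictDerivAt (by simp)
    have h2 : ∀ᶠ v in 𝓝 (S t u), a v = C * a u := by
      rw [← h1.map_nhds_eq h0, eventually_map]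
      exact ha.mono fun s hs => hs u hu
    have hS0 := hS.self_of_nhds
    have h3 : ContinuousAt (fun u' => k t * u' + b t) u := by fun_prop
    rw [hS0 u hu] at h2
    filter_upwards [h3.eventually h2, hΩo.mem_nhds hu] with u' h4 hu'
    rw [← hS0 u' hu', ha.self_of_nhds u' hu'] at h4
    exact mul_left_cancel₀ hC h4
  by_contra h0
  obtain ⟨u1, h₁, u2, h₂, hn⟩ := hne
  -- the derivative is an affine function of `u`
  by_cases hz : ∃ p ∈ Ω, deriv (fun s => S s p) t = 0
  · obtain ⟨p, hp, hp0⟩ := hz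
    refine hn (eq_of_locally_constant_off_point hΩ hc p (fun u hu hup => hloc u hu fun hu0 => h0 ?_)
      h₁ h₂)
    have hup' : u - p ≠ 0 := sub_ne_zero.2 hup
    have h1 : (fun s => S s u0) =ᶠ[𝓝 t] fun s => S s p + (u0 - p) / (u - p) * (S s u - S s p) := by
      filter_upwards [hS] with s hs
      rw [hs _ hu₀, hs _ hp, hs _ hu]
      field_simp
      ring
    rw [h1.deriv_eq, ((hda p hp).fun_add (((hda u hu).fun_sub (hda p hp)).const_mul _)).deriv, hp0,
      hu0]
    ring
  · push Not at hz
    exact hn (eq_of_locally_constant_off_point hΩ hc (u1 : ℝ) (fun u hu _ => hloc u hu (hz u hu))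
      h₁ h₂)

lemma ContMDiffAt.deriv_snd {n : ℕ} {X : Type*} [TopologicalSpace X] [ChartedSpace 𝔼 n X]
    [IsManifold (𝓡 n) ∞ X] {U : X × ℝ → ℝ} {x : X} {v : ℝ} (hU : SmAt ((𝓡 n).prod 𝓘₁) 𝓘₁ U (x, v)) :
    SmoothAt n (fun x' => deriv (fun v => U (x', v)) v) x := by
  set φ := chart n x
  set Uh : 𝔼 n × ℝ → ℝ := fun z => U (φ.symm z.1, z.2) with hUh
  have hUc : ContDiffAt ℝ ∞ Uh (φ x, v) := by
    have h := hU.contDiffAt_comp_extChartAt_symm (c := ((x, v) : X × ℝ)) (mem_extChartAt_source _)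
    rwa [extChartAt_prod] at h
  have h1 : ContDiffAt ℝ ∞ (fun z => fderiv ℝ Uh (z, v) (0, 1)) (φ x) := by
    have h2 : ContDiffAt ℝ ∞ (fderiv ℝ Uh) ((fun z => (z, v)) (φ x)) :=
      hUc.fderiv_right (m := ∞) (by simp)
    exact (h2.comp (φ x) (contDiffAt_id.prodMk contDiffAt_const)).clm_apply contDiffAt_const
  refine (h1.contMDiffAt_comp_extChartAt (mem_extChartAt_source x)).congr_of_eventuallyEq ?_
  have hd : ∀ᶠ z in 𝓝 (φ x, v), DifferentiableAt ℝ Uh z :=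
    ((hUc.of_le (m := 1) (by simp)).eventually (by simp)).mono fun z h => h.diffAt
  have hφc : ContinuousAt (fun x' => (φ x', v)) x :=
    (continuousAt_extChartAt x).prodMk continuousAt_const
  filter_upwards [hφc.eventually hd, extChartAt_source_mem_nhds (I := 𝓡 n) x] with x' h2 hx'
  have h4 := HasFDerivAt.comp_hasDerivAt (l := Uh) (f := fun v => (φ x', v)) v h2.hasFDerivAt
      ((hasDerivAt_const v (φ x')).prodMk (hasDerivAt_id v))
  refine Eq.trans ?_ h4.deriv
  simp only [hUh, Function.comp_def, φ.left_inv hx']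

lemma injOn_of_deriv_ne_zero {f : ℝ → ℝ} {s : Set ℝ} (hs : s.OrdConnected)
    (hf : ∀ x ∈ s, deriv f x ≠ 0) : InjOn f s := by
  have key a (ha : a ∈ s) b (hb : b ∈ s) : f a = f b → ¬ a < b := by
    intro hab hlt
    obtain ⟨c, hc, h0⟩ := exists_deriv_eq_zero hlt (fun x hx =>
      (differentiableAt_of_deriv_ne_zero (hf x (hs.out ha hb hx))).continuousAt.continuousWithinAt) hab
    exact hf c (hs.out ha hb (Ioo_subset_Icc_self hc)) h0
  intro a ha b hb hab
  rcases lt_trichotomy a b with h | h | h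
  · exact absurd h (key a ha b hb hab)
  · exact h
  · exact absurd h (key b hb a ha hab.symm)

end Affine

section Coordinates

variable {m : ℕ} {Y : Type*} [TopologicalSpace Y] [ChartedSpace 𝔼 m Y] [IsManifold (𝓡 m) ∞ Y]

/-- A local coordinate around `c`, vanishing at `c`. -/
def coordFn (c : Y) (i : Fin m) (y : Y) : ℝ := chart m c y i - chart m c c i

lemma coordFn_self (c : Y) (i : Fin m) : coordFn c i c = 0 := sub_self _

lemma eventually_contMDiffAt_coordFn (c : Y) (i : Fin m) :
    ∀ᶠ y in 𝓝 c, SmoothAt m (coordFn c i) y :=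
  (DiffusionOp.eventually_contMDiffAt_extChartAt_coord (mem_extChartAt_source c) i).mono
    fun _ h => h.sub contMDiffAt_const

lemma pd₁_coordFn_ne_zero (c : Y) (i : Fin m) : pd₁ (n := m) (coordFn c i) c ≠ 0 := by
  intro h
  have h1 := congrFun h i
  have e : coordFn c i ∘ (chart m c).symm =ᶠ[𝓝 (chart m c c)]
      fun z => (proj i : 𝔼 m →L[ℝ] ℝ) z - chart m c c i := by
    filter_upwards [(isOpen_extChartAt_target c).mem_nhds (mem_extChartAt_target c)] with z hz
    simp only [coordFn, Function.comp, (chart m c).right_inv hz]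
    rfl
  rw [pd₁, e.fderiv_eq, fderiv_sub_const, ContinuousLinearMap.fderiv] at h1
  simp at h1

/-- The velocity of a curve in a manifold in terms of local coordinates. -/
lemma deriv_coordFn_comp {γ : ℝ → Y} {t : ℝ} (hγ : SmAt 𝓘₁ (𝓡 m) γ t) {c : Y}
    (hc : γ t ∈ (chart m c).source) (i : Fin m) :
    deriv (fun s => coordFn c i (γ s)) t = deriv (fun s => chart m c (γ s)) t i := by
  have h : DifferentiableAt ℝ (fun s => chart m c (γ s)) t :=
    ((contMDiffAt_extChartAt_of_mem (I := 𝓡 m) hc).comp t hγ).contDiffAt.diffAt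
  have h2 := ((proj i : 𝔼 m →L[ℝ] ℝ).hasFDerivAt.comp_hasDerivAt
    t h.hasDerivAt).sub_const (chart m c c i)
  exact h2.deriv

lemma mfderiv_eq_zero_of_deriv_coordFn {γ : ℝ → Y} {t : ℝ} (hγ : SmAt 𝓘₁ (𝓡 m) γ t)
    (h : ∀ i : Fin m, deriv (fun s => coordFn (γ t) i (γ s)) t = 0) : mfderiv 𝓘₁ (𝓡 m) γ t = 0 := by
  rw [hγ.mfderiv_eq_fderiv_chart]
  have h1 : deriv (fun s => chart m (γ t) (γ s)) t = 0 := by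
    ext i
    rw [← deriv_coordFn_comp hγ (mem_extChartAt_source _), h]
    rfl
  apply ContinuousLinearMap.ext
  intro s
  have e : fderiv ℝ (fun s => chart m (γ t) (γ s)) t s = 0 := by
    have : s = s • (1 : ℝ) := by simp
    rw [this, map_smul, fderiv_apply_one_eq_deriv, h1, smul_zero]
  exact e

end Coordinates

/-! ### Descent of diffusion operators along submersions -/

section Descent

variable {n m : ℕ} {X Y : Type*} [TopologicalSpace X] [ChartedSpace 𝔼 n X]
  [TopologicalSpace Y] [ChartedSpace 𝔼 m Y]
  [IsManifold (𝓡 n) ∞ X] [IsManifold (𝓡 m) ∞ Y]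

namespace DiffusionOp

variable (𝒟 : DiffusionOp n X)

lemma pd₁_coord {Z : X → 𝔼 m} {x : X} (hZ : SmAt (𝓡 n) 𝓘(ℝ, 𝔼 m) Z x) (k : Fin m)
    (i : Fin n) : pd₁ (fun x => Z x k) x i = pd₁ Z x i k := by
  have h := pd₁_comp hZ (h := (proj k : 𝔼 m →L[ℝ] ℝ)) (proj k : 𝔼 m →L[ℝ] ℝ).contDiff.contDiffAt i
  rwa [ContinuousLinearMap.fderiv] at h

lemma op_coord {Z : X → 𝔼 m} {x : X} (hZ : SmAt (𝓡 n) 𝓘(ℝ, 𝔼 m) Z x) (k : Fin m) :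
    𝒟.op (fun x => Z x k) x = 𝒟.op Z x k := by
  have h := 𝒟.op_comp hZ (h := (proj k : 𝔼 m →L[ℝ] ℝ)) (proj k : 𝔼 m →L[ℝ] ℝ).contDiff.contDiffAt
  have e : fderiv ℝ (proj k : 𝔼 m →L[ℝ] ℝ) =
    fun _ => (proj k : 𝔼 m →L[ℝ] ℝ) := funext fun _ => ContinuousLinearMap.fderiv _
  rw [e] at h
  simp only [fderiv_fun_const, Pi.zero_apply, _root_.zero_apply, mul_zero, Finset.sum_const_zero,
    zero_add] at h
  exact h

/-- Chain rule of the second order, in terms of the coordinates of a vector-valued function. -/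
lemma op_comp_coord {Z : X → 𝔼 m} {x : X} (hZ : SmAt (𝓡 n) 𝓘(ℝ, 𝔼 m) Z x) {h : 𝔼 m → ℝ}
    (hh : ContDiffAt ℝ 2 h (Z x)) : 𝒟.op (h ∘ Z) x =
    (∑ k, ∑ l, 𝒟.gamma (fun x => Z x k) (fun x => Z x l) x * D² h (Z x) (single k 1) (single l 1)) +
    ∑ k, 𝒟.op (fun x => Z x k) x * fderiv ℝ h (Z x) (single k 1) := by
  rw [𝒟.op_comp hZ hh]
  simp only [gamma, pd₁_coord hZ, 𝒟.op_coord hZ]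
  congr 1
  · have e (i j : Fin n) : D² h (Z x) (pd₁ Z x i) (pd₁ Z x j) =
        ∑ k, ∑ l, pd₁ Z x i k * pd₁ Z x j l * D² h (Z x) (single k 1) (single l 1) := by
      conv_lhs => rw [sum_smul_single (pd₁ Z x i), sum_smul_single (pd₁ Z x j)]
      simp only [map_sum, map_smul, _root_.sum_apply, _root_.smul_apply, smul_eq_mul, mul_sum]
      rw [sum_comm]
      exact sum_congr rfl fun _ _ => sum_congr rfl fun _ _ => by ring
    simp only [e, mul_sum, sum_mul]
    rw [sum_congr rfl fun i _ => sum_comm, sum_comm]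
    refine sum_congr rfl fun k _ => ?_
    rw [sum_congr rfl fun i _ => sum_comm, sum_comm]
    exact sum_congr rfl fun _ _ => sum_congr rfl fun _ _ => sum_congr rfl fun _ _ => by ring
  · conv_lhs => rw [sum_smul_single (𝒟.op Z x)]
    simp only [map_sum, map_smul, smul_eq_mul]

lemma posDef_gamma {Z : X → 𝔼 m} {x : X} (hZ : SmAt (𝓡 n) 𝓘(ℝ, 𝔼 m) Z x)
    (hs : Surjective (mfderiv (𝓡 n) 𝓘(ℝ, 𝔼 m) Z x)) :
    (Matrix.of fun k l => 𝒟.gamma (fun x => Z x k) (fun x => Z x l) x).PosDef := by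
  set P : Matrix (Fin m) (Fin n) ℝ := Matrix.of fun k i => pd₁ Z x i k with hP
  have e : (Matrix.of fun k l => 𝒟.gamma (fun x => Z x k) (fun x => Z x l) x) =
      P * 𝒟.mat x * P.conjTranspose := by
    ext k l
    simp only [gamma, pd₁_coord hZ, Matrix.mul_apply, Matrix.conjTranspose_apply, sum_mul,
      Matrix.of_apply, hP, star_trivial]
    rw [sum_comm]
    exact sum_congr rfl fun i _ => sum_congr rfl fun j _ => by ring
  rw [e]
  rw [hZ.mfderiv_eq_fderiv_chart] at hs
  have hs' (k : Fin m) : ∃ v : 𝔼 n, fderiv ℝ (Z ∘ (chart n x).symm)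
    (chart n x x) v = single k (1 : ℝ) := hs _
  choose v hv using hs'
  have hPJ : P * Matrix.of (fun i k => v k i) = 1 := by
    ext l k
    have h' := hv k
    rw [sum_smul_single (v k)] at h'
    have h2 := congrArg (fun u : 𝔼 m => u l) h'
    simp only [map_sum, map_smul, WithLp.ofLp_sum, Finset.sum_apply, PiLp.smul_apply,
      smul_eq_mul] at h2
    rw [Matrix.mul_apply, Matrix.one_apply, show (if l = k then (1 : ℝ) else 0) =
      (single k (1 : ℝ) : 𝔼 m) l by simp, ← h2]
    exact sum_congr rfl fun i _ => mul_comm _ _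
  refine (𝒟.posDef x).mul_mul_conjTranspose_same fun ξ ξ' hξ => ?_
  simpa only [Matrix.vecMul_vecMul, hPJ, Matrix.vecMul_one] using
      congrArg (fun η => Matrix.vecMul η (Matrix.of fun i k => v k i)) hξ

lemma surjective_mfderiv_extChartAt {c y : Y} (hy : y ∈ (chart m c).source) :
    Surjective (mfderiv (𝓡 m) 𝓘(ℝ, 𝔼 m) (chart m c) y) := by
  refine HasLocalSection.surjective_mfderiv ⟨(chart m c).symm, ?_, (chart m c).left_inv hy, ?_⟩
    ((contMDiffAt_extChartAt_of_mem hy).mdiffAt)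
  · filter_upwards [(isOpen_extChartAt_target c).mem_nhds ((chart m c).map_source hy)] with z hz
    have := contMDiffAt_extChartAt_symm_apply (I := 𝓡 m) ((chart m c).map_target hz)
    rwa [(chart m c).right_inv hz] at this
  · filter_upwards [(isOpen_extChartAt_target c).mem_nhds
      ((chart m c).map_source hy)] with z hz using (chart m c).right_inv hz

variable {𝒟} in
/-- A diffusion operator that maps functions constant on the fibres of a submersion to functions
of this kind descends to the base. -/
lemma IsSmooth.exists_pushforward (h𝒟 : 𝒟.IsSmooth) {f : X → Y} (hf : ∀ x, SmAt (𝓡 n) (𝓡 m) f x)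
    (hfs : Surjective f) (hsec : ∀ x, HasLocalSection (𝓡 n) (𝓡 m) f x)
    (hd : ∀ x1 x2, f x1 = f x2 → ∀ w : Y → ℝ, (∀ᶠ y in 𝓝 (f x1), SmoothAt m w y) →
        𝒟.op (fun x => w (f x)) x1 = 𝒟.op (fun x => w (f x)) x2) :
    ∃ 𝒟' : DiffusionOp m Y, 𝒟'.IsSmooth ∧ ∀ x (w : Y → ℝ), SmoothAt m w (f x) →
      𝒟'.op w (f x) = 𝒟.op (fun x => w (f x)) x := by
  choose s hs using hfs
  have hZ : ∀ {y x}, f x = y → SmAt (𝓡 n) 𝓘(ℝ, 𝔼 m) (fun x => chart m y (f x)) x :=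
    fun {y x} h => (contMDiffAt_extChartAt_of_mem (h ▸ mem_extChartAt_source (f x))).comp x (hf x)
  have hZs x : Surjective (mfderiv (𝓡 n) 𝓘(ℝ, 𝔼 m) (fun x' => chart m (f x) (f x')) x) := by
    have hfx := (hf x).mdiffAt
    have e : mfderiv (𝓡 n) 𝓘(ℝ, 𝔼 m) (fun x' => chart m (f x) (f x')) x = _ :=
      mfderiv_comp x ((contMDiffAt_extChartAt_of_mem (mem_extChartAt_source (f x))).mdifferentiableAt
        (by simp)) hfx
    rw [e]
    exact (surjective_mfderiv_extChartAt (mem_extChartAt_source (f x))).comp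
      ((hsec x).surjective_mfderiv hfx)
  have hY : ∀ (y : Y) (k : Fin m), ∀ᶠ y' in 𝓝 y,
      SmoothAt m (fun y' => chart m y y' k) y' := fun y =>
    eventually_contMDiffAt_extChartAt_coord (mem_extChartAt_source y)
  have hΓ x1 x2 : f x1 = f x2 → ∀ w1 w2 : Y → ℝ, (∀ᶠ y in 𝓝 (f x1), SmoothAt m w1 y) →
      (∀ᶠ y in 𝓝 (f x1), SmoothAt m w2 y) →
      𝒟.gamma (fun x => w1 (f x)) (fun x => w2 (f x)) x1 =
        𝒟.gamma (fun x => w1 (f x)) (fun x => w2 (f x)) x2 := by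
    intro hx w1 w2 h₁ h₂
    have h := hd x1 x2 hx (fun y => w1 y * w2 y) (by filter_upwards [h₁, h₂] with y a b using a.mul b)
    rw [𝒟.op_mul (f := fun x => w1 (f x)) (h := fun x => w2 (f x))
        (h₁.self_of_nhds.comp x1 (hf x1)) (h₂.self_of_nhds.comp x1 (hf x1)),
      𝒟.op_mul (f := fun x => w1 (f x)) (h := fun x => w2 (f x))
        ((hx ▸ h₁.self_of_nhds).comp x2 (hf x2)) ((hx ▸ h₂.self_of_nhds).comp x2 (hf x2)),
      hd x1 x2 hx w1 h₁, hd x1 x2 hx w2 h₂, hx] at h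
    linarith
  -- the coefficients of the operator at `y` are its values on coordinate functions, computed at an
  -- arbitrary point of the fibre
  let 𝒟' : DiffusionOp m Y :=
    { mat := fun y => Matrix.of fun k l => 𝒟.gamma (fun x => chart m y (f x) k)
        (fun x => chart m y (f x) l) (s y)
      drift := fun y k => 𝒟.op (fun x => chart m y (f x) k) (s y)
      posDef := fun y => 𝒟.posDef_gamma (Z := fun x => chart m y (f x)) (hZ (hs y))
        (by have := hZs (s y); rwa [hs y] at this) }
  have key : ∀ x (w : Y → ℝ), SmoothAt m w (f x) → 𝒟'.op w (f x) = 𝒟.op (fun x => w (f x)) x := by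
    intro x w hw
    have h1 := 𝒟.op_comp_coord (hZ (x := x) rfl) (h := w ∘ (chart m (f x)).symm) hw.contDiffAt_two
    have e : (w ∘ (chart m (f x)).symm) ∘ (fun x' => chart m (f x) (f x'))
        =ᶠ[𝓝 x] fun x' => w (f x') := by
      filter_upwards [(hf x).continuousAt.eventually
        (extChartAt_source_mem_nhds (I := 𝓡 m) (f x))] with x' hx'
      exact congrArg w ((chart m (f x)).left_inv hx')
    rw [𝒟.op_congr e] at h1
    rw [h1]
    simp only [op, pd₁, pd₂, 𝒟', Matrix.of_apply, smul_eq_mul]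
    congr 1
    · exact sum_congr rfl fun k _ => sum_congr rfl fun l _ =>
        congrArg (· * _) (hΓ (s (f x)) x (hs _) (fun y : Y => chart m (f x) y k)
          (fun y : Y => chart m (f x) y l) (by rw [hs]; exact hY _ k) (by rw [hs]; exact hY _ l))
    · exact sum_congr rfl fun k _ =>
        congrArg (· * _) (hd (s (f x)) x (hs _) (fun y : Y => chart m (f x) y k)
          (by rw [hs]; exact hY _ k))
  refine ⟨𝒟', fun y w hw => ?_, key⟩
  obtain ⟨x, rfl⟩ : ∃ x, f x = y := ⟨s y, hs y⟩
  refine (hsec x).contMDiffAt_of_comp ?_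
  refine (h𝒟 x (fun x => w (f x)) ?_).congr_of_eventuallyEq ?_
  · filter_upwards [(hf x).continuousAt.eventually hw] with x' hx' using hx'.comp x' (hf x')
  · filter_upwards [(hf x).continuousAt.eventually hw] with x' hx' using key x' w hx'

/-- The operator `r (𝒟 + 2 s Γ(·, f))`, where `Γ` is the principal symbol of `𝒟`. -/
def conj (r s f : X → ℝ) (hr : ∀ x, 0 < r x) : DiffusionOp n X where
  mat x := r x • 𝒟.mat x
  drift x i := r x * (𝒟.drift x i + 2 * s x * ∑ j, 𝒟.mat x i j * pd₁ f x j)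
  posDef x := (𝒟.posDef x).smul (hr x)

lemma conj_op (r s f : X → ℝ) (hr : ∀ x, 0 < r x) (w : X → ℝ) (x : X) :
    (𝒟.conj r s f hr).op w x = r x * (𝒟.op w x + 2 * s x * 𝒟.gamma w f x) := by
  simp only [op, conj, gamma, smul_eq_mul, Matrix.smul_apply, mul_add, add_mul, mul_sum,
    sum_mul, sum_add_distrib, add_assoc]
  congr 1
  · exact sum_congr rfl fun _ _ => sum_congr rfl fun _ _ => by ring
  · congr 1
    · exact sum_congr rfl fun _ _ => by ring
    · exact sum_congr rfl fun _ _ => sum_congr rfl fun _ _ => by ring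

end DiffusionOp

/-- The equation `u_t = a(u) 𝒟 u + Q(x, u)` with `t` and `u` in given intervals. -/
def ParabolicEquation.ofForm (A : PEq n X) (hm : 0 < m) {a : ℝ → ℝ}
    (hc : ContinuousOn a A.Ω) (ha : ∀ u ∈ A.Ω, 0 < a u) {𝒟 : DiffusionOp m Y} (h𝒟 : 𝒟.IsSmooth)
    {Q : Y → ℝ → ℝ} (hQ : ContinuousOn (fun p : Y × ℝ => Q p.1 p.2) (univ ×ˢ A.Ω)) :
    PEq m Y where
  T := A.T
  Ω := A.Ω
  isOpen_T := A.isOpen_T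
  isOpen_Ω := A.isOpen_Ω
  ordConnected_T := A.ordConnected_T
  ordConnected_Ω := A.ordConnected_Ω
  nonempty_T := A.nonempty_T
  nonempty_Ω := A.nonempty_Ω
  dim_pos := hm
  op _ y w := a (w y) * 𝒟.op w y + Q y (w y)
  parabolic y0 := by
    have hs := fun {y} (hy : y ∈ (chart m y0).source) (k : Fin m) =>
      DiffusionOp.eventually_contMDiffAt_extChartAt_coord hy k
    have hc' : ContinuousOn (fun p : ℝ × Y × ℝ => a p.2.2) (A.T ×ˢ (chart m y0).source ×ˢ A.Ω) :=
      hc.comp (by fun_prop) fun p hp => hp.2.2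
    have hy : ∀ {f : Y → ℝ}, (∀ y ∈ (chart m y0).source, ContinuousAt f y) →
        ContinuousOn (fun p : ℝ × Y × ℝ => f p.2.1) (A.T ×ˢ (chart m y0).source ×ˢ A.Ω) := fun hf =>
      ContinuousOn.comp (t := (chart m y0).source)
        (fun y hy => (hf y hy).continuousWithinAt) (by fun_prop) fun p hp => hp.2.1
    refine ⟨_, extChartAt_source_mem_nhds y0, subset_rfl, fun p => a p.2.2 • 𝒟.chartMat y0 p.2.1,
      fun _ => 0, fun p k => a p.2.2 * 𝒟.op (fun y => chart m y0 y k) p.2.1,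
      fun p => Q p.2.1 p.2.2, ?_, continuousOn_const, ?_, ?_, ?_, ?_⟩
    · exact continuousOn_pi.2 fun k => continuousOn_pi.2 fun l => hc'.mul
        (hy fun y hy => (h𝒟.contMDiffAt_gamma (hs hy k) (hs hy l)).continuousAt)
    · exact continuousOn_pi.2 fun k => hc'.mul (hy fun y hy => (h𝒟 y _ (hs hy k)).continuousAt)
    · exact hQ.comp (f := fun p : ℝ × Y × ℝ => (p.2.1, p.2.2)) (by fun_prop)
        fun p hp => ⟨trivial, hp.2.2⟩
    · intro p hp
      exact ⟨(𝒟.posDef_gamma (contMDiffAt_extChartAt_of_mem hp.2.1)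
        (DiffusionOp.surjective_mfderiv_extChartAt hp.2.1)).smul (ha _ hp.2.2),
        Matrix.isSymm_zero⟩
    · intro t ht y hy w hw hwy
      have h1 := 𝒟.op_comp_coord (contMDiffAt_extChartAt_of_mem (I := 𝓡 m) hy)
        (h := w ∘ (chart m y0).symm) ((hw.contDiffAt_comp_extChartAt_symm hy).of_le two_le_infty)
      have e : (w ∘ (chart m y0).symm) ∘ chart m y0 =ᶠ[𝓝 y] w := by
        filter_upwards [(isOpen_extChartAt_source y0).mem_nhds hy] with y' hy'
        exact congrArg w ((chart m y0).left_inv hy')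
      rw [𝒟.op_congr e] at h1
      rw [h1]
      simp only [pderiv₁, pderiv₂, DiffusionOp.chartMat, Matrix.smul_apply, Matrix.of_apply,
        smul_eq_mul, mul_add, mul_sum, mul_assoc, Matrix.zero_apply, zero_mul,
        Finset.sum_const_zero, add_zero]

end Descent

/-! ### Construction of isomorphisms -/

section Isomorphisms

variable {n m : ℕ} {X Y : Type*} [TopologicalSpace X] [ChartedSpace 𝔼 n X]
  [TopologicalSpace Y] [ChartedSpace 𝔼 m Y]
  [IsManifold (𝓡 n) ∞ X] [IsManifold (𝓡 m) ∞ Y]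

section Transport

variable {B : PEq n X} {B' : PEq m Y} {J : ℝ × X × ℝ → ℝ × Y × ℝ}
  {K : ℝ × Y × ℝ → ℝ × X × ℝ} (hJ : ∀ p ∈ B.space, SmAt (txuModel n) (txuModel m) J p)
  (hK : ∀ p ∈ B'.space, SmAt (txuModel m) (txuModel n) K p)
  (hJB : ∀ p ∈ B.space, J p ∈ B'.space) (hKB : ∀ p ∈ B'.space, K p ∈ B.space)
  (hKJ : ∀ p ∈ B.space, K (J p) = p) (hJK : ∀ p ∈ B'.space, J (K p) = p)
include hJ hK hJB hKB hKJ hJK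

lemma hasLocalSection_of_inverse {p : ℝ × X × ℝ} (hp : p ∈ B.space) :
    HasLocalSection (txuModel n) (txuModel m) J p :=
  ⟨K, by filter_upwards [B'.isOpen_space.mem_nhds (hJB p hp)] with q hq using hK q hq, hKJ p hp,
    by filter_upwards [B'.isOpen_space.mem_nhds (hJB p hp)] with q hq using hJK q hq⟩

/-- Reversal of the direction in which a diffeomorphism relates two hypersurfaces. -/
lemma eventually_mem_iff_inverse {L : Hyp n X} {L' : Hyp m Y} (hL' : L'.pt ∈ B'.space)
    (hpt : L.pt = K L'.pt) (hc : Corr K L' L) : L'.pt = J L.pt ∧ Corr J L L' := by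
  have h : J L.pt = L'.pt := by rw [hpt, hJK _ hL']
  have hL : L.pt ∈ B.space := hpt ▸ hKB _ hL'
  have hJt := (hJ _ hL).continuousAt.tendsto
  rw [h] at hJt
  refine ⟨h.symm, ?_⟩
  filter_upwards [hJt.eventually hc, B.isOpen_space.mem_nhds hL] with q h1 h2
  rw [h1, hKJ q h2]

/-- A diffeomorphism that maps the graphs satisfying one equation to jets of the other one maps the
extended equation into the extended equation. -/
lemma mem_extended_of_graphs (h : ∀ (L : Hyp n X) (L' : Hyp m Y) (u : ℝ × X → ℝ), L.pt ∈ B.space →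
      L'.pt = J L.pt → Corr J L L' → L.IsGraph u →
      L.jet ∈ B.extended → L'.jet ∈ B'.extended)
    {L : Hyp n X}
    {L' : Hyp m Y} (hL : L.pt ∈ B.space)
    (hpt : L'.pt = J L.pt) (hc : Corr J L L')
    (hmem : L.jet ∈ B.extended) : L'.jet ∈ B'.extended := by
  have key := jet_mem_closure_of_map (A := B.graphJets) (A' := B'.extended) B.isOpen_space
    B'.isOpen_space hJ hK hJB hKJ hJK ?_ hL hpt
        (eventually_mem_iff_inverse hK hJ hKB hJB hJK hKJ hL hpt hc).2 hmem
  · rwa [extended, closure_closure] at key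
  · rintro M M' hM hMpt hMc ⟨L0, U, u, hj, h0, hUo, hU, hu, hg, he⟩
    have hMc' := (eventually_mem_iff_inverse hJ hK hJB hKB hKJ hJK (hMpt ▸ hJB _ hM)
      (by rw [hMpt, hKJ _ hM]) hMc).2
    have hpt0 : M.pt = L0.pt := (PointedHypersurface.jet_eq_iff.1 hj).1
    have hs : Surjective (mfderiv (txuModel m) (txuModel n) K (J L0.pt)) :=
      (hasLocalSection_of_inverse hK hJ hKB hJB hJK hKJ (hJB _ h0)).surjective_mfderiv
        ((hK _ (hJB _ h0)).mdiffAt)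
    let L1 := L0.map J K (by
      filter_upwards [B'.isOpen_space.mem_nhds (hJB _ h0)] with q hq using hK q hq) (hKJ _ h0) hs
    have hc₁ : Corr J L0 L1 := by
      filter_upwards [B.isOpen_space.mem_nhds h0] with q hq
      change _ ↔ K (J q) ∈ L0.carrier
      rw [hKJ q hq]
    have h1 : L1.jet ∈ B'.extended := h L0 L1 u h0 rfl hc₁
      ⟨by filter_upwards [hUo.mem_nhds hU] with q hq using hu.contMDiffAt (hUo.mem_nhds hq), hg⟩
      (hj ▸ B.graphJets_subset_extended ⟨L0, U, u, hj, h0, hUo, hU, hu, hg, he⟩)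
    rwa [PointedHypersurface.jet_eq_of_map hj hMpt rfl (hJ _ hM) (hK _ (hJB _ hM)) (hKJ _ hM)
      (by filter_upwards [B'.isOpen_space.mem_nhds (hJB _ hM)] with q hq using hJK q hq) hMc' hc₁]

lemma isPEMorphism_of_inverse (h : ∀ (L : Hyp n X) (L' : Hyp m Y), L.pt ∈ B.space → L'.pt = J L.pt →
      Corr J L L' → (L.jet ∈ B.extended ↔ L'.jet ∈ B'.extended)) : IsPEMorphism B B' J where
  smooth p hp := (hJ p hp).contMDiffWithinAt
  image_eq := (image_subset_iff.2 hJB).antisymm fun q hq => ⟨K q, hKB q hq, hJK q hq⟩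
  submersion p hp := (hasLocalSection_of_inverse hJ hK hJB hKB hKJ hJK hp).surjective_mfderiv
    ((hJ p hp).mdiffAt)
  jets := h

lemma isPEIso_of_graphs (h : ∀ (L : Hyp n X) (L' : Hyp m Y), L.pt ∈ B.space → L'.pt = J L.pt →
      Corr J L L' →
      ((∃ u, L.IsGraph u) ∨ ∃ u, L'.IsGraph u) → (L.jet ∈ B.extended ↔ L'.jet ∈ B'.extended)) :
    IsPEIso B B' J := by
  have hm (L : Hyp n X) (L' : Hyp m Y) : L.pt ∈ B.space → L'.pt = J L.pt → Corr J L L' →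
      (L.jet ∈ B.extended ↔ L'.jet ∈ B'.extended) := by
    intro hL hpt hc
    refine ⟨mem_extended_of_graphs hJ hK hJB hKB hKJ hJK (fun M M' u h1 h2 h3 h4 h5 =>
      (h M M' h1 h2 h3 (Or.inl ⟨u, h4⟩)).1 h5) hL hpt hc, ?_⟩
    obtain ⟨e1, e2⟩ := eventually_mem_iff_inverse hK hJ hKB hJB hJK hKJ hL hpt hc
    refine mem_extended_of_graphs hK hJ hKB hJB hJK hKJ (fun M M' u h1 h2 h3 h4 h5 => ?_)
        (hpt ▸ hJB _ hL) e1 e2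
    obtain ⟨e3, e4⟩ := eventually_mem_iff_inverse hJ hK hJB hKB hKJ hJK h1 h2 h3
    exact (h M' M (h2 ▸ hKB _ h1) e3 e4 (Or.inr ⟨u, h4⟩)).2 h5
  refine ⟨isPEMorphism_of_inverse hJ hK hJB hKB hKJ hJK hm, K,
    isPEMorphism_of_inverse hK hJ hKB hJB hJK hKJ fun L L' hL hpt hc => ?_, hKJ, hJK⟩
  obtain ⟨e3, e4⟩ := eventually_mem_iff_inverse hJ hK hJB hKB hKJ hJK hL hpt hc
  exact (hm L' L (hpt ▸ hKB _ hL) e3 e4).symm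

end Transport

/-- The preimage of a hypersurface under a submersion. -/
lemma PointedHypersurface.exists_comap {F : ℝ × X × ℝ → ℝ × Y × ℝ} {p : ℝ × X × ℝ}
    (hF : ∀ᶠ q in 𝓝 p, SmAt (txuModel n) (txuModel m) F q)
    (hs : Surjective (mfderiv (txuModel n) (txuModel m) F p)) {L' : Hyp m Y} (hpt : L'.pt = F p) : ∃
    L : Hyp n X, L.pt = p ∧ L.carrier = F ⁻¹' L'.carrier := by
  obtain ⟨f, hf⟩ := L'.exists_equation
  rw [hpt] at hf
  exact ⟨⟨p, F ⁻¹' L'.carrier, f ∘ F, hf.comp hF hs (.of_forall fun q => Iff.rfl)⟩, rfl, rfl⟩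

lemma IsPEMorphism.comp {k : ℕ} {Z : Type*} [TopologicalSpace Z]
    [ChartedSpace 𝔼 k Z] [IsManifold (𝓡 k) ∞ Z]
    {A : PEq n X} {B : PEq m Y} {C : PEq k Z}
    {F : ℝ × X × ℝ → ℝ × Y × ℝ} {J : ℝ × Y × ℝ → ℝ × Z × ℝ} (hJ : IsPEMorphism B C J)
    (hF : IsPEMorphism A B F) : IsPEMorphism A C (J ∘ F) where
  smooth p hp := ((hJ.contMDiffAt (hF.map_mem hp)).comp p (hF.contMDiffAt hp)).contMDiffWithinAt
  image_eq := by rw [image_comp, hF.image_eq, hJ.image_eq]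
  submersion p hp := by
    rw [mfderiv_comp p ((hJ.contMDiffAt (hF.map_mem hp)).mdiffAt) ((hF.contMDiffAt hp).mdiffAt)]
    exact (hJ.submersion _ (hF.map_mem hp)).comp (hF.submersion p hp)
  jets L L' hL hpt hc := by
    have hFL := hF.map_mem hL
    obtain ⟨M, hM, hMc⟩ := PointedHypersurface.exists_comap (hJ.eventually_contMDiffAt hFL)
      (hJ.submersion _ hFL) (L' := L') hpt
    rw [hF.jets L M hL hM (by rw [hMc]; exact hc), hJ.jets M L' (hM ▸ hFL) (by rw [hM]; exact hpt)
      (by rw [hMc]; exact Eventually.of_forall fun q => Iff.rfl)]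

end Isomorphisms

/-! ### The components of a morphism -/

section Morphisms

variable {n m : ℕ} {X Y : Type*} [TopologicalSpace X] [ChartedSpace 𝔼 n X]
  [TopologicalSpace Y] [ChartedSpace 𝔼 m Y]

/-- The time component `τ` of a morphism `(t, x, u) ↦ (τ(t), y(t, x), v(t, x, u))`. -/
def timeMap [Nonempty X] (A : PEq n X) (F : ℝ × X × ℝ → ℝ × Y × ℝ) (t : ℝ) : ℝ :=
  (F (t, Classical.arbitrary X, A.nonempty_Ω.some)).1

/-- The space component `y` of a morphism `(t, x, u) ↦ (τ(t), y(t, x), v(t, x, u))`. -/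
def spaceMap (A : PEq n X) (F : ℝ × X × ℝ → ℝ × Y × ℝ) (t : ℝ) (x : X) : Y :=
  (F (t, x, A.nonempty_Ω.some)).2.1

/-- The inverse of `u ↦ v(t, x, u)` for a morphism `(t, x, u) ↦ (τ(t), y(t, x), v(t, x, u))`, as a
function of `(t, x, v)`. -/
def valInv (A : PEq n X) (F : ℝ × X × ℝ → ℝ × Y × ℝ) (q : ℝ × X × ℝ) : ℝ :=
  Function.invFunOn (fun u => (F (q.1, q.2.1, u)).2.2) A.Ω q.2.2

/-- The interval of values of the new dependent variable over a point `(t, x)`. -/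
def valRange (A : PEq n X) (F : ℝ × X × ℝ → ℝ × Y × ℝ) (t : ℝ) (x : X) : Set ℝ :=
  (fun u => 𝓋 t x u) '' A.Ω

/-- The part of an equation that is linear in the derivatives of the unknown function, with
coefficients taken at fixed `t` and `u`. -/
def ParabolicEquation.frozen (B : PEq m Y) {t v : ℝ} (ht : t ∈ B.T) (hv : v ∈ B.Ω) :
    DiffusionOp m Y where
  mat y := (B.coeffs y).b (t, y, v)
  drift y := (B.coeffs y).b₁ (t, y, v)
  posDef y := (B.coeffs y).posDef _ ⟨ht, (B.coeffs y).mem_W, hv⟩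

/-- The part of an equation that is quadratic in the first derivatives. -/
def ParabolicEquation.quad (B : PEq m Y) (t v : ℝ) (k : Y → ℝ) (y : Y) : ℝ :=
  ∑ i, ∑ j, (B.coeffs y).c (t, y, v) i j * pd₁ k y i * pd₁ k y j

variable [IsManifold (𝓡 n) ∞ X] [IsManifold (𝓡 m) ∞ Y]
  {A : PEq n X} {B : PEq m Y} {F : ℝ × X × ℝ → ℝ × Y × ℝ}
  {a : ℝ → ℝ} {𝒟 : DiffusionOp n X} {q : X → ℝ → ℝ}

lemma ContMDiffAt.const_mul_fun {k : Y → ℝ} {y : Y} (hk : SmoothAt m k y) (s : ℝ) :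
    SmoothAt m (fun z => s * k z) y :=
  contMDiffAt_const.mul hk

lemma ContMDiffAt.const_add_mul_fun {k : Y → ℝ} {y : Y} (hk : SmoothAt m k y)
    (v s : ℝ) : SmoothAt m (fun z => v + s * k z) y :=
  contMDiffAt_const.add (hk.const_mul_fun s)

lemma pd₁_const_add_mul {k : Y → ℝ} {y : Y} (hk : SmoothAt m k y) (v s : ℝ)
    (i : Fin m) : pd₁ (fun z => v + s * k z) y i = s * pd₁ k y i := by
  rw [pd₁_add contMDiffAt_const (hk.const_mul_fun s), pd₁_const, zero_add, pd₁_const_mul s hk]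

lemma pd₂_const_add_mul {k : Y → ℝ} {y : Y} (hk : SmoothAt m k y) (v s : ℝ)
    (i j : Fin m) : pd₂ (fun z => v + s * k z) y i j = s * pd₂ k y i j := by
  rw [pd₂_add contMDiffAt_const (hk.const_mul_fun s), pd₂_const, zero_add, pd₂_const_mul s hk]

lemma ParabolicEquation.op_const_add_mul (B : PEq m Y) {t v : ℝ} (ht : t ∈ B.T) (hv : v ∈ B.Ω)
    {k : Y → ℝ} {y : Y} (hk : SmoothAt m k y) (hk0 : k y = 0) (s : ℝ) : B.op t y
    (fun z => v + s * k z) = (B.coeffs y).q (t, y, v) + s * (B.frozen ht hv).op k y + s ^ 2 * B.quad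
    t v k y := by
  have h0 : v + s * k y = v := by rw [hk0]; ring
  rw [(B.coeffs y).op_eq t ht y (B.coeffs y).mem_W _
    (hk.const_add_mul_fun v s) (by rw [h0]; exact hv), h0]
  have e1 : ∀ i : Fin m, pderiv₁ y (fun z => v + s * k z) y i = s * pd₁ k y i :=
    pd₁_const_add_mul hk v s
  have e2 : ∀ i j : Fin m, pderiv₂ y (fun z => v + s * k z) y i j = s * pd₂ k y i j :=
    pd₂_const_add_mul hk v s
  simp only [e1, e2, DiffusionOp.op, quad, frozen, smul_eq_mul, mul_add, mul_sum]
  rw [sum_congr rfl fun i _ => sum_congr rfl fun j _ =>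
      show (B.coeffs y).b (t, y, v) i j * (s * pd₂ k y i j) =
        s * ((B.coeffs y).b (t, y, v) i j * pd₂ k y i j) by ring,
    sum_congr rfl fun i _ => sum_congr rfl fun j _ =>
      show (B.coeffs y).c (t, y, v) i j * (s * pd₁ k y i) * (s * pd₁ k y j) =
        s ^ 2 * ((B.coeffs y).c (t, y, v) i j * pd₁ k y i * pd₁ k y j) by ring,
    sum_congr rfl fun i _ =>
      show (B.coeffs y).b₁ (t, y, v) i * (s * pd₁ k y i) =
        s * ((B.coeffs y).b₁ (t, y, v) i * pd₁ k y i) by ring]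
  ring

lemma ParabolicEquation.HasForm.op_const_add_mul (hA : A.HasForm a 𝒟 q) {t v : ℝ} (ht : t ∈ A.T)
    (hv : v ∈ A.Ω) {k : X → ℝ} {x : X} (hk : SmoothAt n k x) (hk0 : k x = 0)
    (s : ℝ) : A.op t x (fun z => v + s * k z) = q x v + s * (a v * 𝒟.op k x) + s ^ 2 * 0 := by
  have h0 : v + s * k x = v := by rw [hk0]; ring
  rw [hA t ht x _ (hk.const_add_mul_fun v s) (by rw [h0]; exact hv), h0,
    𝒟.op_add contMDiffAt_const (hk.const_mul_fun s), 𝒟.op_const, 𝒟.op_const_mul s hk]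
  ring

variable [ConnectedSpace X] [T2Space Y]

namespace IsPEMorphism

variable (hF : IsPEMorphism A B F) {t : ℝ} (ht : t ∈ A.T)
include hF ht

lemma fst_eq_timeMap (x : X) {u : ℝ} (hu : u ∈ A.Ω) : (F (t, x, u)).1 = τmap t :=
  hF.fst_eq ht hu A.nonempty_Ω.some_mem

lemma snd_fst_eq_spaceMap (x : X) {u : ℝ} (hu : u ∈ A.Ω) : (F (t, x, u)).2.1 = ymap t x :=
  hF.snd_fst_eq ht x hu A.nonempty_Ω.some_mem

lemma timeMap_mem : τmap t ∈ B.T := by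
  have h := hF.map_mem (p := (t, Classical.arbitrary X, A.nonempty_Ω.some))
    (mem_space.2 ⟨ht, A.nonempty_Ω.some_mem⟩)
  exact (mem_space.1 h).1

lemma val_mem (x : X) {u : ℝ} (hu : u ∈ A.Ω) : 𝓋 t x u ∈ B.Ω :=
  (mem_space.1 (hF.map_mem (p := (t, x, u)) (mem_space.2 ⟨ht, hu⟩))).2

lemma contMDiffAt_timeMap : SmAt 𝓘₁ 𝓘₁ (τmap) t :=
  contMDiffAt_fst.comp t ((hF.contMDiffAt (p := (t, Classical.arbitrary X, A.nonempty_Ω.some))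
    (mem_space.2 ⟨ht, A.nonempty_Ω.some_mem⟩)).comp t (contMDiffAt_id.prodMk contMDiffAt_const))

lemma contMDiffAt_spaceMap (x : X) : SmAt (txM n) (𝓡 m) (fun q : ℝ × X => ymap q.1 q.2) (t, x) :=
  contMDiffAt_fst.comp (t, x) (contMDiffAt_snd.comp (t, x)
    ((hF.contMDiffAt (p := (t, x, A.nonempty_Ω.some)) (mem_space.2 ⟨ht, A.nonempty_Ω.some_mem⟩)).comp
      (t, x) (contMDiffAt_fst.prodMk (contMDiffAt_snd.prodMk contMDiffAt_const))))

lemma contMDiffAt_spaceMap_slice (x : X) : SmAt (𝓡 n) (𝓡 m) (ymap t) x :=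
  (hF.contMDiffAt_spaceMap ht x).comp x (contMDiffAt_const.prodMk contMDiffAt_id)

lemma contMDiffAt_spaceMap_time (x : X) : SmAt 𝓘₁ (𝓡 m) (fun s => ymap s x) t :=
  ContMDiffAt.comp (g := fun q : ℝ × X => ymap q.1 q.2) (f := fun s : ℝ => (s, x)) t
    (hF.contMDiffAt_spaceMap ht x) (contMDiffAt_id.prodMk contMDiffAt_const)

lemma contMDiffAt_val (x : X) {u : ℝ} (hu : u ∈ A.Ω) :
    SmAt (txuModel n) 𝓘₁ (fun q => (F q).2.2) (t, x, u) :=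
  contMDiffAt_snd.comp _ (contMDiffAt_snd.comp _
    (hF.contMDiffAt (p := (t, x, u)) (mem_space.2 ⟨ht, hu⟩)))

lemma differentiableAt_txuRep (x : X) {u : ℝ} (hu : u ∈ A.Ω) :
    DifferentiableAt ℝ (txuRep n m x (F (t, x, u)).2.1 F) (t, chart n x x, u) := by
  have h := ((hF.contMDiffAt (p := (t, x, u)) (mem_space.2 ⟨ht, hu⟩)).contDiffAt_chart
    (c := (0, x, 0)) (c' := (0, (F (t, x, u)).2.1, 0)) (mem_txuChart_source.2 (mem_extChartAt_source _))
    (mem_txuChart_source.2 (mem_extChartAt_source _))).diffAt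
  rwa [extChartAt_txu_apply] at h

lemma deriv_val_ne_zero (x : X) {u : ℝ} (hu : u ∈ A.Ω) : deriv (fun u => 𝓋 t x u) u ≠ 0 := by
  have h := (hF.mfderiv_eU (p := (t, x, u)) (mem_space.2 ⟨ht, hu⟩) rfl).2.1
  rw [show txuChart n x (t, x, u) = (t, chart n x x, u) from extChartAt_txu_apply _ _] at h
  have hc : HasDerivAt (fun u : ℝ => ((t, chart n x x, u) : ℝ × 𝔼 n × ℝ)) eU u :=
    (hasDerivAt_const u t).prodMk ((hasDerivAt_const u _).prodMk (hasDerivAt_id u))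
  have h1 := (hF.differentiableAt_txuRep ht x hu).hasFDerivAt.comp_hasDerivAt u hc
  have h2 := (coordU m).hasFDerivAt.comp_hasDerivAt u h1
  have h3 : (coordU m ∘ txuRep n m x (F (t, x, u)).2.1 F ∘
      fun u : ℝ => ((t, chart n x x, u) : ℝ × 𝔼 n × ℝ)) =
      fun u => 𝓋 t x u := by
    funext u'
    simp only [Function.comp, txuRep, extChartAt_txu_apply, extChartAt_txu_symm_apply,
      extChartAt_to_inv]
    rfl
  rw [h3] at h2
  rwa [h2.deriv]

lemma deriv_timeMap_ne_zero : deriv (τmap) t ≠ 0 := by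
  set x := Classical.arbitrary X
  set u := A.nonempty_Ω.some
  have hu : u ∈ A.Ω := A.nonempty_Ω.some_mem
  have h := (hF.mfderiv_eU (p := (t, x, u)) (mem_space.2 ⟨ht, hu⟩) rfl).2.2
  rw [show txuChart n x (t, x, u) = (t, chart n x x, u) from extChartAt_txu_apply _ _] at h
  have hc : HasDerivAt (fun t : ℝ => ((t, chart n x x, u) : ℝ × 𝔼 n × ℝ)) eT t :=
    (hasDerivAt_id t).prodMk ((hasDerivAt_const t _).prodMk (hasDerivAt_const t _))
  have h1 := (hF.differentiableAt_txuRep ht x hu).hasFDerivAt.comp_hasDerivAt t hc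
  have h2 := (fst ℝ ℝ (𝔼 m × ℝ)).hasFDerivAt.comp_hasDerivAt t h1
  have h3 : (fst ℝ ℝ (𝔼 m × ℝ) ∘ txuRep n m x (F (t, x, u)).2.1 F ∘
      fun t : ℝ => ((t, chart n x x, u) : ℝ × 𝔼 n × ℝ)) =
      τmap := by
    funext t'
    simp only [Function.comp, txuRep, extChartAt_txu_apply, extChartAt_txu_symm_apply,
      extChartAt_to_inv]
    rfl
  rw [h3] at h2
  rwa [h2.deriv]

lemma injOn_val (x : X) : InjOn (fun u => 𝓋 t x u) A.Ω :=
  injOn_of_deriv_ne_zero A.ordConnected_Ω fun _ hu => hF.deriv_val_ne_zero ht x hu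

lemma valInv_val (x : X) {u : ℝ} (hu : u ∈ A.Ω) : uinv (t, x, 𝓋 t x u) = u :=
  (hF.injOn_val ht x).leftInvOn_invFunOn hu

omit ht in
lemma injOn_timeMap : InjOn (τmap) A.T :=
  injOn_of_deriv_ne_zero A.ordConnected_T fun _ h => hF.deriv_timeMap_ne_zero h

lemma eq_of_map_eq {t' : ℝ} (ht' : t' ∈ A.T) (x x' : X) {u u' : ℝ} (hu : u ∈ A.Ω) (hu' : u' ∈ A.Ω) :
    F (t, x, u) = F (t', x', u') ↔ t = t' ∧ ymap t x = ymap t x' ∧ 𝓋 t x u = 𝓋 t x' u' := by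
  constructor
  · intro h
    have h1 : t = t' := hF.injOn_timeMap ht ht' (by
      rw [← hF.fst_eq_timeMap ht x hu, ← hF.fst_eq_timeMap ht' x' hu', h])
    subst h1
    refine ⟨rfl, ?_, by rw [h]⟩
    rw [← hF.snd_fst_eq_spaceMap ht x hu, ← hF.snd_fst_eq_spaceMap ht x' hu', h]
  · rintro ⟨rfl, h2, h3⟩
    refine Prod.ext ?_ (Prod.ext ?_ h3)
    · rw [hF.fst_eq_timeMap ht x hu, hF.fst_eq_timeMap ht x' hu']
    · rw [hF.snd_fst_eq_spaceMap ht x hu, hF.snd_fst_eq_spaceMap ht x' hu', h2]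

/-- The inverse `valInv` is smooth. -/
lemma eventually_valInv (x : X) {u : ℝ} (hu : u ∈ A.Ω) : ∀ᶠ q in 𝓝 (t, x, 𝓋 t x u), SmAt
    (txuModel n) 𝓘₁ (uinv) q ∧ uinv q ∈ A.Ω ∧ (F (q.1, q.2.1, uinv q)).2.2 = q.2.2 := by
  have hev : ∀ᶠ q in 𝓝 ((t, x, u) : ℝ × X × ℝ), SmAt (txuModel n) 𝓘₁ (fun q => (F q).2.2) q := by
    filter_upwards [A.isOpen_space.mem_nhds (show (t, x, u) ∈ A.space from mem_space.2 ⟨ht, hu⟩)]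
      with q hq
    exact hF.contMDiffAt_val (mem_space.1 hq).1 q.2.1 (mem_space.1 hq).2
  have hne : fderiv ℝ ((fun q => (F q).2.2) ∘ (χ (txuModel n) ((t, x, u) : ℝ × X × ℝ)).symm)
      (χ (txuModel n) ((t, x, u) : ℝ × X × ℝ) (t, x, u)) (0, 0, 1) ≠ 0 := by
    have hd := (hev.self_of_nhds.contDiffAt_comp_extChartAt_symm
      (mem_extChartAt_source ((t, x, u) : ℝ × X × ℝ))).diffAt
    rw [extChartAt_txu_apply _ _] at hd ⊢
    have hc : HasDerivAt (fun u : ℝ => ((t, chart n x x, u) : ℝ × 𝔼 n × ℝ)) (0, 0, 1) u :=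
      (hasDerivAt_const u t).prodMk ((hasDerivAt_const u _).prodMk (hasDerivAt_id u))
    have h1 := hd.hasFDerivAt.comp_hasDerivAt u hc
    have h3 : (((fun q => (F q).2.2) ∘ (χ (txuModel n) ((t, x, u) : ℝ × X × ℝ)).symm) ∘
        fun u : ℝ => ((t, chart n x x, u) : ℝ × 𝔼 n × ℝ)) =
        fun u => 𝓋 t x u := by
      funext u'
      simp only [Function.comp, extChartAt_txu_symm_apply, extChartAt_to_inv]
    rw [h3] at h1
    rw [← h1.deriv]
    exact hF.deriv_val_ne_zero ht x hu
  obtain ⟨g, g1, g2, g3, -⟩ := exists_implicit_txu hev hne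
  have hgΩ : ∀ᶠ q in 𝓝 (t, x, 𝓋 t x u), g q ∈ A.Ω :=
    g1.self_of_nhds.continuousAt.eventually (by rw [g2]; exact A.isOpen_Ω.mem_nhds hu)
  have heq : ∀ᶠ q in 𝓝 (t, x, 𝓋 t x u), uinv q = g q := by
    filter_upwards [g3, hgΩ, continuousAt_fst.eventually (A.isOpen_T.mem_nhds ht)] with q h1 h2 h3
    have h4 := hF.valInv_val h3 q.2.1 h2
    rwa [h1] at h4
  filter_upwards [heq.eventually_nhds, g1, g3, hgΩ] with q h1 h2 h3 h4
  refine ⟨h2.congr_of_eventuallyEq h1, ?_, ?_⟩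
  · rwa [h1.self_of_nhds]
  · rwa [h1.self_of_nhds]

lemma contMDiffAt_valInv (x : X) {u : ℝ} (hu : u ∈ A.Ω) :
    SmAt (txuModel n) 𝓘₁ (uinv) (t, x, 𝓋 t x u) :=
  (hF.eventually_valInv ht x hu).self_of_nhds.1

lemma contMDiffAt_prodMap (x : X) :
    SmAt (txM n) (txM m) (fun q : ℝ × X => (τmap q.1, ymap q.1 q.2)) (t, x) :=
  ((hF.contMDiffAt_timeMap ht).comp (t, x) contMDiffAt_fst).prodMk (hF.contMDiffAt_spaceMap ht x)

omit ht in
/-- The preimage of the graph of `w` is the graph of `u(t, x, w(τ(t), y(t, x)))`. -/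
lemma isGraph_of_map {L : Hyp n X} {L' : Hyp m Y} (hL : L.pt ∈ A.space) (hpt : L'.pt = F L.pt)
    (hc : Corr F L L') {w : ℝ × Y → ℝ} (hw : L'.IsGraph w) :
    L.IsGraph fun q => uinv (q.1, q.2, w (τmap q.1, ymap q.1 q.2)) := by
  obtain ⟨⟨t, x, u⟩, L, hLe⟩ := L
  obtain ⟨ht, hu⟩ : t ∈ A.T ∧ u ∈ A.Ω := mem_space.1 hL
  have hF2 := hF.snd_fst_eq_spaceMap ht x hu
  have hw0 := hw.apply
  have hws := hw.1
  have hwc := hw.2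
  rw [hpt] at hw0 hws hwc
  change w ((F (t, x, u)).1, (F (t, x, u)).2.1) = 𝓋 t x u at hw0
  change ∀ᶠ q in 𝓝 ((F (t, x, u)).1, (F (t, x, u)).2.1), _ at hws
  rw [hF.fst_eq_timeMap ht x hu, hF2] at hw0 hws
  have hc1 := hF.contMDiffAt_prodMap ht x
  have ht2 : Tendsto (fun q : ℝ × X => (q.1, q.2, w (τmap q.1, ymap q.1 q.2)))
      (𝓝 (t, x)) (𝓝 (t, x, 𝓋 t x u)) := by
    rw [← hw0]
    exact continuousAt_fst.prodMk (continuousAt_snd.prodMk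
      (ContinuousAt.comp (g := w) hws.self_of_nhds.continuousAt hc1.continuousAt))
  have hval := ht2.eventually (hF.eventually_valInv ht x hu)
  refine ⟨?_, ?_⟩
  · filter_upwards [continuousAt_fst.eventually (A.isOpen_T.mem_nhds ht), hval,
      hc1.continuousAt.eventually hws] with q e1 e2 e3
    exact e2.1.comp q (contMDiffAt_fst.prodMk
      (contMDiffAt_snd.prodMk (e3.comp q (hF.contMDiffAt_prodMap e1 q.2))))
  · have hpr : Tendsto (fun q : ℝ × X × ℝ => (q.1, q.2.1)) (𝓝 (t, x, u)) (𝓝 (t, x)) :=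
      Continuous.tendsto (by fun_prop) _
    filter_upwards [hc, A.isOpen_space.mem_nhds hL, hpr.eventually hval,
      (hF.contMDiffAt hL).continuousAt.eventually hwc] with q e0 e1 e2 e3
    obtain ⟨h3, h4⟩ := mem_space.1 e1
    rw [e0, e3, hF.fst_eq_timeMap h3 _ h4, hF.snd_fst_eq_spaceMap h3 _ h4]
    refine ⟨fun h => ?_, fun h => ?_⟩
    · rw [← h]
      exact (hF.valInv_val h3 _ h4).symm
    · simpa only [← h] using e2.2.2

/-- Local sections of the maps `x ↦ y(t, x)`, smooth in `t` as well. -/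
lemma exists_section (x : X) : ∃ σ : ℝ × Y → X, σ (t, ymap t x) = x ∧
    (∀ᶠ q in 𝓝 (t, ymap t x), SmAt (txM m) (𝓡 n) σ q) ∧
    ∀ᶠ q in 𝓝 (t, ymap t x), ymap q.1 (σ q) = q.2 := by
  set u := A.nonempty_Ω.some
  have hu : u ∈ A.Ω := A.nonempty_Ω.some_mem
  have hp : (t, x, u) ∈ A.space := mem_space.2 ⟨ht, hu⟩
  obtain ⟨σ, h1, h2, h3⟩ := hasLocalSection_of_surjective_mfderiv (hF.eventually_contMDiffAt hp)
    (hF.submersion _ hp)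
  set ι : ℝ × Y → ℝ × Y × ℝ := fun q => (τmap q.1, q.2, 𝓋 t x u)
  have hι0 : ι (t, ymap t x) = F (t, x, u) := by
    refine Prod.ext ?_ (Prod.ext ?_ rfl)
    · exact (hF.fst_eq_timeMap ht x hu).symm
    · exact (hF.snd_fst_eq_spaceMap ht x hu).symm
  have hιs : ∀ᶠ q in 𝓝 (t, ymap t x), SmAt (txM m) (txuModel m) ι q := by
    filter_upwards [continuousAt_fst.eventually (A.isOpen_T.mem_nhds ht)] with q hq
    exact ((hF.contMDiffAt_timeMap hq).comp q contMDiffAt_fst).prodMk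
      (contMDiffAt_snd.prodMk contMDiffAt_const)
  have hιt : Tendsto ι (𝓝 (t, ymap t x)) (𝓝 (F (t, x, u))) := by
    have := hιs.self_of_nhds.continuousAt.tendsto
    rwa [hι0] at this
  have hσt : Tendsto σ (𝓝 (F (t, x, u))) (𝓝 (t, x, u)) := by
    have := h1.self_of_nhds.continuousAt.tendsto
    rwa [h2] at this
  refine ⟨fun q => (σ (ι q)).2.1, by simp only [hι0, h2], ?_, ?_⟩
  · filter_upwards [hιs, hιt.eventually h1] with q e1 e2
    exact contMDiffAt_fst.comp q (contMDiffAt_snd.comp q (e2.comp q e1))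
  · filter_upwards [continuousAt_fst.eventually (A.isOpen_T.mem_nhds ht), hιt.eventually h3,
      hιt.eventually (hσt.eventually (A.isOpen_space.mem_nhds hp))] with q e1 e2 e3
    obtain ⟨e4, e5⟩ := mem_space.1 e3
    have e8 : (F (σ (ι q))).1 = τmap q.1 := by rw [e2]
    have e9 : (F (σ (ι q))).2.1 = q.2 := by rw [e2]
    have e7 := (hF.snd_fst_eq_spaceMap e4 (σ (ι q)).2.1 e5).symm.trans e9
    rwa [hF.injOn_timeMap e4 e1 ((hF.fst_eq_timeMap e4 (σ (ι q)).2.1 e5).symm.trans e8)] at e7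

lemma hasLocalSection_spaceMap (x : X) : HasLocalSection (𝓡 n) (𝓡 m) (ymap t) x := by
  obtain ⟨σ, h1, h2, h3⟩ := hF.exists_section ht x
  have hc : Tendsto (fun y : Y => (t, y)) (𝓝 (ymap t x)) (𝓝 (t, ymap t x)) :=
    tendsto_const_nhds.prodMk_nhds tendsto_id
  exact ⟨fun y => σ (t, y), (hc.eventually h2).mono fun y hy =>
    hy.comp y (contMDiffAt_const.prodMk contMDiffAt_id), h1, hc.eventually h3⟩

lemma surjective_spaceMap : Surjective (ymap t) := by
  intro y
  have : (τmap t, y, B.nonempty_Ω.some) ∈ B.space :=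
    mem_space.2 ⟨hF.timeMap_mem ht, B.nonempty_Ω.some_mem⟩
  rw [← hF.image_eq] at this
  obtain ⟨⟨t', x, u⟩, hp, h⟩ := this
  obtain ⟨ht', hu⟩ := mem_space.1 hp
  have h1 : t' = t := hF.injOn_timeMap ht' ht (by rw [← hF.fst_eq_timeMap ht' x hu, h])
  subst h1
  exact ⟨x, by rw [← hF.snd_fst_eq_spaceMap ht x hu, h]⟩

/-- The graph of `w(y) + r (t' - τ(t0))` solves the second equation at a point for a suitable `r`.
Its preimage is a graph that solves the first equation. -/
lemma op_valInv_comp (x : X) {u : ℝ} (hu : u ∈ A.Ω) {w : Y → ℝ}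
    (hw : ∀ᶠ y in 𝓝 (ymap t x), SmoothAt m w y) (hwv : w (ymap t x) = 𝓋 t x u) : A.op t x
    (fun x' => uinv (t, x', w (ymap t x'))) = deriv (fun s => uinv (s, x, 𝓋 t x u)) t + deriv
    (fun c => uinv (t, x, c)) 𝓋 t x u *
    (deriv (fun s => w (ymap s x)) t + deriv (τmap) t * B.op (τmap t) (ymap t x) w) := by
  set v := 𝓋 t x u
  set y := ymap t x with hy
  set r := B.op (τmap t) y w
  have hp : (t, x, u) ∈ A.space := mem_space.2 ⟨ht, hu⟩
  have hFp : F (t, x, u) = (τmap t, y, v) :=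
    Prod.ext (hF.fst_eq_timeMap ht x hu) (Prod.ext (hF.snd_fst_eq_spaceMap ht x hu) rfl)
  -- the graph in the second space and its preimage
  let w' : ℝ × Y → ℝ := fun q => w q.2 + r * (q.1 - τmap t)
  have hw's : ∀ᶠ q in 𝓝 (τmap t, y), SmAt (txM m) 𝓘₁ w' q := by
    filter_upwards [continuousAt_snd.eventually hw] with q hq
    have e1 : ContDiff ℝ ∞ (fun s : ℝ => r * (s - τmap t)) := by fun_prop
    exact (hq.comp q contMDiffAt_snd).add (e1.contMDiff.contMDiffAt.comp q contMDiffAt_fst)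
  have hw'0 : w' (τmap t, y) = v := by simp [w', hwv]
  obtain ⟨L', hL', hw'⟩ := PointedHypersurface.exists_isGraph (p := (τmap t, y, v)) hw's hw'0
  obtain ⟨L, hL, hLc⟩ := PointedHypersurface.exists_comap (hF.eventually_contMDiffAt hp)
    (hF.submersion _ hp) (hL'.trans hFp.symm)
  have hpt : L'.pt = F L.pt := by rw [hL, hL', hFp]
  have hc : Corr F L L' := .of_forall fun q => by rw [hLc]; rfl
  set W : ℝ × X → ℝ := fun q => uinv (q.1, q.2, w' (τmap q.1, ymap q.1 q.2))
  have hB' : L'.jet ∈ B.extended := by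
    rw [B.graph_mem_extended_iff (by rw [hpt]; exact hF.map_mem (hL ▸ hp)) hw', hL']
    have e1 : (fun z => w' (τmap t, z)) = w := by funext z; simp [w']
    have e2 : HasDerivAt (fun s => w' (s, y)) r (τmap t) := by
      have h := ((hasDerivAt_id (τmap t)).sub_const (τmap t)).const_mul r
      rw [mul_one] at h
      exact h.const_add (w y)
    rw [e1, e2.deriv]
  have hfin := (A.graph_mem_extended_iff (hL ▸ hp)
      (hF.isGraph_of_map (hL ▸ hp) hpt hc hw')).1 ((hF.jets L L' (hL ▸ hp) hpt hc).2 hB')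
  rw [hL] at hfin
  have e1 : (fun x' => W (t, x')) = fun x' => uinv (t, x', w (ymap t x')) := by
    funext x'; simp [W, w']
  change deriv (fun s => W (s, x)) t = A.op t x (fun x' => W (t, x')) at hfin
  rw [e1] at hfin
  rw [← hfin]
  -- the chain rule
  have hgm : SmAt (𝓘(ℝ, ℝ).prod 𝓘₁) 𝓘₁ (fun q : ℝ × ℝ => uinv (q.1, x, q.2)) (t, v) :=
    ContMDiffAt.comp (g := uinv) (f := fun q : ℝ × ℝ => (q.1, x, q.2)) (t, v)
      (hF.contMDiffAt_valInv ht x hu)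
      (contMDiffAt_fst.prodMk (contMDiffAt_const.prodMk contMDiffAt_snd))
  have hgd : DifferentiableAt ℝ (fun q : ℝ × ℝ => uinv (q.1, x, q.2)) (t, v) := by
    rw [← modelWithCornersSelf_prod, chartedSpaceSelf_prod] at hgm
    exact hgm.contDiffAt.diffAt
  set G := fderiv ℝ (fun q : ℝ × ℝ => uinv (q.1, x, q.2)) (t, v) with hG
  have d1 : HasDerivAt (fun s => uinv (s, x, v)) (G (1, 0)) t :=
    HasFDerivAt.comp_hasDerivAt (l := fun q : ℝ × ℝ => uinv (q.1, x, q.2))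
      (f := fun s => (s, v)) t hgd.hasFDerivAt ((hasDerivAt_id t).prodMk (hasDerivAt_const t v))
  have d2 : HasDerivAt (fun c => uinv (t, x, c)) (G (0, 1)) v :=
    HasFDerivAt.comp_hasDerivAt (l := fun q : ℝ × ℝ => uinv (q.1, x, q.2))
      (f := fun c => (t, c)) v hgd.hasFDerivAt ((hasDerivAt_const v t).prodMk (hasDerivAt_id v))
  have d3 : HasDerivAt (fun s => w (ymap s x)) (deriv (fun s => w (ymap s x)) t) t := by
    have : SmAt 𝓘₁ 𝓘₁ (fun s => w (ymap s x)) t :=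
      hw.self_of_nhds.comp t (hF.contMDiffAt_spaceMap_time ht x)
    exact this.contDiffAt.diffAt.hasDerivAt
  have d5 : HasDerivAt (fun s => w' (τmap s, ymap s x))
      (deriv (fun s => w (ymap s x)) t + r * deriv (τmap) t) t :=
    d3.add (((((hF.contMDiffAt_timeMap ht).contDiffAt.diffAt).hasDerivAt).sub_const _).const_mul r)
  have hgd' : DifferentiableAt ℝ (fun q : ℝ × ℝ => uinv (q.1, x, q.2))
      (t, w' (τmap t, ymap t x)) := by rw [← hy, hw'0]; exact hgd
  have d6 := hgd'.hasFDerivAt.comp_hasDerivAt t ((hasDerivAt_id t).prodMk d5)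
  rw [← hy, hw'0, ← hG] at d6
  have d7 : deriv (fun s => W (s, x)) t =
      G (1, deriv (fun s => w (ymap s x)) t + r * deriv (τmap) t) := d6.deriv
  rw [d7, d1.deriv, d2.deriv]
  have e8 (c : ℝ) : G (1, c) = G (1, 0) + G (0, 1) * c := by
    have : ((1, c) : ℝ × ℝ) = (1, 0) + c • (0, 1) := by simp
    rw [this, map_add, map_smul, smul_eq_mul, mul_comm]
  rw [e8]
  ring

/-! ### Comparison of the coefficients of the two equations -/

lemma contMDiffAt_valInv_slice (x : X) {u : ℝ} (hu : u ∈ A.Ω) :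
    SmAt ((𝓡 n).prod 𝓘₁) 𝓘₁ (fun q : X × ℝ => uinv (t, q.1, q.2)) (x, 𝓋 t x u) :=
  ContMDiffAt.comp (g := uinv) (f := fun q : X × ℝ => (t, q.1, q.2)) _
    (hF.contMDiffAt_valInv ht x hu) (contMDiffAt_const.prodMk (contMDiffAt_fst.prodMk contMDiffAt_snd))

lemma contDiffAt_valInv (x : X) {u : ℝ} (hu : u ∈ A.Ω) :
    ContDiffAt ℝ ∞ (fun v => uinv (t, x, v)) 𝓋 t x u := by
  rw [← contMDiffAt_iff_contDiffAt]
  exact ContMDiffAt.comp (g := uinv) (f := fun v : ℝ => (t, x, v)) _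
    (hF.contMDiffAt_valInv ht x hu) (contMDiffAt_const.prodMk (contMDiffAt_const.prodMk contMDiffAt_id))

lemma contDiffAt_val (x : X) {u : ℝ} (hu : u ∈ A.Ω) : ContDiffAt ℝ ∞ (fun u => 𝓋 t x u) u := by
  rw [← contMDiffAt_iff_contDiffAt]
  exact ContMDiffAt.comp (g := fun q => (F q).2.2) (f := fun u : ℝ => (t, x, u)) _
    (hF.contMDiffAt_val ht x hu) (contMDiffAt_const.prodMk (contMDiffAt_const.prodMk contMDiffAt_id))

lemma deriv_valInv_mul (x : X) {u : ℝ} (hu : u ∈ A.Ω) : ∂uinv t x 𝓋 t x u * deriv (fun u => 𝓋 t x u)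
    u = 1 := by
  have h3 := HasDerivAt.comp (h₂ := fun v => uinv (t, x, v)) (h := fun u => 𝓋 t x u) u
      (((hF.contDiffAt_valInv ht x hu).diffAt).hasDerivAt)
          (((hF.contDiffAt_val ht x hu).diffAt).hasDerivAt)
  have h4 : (fun v => uinv (t, x, v)) ∘ (fun u => 𝓋 t x u) =ᶠ[𝓝 u] id := by
    filter_upwards [A.isOpen_Ω.mem_nhds hu] with u' hu'
    exact hF.valInv_val ht x hu'
  rw [← h3.deriv, h4.deriv_eq]
  exact deriv_id u

lemma deriv_valInv_ne_zero (x : X) {u : ℝ} (hu : u ∈ A.Ω) : ∂uinv t x 𝓋 t x u ≠ 0 :=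
  left_ne_zero_of_mul_eq_one (hF.deriv_valInv_mul ht x hu)

lemma contMDiffAt_comp_spaceMap (x : X) {k : Y → ℝ} (hk : SmoothAt m k (ymap t x)) :
    SmoothAt n k⋄t x :=
  hk.comp x (hF.contMDiffAt_spaceMap_slice ht x)

/-- Both sides of `op_valInv_comp` for the test functions `v + s k` are quadratic polynomials
in `s`; their coefficients are compared. -/
lemma compare_coeffs (hA : A.HasForm a 𝒟 q) (x : X) {u : ℝ} (hu : u ∈ A.Ω) {k : Y → ℝ}
    (hk : ∀ᶠ y in 𝓝 (ymap t x), SmoothAt m k y) (hk0 : k (ymap t x) = 0) {q0 l c : ℝ}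
    (hB : ∀ s : ℝ, B.op (τmap t) (ymap t x) (fun z => 𝓋 t x u + s * k z) = q0 + s * l + s ^ 2 * c) :
    a u * (2 * 𝒟.gamma (fun x' => ∂uinv t x' 𝓋 t x u) k⋄t x + ∂uinv t x 𝓋 t x u * 𝒟.op k⋄t x) =
    ∂uinv t x 𝓋 t x u * (deriv (fun s => k (ymap s x)) t + deriv (τmap) t * l) ∧ a u *
    (deriv (∂uinv t x) 𝓋 t x u * 𝒟.gamma k⋄t k⋄t x) = ∂uinv t x 𝓋 t x u * (deriv (τmap) t * c) := by
  set v := 𝓋 t x u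
  have hκ := hF.contMDiffAt_comp_spaceMap ht x hk.self_of_nhds
  have hkt : DifferentiableAt ℝ (fun s => k (ymap s x)) t := by
    have : SmAt 𝓘₁ 𝓘₁ (fun s => k (ymap s x)) t :=
      hk.self_of_nhds.comp t (hF.contMDiffAt_spaceMap_time ht x)
    exact this.contDiffAt.diffAt
  have key (s : ℝ) : a u * (𝒟.op (fun x' => uinv (t, x', v)) x +
      s * (2 * 𝒟.gamma (fun x' => ∂uinv t x' v) k⋄t x + ∂uinv t x v * 𝒟.op k⋄t x) +
      s ^ 2 * (deriv (∂uinv t x) v *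
      𝒟.gamma k⋄t k⋄t x)) + q x u =
      deriv (fun s => uinv (s, x, v)) t + ∂uinv t x v *
        (s * deriv (fun s => k (ymap s x)) t + deriv (τmap) t * (q0 + s * l + s ^ 2 * c)) := by
    have hw : ∀ᶠ y in 𝓝 (ymap t x), SmoothAt m (fun z => v + s * k z) y :=
      hk.mono fun y hy => contMDiffAt_const.add (contMDiffAt_const.mul hy)
    have hw0 : v + s * k (ymap t x) = v := by rw [hk0]; ring
    have h1 := hF.op_valInv_comp ht x hu hw (by exact hw0)
    have hval : uinv (t, x, v + s * k (ymap t x)) = u := by rw [hw0]; exact hF.valInv_val ht x hu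
    have hsm : SmoothAt n (fun x' => uinv (t, x', v + s * k (ymap t x'))) x := by
      refine ContMDiffAt.comp (g := fun q : X × ℝ => uinv (t, q.1, q.2))
        (f := fun x' => (x', v + s * k (ymap t x'))) x ?_
        (contMDiffAt_id.prodMk (contMDiffAt_const.add (contMDiffAt_const.mul hκ)))
      rw [hw0]
      exact hF.contMDiffAt_valInv_slice ht x hu
    rw [hA t ht x _ hsm (by simp only [hval]; exact hu), hB s] at h1
    simp only [hval] at h1
    have h2 := 𝒟.op_comp_add_smul (U := fun x' v => uinv (t, x', v))
      (hF.contMDiffAt_valInv_slice ht x hu) hκ hk0 s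
    rw [h2] at h1
    rw [h1]
    congr 3
    rw [deriv_const_add, deriv_const_mul _ hkt]
  -- three values of `s` determine the coefficients of a quadratic polynomial
  have k0 := key 0
  have k1 := key 1
  have k2 := key (-1)
  constructor <;> linarith

lemma compare_frozen (hA : A.HasForm a 𝒟 q) (x : X) {u : ℝ} (hu : u ∈ A.Ω) {k : Y → ℝ}
    (hk : ∀ᶠ y in 𝓝 (ymap t x), SmoothAt m k y)
    (hk0 : k (ymap t x) = 0) :
    a u * (2 * 𝒟.gamma (fun x' => ∂uinv t x' 𝓋 t x u) k⋄t x + ∂uinv t x 𝓋 t x u * 𝒟.op k⋄t x) =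
      ∂uinv t x 𝓋 t x u * (deriv (fun s => k (ymap s x)) t + deriv (τmap) t *
          (B.frozen (hF.timeMap_mem ht) (hF.val_mem ht x hu)).op k (ymap t x)) ∧
    a u * (deriv (∂uinv t x) 𝓋 t x u * 𝒟.gamma k⋄t k⋄t x) = ∂uinv t x 𝓋 t x u * (deriv (τmap) t *
        B.quad (τmap t) 𝓋 t x u k (ymap t x)) :=
  hF.compare_coeffs ht hA x hu hk hk0 fun s =>
    B.op_const_add_mul (hF.timeMap_mem ht) (hF.val_mem ht x hu) hk.self_of_nhds hk0 s

/-- The principal parts of the two equations are proportional: this is `compare_frozen` for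
the product of two functions. -/
lemma gamma_comp_spaceMap (hA : A.HasForm a 𝒟 q) (x : X) {u : ℝ} (hu : u ∈ A.Ω) {k₁ k₂ : Y → ℝ}
    (hk₁ : ∀ᶠ y in 𝓝 (ymap t x), SmoothAt m k₁ y) (hk2 : ∀ᶠ y in 𝓝 (ymap t x), SmoothAt m k₂ y)
    (h₁ : k₁ (ymap t x) = 0) (h₂ : k₂ (ymap t x) = 0) : a u * 𝒟.gamma k₁⋄t k₂⋄t x = deriv (τmap) t *
    (B.frozen (hF.timeMap_mem ht) (hF.val_mem ht x hu)).gamma k₁ k₂ (ymap t x) := by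
  have h := (hF.compare_frozen ht hA x hu (k := fun y => k₁ y * k₂ y)
    (by filter_upwards [hk₁, hk2] with y e1 e2 using e1.mul e2) (by simp [h₁])).1
  have c1 := hF.contMDiffAt_comp_spaceMap ht x hk₁.self_of_nhds
  have c2 := hF.contMDiffAt_comp_spaceMap ht x hk2.self_of_nhds
  have d : ∀ {k : Y → ℝ}, SmoothAt m k (ymap t x) →
      DifferentiableAt ℝ (fun s => k (ymap s x)) t := by
    intro k hk
    have : SmAt 𝓘₁ 𝓘₁ (fun s => k (ymap s x)) t := hk.comp t (hF.contMDiffAt_spaceMap_time ht x)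
    exact this.contDiffAt.diffAt
  rw [𝒟.gamma_comm, 𝒟.gamma_mul_left c1 c2, 𝒟.op_mul c1 c2,
    (B.frozen _ _).op_mul hk₁.self_of_nhds hk2.self_of_nhds,
    ((d hk₁.self_of_nhds).hasDerivAt.fun_mul (d hk2.self_of_nhds).hasDerivAt).deriv] at h
  simp only [h₁, h₂, zero_mul, mul_zero, add_zero, zero_add] at h
  have h' := mul_left_cancel₀ (hF.deriv_valInv_ne_zero ht x hu) (show _ * (2 * (a u * 𝒟.gamma k₁⋄t
    k₂⋄t x)) = _ * _ by rw [← h]; ring)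
  linarith

lemma isOpen_valRange (x : X) : IsOpen (valRange A F t x) := by
  rw [isOpen_iff_mem_nhds]
  rintro _ ⟨u, hu, rfl⟩
  have h : HasStrictDerivAt (fun u => 𝓋 t x u) _ u :=
    (hF.contDiffAt_val ht x hu).hasStrictDerivAt (by simp)
  rw [← h.map_nhds_eq (hF.deriv_val_ne_zero ht x hu)]
  exact image_mem_map (A.isOpen_Ω.mem_nhds hu)

lemma isPreconnected_valRange (x : X) : IsPreconnected (valRange A F t x) :=
  A.ordConnected_Ω.isPreconnected.image _ fun u hu =>
    (hF.contDiffAt_val ht x hu).continuousAt.continuousWithinAt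

lemma valRange_subset (x : X) : valRange A F t x ⊆ B.Ω := by
  rintro _ ⟨_, hu, rfl⟩
  exact hF.val_mem ht x hu

lemma valInv_mem (x : X) {v : ℝ} (hv : v ∈ valRange A F t x) : uinv (t, x, v) ∈ A.Ω := by
  obtain ⟨u, hu, rfl⟩ := hv
  rwa [hF.valInv_val ht x hu]

lemma val_valInv (x : X) {v : ℝ} (hv : v ∈ valRange A F t x) : (F (t, x, uinv (t, x, v))).2.2 = v := by
  obtain ⟨u, hu, rfl⟩ := hv
  rw [hF.valInv_val ht x hu]

lemma contDiffAt_valInv' (x : X) {v : ℝ} (hv : v ∈ valRange A F t x) :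
    ContDiffAt ℝ ∞ (fun v => uinv (t, x, v)) v := by
  obtain ⟨u, hu, rfl⟩ := hv
  exact hF.contDiffAt_valInv ht x hu

lemma deriv_valInv_ne_zero' (x : X) {v : ℝ} (hv : v ∈ valRange A F t x) : ∂uinv t x v ≠ 0 := by
  obtain ⟨u, hu, rfl⟩ := hv
  exact hF.deriv_valInv_ne_zero ht x hu

lemma eventually_mem_valRange (x : X) {v : ℝ} (hv : v ∈ valRange A F t x) :
    ∀ᶠ q in 𝓝 (t, x, v), uinv q ∈ A.Ω ∧ (F (q.1, q.2.1, uinv q)).2.2 = q.2.2 := by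
  obtain ⟨u, hu, rfl⟩ := hv
  exact (hF.eventually_valInv ht x hu).mono fun q h => h.2

lemma gamma_comp_spaceMap_pos (hA : A.HasForm a 𝒟 q) (x : X) {k : Y → ℝ}
    (hk : ∀ᶠ y in 𝓝 (ymap t x), SmoothAt m k y) (hk0 : k (ymap t x) = 0) (hk1 : pd₁ (n := m) k (ymap t x) ≠ 0) :
    0 < 𝒟.gamma k⋄t k⋄t x := by
  obtain ⟨u, hu⟩ := A.nonempty_Ω
  have h := hF.gamma_comp_spaceMap ht hA x hu hk hk hk0 hk0
  refine (𝒟.gamma_self_nonneg _ x).lt_of_ne fun h0 => ?_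
  rw [← h0, mul_zero] at h
  exact (mul_ne_zero (hF.deriv_timeMap_ne_zero ht) (DiffusionOp.gamma_self_pos _ hk1).ne') h.symm

/-! ### Morphisms between reaction-diffusion equations with the same nonlinearity -/

section SameNonlinearity

variable {𝒟' : DiffusionOp m Y} {Q : Y → ℝ → ℝ} (hA : A.HasForm a 𝒟 q) (hB : B.HasForm a 𝒟' Q)
include hA hB

lemma compare_hasForm (x : X) {u : ℝ} (hu : u ∈ A.Ω) {k : Y → ℝ}
    (hk : ∀ᶠ y in 𝓝 (ymap t x), SmoothAt m k y) (hk0 : k (ymap t x) = 0) : a u *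
    (2 * 𝒟.gamma (fun x' => ∂uinv t x' 𝓋 t x u) k⋄t x + ∂uinv t x 𝓋 t x u * 𝒟.op k⋄t x) = ∂uinv t x
    𝓋 t x u * (deriv (fun s => k (ymap s x)) t + deriv (τmap) t * (a 𝓋 t x u * 𝒟'.op k (ymap t x)))
    ∧ a u * (deriv (∂uinv t x) 𝓋 t x u * 𝒟.gamma k⋄t k⋄t x) = ∂uinv t x 𝓋 t x u *
    (deriv (τmap) t * 0) :=
  hF.compare_coeffs ht hA x hu hk hk0 fun s =>
    hB.op_const_add_mul (hF.timeMap_mem ht) (hF.val_mem ht x hu) hk.self_of_nhds hk0 s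

lemma gamma_comp_spaceMap_hasForm (x : X) {u : ℝ} (hu : u ∈ A.Ω) {k : Y → ℝ}
    (hk : ∀ᶠ y in 𝓝 (ymap t x), SmoothAt m k y) (hk0 : k (ymap t x) = 0) : a u * 𝒟.gamma k⋄t k⋄t x =
    deriv (τmap) t * (a 𝓋 t x u * 𝒟'.gamma k k (ymap t x)) := by
  have hk' := hk.self_of_nhds
  have hv := hF.val_mem ht x hu
  have hkk : SmoothAt m (fun y => k y * k y) (ymap t x) := hk'.mul hk'
  have hkk0 : (fun y => k y * k y) (ymap t x) = 0 := by simp only [hk0, mul_zero]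
  have key (s : ℝ) : _ := (hB.op_const_add_mul (hF.timeMap_mem ht) hv hkk hkk0 s).symm.trans
    (B.op_const_add_mul (hF.timeMap_mem ht) hv hkk hkk0 s)
  have h1 := key 1
  have h2 := key (-1)
  have e := 𝒟'.op_mul hk' hk'
  have e' := (B.frozen (hF.timeMap_mem ht) hv).op_mul hk' hk'
  rw [hk0] at e e'
  have h3 : (B.frozen (hF.timeMap_mem ht) hv).gamma k k (ymap t x) =
      a 𝓋 t x u * 𝒟'.gamma k k (ymap t x) := by
    rw [e, e'] at h1 h2
    linarith
  rw [← h3]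
  exact hF.gamma_comp_spaceMap ht hA x hu hk hk hk0 hk0

variable (ha : ∀ u ∈ A.Ω, 0 < a u)
include ha

lemma exists_val_eq_affine (x : X) : ∃ k b : ℝ, k ≠ 0 ∧ ∀ u ∈ A.Ω, 𝓋 t x u = k * u + b := by
  have h2 : ∀ v ∈ valRange A F t x, deriv (∂uinv t x) v = 0 := by
    rintro _ ⟨u, hu, rfl⟩
    have h0 := coordFn_self (ymap t x) ⟨0, B.dim_pos⟩
    have hk := eventually_contMDiffAt_coordFn (ymap t x) ⟨0, B.dim_pos⟩
    have h := (hF.compare_hasForm ht hA hB x hu hk h0).2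
    rw [mul_zero, mul_zero] at h
    exact (mul_eq_zero.1 ((mul_eq_zero.1 h).resolve_left (ha u hu).ne')).resolve_right
      (hF.gamma_comp_spaceMap_pos ht hA x hk h0 (pd₁_coordFn_ne_zero _ _)).ne'
  obtain ⟨k, b, hkb⟩ := exists_affine_of_deriv_deriv (hF.isOpen_valRange ht x)
    (hF.isPreconnected_valRange ht x) (g := fun v => v)
    (fun v hv => hF.contDiffAt_valInv' ht x hv) (fun v _ => contDiffAt_id) (by simp) (by
      intro v hv
      have : deriv (deriv fun v : ℝ => v) v = 0 := by simp
      rw [h2 v hv, this]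
      ring)
  have hk0 : k ≠ 0 := by
    rintro rfl
    obtain ⟨u, hu⟩ := A.nonempty_Ω
    have hv : 𝓋 t x u ∈ valRange A F t x := ⟨u, hu, rfl⟩
    refine hF.deriv_valInv_ne_zero' ht x hv ?_
    have : (fun v => uinv (t, x, v)) =ᶠ[𝓝 𝓋 t x u] fun _ => b := by
      filter_upwards [(hF.isOpen_valRange ht x).mem_nhds hv] with v hv
      rw [hkb v hv, zero_mul, zero_add]
    rw [this.deriv_eq, deriv_const]
  refine ⟨k⁻¹, -(k⁻¹ * b), inv_ne_zero hk0, fun u hu => ?_⟩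
  have := hkb _ ⟨u, hu, rfl⟩
  simp only [hF.valInv_val ht x hu] at this
  have h3 : k * 𝓋 t x u = u - b := by linarith
  rw [show k⁻¹ * u + -(k⁻¹ * b) = k⁻¹ * (u - b) by ring, ← h3, inv_mul_cancel_left₀ hk0]

variable (hne : ∃ u1 ∈ A.Ω, ∃ u2 ∈ A.Ω, a u1 ≠ a u2)
include hne

/-- The space map of a morphism between reaction-diffusion equations with the same nonlinearity does
not move: its velocity times a constant would be proportional to `a`. -/
lemma deriv_coordFn_spaceMap_eq_zero (x : X) (i : Fin m) :
    deriv (fun s => coordFn (ymap t x) i (ymap s x)) t = 0 := by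
  have hk := eventually_contMDiffAt_coordFn (ymap t x) i
  have hk0 := coordFn_self (ymap t x) i
  have hk1 := pd₁_coordFn_ne_zero (ymap t x) i
  generalize coordFn (ymap t x) i = k at *
  choose φ ψ hφ0 hφ using hF.exists_val_eq_affine ht hA hB ha
  have hderiv : ∀ x', ∀ v ∈ valRange A F t x', ∂uinv t x' v = (φ x')⁻¹ := by
    rintro x' _ ⟨u, hu, rfl⟩
    have h1 := hF.deriv_valInv_mul ht x' hu
    have h2 : (fun u => 𝓋 t x' u) =ᶠ[𝓝 u] fun u => φ x' * u + ψ x' := by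
      filter_upwards [A.isOpen_Ω.mem_nhds hu] with u hu using hφ x' u hu
    have h3 : deriv (fun u => φ x' * u + ψ x') u = φ x' := by
      rw [deriv_add_const, deriv_const_mul _ differentiableAt_id]
      simp
    rw [h2.deriv_eq, h3] at h1
    exact eq_inv_of_mul_eq_one_left h1
  have hderiv' v (hv : v ∈ valRange A F t x) : (fun x' => ∂uinv t x' v) =ᶠ[𝓝 x] fun x' => (φ x')⁻¹ := by
    have hc : ContinuousAt (fun x' => (t, x', v)) x := by fun_prop
    filter_upwards [hc.eventually (hF.eventually_mem_valRange ht x hv)] with x' h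
    exact hderiv x' v ⟨_, h.1, h.2⟩
  -- the principal parts determine `a(v)` as a multiple of `a(u)`
  have hD' u (hu : u ∈ A.Ω) : a 𝓋 t x u * 𝒟'.gamma k k (ymap t x) = a u * ((deriv (τmap) t)⁻¹ *
        𝒟.gamma k⋄t k⋄t x) := by
    have h := hF.gamma_comp_spaceMap_hasForm ht hA hB x hu hk hk0
    have hτ := hF.deriv_timeMap_ne_zero ht
    rw [mul_left_comm, h]
    field_simp
  have hg : 𝒟'.gamma k k (ymap t x) ≠ 0 := (DiffusionOp.gamma_self_pos _ hk1).ne'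
  refine (mul_eq_zero.1 (eq_zero_of_mul_eq hne (D := (φ x)⁻¹ *
    deriv (fun s => k (ymap s x)) t) (K := 2 * 𝒟.gamma (fun x' => (φ x')⁻¹)
      k⋄t x + (φ x)⁻¹ * 𝒟.op k⋄t x -
      (φ x)⁻¹ * (deriv (τmap) t * ((deriv (τmap) t)⁻¹ * 𝒟.gamma k⋄t k⋄t x /
          𝒟'.gamma k k (ymap t x) * 𝒟'.op k (ymap t x))))
    fun u hu => ?_)).resolve_left (inv_ne_zero (hφ0 x))
  have h := (hF.compare_hasForm ht hA hB x hu hk hk0).1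
  have hv : 𝓋 t x u ∈ valRange A F t x := ⟨u, hu, rfl⟩
  rw [𝒟.gamma_congr (hderiv' _ hv) (EventuallyEq.refl _ _), hderiv x _ hv,
    eq_div_of_mul_eq hg (hD' u hu)] at h
  rw [mul_sub, h]
  ring

omit ht in
lemma spaceMap_eq_of_hasForm {t t' : ℝ} (ht : t ∈ A.T) (ht' : t' ∈ A.T) (x : X) : ymap t x = ymap t' x :=
  eq_of_mfderiv_eq_zero (F := fun s => ymap s x) A.isOpen_T A.ordConnected_T.isPreconnected
    (fun _ hs => hF.contMDiffAt_spaceMap_time hs x)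
    (fun _ hs => mfderiv_eq_zero_of_deriv_coordFn (hF.contMDiffAt_spaceMap_time hs x)
      (hF.deriv_coordFn_spaceMap_eq_zero hs hA hB ha hne x)) ht ht'

omit ht in
/-- The function `a` is scaled by a factor that depends only on the point of `X`. -/
lemma exists_scaling_of_hasForm (hτ : ∀ t ∈ A.T, τmap t = t) (x : X) :
    ∃ C : ℝ, 0 < C ∧ ∀ t ∈ A.T, ∀ u ∈ A.Ω, a 𝓋 t x u = C * a u := by
  obtain ⟨t0, ht0⟩ := A.nonempty_T
  set y0 := ymap t0 x
  set k := coordFn y0 ⟨0, B.dim_pos⟩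
  have hk := eventually_contMDiffAt_coordFn y0 ⟨0, B.dim_pos⟩
  have hk0 : k y0 = 0 := coordFn_self _ _
  have hy t (ht : t ∈ A.T) x' : ymap t x' = ymap t0 x' :=
    hF.spaceMap_eq_of_hasForm hA hB ha hne ht ht0 x'
  have hg : 0 < 𝒟'.gamma k k y0 := DiffusionOp.gamma_self_pos _ (pd₁_coordFn_ne_zero _ _)
  have hg' := hF.gamma_comp_spaceMap_pos ht0 hA x hk hk0 (pd₁_coordFn_ne_zero _ _)
  refine ⟨_, div_pos hg' hg, fun t ht u hu => ?_⟩
  have h := hF.gamma_comp_spaceMap_hasForm ht hA hB x hu (k := k) (by rw [hy t ht]; exact hk)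
    (by rw [hy t ht]; exact hk0)
  have hτ' : deriv (τmap) t = 1 := by
    have : τmap =ᶠ[𝓝 t] id := by filter_upwards [A.isOpen_T.mem_nhds ht] with s hs using hτ s hs
    rw [this.deriv_eq, deriv_id]
  rw [hτ', one_mul, hy t ht, 𝒟.gamma_congr (f' := fun x' => k (ymap t0 x'))
    (h' := fun x' => k (ymap t0 x')) (.of_forall fun x' => by rw [hy t ht])
    (.of_forall fun x' => by rw [hy t ht])] at h
  rw [div_mul_eq_mul_div, mul_comm _ (a u), h, mul_div_assoc, div_self hg.ne', mul_one]

omit ht in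
/-- The dependent variable is transformed by affine maps that do not depend on time. -/
lemma exists_affine_of_hasForm (hc : ContinuousOn a A.Ω) (hτ : ∀ t ∈ A.T, τmap t = t) (x : X) : ∃ k
    b C : ℝ, k ≠ 0 ∧ 0 < C ∧ ∀ t ∈ A.T, ∀ u ∈ A.Ω, 𝓋 t x u = k * u + b ∧ a (k * u + b) = C * a u := by
  obtain ⟨C, hC, hCa⟩ := hF.exists_scaling_of_hasForm hA hB ha hne hτ x
  obtain ⟨t0, ht0⟩ := A.nonempty_T
  have hd t (ht : t ∈ A.T) u (hu : u ∈ A.Ω) : ContDiffAt ℝ ∞ (fun s => 𝓋 s x u) t := by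
    have : SmAt 𝓘₁ 𝓘₁ (fun s => 𝓋 s x u) t :=
      ContMDiffAt.comp (g := fun q => (F q).2.2) (f := fun s : ℝ => (s, x, u)) t
        (hF.contMDiffAt_val ht x hu) (contMDiffAt_id.prodMk (contMDiffAt_const.prodMk contMDiffAt_const))
    exact this.contDiffAt
  have haff t : ∃ k b : ℝ, t ∈ A.T → ∀ u ∈ A.Ω, 𝓋 t x u = k * u + b := by
    by_cases ht : t ∈ A.T
    · obtain ⟨k, b, -, h⟩ := hF.exists_val_eq_affine ht hA hB ha x
      exact ⟨k, b, fun _ => h⟩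
    · exact ⟨0, 0, fun h => absurd h ht⟩
  choose k b hkb using haff
  have hconst u (hu : u ∈ A.Ω) t (ht : t ∈ A.T) : 𝓋 t x u = 𝓋 t0 x u := by
    refine A.isOpen_T.is_const_of_deriv_eq_zero A.ordConnected_T.isPreconnected
      (f := fun s => 𝓋 s x u)
      (fun s hs => ((hd s hs u hu).diffAt).differentiableWithinAt)
      (fun s hs => ?_) ht ht0
    have hT := A.isOpen_T.mem_nhds hs
    exact deriv_eq_zero_of_scaling (S := fun s u => 𝓋 s x u) A.ordConnected_Ω A.isOpen_Ω
      hc hne hC.ne' (k := k) (b := b)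
      (by filter_upwards [hT] with s hs using hkb s hs) (hd s hs)
      (by filter_upwards [hT] with s hs using hCa s hs) hu
  obtain ⟨k, b, hk0, hkb⟩ := hF.exists_val_eq_affine ht0 hA hB ha x
  refine ⟨k, b, C, hk0, hC, fun t ht u hu => ?_⟩
  rw [hconst u hu t ht, ← hkb u hu]
  exact ⟨rfl, hCa t0 ht0 u hu⟩

omit ht hA hB in
/-- For a nonexceptional function the affine maps are either all trivial, or all equal to the same
reflection. -/
lemma eq_id_or_reflection (hc : ContinuousOn a A.Ω) (hΩ : B.Ω = A.Ω)
    (hext : a ∉ AExpExt A.Ω ∪ ADegExt A.Ω) {k b C : X → ℝ} (hC : ∀ x, 0 < C x) (hk : ∀ x, k x ≠ 0)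
    (h : ∀ x, ∀ t ∈ A.T, ∀ u ∈ A.Ω, 𝓋 t x u = k x * u + b x ∧ a (k x * u + b x) = C x * a u) :
    (∀ x, k x = 1 ∧ b x = 0) ∨ ∃ u0, (∀ u ∈ A.Ω, 2 * u0 - u ∈ A.Ω ∧ a (2 * u0 - u) = a u) ∧ ∀ x, k x
    = -1 ∧ b x = 2 * u0 := by
  obtain ⟨t0, ht0⟩ := A.nonempty_T
  obtain ⟨u1, h₁, u2, h₂, hn⟩ := id hne
  have hmem x u (hu : u ∈ A.Ω) : k x * u + b x ∈ A.Ω := by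
    rw [← (h x t0 ht0 u hu).1, ← hΩ]
    exact hF.val_mem ht0 x hu
  have hid : ∀ {k b C : ℝ}, IsAffineSymmetry A.Ω a k b C → k = 1 ∧ b = 0 := fun h =>
    (h.eq_id_or A.ordConnected_Ω hc ha hne).resolve_right fun h => hext (h.elim Or.inl Or.inr)
  -- the composition of two of these maps is a symmetry of `a` if its slope is positive
  have hcomp x x' : 0 < k x * k x' → k x * k x' = 1 ∧ k x * b x' + b x = 0 := by
    intro hpos
    have e u : k x * k x' * u + (k x * b x' + b x) = k x * (k x' * u + b x') + b x := by ring
    refine hid (C := C x * C x') ⟨hpos, ⟨u1, h₁, ?_⟩, fun u hu _ => ?_⟩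
    · rw [e]
      exact hmem x _ (hmem x' _ h₁)
    · rw [e, (h x t0 ht0 _ (hmem x' _ hu)).2, (h x' t0 ht0 u hu).2, mul_assoc]
  have hsq x : k x = 1 ∨ k x = -1 := by
    have := (hcomp x x (mul_self_pos.2 (hk x))).1
    exact mul_self_eq_one_iff.1 this
  have hone x : k x = 1 → b x = 0 := fun hx =>
    (hid (C := C x) ⟨by rw [hx]; exact one_pos, ⟨u1, h₁, hmem x _ h₁⟩,
      fun u hu _ => (h x t0 ht0 u hu).2⟩).2
  -- the sign is constant by connectedness
  have hu12 : u2 - u1 ≠ 0 := fun e => hn (by rw [sub_eq_zero.1 e])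
  have hkc : Continuous k := by
    have e : k = fun x => (𝓋 t0 x u2 - 𝓋 t0 x u1) / (u2 - u1) := by
      funext x
      rw [(h x t0 ht0 _ h₁).1, (h x t0 ht0 _ h₂).1]
      field_simp
      ring
    have hcv u (hu : u ∈ A.Ω) : Continuous fun x => 𝓋 t0 x u :=
      continuous_iff_continuousAt.2 fun x =>
        ContinuousAt.comp (g := fun q => (F q).2.2) (f := fun x => (t0, x, u))
          (hF.contMDiffAt_val ht0 x hu).continuousAt (by fun_prop)
    rw [e]
    exact ((hcv _ h₂).sub (hcv _ h₁)).div_const _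
  by_cases hall : ∀ x, k x = 1
  · exact Or.inl fun x => ⟨hall x, hone x (hall x)⟩
  push Not at hall
  obtain ⟨x0, hx0⟩ := hall
  have hx0' := (hsq x0).resolve_left hx0
  have hneg x : k x = -1 := by
    refine (hsq x).resolve_left fun hx => ?_
    obtain ⟨x', hx'⟩ := mem_range_of_exists_le_of_exists_ge hkc (c := 0) ⟨x0, by rw [hx0']; norm_num⟩
      ⟨x, by rw [hx]; norm_num⟩
    exact hk x' hx'
  have hb x : b x = b x0 := by
    have := (hcomp x0 x (by rw [hneg, hneg]; norm_num)).2
    rw [hneg] at this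
    linarith
  have e u : k x0 * u + b x0 = 2 * (b x0 / 2) - u := by rw [hx0']; ring
  have hC1 : C x0 = 1 := by
    have h3 := (h x0 t0 ht0 _ (hmem x0 u1 h₁)).2
    rw [(h x0 t0 ht0 _ h₁).2, show k x0 * (k x0 * u1 + b x0) + b x0 = u1 by rw [hx0']; ring,
      ← mul_assoc] at h3
    have h4 : C x0 * C x0 = 1 := mul_right_cancel₀ (ha u1 h₁).ne' (by rw [one_mul]; exact h3.symm)
    rcases mul_self_eq_one_iff.1 h4 with h5 | h5
    · exact h5
    · linarith [hC x0]
  refine Or.inr ⟨b x0 / 2, fun u hu => ?_, fun x => ⟨hneg x, by rw [hb]; ring⟩⟩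
  rw [← e]
  refine ⟨hmem x0 u hu, ?_⟩
  rw [(h x0 t0 ht0 u hu).2, hC1, one_mul]

end SameNonlinearity

/-! ### Points with the same image under the space map -/

lemma contMDiffAt_deriv_valInv (x : X) {v : ℝ} (hv : v ∈ valRange A F t x) :
    SmoothAt n (fun x' => ∂uinv t x' v) x := by
  obtain ⟨u, hu, rfl⟩ := hv
  exact (hF.contMDiffAt_valInv_slice ht x hu).deriv_snd

/-- `compare_frozen` at a value of the new variables. -/
lemma compare_frozen_at (hA : A.HasForm a 𝒟 q) {x : X} {y : Y} (hy : ymap t x = y) {v : ℝ}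
    (hv : v ∈ valRange A F t x) (hvB : v ∈ B.Ω) {k : Y → ℝ} (hk : ∀ᶠ y in 𝓝 y, SmoothAt m k y)
    (hk0 : k y = 0) : a (uinv (t, x, v)) *
    (2 * 𝒟.gamma (fun x' => ∂uinv t x' v) k⋄t x + ∂uinv t x v * 𝒟.op k⋄t x) = ∂uinv t x v *
    (deriv (fun s => k (ymap s x)) t + deriv (τmap) t * (B.frozen (hF.timeMap_mem ht) hvB).op k y) ∧
    a (uinv (t, x, v)) * (deriv (∂uinv t x) v * 𝒟.gamma k⋄t k⋄t x) = ∂uinv t x v *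
    (deriv (τmap) t * B.quad (τmap t) v k y) := by
  obtain ⟨u, hu, rfl⟩ := hv
  subst hy
  simp only [hF.valInv_val ht x hu]
  exact hF.compare_frozen ht hA x hu hk hk0

lemma gamma_comp_spaceMap_at (hA : A.HasForm a 𝒟 q) {x : X} {y : Y} (hy : ymap t x = y) {v : ℝ}
    (hv : v ∈ valRange A F t x) (hvB : v ∈ B.Ω) {k₁ k₂ : Y → ℝ} (hk₁ : ∀ᶠ y in 𝓝 y, SmoothAt m k₁ y)
    (hk2 : ∀ᶠ y in 𝓝 y, SmoothAt m k₂ y) (h₁ : k₁ y = 0) (h₂ : k₂ y = 0) : a (uinv (t, x, v)) *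
    𝒟.gamma k₁⋄t k₂⋄t x = deriv (τmap) t * (B.frozen (hF.timeMap_mem ht) hvB).gamma k₁ k₂ y := by
  obtain ⟨u, hu, rfl⟩ := hv
  subst hy
  simp only [hF.valInv_val ht x hu]
  exact hF.gamma_comp_spaceMap ht hA x hu hk₁ hk2 h₁ h₂

/-- At a fixed time the dependent variable is transformed either increasingly everywhere or
decreasingly everywhere. -/
lemma deriv_val_mul_pos (x1 x2 : X) {u1 u2 : ℝ} (h₁ : u1 ∈ A.Ω) (h₂ : u2 ∈ A.Ω) :
    0 < deriv (fun u => 𝓋 t x1 u) u1 * deriv (fun u => 𝓋 t x2 u) u2 := by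
  have hX : 0 < deriv (fun u => 𝓋 t x1 u) u1 * deriv (fun u => 𝓋 t x2 u) u1 := by
    have hc : Continuous fun x => deriv (fun u => 𝓋 t x u) u1 :=
      continuous_iff_continuousAt.2 fun x => by
        refine (ContMDiffAt.deriv_snd (n := n) (U := fun p : X × ℝ => (F (t, p.1, p.2)).2.2)
          ?_).continuousAt
        exact ContMDiffAt.comp (g := fun q => (F q).2.2) (f := fun p : X × ℝ => (t, p.1, p.2)) (x, u1)
          (hF.contMDiffAt_val ht x h₁) (contMDiffAt_const.prodMk
            (contMDiffAt_fst.prodMk contMDiffAt_snd))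
    by_contra! hle
    obtain ⟨x, hx⟩ : (0 : ℝ) ∈ range fun x => deriv (fun u => 𝓋 t x u) u1 := by
      rcases mul_nonpos_iff.1 hle with ⟨p, q⟩ | ⟨p, q⟩
      · exact mem_range_of_exists_le_of_exists_ge hc ⟨x2, q⟩ ⟨x1, p⟩
      · exact mem_range_of_exists_le_of_exists_ge hc ⟨x1, p⟩ ⟨x2, q⟩
    exact hF.deriv_val_ne_zero ht x h₁ hx
  rcases hasDerivWithinAt_forall_lt_or_forall_gt_of_forall_ne A.ordConnected_Ω.convex
    (fun u hu => ((hF.contDiffAt_val ht x2 hu).diffAt).hasDerivAt.hasDerivWithinAt)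
    (m := 0) (fun u hu => hF.deriv_val_ne_zero ht x2 hu) with h | h
  · exact mul_pos_of_neg_of_neg (neg_of_mul_pos_left hX (h u1 h₁).le) (h u2 h₂)
  · exact mul_pos (pos_of_mul_pos_left hX (h u1 h₁).le) (h u2 h₂)

lemma deriv_valInv_mul_pos (x1 x2 : X) {v : ℝ} (h₁ : v ∈ valRange A F t x1)
    (h₂ : v ∈ valRange A F t x2) : 0 < ∂uinv t x1 v * ∂uinv t x2 v := by
  have e₁ := hF.deriv_valInv_mul ht x1 (hF.valInv_mem ht x1 h₁)
  have e₂ := hF.deriv_valInv_mul ht x2 (hF.valInv_mem ht x2 h₂)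
  rw [hF.val_valInv ht x1 h₁] at e₁
  rw [hF.val_valInv ht x2 h₂] at e₂
  refine pos_of_mul_pos_left (b := _) ?_
      (hF.deriv_val_mul_pos ht x1 x2 (hF.valInv_mem ht x1 h₁) (hF.valInv_mem ht x2 h₂)).le
  rw [mul_mul_mul_comm, e₁, e₂]
  norm_num

lemma exists_affine_on_overlap (ha : ∀ u ∈ A.Ω, 0 < a u) (hA : A.HasForm a 𝒟 q) {x1 x2 : X}
    (hx : ymap t x1 = ymap t x2) (hne : (valRange A F t x1 ∩ valRange A F t x2).Nonempty) : ∃ k b :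
    ℝ, 0 < k ∧ ∀ v ∈ valRange A F t x1 ∩ valRange A F t x2, uinv (t, x1, v) = k * uinv (t, x2, v) +
    b := by
  have hI : IsOpen (valRange A F t x1 ∩ valRange A F t x2) :=
    (hF.isOpen_valRange ht x1).inter (hF.isOpen_valRange ht x2)
  have hc : IsPreconnected (valRange A F t x1 ∩ valRange A F t x2) :=
    ((hF.isPreconnected_valRange ht x1).ordConnected.inter
      (hF.isPreconnected_valRange ht x2).ordConnected).isPreconnected
  obtain ⟨k, b, h⟩ := exists_affine_of_deriv_deriv hI hc
    (fun v hv => hF.contDiffAt_valInv' ht x1 hv.1) (fun v hv => hF.contDiffAt_valInv' ht x2 hv.2)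
    (fun v hv => hF.deriv_valInv_ne_zero' ht x2 hv.2) (by
      intro v hv
      set y := ymap t x2 with hy
      have hvB := hF.valRange_subset ht x1 hv.1
      -- the coefficients of `s²` over the two points: `a(u) u_vv Γ = u_v c`, where `c` is common
      have hk := eventually_contMDiffAt_coordFn y ⟨0, B.dim_pos⟩
      have hk0 := coordFn_self y ⟨0, B.dim_pos⟩
      have hk1 := pd₁_coordFn_ne_zero y ⟨0, B.dim_pos⟩
      generalize coordFn y ⟨0, B.dim_pos⟩ = k at *
      have e₁ := (hF.compare_frozen_at ht hA hx hv.1 hvB hk hk0).2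
      have e₂ := (hF.compare_frozen_at ht hA hy.symm hv.2 hvB hk hk0).2
      have g₁ := hF.gamma_comp_spaceMap_at ht hA hx hv.1 hvB hk hk hk0 hk0
      have g₂ := hF.gamma_comp_spaceMap_at ht hA hy.symm hv.2 hvB hk hk hk0 hk0
      have hpos := mul_pos (ha _ (hF.valInv_mem ht x2 hv.2))
        (hF.gamma_comp_spaceMap_pos ht hA x2 hk hk0 hk1)
      rw [mul_left_comm, g₁, ← g₂] at e₁
      rw [mul_left_comm] at e₂
      refine mul_right_cancel₀ hpos.ne' ?_
      linear_combination ∂uinv t x2 v * e₁ - ∂uinv t x1 v * e₂)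
  refine ⟨k, b, ?_, h⟩
  obtain ⟨v, hv⟩ := hne
  have e : (fun v => uinv (t, x1, v)) =ᶠ[𝓝 v] fun v => k * uinv (t, x2, v) + b := by
    filter_upwards [hI.mem_nhds hv] with v hv using h v hv
  have hpos := hF.deriv_valInv_mul_pos ht x1 x2 hv.1 hv.2
  rw [e.deriv_eq, deriv_add_const, deriv_const_mul _
    ((hF.contDiffAt_valInv' ht x2 hv.2).diffAt), mul_assoc] at hpos
  exact pos_of_mul_pos_left hpos (mul_self_nonneg _)

/-- The affine relation persists as long as both sides make sense. -/
lemma val_affine_eq {x1 x2 : X} {k b : ℝ} (hk : 0 < k)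
    (hne : (valRange A F t x1 ∩ valRange A F t x2).Nonempty)
    (h : ∀ v ∈ valRange A F t x1 ∩ valRange A F t x2, uinv (t, x1, v) = k * uinv (t, x2, v) + b)
    {u : ℝ} (hu : u ∈ A.Ω) (hu' : k * u + b ∈ A.Ω) : (F (t, x1, k * u + b)).2.2 = 𝓋 t x2 u := by
  set D := A.Ω ∩ (fun u => k * u + b) ⁻¹' A.Ω
  set E := {u | u ∈ D ∧ (F (t, x1, k * u + b)).2.2 = 𝓋 t x2 u}
  have hDo : IsOpen D := A.isOpen_Ω.inter (A.isOpen_Ω.preimage (by fun_prop))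
  have hDc : IsPreconnected D := (A.ordConnected_Ω.inter
    (A.ordConnected_Ω.preimage_mono fun u u' h => by gcongr)).isPreconnected
  have c₁ u (hu : u ∈ D) : ContinuousAt (fun u => (F (t, x1, k * u + b)).2.2) u :=
    ContinuousAt.comp (g := fun u => 𝓋 t x1 u) (f := fun u => k * u + b)
      (hF.contDiffAt_val ht x1 hu.2).continuousAt (by fun_prop)
  have c₂ u (hu : u ∈ D) : ContinuousAt (fun u => 𝓋 t x2 u) u :=
    (hF.contDiffAt_val ht x2 hu.1).continuousAt
  -- `E` is open and closed in the interval `D`, and nonempty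
  have hsub : D ⊆ E := by
    refine hDc.subset_of_closure_inter_subset ?_ ?_ ?_
    · rw [isOpen_iff_mem_nhds]
      rintro u ⟨huD, hu⟩
      have hv : 𝓋 t x2 u ∈ valRange A F t x1 ∩ valRange A F t x2 :=
        ⟨⟨_, huD.2, hu⟩, ⟨u, huD.1, rfl⟩⟩
      filter_upwards [hDo.mem_nhds huD, (c₂ u huD).eventually
        (((hF.isOpen_valRange ht x1).inter (hF.isOpen_valRange ht x2)).mem_nhds hv)] with u' h1 h2
      refine ⟨h1, ?_⟩
      have h3 := h _ h2
      rw [hF.valInv_val ht x2 h1.1] at h3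
      rw [← h3, hF.val_valInv ht x1 h2.1]
    · obtain ⟨v, hv⟩ := hne
      have h3 := h v hv
      have h1 := hF.valInv_mem ht x1 hv.1
      refine ⟨uinv (t, x2, v), ⟨hF.valInv_mem ht x2 hv.2, ?_⟩, ⟨hF.valInv_mem ht x2 hv.2, ?_⟩, ?_⟩
      · rwa [mem_preimage, ← h3]
      · rwa [mem_preimage, ← h3]
      · rw [← h3, hF.val_valInv ht x1 hv.1, hF.val_valInv ht x2 hv.2]
    · rintro u ⟨hcl, huD⟩
      refine ⟨huD, ?_⟩
      by_contra hne'
      obtain ⟨u', h2, h3⟩ := (mem_closure_iff_frequently.1 hcl).and_eventually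
          (((c₁ u huD).sub (c₂ u huD)).tendsto.eventually_ne (sub_ne_zero.2 hne')) |>.exists
      exact h3 (sub_eq_zero.2 h2.2)
  exact (hsub ⟨hu, hu'⟩).2

variable (N : SymmetryNormalizer A.Ω a) (ha : ∀ u ∈ A.Ω, 0 < a u) (hA : A.HasForm a 𝒟 q)
include N ha hA

lemma exists_symmetry_of_overlap {x1 x2 : X} (hx : ymap t x1 = ymap t x2)
    (hne : (valRange A F t x1 ∩ valRange A F t x2).Nonempty) : ∃ k b C : ℝ, IsAffineSymmetry A.Ω a k
    b C ∧ (∀ u ∈ A.Ω, (F (t, x1, k * u + b)).2.2 = 𝓋 t x2 u) ∧ ∀ κ : Y → ℝ,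
    (∀ᶠ y in 𝓝 (ymap t x2), SmoothAt m κ y) → κ (ymap t x2) = 0 → C * 𝒟.gamma κ⋄t κ⋄t x1 = 𝒟.gamma
    κ⋄t κ⋄t x2 := by
  obtain ⟨k, b, hk, h⟩ := hF.exists_affine_on_overlap ht ha hA hx hne
  have hval := fun u hu hu' => hF.val_affine_eq ht hk hne h (u := u) hu hu'
  have hγ (κ : Y → ℝ) : (∀ᶠ y in 𝓝 (ymap t x2), SmoothAt m κ y) →
      κ (ymap t x2) = 0 → ∀ u ∈ A.Ω, k * u + b ∈ A.Ω → a (k * u + b) * 𝒟.gamma κ⋄t κ⋄t x1 = a u *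
        𝒟.gamma κ⋄t κ⋄t x2 := by
    intro hκ hκ0 u hu hu'
    have hvB := hF.val_mem ht x2 hu
    have g₁ := hF.gamma_comp_spaceMap_at ht hA hx ⟨_, hu', hval u hu hu'⟩ hvB hκ hκ hκ0 hκ0
    have g₂ := hF.gamma_comp_spaceMap_at ht hA rfl ⟨u, hu, rfl⟩ hvB hκ hκ hκ0 hκ0
    rw [hF.valInv_val ht x2 hu] at g₂
    have e : uinv (t, x1, 𝓋 t x2 u) = k * u + b := by rw [← hval u hu hu', hF.valInv_val ht x1 hu']
    rw [e] at g₁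
    rw [g₁, g₂]
  have hk₀ := eventually_contMDiffAt_coordFn (ymap t x2) ⟨0, B.dim_pos⟩
  have hk00 := coordFn_self (ymap t x2) ⟨0, B.dim_pos⟩
  have hk01 := pd₁_coordFn_ne_zero (ymap t x2) ⟨0, B.dim_pos⟩
  generalize coordFn (ymap t x2) ⟨0, B.dim_pos⟩ = κ0 at *
  have hpos1 := hF.gamma_comp_spaceMap_pos ht hA x1 (k := κ0) (by rwa [hx]) (by rwa [hx])
    (by rwa [hx])
  -- the ratio of the symbols over the two points is the factor of the symmetry
  have hmap u (hu : u ∈ A.Ω) : k * u + b ∈ A.Ω → a (k * u + b) = (𝒟.gamma κ0⋄t κ0⋄t x2 /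
        𝒟.gamma κ0⋄t κ0⋄t x1) * a u := by
    intro hu'
    rw [div_mul_eq_mul_div, eq_div_iff hpos1.ne', hγ κ0 hk₀ hk00 u hu hu', mul_comm]
  obtain ⟨v, hv⟩ := hne
  have hu := hF.valInv_mem ht x2 hv.2
  have hu' : k * uinv (t, x2, v) + b ∈ A.Ω := by
    rw [← h v hv]
    exact hF.valInv_mem ht x1 hv.1
  have hsymm : IsAffineSymmetry A.Ω a k b _ := ⟨hk, ⟨_, hu, hu'⟩, hmap⟩
  refine ⟨k, b, _, hsymm, fun u hu => hval u hu ((N.symm_mem_iff hsymm u).2 hu), fun κ hκ hκ0 => ?_⟩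
  refine mul_left_cancel₀ (ha _ hu).ne' ?_
  rw [← hγ κ hκ hκ0 _ hu hu', hmap _ hu hu']
  ring

/-- The interval of new values is the same over all points. -/
lemma valRange_eq (x : X) : valRange A F t x = B.Ω := by
  refine (hF.valRange_subset ht x).antisymm ?_
  refine B.ordConnected_Ω.isPreconnected.subset_of_closure_inter_subset (hF.isOpen_valRange ht x)
    ?_ ?_
  · obtain ⟨u, hu⟩ := A.nonempty_Ω
    exact ⟨_, hF.val_mem ht x hu, ⟨u, hu, rfl⟩⟩
  · rintro v ⟨hcl, hv⟩
    have hmem : (τmap t, ymap t x, v) ∈ F '' A.space := by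
      rw [hF.image_eq]
      exact mem_space.2 ⟨hF.timeMap_mem ht, hv⟩
    obtain ⟨⟨t', x', u'⟩, hp, he⟩ := hmem
    obtain ⟨ht', hu'⟩ := mem_space.1 hp
    have e1 : τmap t' = τmap t := by rw [← hF.fst_eq_timeMap ht' x' hu', he]
    obtain rfl := hF.injOn_timeMap ht' ht e1
    have e2 : ymap t' x' = ymap t' x := by rw [← hF.snd_fst_eq_spaceMap ht' x' hu', he]
    have e3 : v ∈ valRange A F t' x' := ⟨u', hu', congrArg (fun p => p.2.2) he⟩
    obtain ⟨v', h1, h2⟩ := mem_closure_iff.1 hcl _ (hF.isOpen_valRange ht x') e3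
    obtain ⟨k, b, C, hs, hval, -⟩ := hF.exists_symmetry_of_overlap ht N ha hA e2.symm ⟨v', h2, h1⟩
    refine ⟨k * u' + b, (N.symm_mem_iff hs u').2 hu', ?_⟩
    simp only [hval u' hu']
    exact congrArg (fun p => p.2.2) he

/-- Over two points of a fibre of the space map the dependent variables are related by a symmetry
of `a`. -/
lemma exists_symmetry {x1 x2 : X} (hx : ymap t x1 = ymap t x2) : ∃ k b C : ℝ, IsAffineSymmetry A.Ω a
    k b C ∧ (∀ v ∈ B.Ω, uinv (t, x1, v) = k * uinv (t, x2, v) + b) ∧ ∀ κ : Y → ℝ,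
    (∀ᶠ y in 𝓝 (ymap t x2), SmoothAt m κ y) → κ (ymap t x2) = 0 → C * 𝒟.gamma κ⋄t κ⋄t x1 = 𝒟.gamma
    κ⋄t κ⋄t x2 := by
  have hne : (valRange A F t x1 ∩ valRange A F t x2).Nonempty := by
    rw [hF.valRange_eq ht N ha hA, hF.valRange_eq ht N ha hA, inter_self]
    exact B.nonempty_Ω
  obtain ⟨k, b, C, hs, hval, hC⟩ := hF.exists_symmetry_of_overlap ht N ha hA hx hne
  refine ⟨k, b, C, hs, fun v hv => ?_, hC⟩
  rw [← hF.valRange_eq ht N ha hA x2] at hv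
  obtain ⟨u, hu, rfl⟩ := hv
  simp only [hF.valInv_val ht x2 hu]
  rw [← hval u hu, hF.valInv_val ht x1 ((N.symm_mem_iff hs u).2 hu)]

/-! ### The fibres of the space map do not depend on time -/

lemma deriv_valInv_eq_mul {x1 x2 : X} (hx : ymap t x1 = ymap t x2) :
    ∃ k : ℝ, ∀ v ∈ B.Ω, ∂uinv t x1 v = k * ∂uinv t x2 v := by
  obtain ⟨k, b, C, -, h, -⟩ := hF.exists_symmetry ht N ha hA hx
  refine ⟨k, fun v hv => ?_⟩
  have e : (fun v => uinv (t, x1, v)) =ᶠ[𝓝 v] fun v => k * uinv (t, x2, v) + b := by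
    filter_upwards [B.isOpen_Ω.mem_nhds hv] with v hv using h v hv
  rw [e.deriv_eq, deriv_add_const, deriv_const_mul _ ((hF.contDiffAt_valInv' ht x2
    (by rwa [hF.valRange_eq ht N ha hA])).diffAt)]

/-- The velocity of the space map at a point of the fibre over `y`, up to a term that is the same
at all points of this fibre, is `a` times a constant. -/
lemma exists_velocity_eq {y : Y} {σ : Y → X} (hσ : ∀ᶠ y' in 𝓝 y, SmAt (𝓡 m) (𝓡 n) σ y')
    (hσy : ∀ᶠ y' in 𝓝 y, ymap t (σ y') = y') {k : Y → ℝ}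
    (hk : ∀ᶠ y in 𝓝 y, SmoothAt m k y) (hk0 : k y = 0) {x : X}
    (hx : ymap t x = y) : ∃ K : ℝ, ∀ v, ∀ hv : v ∈ B.Ω, a (uinv (t, x, v)) * K =
      deriv (fun s => k (ymap s x)) t + (deriv (τmap) t *
        (B.frozen (hF.timeMap_mem ht) hv).op k y - 2 * (deriv (τmap) t *
          (B.frozen (hF.timeMap_mem ht) hv).gamma (fun y' =>
            ∂uinv t (σ y') v - ∂uinv t (σ y) v)
            k y) / ∂uinv t (σ y) v) := by
  have hR x' v : v ∈ B.Ω → v ∈ valRange A F t x' := fun hv => by rwa [hF.valRange_eq ht N ha hA]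
  set Ub : ℝ → Y → ℝ := fun v y' => ∂uinv t (σ y') v
  have hUb0 v (hv : v ∈ B.Ω) y' : Ub v y' ≠ 0 := hF.deriv_valInv_ne_zero' ht _ (hR _ v hv)
  have hUbs v (hv : v ∈ B.Ω) : ∀ᶠ y' in 𝓝 y, SmoothAt m (Ub v) y' := by
    filter_upwards [hσ] with y' h
    exact (hF.contMDiffAt_deriv_valInv ht (σ y') (hR _ v hv)).comp y' h
  obtain ⟨v0, hv₀⟩ := B.nonempty_Ω
  -- along a fibre `u_v` is multiplied by the factor `ρ` that does not depend on `v`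
  set ρ : X → ℝ := fun x' => ∂uinv t x' v0 * (Ub v0 (ymap t x'))⁻¹ with hρ
  have hcomp v (hv : v ∈ B.Ω) : SmoothAt n (fun x' => Ub v (ymap t x')) x := hF.contMDiffAt_comp_spaceMap ht x (by rw [hx]; exact (hUbs v hv).self_of_nhds)
  have hρs : SmoothAt n ρ x := (hF.contMDiffAt_deriv_valInv ht x (hR _ v0 hv₀)).mul
      ((hcomp v0 hv₀).inv₀ (hUb0 v0 hv₀ _))
  have hρ0 : ρ x ≠ 0 :=
    mul_ne_zero (hF.deriv_valInv_ne_zero' ht x (hR _ v0 hv₀)) (inv_ne_zero (hUb0 v0 hv₀ _))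
  have hsc : Tendsto (ymap t) (𝓝 x) (𝓝 y) := by
    have := (hF.contMDiffAt_spaceMap_slice ht x).continuousAt.tendsto
    rwa [hx] at this
  have hfac v (hv : v ∈ B.Ω) : (fun x' => ∂uinv t x' v) =ᶠ[𝓝 x]
      fun x' => ρ x' * Ub v (ymap t x') := by
    filter_upwards [hsc.eventually hσy] with x' hx'
    obtain ⟨l, hl⟩ := hF.deriv_valInv_eq_mul ht N ha hA hx'.symm
    simp only [hρ]
    rw [hl v hv, hl v0 hv₀, mul_inv_cancel_right₀ (hUb0 v0 hv₀ _)]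
  refine ⟨2 * 𝒟.gamma ρ k⋄t x / ρ x + 𝒟.op k⋄t x, fun v hv => ?_⟩
  have e1 := (hF.compare_frozen_at ht hA hx (hR x v hv) hv hk hk0).1
  have e2 := hF.gamma_comp_spaceMap_at ht hA hx (hR x v hv) hv
    (k₁ := fun y' => Ub v y' - Ub v y) ((hUbs v hv).mono fun y' h => h.sub contMDiffAt_const) hk
    (sub_self _) hk0
  have e3 : 𝒟.gamma (fun x' => Ub v (ymap t x')) k⋄t x =
      𝒟.gamma (fun x' => Ub v (ymap t x') - Ub v y) k⋄t x := by
    have := 𝒟.gamma_add_left (k := fun x' => k (ymap t x')) (hcomp v hv)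
      (contMDiffAt_const (c := -Ub v y))
    rw [𝒟.gamma_const_left, add_zero] at this
    rw [← this]
    rfl
  have hU0 := hUb0 v hv y
  have e4 : ∂uinv t x v = ρ x * Ub v y := by
    have h : ∂uinv t x v = ρ x * Ub v (ymap t x) := (hfac v hv).self_of_nhds
    rwa [hx] at h
  rw [𝒟.gamma_congr (hfac v hv) (EventuallyEq.refl _ _), 𝒟.gamma_mul_left hρs (hcomp v hv), e3, e4,
    hx] at e1
  change _ = _ + (_ - 2 * _ / Ub v y)
  rw [← e2]
  field_simp
  linear_combination e1

/-- All points of a fibre of the space map move with the same velocity. -/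
lemma deriv_comp_spaceMap_eq (hne : ∃ u1 ∈ A.Ω, ∃ u2 ∈ A.Ω, a u1 ≠ a u2) {x1 x2 : X}
    (hx : ymap t x1 = ymap t x2) {k : Y → ℝ} (hk : ∀ᶠ y in 𝓝 (ymap t x2), SmoothAt m k y)
    (hk0 : k (ymap t x2) = 0) : deriv (fun s => k (ymap s x1)) t = deriv (fun s => k (ymap s x2)) t
    := by
  obtain ⟨σ, hσ, -, hσy⟩ := hF.hasLocalSection_spaceMap ht x2
  obtain ⟨K1, h₁⟩ := hF.exists_velocity_eq ht N ha hA hσ hσy hk hk0 hx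
  obtain ⟨K2, h₂⟩ := hF.exists_velocity_eq ht N ha hA hσ hσy hk hk0 rfl
  obtain ⟨l, b, C, hs, hval, -⟩ := hF.exists_symmetry ht N ha hA hx
  refine sub_eq_zero.1 (eq_zero_of_mul_eq hne (K := C * K1 - K2) fun u hu => ?_)
  have hv := hF.val_mem ht x2 hu
  have e₁ := h₁ _ hv
  have e₂ := h₂ _ hv
  rw [hval _ hv, hF.valInv_val ht x2 hu, hs.map_eq u hu ((N.symm_mem_iff hs u).2 hu)] at e₁
  rw [hF.valInv_val ht x2 hu] at e₂
  linear_combination e₁ - e₂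

variable (hne : ∃ u1 ∈ A.Ω, ∃ u2 ∈ A.Ω, a u1 ≠ a u2)
include hne

omit ht in
/-- The fibres of the space map do not depend on time: two points of a fibre solve the same
ordinary differential equation. -/
lemma spaceMap_eq_of_eq {x1 x2 : X} {t₁ t : ℝ} (ht1 : t₁ ∈ A.T) (ht : t ∈ A.T)
    (hx : ymap t₁ x1 = ymap t₁ x2) : ymap t x1 = ymap t x2 := by
  have hcont x s (hs : s ∈ A.T) : ContinuousAt (fun s => ymap s x) s :=
    (hF.contMDiffAt_spaceMap_time hs x).continuousAt
  have hloc s (hs : s ∈ A.T) : ymap s x1 = ymap s x2 → ∀ᶠ s' in 𝓝 s, ymap s' x1 = ymap s' x2 := by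
    intro he
    obtain ⟨σ, hσ0, hσ, hσy⟩ := hF.exists_section hs x1
    set y := ymap s x1 with hy
    set φ := chart m y
    -- the vector field is the velocity of the section
    set G : ℝ × ℝ × 𝔼 m → 𝔼 m := fun p => φ (ymap p.1 (σ (p.2.1, φ.symm p.2.2))) with hG
    have hyφ : y ∈ φ.source := mem_extChartAt_source y
    have hGs : ContDiffAt ℝ ∞ G (s, s, φ y) := by
      rw [← contMDiffAt_iff_contDiffAt]
      have h1 : SmAt 𝓘(ℝ, ℝ × ℝ × 𝔼 m) (txM m)
          (fun p : ℝ × ℝ × 𝔼 m => (p.2.1, φ.symm p.2.2)) (s, s, φ y) :=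
        (contDiff_fst.comp contDiff_snd).contMDiff.contMDiffAt.prodMk
          (ContMDiffAt.comp (g := φ.symm) (f := fun p : ℝ × ℝ × 𝔼 m => p.2.2) (s, s, φ y)
            (contMDiffAt_extChartAt_symm_apply (I := 𝓡 m) hyφ)
            (contDiff_snd.comp contDiff_snd).contMDiff.contMDiffAt)
      have e1 : φ.symm (φ y) = y := φ.left_inv hyφ
      have h2 : SmAt 𝓘(ℝ, ℝ × ℝ × 𝔼 m) (𝓡 n)
          (fun p : ℝ × ℝ × 𝔼 m => σ (p.2.1, φ.symm p.2.2)) (s, s, φ y) := by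
        refine ContMDiffAt.comp (g := σ) _ ?_ h1
        simp only [e1]
        exact hσ.self_of_nhds
      have h3 : SmAt 𝓘(ℝ, ℝ × ℝ × 𝔼 m) (𝓡 m) (fun p : ℝ × ℝ × 𝔼 m =>
            ymap p.1 (σ (p.2.1, φ.symm p.2.2))) (s, s, φ y) := by
        refine ContMDiffAt.comp (g := fun q : ℝ × X => ymap q.1 q.2)
          (f := fun p : ℝ × ℝ × 𝔼 m => (p.1, σ (p.2.1, φ.symm p.2.2))) _ ?_
          (contDiff_fst.contMDiff.contMDiffAt.prodMk h2)
        simp only [e1, hσ0]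
        exact hF.contMDiffAt_spaceMap hs x1
      refine ContMDiffAt.comp (g := φ) _ ?_ h3
      simp only [e1, hσ0]
      exact contMDiffAt_extChartAt_of_mem hyφ
    set Z : ℝ × 𝔼 m → 𝔼 m := fun p => fderiv ℝ G (p.1, p.1, p.2) (1, 0, 0)
    have hZs : ContDiffAt ℝ 1 Z (s, φ y) := by
      have h1 : ContDiffAt ℝ 1 (fderiv ℝ G) (s, s, φ y) :=
        (hGs.fderiv_right (m := ∞) (by simp)).of_le (by simp)
      exact (ContDiffAt.comp (g := fderiv ℝ G) (f := fun p : ℝ × 𝔼 m =>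
        (p.1, p.1, p.2)) (s, φ y) h1
        (contDiffAt_fst.prodMk (contDiffAt_fst.prodMk contDiffAt_snd))).clm_apply contDiffAt_const
    obtain ⟨K, W, hW, hlip⟩ := hZs.exists_lipschitzOnWith
    have hsol x : ymap s x = y → ∀ᶠ s' in 𝓝 s,
        HasDerivAt (fun s => φ (ymap s x)) (Z (s', φ (ymap s' x))) s' ∧
        φ (ymap s' x) ∈ {z | (s', z) ∈ W} := by
      intro hx
      have hc1 : Tendsto (fun s' => ymap s' x) (𝓝 s) (𝓝 y) := by
        have := (hcont x s hs).tendsto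
        rwa [hx] at this
      have hc2 : Tendsto (fun s' => φ (ymap s' x)) (𝓝 s) (𝓝 (φ y)) :=
        (continuousAt_extChartAt y).tendsto.comp hc1
      have hc3 : Tendsto (fun s' => (s', s', φ (ymap s' x))) (𝓝 s) (𝓝 (s, s, φ y)) :=
        tendsto_id.prodMk_nhds (tendsto_id.prodMk_nhds hc2)
      filter_upwards [A.isOpen_T.mem_nhds hs, hc1.eventually ((isOpen_extChartAt_source y).mem_nhds hyφ),
        (tendsto_id.prodMk_nhds hc2 : Tendsto (fun s' => (s', φ (ymap s' x))) (𝓝 s)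
          (𝓝 (s, φ y))).eventually hW, hc3.eventually
              (((hGs.of_le (m := 1) (by simp)).eventually (by simp)).mono fun p h => h.diffAt),
              (tendsto_id.prodMk_nhds hc1).eventually hσy] with s' h1 h2 h3 h4 h5
      refine ⟨?_, h3⟩
      have hsm := hF.contMDiffAt_spaceMap_time h1 x
      have hd : DifferentiableAt ℝ (fun s => φ (ymap s x)) s' :=
        ((contMDiffAt_extChartAt_of_mem (I := 𝓡 m) h2).comp s' hsm).contDiffAt.differentiableAt
          (by simp)
      have hfib : ymap s' (σ (s', ymap s' x)) = ymap s' x := h5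
      have e2 : φ.symm (φ (ymap s' x)) = ymap s' x := φ.left_inv h2
      have h6 : HasDerivAt (fun s => φ (ymap s (σ (s', ymap s' x))))
          (Z (s', φ (ymap s' x))) s' := by
        have h8 := HasFDerivAt.comp_hasDerivAt (l := G)
          (f := fun s'' => (s'', s', φ (ymap s' x))) s' h4.hasFDerivAt
              ((hasDerivAt_id s').prodMk ((hasDerivAt_const _ _).prodMk (hasDerivAt_const _ _)))
        simpa only [hG, Function.comp_def, e2] using h8
      -- the points of a fibre have a common velocity
      have h9 : deriv (fun s => φ (ymap s x)) s' =
          deriv (fun s => φ (ymap s (σ (s', ymap s' x)))) s' := by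
        ext i
        rw [← deriv_coordFn_comp hsm h2, ← deriv_coordFn_comp
            (hF.contMDiffAt_spaceMap_time h1 (σ (s', ymap s' x))) (by rw [hfib]; exact h2)]
        have h10 := hF.deriv_comp_spaceMap_eq h1 N ha hA hne hfib
          (k := fun y' => coordFn y i y' - coordFn y i (ymap s' x))
          (by
            have := DiffusionOp.eventually_contMDiffAt_extChartAt_coord (n := m) h2 i
            filter_upwards [this] with y' h
            exact (h.sub contMDiffAt_const).sub contMDiffAt_const) (sub_self _)
        simpa only [deriv_sub_const] using h10.symm
      rw [← h6.deriv, ← h9]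
      exact hd.hasDerivAt
    have h1 := hsol x1 rfl
    have h2 := hsol x2 he.symm
    have hlip' s' : LipschitzOnWith K (fun z => Z (s', z)) {z | (s', z) ∈ W} := by
      refine LipschitzOnWith.of_dist_le_mul fun z hz z' hz' => ?_
      have := hlip.dist_le_mul _ hz _ hz'
      simpa [Prod.dist_eq] using this
    have h3 := ODE_solution_unique_of_eventually (v := fun s' z => Z (s', z))
      (s := fun s' => {z | (s', z) ∈ W}) (.of_forall hlip') h1 h2
      (by simp only [he, ← hy])
    have hc1 := (hcont x1 s hs).eventually ((isOpen_extChartAt_source y).mem_nhds hyφ)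
    have hc2 := (hcont x2 s hs).eventually ((isOpen_extChartAt_source y).mem_nhds
        (show ymap s x2 ∈ φ.source by rw [← he]; exact hyφ))
    filter_upwards [h3, hc1, hc2] with s' e1 e2 e3
    exact φ.injOn e2 e3 e1
  -- the set of times at which the values coincide is open and closed
  have hsub : A.T ⊆ {s | s ∈ A.T ∧ ymap s x1 = ymap s x2} := by
    refine A.ordConnected_T.isPreconnected.subset_of_closure_inter_subset ?_ ⟨t₁, ht1, ht1, hx⟩ ?_
    · rw [isOpen_iff_mem_nhds]
      rintro s ⟨hs, he⟩
      filter_upwards [hloc s hs he, A.isOpen_T.mem_nhds hs] with s' h1 h2 using ⟨h2, h1⟩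
    · rintro s ⟨hcl, hs⟩
      refine ⟨hs, ?_⟩
      by_contra hne'
      obtain ⟨V1, V2, hV1, hV2, m1, m2, hd⟩ := t2_separation hne'
      have h1 := ((hcont x1 s hs).eventually (hV1.mem_nhds m1)).and
        ((hcont x2 s hs).eventually (hV2.mem_nhds m2))
      obtain ⟨s', h2, h3, h4⟩ := (mem_closure_iff_frequently.1 hcl).and_eventually h1 |>.exists
      exact disjoint_left.1 hd h3 (h2.2 ▸ h4)
  exact (hsub ht).2

omit ht in
/-- Over two points of a fibre the dependent variables are related by a symmetry of `a` that does
not depend on time. -/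
lemma exists_symmetry_forall {x1 x2 : X} {t₁ : ℝ} (ht1 : t₁ ∈ A.T) (hx : ymap t₁ x1 = ymap t₁ x2) :
    ∃ k b C : ℝ, IsAffineSymmetry A.Ω a k b C ∧ ∀ t ∈ A.T, ∀ v ∈ B.Ω, uinv (t, x1, v) = k * uinv
    (t, x2, v) + b := by
  obtain ⟨k, b, C, hs, hval, hC⟩ := hF.exists_symmetry ht1 N ha hA hx
  refine ⟨k, b, C, hs, fun t ht => ?_⟩
  obtain ⟨k', b', C', hs', hval', hC'⟩ := hF.exists_symmetry ht N ha hA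
    (hF.spaceMap_eq_of_eq N ha hA hne ht1 ht hx)
  -- the same test function, transported from time `t₁` to time `t`, shows that `C' = C`
  have hk₀ := eventually_contMDiffAt_coordFn (ymap t₁ x2) ⟨0, B.dim_pos⟩
  have hk00 := coordFn_self (ymap t₁ x2) ⟨0, B.dim_pos⟩
  have hk01 := pd₁_coordFn_ne_zero (ymap t₁ x2) ⟨0, B.dim_pos⟩
  generalize coordFn (ymap t₁ x2) ⟨0, B.dim_pos⟩ = κ0 at *
  obtain ⟨σ, hσ, hσ0, hσy⟩ := hF.hasLocalSection_spaceMap ht x2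
  set κ : Y → ℝ := fun y => κ0 (ymap t₁ (σ y)) with hκ
  have hcs : Tendsto (fun y => ymap t₁ (σ y)) (𝓝 (ymap t x2)) (𝓝 (ymap t₁ x2)) := by
    have h1 := hσ.self_of_nhds.continuousAt.tendsto
    rw [hσ0] at h1
    exact (hF.contMDiffAt_spaceMap_slice ht1 x2).continuousAt.tendsto.comp h1
  have hκs : ∀ᶠ y in 𝓝 (ymap t x2), SmoothAt m κ y := by
    filter_upwards [hσ, hcs.eventually hk₀] with y h1 h2
    exact h2.comp y ((hF.contMDiffAt_spaceMap_slice ht1 (σ y)).comp y h1)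
  have hκe x : ymap t x = ymap t x2 → κ⋄t =ᶠ[𝓝 x] fun x' => κ0 (ymap t₁ x') := by
    intro he
    have h1 := (hF.contMDiffAt_spaceMap_slice ht x).continuousAt.tendsto
    rw [he] at h1
    filter_upwards [h1.eventually hσy] with x' hx'
    simp only [hκ]
    rw [hF.spaceMap_eq_of_eq N ha hA hne ht ht1 hx']
  have h1 := hC' κ hκs (by simp only [hκ, hσ0, hk00])
  have hx' := hF.spaceMap_eq_of_eq N ha hA hne ht1 ht hx
  rw [𝒟.gamma_congr (hκe x1 hx') (hκe x1 hx'), 𝒟.gamma_congr (hκe x2 rfl) (hκe x2 rfl)] at h1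
  have hpos := hF.gamma_comp_spaceMap_pos ht1 hA x1 (k := κ0) (by rwa [hx]) (by rwa [hx])
    (by rwa [hx])
  rw [mul_right_cancel₀ hpos.ne' (h1.trans (hC κ0 hk₀ hk00).symm)] at hs'
  obtain ⟨rfl, rfl⟩ := N.symm_unique hs hs'
  exact hval'

end IsPEMorphism

/-! ### The canonical form of a morphism -/

variable {t0 : ℝ} {φ ψ c : X → ℝ}

/-- The affine maps `u ↦ φ(x) u + ψ(x)` preserve `Ω`, multiply `a` by `c(x)`, and take the
dependent variable of the first equation, at all points of a fibre of `x ↦ y(t, x)`, to the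
same function of `t` and of the dependent variable of the second equation. -/
structure IsFibreNormalization (A : PEq n X) (B : PEq m Y)
    (F : ℝ × X × ℝ → ℝ × Y × ℝ) (a : ℝ → ℝ) (t0 : ℝ) (φ ψ c : X → ℝ) : Prop where
  mem : t0 ∈ A.T
  valRange_eq : ∀ t ∈ A.T, ∀ x, valRange A F t x = B.Ω
  contMDiffAt_slope : ∀ x, SmoothAt n φ x
  contMDiffAt_shift : ∀ x, SmoothAt n ψ x
  contMDiffAt_factor : ∀ x, SmoothAt n c x
  slope_pos : ∀ x, 0 < φ x
  factor_pos : ∀ x, 0 < c x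
  mem_iff : ∀ x u, φ x * u + ψ x ∈ A.Ω ↔ u ∈ A.Ω
  map_eq : ∀ x, ∀ u ∈ A.Ω, a (φ x * u + ψ x) = c x * a u
  spaceMap_iff : ∀ t ∈ A.T, ∀ x1 x2, ymap t x1 = ymap t x2 ↔ ymap t0 x1 = ymap t0 x2
  fibre : ∀ x1 x2, ymap t0 x1 = ymap t0 x2 → ∃ k b, φ x1 * k = φ x2 ∧ φ x1 * b + ψ x1 = ψ x2 ∧
      ∀ t ∈ A.T, ∀ v ∈ B.Ω, uinv (t, x1, v) = k * uinv (t, x2, v) + b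
  deriv_eq : ∀ x1 x2, ymap t0 x1 = ymap t0 x2 → ∀ k : Y → ℝ,
    (∀ᶠ y in 𝓝 (ymap t0 x2), SmoothAt m k y) →
      deriv (fun s => k (ymap s x1)) t0 = deriv (fun s => k (ymap s x2)) t0

lemma IsPEMorphism.isFibreNormalization (hF : IsPEMorphism A B F) (N : SymmetryNormalizer A.Ω a)
    (ha : ∀ u ∈ A.Ω, 0 < a u) (hA : A.HasForm a 𝒟 q) (hne : ∃ u1 ∈ A.Ω, ∃ u2 ∈ A.Ω, a u1 ≠ a u2)
    (ht0 : t0 ∈ A.T) {v0 : ℝ} (hv₀ : v0 ∈ B.Ω) : IsFibreNormalization A B F a t0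
    (fun x => N.slope (uinv (t0, x, v0))) (fun x => N.shift (uinv (t0, x, v0))) fun x => N.factor
    (uinv (t0, x, v0)) := by
  have hR t (ht : t ∈ A.T) : ∀ x, valRange A F t x = B.Ω := hF.valRange_eq ht N ha hA
  have hv x : v0 ∈ valRange A F t0 x := by rwa [hR t0 ht0]
  have hp x : uinv (t0, x, v0) ∈ A.Ω := hF.valInv_mem ht0 x (hv x)
  have hps x : SmoothAt n (fun x => uinv (t0, x, v0)) x := by
    obtain ⟨u, hu, hu' : 𝓋 t0 x u = v0⟩ := hv x
    have h := hF.contMDiffAt_valInv_slice ht0 x hu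
    rw [hu'] at h
    exact ContMDiffAt.comp (g := fun q : X × ℝ => uinv (t0, q.1, q.2))
      (f := fun x => (x, v0)) x h (contMDiffAt_id.prodMk contMDiffAt_const)
  refine ⟨ht0, hR, fun x => (N.contDiffAt_slope _ (hp x)).contMDiffAt.comp x (hps x),
    fun x => (N.contDiffAt_shift _ (hp x)).contMDiffAt.comp x (hps x),
    fun x => (N.contDiffAt_factor _ (hp x)).contMDiffAt.comp x (hps x),
    fun x => N.slope_pos _ (hp x), fun x => N.factor_pos _ (hp x), fun x => N.mem_iff _ (hp x),
    fun x => N.map_eq _ (hp x), fun t ht x1 x2 =>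
      ⟨hF.spaceMap_eq_of_eq N ha hA hne ht ht0, hF.spaceMap_eq_of_eq N ha hA hne ht0 ht⟩, ?_, ?_⟩
  · intro x1 x2 hx
    obtain ⟨k, b, C, hs, h⟩ := hF.exists_symmetry_forall N ha hA hne ht0 hx
    refine ⟨k, b, ?_, ?_, h⟩
    · simp only [h t0 ht0 v0 hv₀, N.slope_symm hs _ (hp x2)]
    · simp only [h t0 ht0 v0 hv₀, N.shift_symm hs _ (hp x2)]
  · intro x1 x2 hx k hk
    have h := hF.deriv_comp_spaceMap_eq ht0 N ha hA hne hx (k := fun y => k y - k (ymap t0 x2)) (by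
        filter_upwards [hk] with y hy using hy.sub contMDiffAt_const) (sub_self _)
    simpa only [deriv_sub_const_fun] using h

variable (hF : IsPEMorphism A B F) (h : IsFibreNormalization A B F a t0 φ ψ c)

namespace IsFibreNormalization

include h in
lemma div_mem (x : X) {v : ℝ} (hv : v ∈ A.Ω) : (v - ψ x) / φ x ∈ A.Ω := by
  rw [← h.mem_iff x]
  rwa [mul_div_cancel₀ _ (h.slope_pos x).ne', sub_add_cancel]

include h in
lemma contMDiffAt_div {w : Y → ℝ} {y : X → Y} {x : X} (hw : SmoothAt m w (y x))
    (hy : SmAt (𝓡 n) (𝓡 m) y x) : SmoothAt n (fun x => (w (y x) - ψ x) / φ x) x :=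
  ((hw.comp x hy).sub (h.contMDiffAt_shift x)).div₀ (h.contMDiffAt_slope x) (h.slope_pos x).ne'

include hF h

/-- The images of two points under `F` coincide if and only if they coincide after
normalization. -/
lemma map_eq_iff {t t' : ℝ} (ht : t ∈ A.T) (ht' : t' ∈ A.T) (x x' : X) {u u' : ℝ} (hu : u ∈ A.Ω)
    (hu' : u' ∈ A.Ω) : F (t, x, u) = F (t', x', u') ↔ t = t' ∧ ymap t0 x = ymap t0 x' ∧ φ x * u + ψ
    x = φ x' * u' + ψ x' := by
  rw [hF.eq_of_map_eq ht ht' x x' hu hu', h.spaceMap_iff t ht]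
  refine and_congr_right fun _ => and_congr_right fun hx => ?_
  obtain ⟨k, b, h1, h2, h3⟩ := h.fibre x x' hx
  have e := h3 t ht _ (hF.val_mem ht x' hu')
  rw [hF.valInv_val ht x' hu'] at e
  rw [← h1, ← h2, show φ x * k * u' + (φ x * b + ψ x) = φ x * (k * u' + b) + ψ x by ring,
    add_left_inj, mul_right_inj' (h.slope_pos x).ne', ← e]
  constructor
  · intro hv
    rw [← hv, hF.valInv_val ht x hu]
  · rintro rfl
    exact hF.val_valInv ht x (by rw [h.valRange_eq t ht]; exact hF.val_mem ht x' hu')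

/-- The operator of the first equation, conjugated with the affine maps, takes functions on `Y` to
functions on `Y`. -/
lemma slope_mul_op_eq (hA : A.HasForm a 𝒟 q) {x1 x2 : X} (hx : ymap t0 x1 = ymap t0 x2) {w : Y → ℝ}
    (hw : ∀ᶠ y in 𝓝 (ymap t0 x2), SmoothAt m w y) (hwΩ : w (ymap t0 x2) ∈ A.Ω) : φ x1 * A.op t0 x1
    (fun x => (w (ymap t0 x) - ψ x) / φ x) = φ x2 * A.op t0 x2 fun x => (w (ymap t0 x) - ψ x) / φ x
    := by
  have ht0 := h.mem
  obtain ⟨σ, hσ, hσ0, hσy⟩ := hF.hasLocalSection_spaceMap ht0 x2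
  have hwΩ' : ∀ᶠ y in 𝓝 (ymap t0 x2), w y ∈ A.Ω :=
    hw.self_of_nhds.continuousAt.eventually (A.isOpen_Ω.mem_nhds hwΩ)
  -- the function on `Y` whose pullback by `F` at the time `t0` is the given function on `X`
  set W : Y → ℝ := fun y => (F (t0, σ y, (w y - ψ (σ y)) / φ (σ y))).2.2 with hW
  have hWs : ∀ᶠ y in 𝓝 (ymap t0 x2), SmoothAt m W y := by
    filter_upwards [hw, hσ, hwΩ'] with y h1 h2 h3
    refine ContMDiffAt.comp (g := fun q => (F q).2.2)
      (f := fun y => (t0, σ y, (w y - ψ (σ y)) / φ (σ y))) y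
      (hF.contMDiffAt_val ht0 (σ y) (h.div_mem (σ y) h3)) (contMDiffAt_const.prodMk (h2.prodMk ?_))
    exact (h1.sub ((h.contMDiffAt_shift _).comp y h2)).div₀ ((h.contMDiffAt_slope _).comp y h2)
      (h.slope_pos _).ne'
  have hWinv x : ymap t0 (σ (ymap t0 x)) = ymap t0 x →
      w (ymap t0 x) ∈ A.Ω → uinv (t0, x, W (ymap t0 x)) = (w (ymap t0 x) - ψ x) / φ x := by
    intro h1 h2
    have hm := h.div_mem (σ (ymap t0 x)) h2
    obtain ⟨k, b, e1, e2, e3⟩ := h.fibre x _ h1.symm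
    simp only [hW]
    rw [e3 t0 ht0 _ (hF.val_mem ht0 _ hm), hF.valInv_val ht0 _ hm, ← e1, ← e2]
    have hφ := (h.slope_pos x).ne'
    have hk : k ≠ 0 := by
      rintro rfl
      exact (h.slope_pos (σ (ymap t0 x))).ne' (by rw [← e1, mul_zero])
    field_simp
    ring
  set V := W (ymap t0 x2)
  have hVB : V ∈ B.Ω := hF.val_mem ht0 _ (h.div_mem _ hwΩ)
  -- the test function `W` for `F` expresses the operator by quantities of the fibre
  have key x : ymap t0 x = ymap t0 x2 → A.op t0 x (fun x => (w (ymap t0 x) - ψ x) / φ x) =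
        deriv (fun s => uinv (s, x, V)) t0 + deriv (fun c => uinv (t0, x, c)) V *
          (deriv (fun s => W (ymap s x)) t0 + deriv (τmap) t0 * B.op (τmap t0) (ymap t0 x2) W) := by
    intro hx
    have hyc := (hF.contMDiffAt_spaceMap_slice ht0 x).continuousAt.tendsto
    rw [hx] at hyc
    have e : (fun x => (w (ymap t0 x) - ψ x) / φ x) =ᶠ[𝓝 x]
        fun x => uinv (t0, x, W (ymap t0 x)) := by
      filter_upwards [hyc.eventually hσy, hyc.eventually hwΩ'] with x' h1 h2
      exact (hWinv x' h1 h2).symm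
    have hxV : uinv (t0, x, V) = (w (ymap t0 x2) - ψ x) / φ x := by
      have := hWinv x (by rw [hx, hσy.self_of_nhds]) (by rwa [hx])
      rwa [hx] at this
    have hum : uinv (t0, x, V) ∈ A.Ω := by rw [hxV]; exact h.div_mem x hwΩ
    have hVx : (F (t0, x, uinv (t0, x, V))).2.2 = V :=
      hF.val_valInv ht0 x (by rwa [h.valRange_eq t0 ht0])
    have h1 := hF.op_valInv_comp ht0 x hum (w := W) (by rwa [hx]) (by rw [hx, hVx])
    rw [hVx, hx] at h1
    rw [← h1]
    have hs1 := h.contMDiffAt_div (w := w) (by rw [hx]; exact hw.self_of_nhds)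
      (hF.contMDiffAt_spaceMap_slice ht0 x)
    have hm1 : (w (ymap t0 x) - ψ x) / φ x ∈ A.Ω := h.div_mem x (by rwa [hx])
    have e0 : (w (ymap t0 x) - ψ x) / φ x = uinv (t0, x, W (ymap t0 x)) := e.self_of_nhds
    rw [hA t0 ht0 x _ hs1 hm1, hA t0 ht0 x _ (hs1.congr_of_eventuallyEq e.symm)
      (by rw [← e0]; exact hm1), ← e0, 𝒟.op_congr e]
  obtain ⟨k, b, e1, -, e3⟩ := h.fibre x1 x2 hx
  have d1 : deriv (fun s => uinv (s, x1, V)) t0 = k * deriv (fun s => uinv (s, x2, V)) t0 := by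
    have e : (fun s => uinv (s, x1, V)) =ᶠ[𝓝 t0] fun s => k * uinv (s, x2, V) + b := by
      filter_upwards [A.isOpen_T.mem_nhds ht0] with s hs using e3 s hs V hVB
    rw [e.deriv_eq, deriv_add_const, deriv_const_mul_field]
  have d2 : ∂uinv t0 x1 V = k * ∂uinv t0 x2 V := by
    have e : (fun v => uinv (t0, x1, v)) =ᶠ[𝓝 V] fun v => k * uinv (t0, x2, v) + b := by
      filter_upwards [B.isOpen_Ω.mem_nhds hVB] with v hv using e3 t0 ht0 v hv
    rw [e.deriv_eq, deriv_add_const, deriv_const_mul_field]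
  rw [key x1 hx, key x2 rfl, d1, d2, h.deriv_eq x1 x2 hx W hWs, ← e1]
  ring

/-- The equation satisfied by `φ u + ψ` is a reaction-diffusion equation on `Y` with the same `a`. -/
lemma exists_equation (hc : ContinuousOn a A.Ω) (ha : ∀ u ∈ A.Ω, 0 < a u) (h𝒟 : 𝒟.IsSmooth)
    (hA : A.HasForm a 𝒟 q) (hq : ContinuousOn (fun p : X × ℝ => q p.1 p.2) (univ ×ˢ A.Ω)) : ∃ B' :
    PEq m Y, B'.T = A.T ∧ B'.Ω = A.Ω ∧ IsReactionDiffusion B' A.Ω a ∧ ∀ t ∈ A.T, ∀ x, ∀ w : Y → ℝ,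
    SmoothAt m w (ymap t0 x) → w (ymap t0 x) ∈ A.Ω → B'.op t (ymap t0 x) w = φ x * A.op t x fun x =>
    (w (ymap t0 x) - ψ x) / φ x := by
  have ht0 := h.mem
  have hys := fun x => hF.contMDiffAt_spaceMap_slice ht0 x
  have hφi x : SmoothAt n (fun x => (φ x)⁻¹) x := (h.contMDiffAt_slope x).inv₀ (h.slope_pos x).ne'
  have hψi x : SmoothAt n (fun x => -ψ x * (φ x)⁻¹) x := (h.contMDiffAt_shift x).neg.mul (hφi x)
  set 𝒟c := 𝒟.conj (fun x => (c x)⁻¹) φ (fun x => (φ x)⁻¹) fun x => inv_pos.2 (h.factor_pos x)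
    with h𝒟c
  have h𝒟cs : 𝒟c.IsSmooth := by
    intro x w hw
    have e : 𝒟c.op w = fun x => (c x)⁻¹ * (𝒟.op w x + 2 * φ x * 𝒟.gamma w (fun x => (φ x)⁻¹) x) :=
      funext fun x => 𝒟.conj_op _ _ _ _ w x
    rw [e]
    exact ((h.contMDiffAt_factor x).inv₀ (h.factor_pos x).ne').mul ((h𝒟 x w hw).add
      ((contMDiffAt_const.mul (h.contMDiffAt_slope x)).mul
        (h𝒟.contMDiffAt_gamma hw (.of_forall hφi))))
  set R : X → ℝ → ℝ := fun x v => (c x)⁻¹ * a v * (φ x * (v * 𝒟.op (fun x => (φ x)⁻¹) x +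
    𝒟.op (fun x => -ψ x * (φ x)⁻¹) x)) + φ x * q x ((v - ψ x) / φ x) with hR
  have hform t (ht : t ∈ A.T) x (w : Y → ℝ) : SmoothAt m w (ymap t0 x) →
      w (ymap t0 x) ∈ A.Ω → φ x * A.op t x (fun x => (w (ymap t0 x) - ψ x) / φ x) =
        a (w (ymap t0 x)) * 𝒟c.op w⋄t0 x + R x (w (ymap t0 x)) := by
    intro hw hwΩ
    have hm := h.div_mem x hwΩ
    have hwy : SmoothAt n w⋄t0 x := hw.comp x (hys x)
    rw [hA t ht x _ (h.contMDiffAt_div hw (hys x)) hm, h𝒟c, 𝒟.conj_op]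
    have e1 : (fun x => (w (ymap t0 x) - ψ x) / φ x) = fun x =>
        w (ymap t0 x) * (φ x)⁻¹ + -ψ x * (φ x)⁻¹ := by
      funext x; ring
    have e2 := h.map_eq x _ hm
    rw [mul_div_cancel₀ _ (h.slope_pos x).ne', sub_add_cancel] at e2
    rw [e1, 𝒟.op_add (f := fun x => w (ymap t0 x) * (φ x)⁻¹)
      (hwy.mul (hφi x)) (hψi x), 𝒟.op_mul hwy (hφi x)]
    simp only [hR]
    rw [e2]
    have h1 := (h.factor_pos x).ne'
    have h2 := (h.slope_pos x).ne'
    generalize (w (ymap t0 x) - ψ x) / φ x = z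
    field_simp
    ring
  -- the zeroth order term and the operator are found separately by testing with constants
  have hRc x v : v ∈ A.Ω → R x v = φ x * A.op t0 x fun x => (v - ψ x) / φ x := by
    intro hv
    rw [hform t0 ht0 x (fun _ => v) contMDiffAt_const hv, DiffusionOp.op_const, mul_zero, zero_add]
  have hRd x1 x2 : ymap t0 x1 = ymap t0 x2 → ∀ v ∈ A.Ω, R x1 v = R x2 v := by
    intro hx v hv
    rw [hRc x1 v hv, hRc x2 v hv]
    exact h.slope_mul_op_eq hF hA hx (w := fun _ => v) (.of_forall fun _ => contMDiffAt_const) hv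
  have h𝒟d x1 x2 : ymap t0 x1 = ymap t0 x2 → ∀ w : Y → ℝ, (∀ᶠ y in 𝓝 (ymap t0 x1), SmoothAt m w y) →
        𝒟c.op w⋄t0 x1 = 𝒟c.op w⋄t0 x2 := by
    intro hx w hw
    obtain ⟨v, hv⟩ := A.nonempty_Ω
    -- the value of `w` at the point is shifted to `v ∈ Ω`
    set w' : Y → ℝ := fun y => w y + (v - w (ymap t0 x1)) with hw'
    have hw's : ∀ᶠ y in 𝓝 (ymap t0 x1), SmoothAt m w' y := by
      filter_upwards [hw] with y hy using hy.add contMDiffAt_const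
    have hv1 : w' (ymap t0 x1) = v := by simp [hw']
    have hv2 : w' (ymap t0 x2) = v := by rw [← hx, hv1]
    have e := h.slope_mul_op_eq hF hA hx (w := w') (by rwa [← hx]) (by rwa [hv2])
    rw [hform t0 ht0 x1 w' hw's.self_of_nhds (by rwa [hv1]),
      hform t0 ht0 x2 w' (hx ▸ hw's.self_of_nhds) (by rwa [hv2]), hv1, hv2, hRd x1 x2 hx v hv,
      add_left_inj, mul_right_inj' (ha v hv).ne'] at e
    simp only [hw'] at e
    rwa [𝒟c.op_add (f := fun x => w (ymap t0 x)) (hw.self_of_nhds.comp x1 (hys x1))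
        contMDiffAt_const,
      𝒟c.op_add (f := fun x => w (ymap t0 x)) ((hx ▸ hw.self_of_nhds : SmoothAt m w _).comp x2
        (hys x2)) contMDiffAt_const, 𝒟c.op_const, 𝒟c.op_const, add_zero, add_zero] at e
  have hsurj := hF.surjective_spaceMap ht0
  obtain ⟨𝒟', h𝒟', h𝒟e⟩ := h𝒟cs.exists_pushforward hys hsurj
    (fun x => hF.hasLocalSection_spaceMap ht0 x) h𝒟d
  choose s hs using hsurj
  have hRcont : ContinuousOn (fun p : X × ℝ => R p.1 p.2) (univ ×ˢ A.Ω) := by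
    have hX : ∀ {f : X → ℝ}, (∀ x, SmoothAt n f x) →
        ContinuousOn (fun p : X × ℝ => f p.1) (univ ×ˢ A.Ω) := fun hf =>
      ((continuous_iff_continuousAt.2 fun x => (hf x).continuousAt).comp
        continuous_fst).continuousOn
    have hφ := hX h.contMDiffAt_slope
    have h2 := hX fun x => h𝒟 x _ (.of_forall hψi)
    have h3 : ContinuousOn (fun p : X × ℝ => a p.2) (univ ×ˢ A.Ω) :=
      hc.comp continuousOn_snd fun p hp => hp.2
    have h5 : ContinuousOn (fun p : X × ℝ => q p.1 ((p.2 - ψ p.1) / φ p.1)) (univ ×ˢ A.Ω) :=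
      hq.comp (f := fun p : X × ℝ => (p.1, (p.2 - ψ p.1) / φ p.1)) (continuousOn_fst.prodMk
          ((continuousOn_snd.sub (hX h.contMDiffAt_shift)).div hφ fun p _ => (h.slope_pos p.1).ne'))
        fun p hp => ⟨trivial, h.div_mem p.1 hp.2⟩
    exact ((((hX h.contMDiffAt_factor).inv₀ fun p _ => (h.factor_pos p.1).ne').mul h3).mul
      (hφ.mul ((continuousOn_snd.mul
          (hX fun x => h𝒟 x _ (.of_forall hφi))).add h2))).add (hφ.mul h5)
  have hQ : ContinuousOn (fun p : Y × ℝ => R (s p.1) p.2) (univ ×ˢ A.Ω) := by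
    rintro ⟨y, v⟩ ⟨-, hv⟩
    obtain ⟨σ, hσ, -, hσy⟩ := hF.hasLocalSection_spaceMap ht0 (s y)
    rw [hs] at hσ hσy
    have hσc : ContinuousAt (fun p : Y × ℝ => (σ p.1, p.2)) (y, v) :=
      (ContinuousAt.comp (f := Prod.fst) (x := (y, v)) hσ.self_of_nhds.continuousAt
        continuousAt_fst).prodMk continuousAt_snd
    refine ((ContinuousAt.comp (f := fun p : Y × ℝ => (σ p.1, p.2)) (x := (y, v))
        (hRcont.continuousAt (prod_mem_nhds univ_mem (A.isOpen_Ω.mem_nhds hv)))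
      hσc).congr ?_).continuousWithinAt
    filter_upwards [continuousAt_fst.eventually hσy,
      continuousAt_snd.eventually (A.isOpen_Ω.mem_nhds hv)] with p h2 h3
    exact hRd _ _ (by rw [h2, hs]) _ h3
  let B' := ParabolicEquation.ofForm A B.dim_pos hc ha h𝒟' (Q := fun y => R (s y)) hQ
  refine ⟨B', rfl, rfl, isReactionDiffusion_of_hasForm (B := B') (Q := fun y => R (s y)) 𝒟' hc ha h𝒟' (fun t _ y w _ _ => rfl) hQ, ?_⟩
  intro t ht x w hw hwΩ
  rw [hform t ht x w hw hwΩ, ← h𝒟e x w hw, hRd x (s (ymap t0 x)) (hs _).symm _ hwΩ]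
  rfl

/-- The normalization `(t, x, u) ↦ (t, y(x), φ(x) u + ψ(x))` factors through `F`, and the second
factor is an isomorphism onto any equation that corresponds to the first one. -/
lemma exists_isPEIso {B' : PEq m Y} (hT : B'.T = A.T) (hΩ : B'.Ω = A.Ω)
    (hop : ∀ t ∈ A.T, ∀ x, ∀ w : Y → ℝ, SmoothAt m w (ymap t0 x) →
      w (ymap t0 x) ∈ A.Ω → B'.op t (ymap t0 x) w =
        φ x * A.op t x fun x => (w (ymap t0 x) - ψ x) / φ x) :
    ∃ J : ℝ × Y × ℝ → ℝ × Y × ℝ, IsPEIso B B' J ∧ IsTriangular B J ∧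
      ∀ t ∈ A.T, ∀ x, ∀ u ∈ A.Ω, J (F (t, x, u)) = (t, ymap t0 x, φ x * u + ψ x) := by
  have ht0 := h.mem
  have hys := fun x => hF.contMDiffAt_spaceMap_slice ht0 x
  set G : ℝ × X × ℝ → ℝ × Y × ℝ := fun p => (p.1, ymap t0 p.2.1, φ p.2.1 * p.2.2 + ψ p.2.1) with hG
  have hGs p : SmAt (txuModel n) (txuModel m) G p := by
    have hx : SmAt (txuModel n) (𝓡 n) (fun p : ℝ × X × ℝ => p.2.1) p :=
      contMDiffAt_fst.comp p contMDiffAt_snd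
    have hu : SmAt (txuModel n) 𝓘₁ (fun p : ℝ × X × ℝ => p.2.2) p :=
      contMDiffAt_snd.comp p contMDiffAt_snd
    exact contMDiffAt_fst.prodMk (((hys _).comp p hx).prodMk
      ((((h.contMDiffAt_slope _).comp p hx).mul hu).add ((h.contMDiffAt_shift _).comp p hx)))
  have hmem' (p : ℝ × Y × ℝ) : p ∈ B'.space ↔ p.1 ∈ A.T ∧ p.2.2 ∈ A.Ω := by rw [mem_space, hT, hΩ]
  have hGB p (hp : p ∈ A.space) : G p ∈ B'.space := by
    obtain ⟨h1, h2⟩ := mem_space.1 hp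
    exact (hmem' _).2 ⟨h1, (h.mem_iff _ _).2 h2⟩
  -- a section of `G` over a section `σ` of `ymap t0`
  let S (σ : Y → X) (q : ℝ × Y × ℝ) : ℝ × X × ℝ :=
    (q.1, σ q.2.1, (q.2.2 - ψ (σ q.2.1)) / φ (σ q.2.1))
  have hc2 p : Tendsto (fun q : ℝ × Y × ℝ => q.2.1) (𝓝 (G p)) (𝓝 (ymap t0 p.2.1)) :=
    (continuous_fst.comp continuous_snd).tendsto _
  have hsec (σ : Y → X) (q : ℝ × Y × ℝ) (hq : q ∈ B'.space) (hσ : ymap t0 (σ q.2.1) = q.2.1) :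
      S σ q ∈ A.space ∧ G (S σ q) = q := by
    obtain ⟨h1, h2⟩ := (hmem' _).1 hq
    refine ⟨mem_space.2 ⟨h1, h.div_mem _ h2⟩, Prod.ext rfl (Prod.ext hσ ?_)⟩
    simp only [S, hG]
    rw [mul_div_cancel₀ _ (h.slope_pos _).ne', sub_add_cancel]
  -- `F` and `G` have the same fibres
  have hFG : ∀ p ∈ A.space, ∀ p' ∈ A.space, F p = F p' ↔ G p = G p' := by
    rintro ⟨t, x, u⟩ hp ⟨t', x', u'⟩ hp'
    obtain ⟨h1, h2⟩ := mem_space.1 hp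
    obtain ⟨h3, h4⟩ := mem_space.1 hp'
    rw [h.map_eq_iff hF h1 h3 x x' h2 h4]
    simp only [hG, Prod.mk.injEq]
  have hFsec p (hp : p ∈ A.space) : HasLocalSection (txuModel n) (txuModel m) F p :=
    hasLocalSection_of_surjective_mfderiv (hF.eventually_contMDiffAt hp) (hF.submersion p hp)
  have hS {σ : Y → X} {p : ℝ × X × ℝ} (hσ : ∀ᶠ y in 𝓝 (ymap t0 p.2.1), SmAt (𝓡 m) (𝓡 n) σ y)
      (hσ0 : σ (ymap t0 p.2.1) = p.2.1) :
      (∀ᶠ q in 𝓝 (G p), SmAt (txuModel m) (txuModel n) (S σ) q) ∧ S σ (G p) = p := by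
    refine ⟨?_, Prod.ext rfl (Prod.ext hσ0 ?_)⟩
    · filter_upwards [(hc2 p).eventually hσ] with q hq
      have hy : SmAt (txuModel m) (𝓡 n) (fun q : ℝ × Y × ℝ => σ q.2.1) q :=
        hq.comp q (contMDiffAt_fst.comp q contMDiffAt_snd)
      exact contMDiffAt_fst.prodMk (hy.prodMk
        (((contMDiffAt_snd.comp q contMDiffAt_snd).sub ((h.contMDiffAt_shift _).comp q hy)).div₀
          ((h.contMDiffAt_slope _).comp q hy) (h.slope_pos _).ne'))
    · simp only [S, hG, hσ0]
      rw [add_sub_cancel_right, mul_div_cancel_left₀ _ (h.slope_pos _).ne']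
  have hGsec p (hp : p ∈ A.space) : HasLocalSection (txuModel n) (txuModel m) G p := by
    obtain ⟨σ, hσ, hσ0, hσy⟩ := hF.hasLocalSection_spaceMap ht0 p.2.1
    refine ⟨S σ, (hS hσ hσ0).1, (hS hσ hσ0).2, ?_⟩
    filter_upwards [(hc2 p).eventually hσy, B'.isOpen_space.mem_nhds (hGB p hp)] with q h1 h2
    exact (hsec σ q h2 h1).2
  -- the isomorphism and its inverse
  set J : ℝ × Y × ℝ → ℝ × Y × ℝ := fun P => G (Function.invFunOn F A.space P)
  set K : ℝ × Y × ℝ → ℝ × Y × ℝ := fun Q => F (Function.invFunOn G A.space Q)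
  have hJF p (hp : p ∈ A.space) : J (F p) = G p :=
    (hFG _ (Function.invFunOn_mem ⟨p, hp, rfl⟩) p hp).1 (Function.invFunOn_eq ⟨p, hp, rfl⟩)
  have hKG p (hp : p ∈ A.space) : K (G p) = F p :=
    (hFG _ (Function.invFunOn_mem ⟨p, hp, rfl⟩) p hp).2 (Function.invFunOn_eq ⟨p, hp, rfl⟩)
  have hFsurj P (hP : P ∈ B.space) : ∃ p ∈ A.space, F p = P := by rwa [← hF.image_eq] at hP
  have hGsurj Q (hQ : Q ∈ B'.space) : ∃ p ∈ A.space, G p = Q := by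
    obtain ⟨x, hx⟩ := hF.surjective_spaceMap ht0 Q.2.1
    exact ⟨_, (hsec (fun _ => x) Q hQ hx).1, (hsec (fun _ => x) Q hQ hx).2⟩
  have hJs P (hP : P ∈ B.space) : SmAt (txuModel m) (txuModel m) J P := by
    obtain ⟨p, hp, rfl⟩ := hFsurj P hP
    refine (hFsec p hp).contMDiffAt_of_comp ((hGs p).congr_of_eventuallyEq ?_)
    filter_upwards [A.isOpen_space.mem_nhds hp] with p' hp' using hJF p' hp'
  have hKs Q (hQ : Q ∈ B'.space) : SmAt (txuModel m) (txuModel m) K Q := by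
    obtain ⟨p, hp, rfl⟩ := hGsurj Q hQ
    refine (hGsec p hp).contMDiffAt_of_comp ((hF.contMDiffAt hp).congr_of_eventuallyEq ?_)
    filter_upwards [A.isOpen_space.mem_nhds hp] with p' hp' using hKG p' hp'
  have hJB P (hP : P ∈ B.space) : J P ∈ B'.space := by
    obtain ⟨p, hp, rfl⟩ := hFsurj P hP
    rw [hJF p hp]; exact hGB p hp
  have hKB Q (hQ : Q ∈ B'.space) : K Q ∈ B.space := by
    obtain ⟨p, hp, rfl⟩ := hGsurj Q hQ
    rw [hKG p hp]; exact hF.map_mem hp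
  have hKJ P (hP : P ∈ B.space) : K (J P) = P := by
    obtain ⟨p, hp, rfl⟩ := hFsurj P hP
    rw [hJF p hp, hKG p hp]
  have hJK Q (hQ : Q ∈ B'.space) : J (K Q) = Q := by
    obtain ⟨p, hp, rfl⟩ := hGsurj Q hQ
    rw [hKG p hp, hJF p hp]
  refine ⟨J, isPEIso_of_graphs hJs hKs hJB hKB hKJ hJK ?_, ?_, fun t ht x u hu =>
    hJF _ (mem_space.2 ⟨ht, hu⟩)⟩
  · intro L L' hL hpt hc hg
    obtain ⟨p, hp, hFp⟩ := hFsurj L.pt hL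
    have hLp : L'.pt = G p := by rw [hpt, ← hFp, hJF p hp]
    obtain ⟨t, x, u⟩ := p
    obtain ⟨ht, hu⟩ := mem_space.1 hp
    have hp2 : L'.pt.2.1 = ymap t0 x := by rw [hLp]
    have hp1 : L'.pt.1 = t := by rw [hLp]
    have hp3 : L'.pt.2.2 = φ x * u + ψ x := by rw [hLp]
    obtain ⟨M, hM, hMc⟩ := PointedHypersurface.exists_comap (hF.eventually_contMDiffAt hp)
      (hF.submersion _ hp) hFp.symm
    have hFt := (hF.contMDiffAt hp).continuousAt.tendsto
    rw [hFp] at hFt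
    have hMG : Corr G M L' := by
      rw [hM]
      filter_upwards [hFt.eventually hc, A.isOpen_space.mem_nhds hp] with q h1 h2
      rw [hMc, mem_preimage, h1, hJF q h2]
    rw [← hF.jets M L (hM ▸ hp) (by rw [hM, hFp]) (by rw [hMc]; exact Eventually.of_forall fun q => Iff.rfl)]
    -- both hypersurfaces are graphs
    obtain ⟨W, hW⟩ : ∃ W, L'.IsGraph W := by
      refine hg.elim ?_ id
      rintro ⟨w, hw⟩
      obtain ⟨U, hU⟩ : ∃ U, M.IsGraph U :=
        ⟨_, hF.isGraph_of_map (hM ▸ hp) (by rw [hM, hFp]) (by rw [hMc]; exact .of_forall fun q => Iff.rfl) hw⟩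
      obtain ⟨σ, hσ, hσ0, hσy⟩ := hF.hasLocalSection_spaceMap ht0 x
      have hU1 := hU.1
      have hU2 := hU.2
      rw [hM] at hMG hU1 hU2
      refine ⟨fun q => φ (σ q.2) * U (q.1, σ q.2) + ψ (σ q.2), ?_, ?_⟩
      · rw [hp1, hp2]
        have hc : Tendsto (fun q : ℝ × Y => (q.1, σ q.2)) (𝓝 (t, ymap t0 x)) (𝓝 (t, x)) := by
          have h1 := hσ.self_of_nhds.continuousAt.tendsto
          rw [hσ0] at h1
          exact continuousAt_fst.tendsto.prodMk_nhds (h1.comp continuousAt_snd.tendsto)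
        filter_upwards [hc.eventually hU1, continuousAt_snd.eventually hσ]
          with q h1 h2
        have h3 : SmAt (txM m) (𝓡 n) (fun q : ℝ × Y => σ q.2) q := h2.comp q contMDiffAt_snd
        exact (((h.contMDiffAt_slope _).comp q h3).mul (h1.comp q (contMDiffAt_fst.prodMk h3))).add
          ((h.contMDiffAt_shift _).comp q h3)
      · obtain ⟨hSs, hS0⟩ := hS hσ hσ0 (p := (t, x, u))
        have hSt := hSs.self_of_nhds.continuousAt.tendsto
        have hc3 := (hc2 (t, x, u)).eventually hσy
        rw [← hLp] at hc3
        rw [hS0, ← hLp] at hSt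
        filter_upwards [hSt.eventually hMG, hSt.eventually hU2,
          B'.isOpen_space.mem_nhds (hpt ▸ hJB _ hL), hc3] with q h1 h2 h3 h4
        rw [(hsec σ q h3 h4).2] at h1
        rw [← h1, h2, ← sub_eq_iff_eq_add, mul_comm, ← div_eq_iff (h.slope_pos _).ne']
    have hyt : ContinuousAt (fun q : ℝ × X => (q.1, ymap t0 q.2)) (t, x) :=
      continuousAt_fst.prodMk (ContinuousAt.comp (f := Prod.snd) (x := (t, x))
        (hys x).continuousAt continuousAt_snd)
    have hW1 := hW.1
    rw [hp1, hp2] at hW1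
    have hu' : ∀ᶠ q in 𝓝 (t, x), SmAt (txM n) 𝓘₁
        (fun q : ℝ × X => (W (q.1, ymap t0 q.2) - ψ q.2) / φ q.2) q := by
      filter_upwards [hyt.eventually hW1] with q hq
      exact ((hq.comp q (contMDiffAt_fst.prodMk ((hys q.2).comp q contMDiffAt_snd))).sub
        ((h.contMDiffAt_shift q.2).comp q contMDiffAt_snd)).div₀
        ((h.contMDiffAt_slope q.2).comp q contMDiffAt_snd) (h.slope_pos _).ne'
    have hW0 : W (t, ymap t0 x) = φ x * u + ψ x := by rw [← hp1, ← hp2, hW.apply, hp3]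
    have hMu : M.IsGraph fun q : ℝ × X => (W (q.1, ymap t0 q.2) - ψ q.2) / φ q.2 := by
      refine ⟨by rw [hM]; exact hu', ?_⟩
      have hGt := (hGs M.pt).continuousAt.tendsto
      rw [hM, ← hLp] at hGt
      rw [hM] at hMG ⊢
      filter_upwards [hMG, hGt.eventually hW.2] with q h1 h2
      rw [h1, h2, eq_div_iff (h.slope_pos q.2.1).ne']
      simp only [hG]
      rw [eq_sub_iff_add_eq, mul_comm]
    rw [A.graph_mem_extended_iff (hM ▸ hp) hMu, B'.graph_mem_extended_iff (hpt ▸ hJB _ hL) hW, hM,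
      hp1, hp2]
    have hWx : SmoothAt m (fun y => W (t, y)) (ymap t0 x) :=
      ContMDiffAt.comp (g := W) (f := fun y => (t, y)) _ hW1.self_of_nhds
        (contMDiffAt_const.prodMk contMDiffAt_id)
    rw [hop t ht x (fun y => W (t, y)) hWx (by rw [hW0]; exact (h.mem_iff x u).2 hu)]
    simp only [deriv_div_const, deriv_sub_const_fun]
    rw [div_eq_iff (h.slope_pos x).ne', mul_comm]
  · have key t' (ht' : t' ∈ B.T) y v (hv : v ∈ B.Ω) : ∃ t ∈ A.T, ∃ x, τmap t = t' ∧
        ymap t x = y ∧ (J (t', y, v)).1 = t ∧ (J (t', y, v)).2.1 = ymap t0 x := by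
      obtain ⟨⟨t, x, u⟩, hp, hFp⟩ := hFsurj (t', y, v) (mem_space.2 ⟨ht', hv⟩)
      obtain ⟨ht, hu⟩ := mem_space.1 hp
      rw [← hFp, hJF _ hp]
      exact ⟨t, ht, x, by rw [← hF.fst_eq_timeMap ht x hu, hFp],
        by rw [← hF.snd_fst_eq_spaceMap ht x hu, hFp], rfl, rfl⟩
    obtain ⟨v0, hv₀⟩ := B.nonempty_Ω
    refine ⟨fun t' => (J (t', ymap t0 (Classical.arbitrary X), v0)).1,
      fun t' y => (J (t', y, v0)).2.1, fun t' y v => (J (t', y, v)).2.2, fun t' ht' y v hv => ?_⟩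
    obtain ⟨t, ht, x, e1, e2, e3, e4⟩ := key t' ht' y v hv
    obtain ⟨t₁, ht1, x1, f1, f2, f3, f4⟩ := key t' ht' y v0 hv₀
    obtain ⟨t₂, ht₂, -, g1, -, g3, -⟩ := key t' ht' (ymap t0 (Classical.arbitrary X)) v0 hv₀
    have ht12 : t = t₁ := hF.injOn_timeMap ht ht1 (e1.trans f1.symm)
    subst ht12
    refine Prod.ext ?_ (Prod.ext ?_ rfl)
    · rw [e3, g3]
      exact hF.injOn_timeMap ht ht₂ (e1.trans g1.symm)
    · rw [e4, f4]
      exact (h.spaceMap_iff t ht x x1).1 (e2.trans f2.symm)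

end IsFibreNormalization

/-- A morphism takes the canonical form after composition with an isomorphism. -/
lemma IsPEMorphism.exists_canonical (hF : IsPEMorphism A B F) (N : SymmetryNormalizer A.Ω a)
    (hA : IsReactionDiffusion A A.Ω a) (hne : ∃ u1 ∈ A.Ω, ∃ u2 ∈ A.Ω, a u1 ≠ a u2) : ∃
    (B' : PEq m Y) (J : ℝ × Y × ℝ → ℝ × Y × ℝ) (y : X → Y) (p : X → ℝ), IsPEIso B B' J ∧
    IsTriangular B J ∧ IsPEMorphism A B' (J ∘ F) ∧ IsReactionDiffusion B' A.Ω a ∧ (∀ x, p x ∈ A.Ω) ∧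
    ∀ t ∈ A.T, ∀ x, ∀ u ∈ A.Ω, (J ∘ F) (t, x, u) = (t, y x, N.slope (p x) * u + N.shift (p x)) := by
  obtain ⟨𝒟, q, h𝒟, hform, hq⟩ := hA.exists_form
  obtain ⟨-, hc, ha, -⟩ := hA
  obtain ⟨t0, ht0⟩ := A.nonempty_T
  obtain ⟨v0, hv₀⟩ := B.nonempty_Ω
  have h := hF.isFibreNormalization N ha hform hne ht0 hv₀
  obtain ⟨B', hT, hΩ, hB', hop⟩ := h.exists_equation hF hc ha h𝒟 hform hq
  obtain ⟨J, hJ, hJt, hJF⟩ := h.exists_isPEIso hF hT hΩ hop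
  exact ⟨B', J, _, _, hJ, hJt, hJ.1.comp hF, hB', fun x => hF.valInv_mem ht0 x
    (by rwa [h.valRange_eq t0 ht0]), hJF⟩

end Morphisms

theorem mainTheorem2 {n m : ℕ} {X Y : Type*}
    [TopologicalSpace X] [T2Space X] [SecondCountableTopology X] [ConnectedSpace X]
    [ChartedSpace 𝔼 n X] [IsManifold (𝓡 n) ∞ X]
    [TopologicalSpace Y] [T2Space Y] [SecondCountableTopology Y] [ConnectedSpace Y]
    [ChartedSpace 𝔼 m Y] [IsManifold (𝓡 m) ∞ Y]
    (A : PEq n X) (Ω : Set ℝ) (a : ℝ → ℝ)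
    (hA : IsReactionDiffusion A Ω a)
    (ha : ∃ u₁ ∈ Ω, ∃ u₂ ∈ Ω, a u₁ ≠ a u₂) :
    (a ∉ AExp Ω ∪ ADeg Ω → HasNaturalDomain Ω a →
      ∀ (B : PEq m Y) (F : ℝ × X × ℝ → ℝ × Y × ℝ), IsPEMorphism A B F →
        ∃ (B' : PEq m Y) (J : ℝ × Y × ℝ → ℝ × Y × ℝ),
          IsPEIso B B' J ∧ IsTriangular B J ∧
          IsPEMorphism A B' (J ∘ F) ∧ IsAffineCanonical A (J ∘ F) ∧
          IsReactionDiffusion B' Ω a) ∧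
    (a ∉ AExpExt Ω ∪ ADegExt Ω →
      ∀ (B : PEq m Y) (F : ℝ × X × ℝ → ℝ × Y × ℝ), IsPEMorphism A B F →
        ∃ (B' : PEq m Y) (J : ℝ × Y × ℝ → ℝ × Y × ℝ),
          IsPEIso B B' J ∧ IsTriangular B J ∧
          IsPEMorphism A B' (J ∘ F) ∧ IsCanonical A (J ∘ F) ∧
          IsReactionDiffusion B' Ω a) ∧
    (∀ (B : PEq m Y) (F : ℝ × X × ℝ → ℝ × Y × ℝ),
      IsReactionDiffusion B Ω a → IsTPEMorphism A B F → IsAffineCanonical A F ∧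
        (a ∉ AExpExt Ω ∪ ADegExt Ω → IsCanonical A F ∨ IsReflectedCanonical A a F)) := by
  obtain rfl : A.Ω = Ω := hA.1
  have hc := hA.2.1
  refine ⟨fun hex hnat B F hF => ?_, fun hex B F hF => ?_, fun B F hB hF => ?_⟩
  · obtain ⟨N⟩ := nonempty_symmetryNormalizer A.ordConnected_Ω hc hA.2.2.1 ha hex hnat
    obtain ⟨B', J, y, p, h1, h2, h3, h4, -, h5⟩ := hF.exists_canonical N hA ha
    exact ⟨B', J, h1, h2, h3, ⟨y, _, _, h5⟩, h4⟩
  · obtain ⟨N, hN⟩ := nonempty_symmetryNormalizer_of_notMem_ext A.ordConnected_Ω hc hA.2.2.1 ha hex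
    obtain ⟨B', J, y, p, h1, h2, h3, h4, -, h5⟩ := hF.exists_canonical N hA ha
    refine ⟨B', J, h1, h2, h3, ⟨y, fun t ht x u hu => ?_⟩, h4⟩
    rw [h5 t ht x u hu, (hN _).1, (hN _).2, one_mul, add_zero]
  · obtain ⟨hFm, y, v, hF⟩ := hF
    obtain ⟨𝒟, q, h𝒟, hA', -⟩ := hA.exists_form
    obtain ⟨ℰ, r, hℰ, hB', -⟩ := hB.exists_form
    have hτ t (ht : t ∈ A.T) : τmap t = t := by
      rw [← hFm.fst_eq_timeMap ht (Classical.arbitrary X) A.nonempty_Ω.some_mem,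
        hF t ht _ _ A.nonempty_Ω.some_mem]
    obtain ⟨t₀, ht₀⟩ := A.nonempty_T
    choose k b C hk hC hkb using hFm.exists_affine_of_hasForm hA' hB' hA.2.2.1 ha hc hτ
    have hform t (ht : t ∈ A.T) x u (hu : u ∈ A.Ω) : F (t, x, u) = (t, ymap t₀ x, k x * u + b x) := Prod.ext (by rw [hF t ht x u hu]) (Prod.ext ((hFm.snd_fst_eq_spaceMap ht x
        hu).trans (hFm.spaceMap_eq_of_hasForm hA' hB' hA.2.2.1 ha ht ht₀ x)) (hkb x t ht u hu).1)
    refine ⟨⟨ymap t₀, k, b, hform⟩, fun hex => ?_⟩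
    rcases hFm.eq_id_or_reflection hA.2.2.1 ha hc hB.1 hex hC hk hkb with h | ⟨u₀, h0, h⟩
    · refine Or.inl ⟨ymap t₀, fun t ht x u hu => ?_⟩
      rw [hform t ht x u hu, (h x).1, (h x).2, one_mul, add_zero]
    · refine Or.inr ⟨ymap t₀, u₀, h0, fun t ht x u hu => ?_⟩
      rw [hform t ht x u hu, (h x).1, (h x).2, neg_one_mul, neg_add_eq_sub]

end
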